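/- **Setting.** Let $d\ge 2$, $k\ge 1$, $n=dk$, and let $M_0,\dots,M_{d-1},N_1,\dots,N_d\in\mathbb C^{k\times k}$. The block companion pencil $S-\lambda T\in\mathbb C^{n\times n}[\lambda]$ has $$S=\begin{bmatrix} &&&-M_0\\ I_k&&&-M_1\\ &\ddots&&\vdots\\ &&I_k&-M_{d-1}\end{bmatrix},\qquad T=\begin{bmatrix} I_k&&&N_1\\ &\ddots&&\vdots\\ &&I_k&N_{d-1}\\ &&&N_d\end{bmatrix}.$$ $\|\cdot\|$ is the Frobenius norm. All computations use floating point arithmetic with unit round-off $u$ in the standard model: each real $+,-,\times,/,\sqrt{\phantom{x}}$ has relative error at most $u$. A core transformation is an identity matrix except for a unitary $2\times2$ block in rows and columns $i,i+1$. **Algorithm** (with fixed constants $\tau,\nu\in\mathbb N$). 1. *Preprocessing.* By at most $\nu k^2$ elementary steps (a computed plane rotation applied from the left or from the right to all coefficients; or setting to zero an entry of $M_0$ or $N_d$ of modulus at most $\tau u\|M_0\|$ or $\tau u\|N_d\|$, respectively), as in the QZ algorithm, $N_d$ is made upper triangular and $M_0$ lower triangular (Frobenius case) or upper triangular (Gaussian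 case). 2. *Factored storage.* Let $\mathcal Q$ be the cyclic downshift, a descending sequence of $n-1$ swaps of neighbouring rows. Then $S=\mathcal QR_1\mathcal QR_2\cdots\mathcal QR_k$ (Frobenius) or $S=\mathcal Q^kR_1\cdots R_k$ (Gaussian), and $T=T_1\cdots T_k$, with upper triangular identity-plus-one-column factors $R_j$, $T_j$. Each factor is stored only through two descending sequences $\mathcal C=C_1\cdots C_n$, $\mathcal B=B_1\cdots B_n$ of core transformations of order $n+1$. The stored sequences represent the matrix $P^T\mathcal C^*(\mathcal B+e_1y^T)P$, where $\rho=e_{n+1}^T\mathcal C^*e_1$, $y^T=-\rho^{-1}e_{n+1}^T\mathcal C^*\mathcal B$, and $P$ consists of the first $n$ columns of $I_{n+1}$. 3. *Reduction to Hessenberg-triangular form.* In all sequences $\mathcal Q$ but the first, the core transformations are removed and chased until they are fused at the bottom. One moves them through sequences by turnovers $F_iG_{i+1}H_i=F'_{i+1}G'_iH'_{i+1}$ (computed by QR factorization of a $3\times3$ matrix), through triangular factors by pass-throughs (two turnovers on $\mathcal B$ and $\mathcal C$), and from one end of the product to the other by unitary equivalences of the pencil. 4. *Iteration.* On the resulting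 pencil, at most $\nu n$ steps are made. Each is an implicit single-shift QR step (arbitrary shift) executed by core chasing between two deflated positions, a deflation of a core transformation whose off-diagonal entry has modulus at most $\tau u$, or a deflation step for a zero eigenvalue. The run ends when all core transformations of the remaining sequence $\mathcal Q$ have been deflated. The computed Schur form $\hat S-\lambda\hat T$ consists of the matrices represented by the stored factors at that time. **Theorem (Backward error on the block companion pencil).** For all $\tau,\nu\in\mathbb N$ there is a polynomial $p$ in two variables such that, for all $d\ge2$, $k\ge1$ and $K\in\mathbb R$, there is $u_0>0$ with the following property. Let $0<u\le u_0$, let $S-\lambda T$ be a block companion pencil as above with $\|S\|,\|T\|\le K$, and let $\hat S-\lambda\hat T$ be a Schur form computed for it by the algorithm, with either factorization of $S$, in floating point arithmetic with unit round-off $u$. Then $\hat S$ and $\hat T$ are upper triangular, and there are matrices $\delta S,\delta T\in\mathbb C^{n\times n}$ and unitary $U,V\in\mathbb C^{n\times n}$ such that $$\hat S=U^*(S+\delta S)V,\qquad \hat T=U^*(T+\delta T)V,\qquad \|\delta S\|\le p(d,k)\,\|S\|^2u,\qquad \|\delta T\|\le p(d,k)\,\|T\|^2u .$$ That is, the computed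 Schur form is the exact Schur form of the perturbed pencil $(S+\delta S)-\lambda(T+\delta T)$. -/

import Mathlib

open scoped Matrix
open scoped Matrix.Norms.Frobenius

noncomputable section

namespace CoreChasing

/-! ### Floating point arithmetic -/

/-- The standard model of floating point arithmetic with unit round-off `u`: each of the five
basic real operations is carried out with relative error at most `u` (no over- or underflow).
Only the values at floating point numbers are ever used by a real machine; elsewhere the operations
may, for example, be taken exact. -/
structure FloatArith (u : ℝ) where
  add : ℝ → ℝ → ℝ
  sub : ℝ → ℝ → ℝ
  mul : ℝ → ℝ → ℝ
  div : ℝ → ℝ → ℝ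
  sqrt : ℝ → ℝ
  add_err : ∀ x y, |add x y - (x + y)| ≤ u * |x + y|
  sub_err : ∀ x y, |sub x y - (x - y)| ≤ u * |x - y|
  mul_err : ∀ x y, |mul x y - x * y| ≤ u * |x * y|
  div_err : ∀ x y, y ≠ 0 → |div x y - x / y| ≤ u * |x / y|
  sqrt_err : ∀ x, 0 ≤ x → |sqrt x - Real.sqrt x| ≤ u * Real.sqrt x

/-- A (stored) core transformation: the active `2 × 2` block, which acts on the rows `i`, `i + 1`
for an index `i` kept separately.  Rows, columns and cores are numbered from `0`. -/
abbrev Core := Matrix (Fin 2) (Fin 2) ℂ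

/-- The `m × m` matrix that is the identity except for the block `G` in the rows and columns
`i`, `i + 1`. -/
def embed (m i : ℕ) (G : Core) : Matrix (Fin m) (Fin m) ℂ := fun r c =>
  if r.val = i ∧ c.val = i then G 0 0
  else if r.val = i ∧ c.val = i + 1 then G 0 1
  else if r.val = i + 1 ∧ c.val = i then G 1 0
  else if r.val = i + 1 ∧ c.val = i + 1 then G 1 1
  else if r = c then 1 else 0

/-- The `m × m` matrix `q₀ q₁ ⋯ q_{m-2}` of a descending sequence of core transformations. -/
def seqMatrix (m : ℕ) (q : ℕ → Core) : Matrix (Fin m) (Fin m) ℂ :=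
  ((List.range (m - 1)).map fun i => embed m i (q i)).prod

/-- The core transformation that swaps two neighbouring rows. -/
def swapCore : Core := !![0, 1; 1, 0]

/-- The core transformation with the order of its two rows and of its two columns reversed. -/
def flip (G : Core) : Core := G.submatrix Fin.rev Fin.rev

/-- Overwrite the entries `i` and `i + 1` of a sequence. -/
def update₂ (q : ℕ → Core) (i : ℕ) (a b : Core) : ℕ → Core :=
  Function.update (Function.update q i a) (i + 1) b

namespace FloatArith

variable {u : ℝ} (fp : FloatArith u)

/-- Complex addition. -/
def cadd (x y : ℂ) : ℂ := ⟨fp.add x.re y.re, fp.add x.im y.im⟩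

/-- Complex subtraction. -/
def csub (x y : ℂ) : ℂ := ⟨fp.sub x.re y.re, fp.sub x.im y.im⟩

/-- Complex multiplication. -/
def cmul (x y : ℂ) : ℂ :=
  ⟨fp.sub (fp.mul x.re y.re) (fp.mul x.im y.im), fp.add (fp.mul x.re y.im) (fp.mul x.im y.re)⟩

/-- Division of a complex by a real number. -/
def cdiv (z : ℂ) (r : ℝ) : ℂ := ⟨fp.div z.re r, fp.div z.im r⟩

/-- The squared modulus of a complex number. -/
def normSq (z : ℂ) : ℝ := fp.add (fp.mul z.re z.re) (fp.mul z.im z.im)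

/-- The Euclidean norm of the vector `(a, b)`. -/
def norm₂ (a b : ℂ) : ℝ := fp.sqrt (fp.add (fp.normSq a) (fp.normSq b))

/-- The phase `z / |z|` of a nonzero complex number. -/
def phase (z : ℂ) : ℂ := if z = 0 then 1 else fp.cdiv z (fp.sqrt (fp.normSq z))

/-- Matrix multiplication, by the textbook formula. -/
def mmul {m : ℕ} (A B : Matrix (Fin m) (Fin m) ℂ) : Matrix (Fin m) (Fin m) ℂ := fun i j =>
  (List.finRange m).foldl (fun acc l => fp.cadd acc (fp.cmul (A i l) (B l j))) 0

/-! ### Core transformations: rotation, fusion, turnover -/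

/-- The computed rotation `G` with `Gᴴ (a, b)ᵀ = (r, 0)ᵀ`, where `r` is the norm of `(a, b)`. -/
def givens (a b : ℂ) : Core :=
  if a = 0 ∧ b = 0 then 1 else
    let r := fp.norm₂ a b
    let c := fp.cdiv a r
    let s := fp.cdiv b r
    !![c, -star s; s, star c]

/-- Renormalization of a computed, nearly unitary `2 × 2` matrix: the first column is normalized
and the second one is rebuilt from it and from the phase of the determinant. -/
def unitarize (A : Core) : Core :=
  let r := fp.norm₂ (A 0 0) (A 1 0)
  let c := fp.cdiv (A 0 0) r
  let s := fp.cdiv (A 1 0) r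
  let φ := fp.phase (fp.csub (fp.cmul (A 0 0) (A 1 1)) (fp.cmul (A 1 0) (A 0 1)))
  !![c, -fp.cmul φ (star s); s, fp.cmul φ (star c)]

/-- Fusion: two core transformations acting on the same rows are multiplied. -/
def fuse (F G : Core) : Core := fp.unitarize (fp.mmul F G)

/-- Turnover `F_i G_{i+1} H_i = F'_{i+1} G'_i H'_{i+1}`, by a QR factorization of the unitary
`3 × 3` matrix on the left.  Read with `F_i G_{i+1}` part of a descending sequence, `H_i` is moved
from the right of the sequence to its left, where it becomes `F'_{i+1}`. -/
def turnRL (F G H : Core) : Core × Core × Core :=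
  let A := fp.mmul (fp.mmul (embed 3 0 F) (embed 3 1 G)) (embed 3 0 H)
  let F' := fp.givens (A 1 0) (A 2 0)
  let A₁ := fp.mmul (embed 3 1 F')ᴴ A
  let G' := fp.givens (A₁ 0 0) (A₁ 1 0)
  let A₂ := fp.mmul (embed 3 0 G')ᴴ A₁
  let H' := fp.unitarize !![A₂ 1 1, A₂ 1 2; A₂ 2 1, A₂ 2 2]
  (F', G', H')

/-- The converse turnover `F_{i+1} G_i H_{i+1} = F'_i G'_{i+1} H'_i`, by a QL factorization (the
same computation with the order of the three coordinates reversed). -/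
def turnLR (F G H : Core) : Core × Core × Core :=
  let r := fp.turnRL (flip F) (flip G) (flip H)
  (flip r.1, flip r.2.1, flip r.2.2)

end FloatArith

/-! ### Compact storage of the triangular unitary-plus-spike factors -/

/-- An `n × n` upper triangular unitary-plus-rank-one matrix is stored as two descending sequences
`C₀ ⋯ C_{n-1}` and `B₀ ⋯ B_{n-1}` of core transformations of size `n + 1`. -/
structure Tri where
  C : ℕ → Core
  B : ℕ → Core

/-- The matrix `Pᵀ Cᴴ (B + e₁ yᵀ) P` that is represented by the stored core transformations, where
`yᵀ = - ρ⁻¹ (e_{n+1}ᵀ Cᴴ B)`, `ρ = e_{n+1}ᵀ Cᴴ e₁`, and `P` drops the last coordinate. -/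
def Tri.toMatrix (n : ℕ) (t : Tri) : Matrix (Fin n) (Fin n) ℂ :=
  let C := seqMatrix (n + 1) t.C
  let B := seqMatrix (n + 1) t.B
  let ρ : ℂ := Cᴴ (Fin.last n) 0
  let y : Fin (n + 1) → ℂ := fun j => -ρ⁻¹ * (Cᴴ * B) (Fin.last n) j
  (Cᴴ * (B + Matrix.vecMulVec (Pi.single 0 1) y)).submatrix Fin.castSucc Fin.castSucc

section Operations

variable {u : ℝ} (fp : FloatArith u)

/-- For the vector `x̲ = (x₀, …, x_ℓ, 0, …, 0, -1)`: after its last `s` relevant entries have been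
processed, `spikeTail fp ℓ x s` is the (computed) norm of `(x_{ℓ-s+1}, …, x_ℓ, -1)`; it is the
entry `-1` itself for `s = 0`. -/
def spikeTail (ℓ : ℕ) (x : ℕ → ℂ) : ℕ → ℂ
  | 0 => -1
  | s + 1 => ((fp.norm₂ (x (ℓ - s)) (spikeTail ℓ x s) : ℝ) : ℂ)

/-- The sequence `C` with `C₀ ⋯ C_{n-1} x̲ = α e₁`; the cores below the spike are swaps. -/
def spikeC (n ℓ : ℕ) (x : ℕ → ℂ) (j : ℕ) : Core :=
  if j ≤ ℓ then (fp.givens (x j) (spikeTail fp ℓ x (ℓ - j)))ᴴ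
  else if j < n then swapCore else 1

/-- Computed compact storage of the identity-plus-spike matrix whose column `ℓ` is
`(x₀, …, x_ℓ, 0, …, 0)ᵀ` and which is the identity otherwise.  Here `B_j = C_j` except for
`B_ℓ = C_ℓ F`, a mere exchange of the two columns of `C_ℓ`. -/
def storeSpike (n ℓ : ℕ) (x : ℕ → ℂ) : Tri where
  C := spikeC fp n ℓ x
  B := Function.update (spikeC fp n ℓ x) ℓ (spikeC fp n ℓ x ℓ * swapCore)

/-- Pass-through from right to left, `R K_i = K̃_i R̃`: two turnovers on the unitary part. -/
def passRL (i : ℕ) (K : Core) (t : Tri) : Core × Tri :=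
  let w := fp.turnRL (t.B i) (t.B (i + 1)) K
  let v := fp.turnLR w.1ᴴ (t.C i) (t.C (i + 1))
  (v.2.2ᴴ, ⟨update₂ t.C i v.1 v.2.1, update₂ t.B i w.2.1 w.2.2⟩)

/-- Pass-through from left to right, `K_i R = R̃ K̃_i`: two turnovers on the unitary part. -/
def passLR (i : ℕ) (K : Core) (t : Tri) : Core × Tri :=
  let w := fp.turnRL (t.C i) (t.C (i + 1)) Kᴴ
  let v := fp.turnLR w.1ᴴ (t.B i) (t.B (i + 1))
  (v.2.2, ⟨update₂ t.C i w.2.1 w.2.2, update₂ t.B i v.1 v.2.1⟩)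

/-- Pass-through from right to left through a product of triangular factors. -/
def passRLs (i : ℕ) (K : Core) : List Tri → Core × List Tri
  | [] => (K, [])
  | t :: ts =>
    let p := passRLs i K ts
    let q := passRL fp i p.1 t
    (q.1, q.2 :: p.2)

/-- Pass-through from left to right through a product of triangular factors. -/
def passLRs (i : ℕ) (K : Core) : List Tri → Core × List Tri
  | [] => (K, [])
  | t :: ts =>
    let p := passLR fp i K t
    let q := passLRs i p.1 ts
    (q.1, p.2 :: q.2)

end Operations

/-! ### The block companion pencil -/

/-- The matrix `S` of the pencil: identities on the block subdiagonal, last block column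
`(-M₀, …, -M_{d-1})`. -/
def pencilS (d k : ℕ) (M : ℕ → Matrix (Fin k) (Fin k) ℂ) :
    Matrix (Fin (d * k)) (Fin (d * k)) ℂ :=
  Matrix.reindex finProdFinEquiv finProdFinEquiv
    (Matrix.of fun (r c : Fin d × Fin k) =>
      if c.1.val + 1 = d then -M r.1 r.2 c.2
      else if r.1.val = c.1.val + 1 ∧ r.2 = c.2 then 1 else 0)

/-- The matrix `T` of the pencil: identities on the block diagonal, last block column
`(N₁, …, N_d)`. -/
def pencilT (d k : ℕ) (N : ℕ → Matrix (Fin k) (Fin k) ℂ) :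
    Matrix (Fin (d * k)) (Fin (d * k)) ℂ :=
  Matrix.reindex finProdFinEquiv finProdFinEquiv
    (Matrix.of fun (r c : Fin d × Fin k) =>
      if c.1.val + 1 = d then N (r.1 + 1) r.2 c.2
      else if r = c then 1 else 0)

/-- The two ways to factor `S`. -/
inductive Factorization
  | frobenius
  | gaussian

/-! ### First step: the constant and the leading coefficient are made triangular -/

/-- The coefficients `M₀, …, M_{d-1}` and `N₁, …, N_d`. -/
structure Coeffs (k : ℕ) where
  M : ℕ → Matrix (Fin k) (Fin k) ℂ
  N : ℕ → Matrix (Fin k) (Fin k) ℂ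

section Preprocessing

variable {u : ℝ} (fp : FloatArith u)

/-- Computed product with a plane rotation from the left: the rows `p`, `q` of `A` are multiplied
by `Gᴴ`. -/
def rotRows {k : ℕ} (G : Core) (p q : Fin k) (A : Matrix (Fin k) (Fin k) ℂ) :
    Matrix (Fin k) (Fin k) ℂ := fun i j =>
  if i = p then fp.cadd (fp.cmul (star (G 0 0)) (A p j)) (fp.cmul (star (G 1 0)) (A q j))
  else if i = q then fp.cadd (fp.cmul (star (G 0 1)) (A p j)) (fp.cmul (star (G 1 1)) (A q j))
  else A i j

/-- Computed product with a plane rotation from the right: the columns `p`, `q` of `A` are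
multiplied by `G`. -/
def rotCols {k : ℕ} (G : Core) (p q : Fin k) (A : Matrix (Fin k) (Fin k) ℂ) :
    Matrix (Fin k) (Fin k) ℂ := fun i j =>
  if j = p then fp.cadd (fp.cmul (A i p) (G 0 0)) (fp.cmul (A i q) (G 1 0))
  else if j = q then fp.cadd (fp.cmul (A i p) (G 0 1)) (fp.cmul (A i q) (G 1 1))
  else A i j

/-- Set one entry of a matrix to zero. -/
def clearEntry {k : ℕ} (p q : Fin k) (A : Matrix (Fin k) (Fin k) ℂ) :
    Matrix (Fin k) (Fin k) ℂ := fun i j => if i = p ∧ j = q then 0 else A i j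

/-- The elementary steps of the QZ algorithm (and of its periodic version) applied to the leading
and the constant coefficient: a computed plane rotation is applied from the left, or from the
right, to all coefficients; an entry of `M₀` or `N_d` that is negligible is set to zero. -/
inductive QZStep (tol d : ℕ) {k : ℕ} : Coeffs k → Coeffs k → Prop
  | left (c : Coeffs k) (p q : Fin k) (hpq : p ≠ q) (a b : ℂ) :
      QZStep tol d c
        ⟨fun i => rotRows fp (fp.givens a b) p q (c.M i),
          fun i => rotRows fp (fp.givens a b) p q (c.N i)⟩
  | right (c : Coeffs k) (p q : Fin k) (hpq : p ≠ q) (a b : ℂ) :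
      QZStep tol d c
        ⟨fun i => rotCols fp (fp.givens a b) p q (c.M i),
          fun i => rotCols fp (fp.givens a b) p q (c.N i)⟩
  | clearM (c : Coeffs k) (p q : Fin k) (h : ‖c.M 0 p q‖ ≤ tol * u * ‖c.M 0‖) :
      QZStep tol d c ⟨Function.update c.M 0 (clearEntry p q (c.M 0)), c.N⟩
  | clearN (c : Coeffs k) (p q : Fin k) (h : ‖c.N d p q‖ ≤ tol * u * ‖c.N d‖) :
      QZStep tol d c ⟨c.M, Function.update c.N d (clearEntry p q (c.N d))⟩

end Preprocessing

/-- The triangular form needed by the factorizations: `N_d` is upper triangular, and `M₀` is lower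
triangular (Frobenius) or upper triangular (Gaussian). -/
def Coeffs.IsReady {k : ℕ} (d : ℕ) (c : Coeffs k) : Factorization → Prop
  | .frobenius => (c.N d).BlockTriangular id ∧ (c.M 0)ᵀ.BlockTriangular id
  | .gaussian => (c.N d).BlockTriangular id ∧ (c.M 0).BlockTriangular id

/-- `r n a b`: one gets from `a` to `b` in `n` steps. -/
inductive Steps {α : Type} (r : α → α → Prop) : ℕ → α → α → Prop
  | refl (a : α) : Steps r 0 a a
  | tail {m : ℕ} {a b c : α} : Steps r m a b → r b c → Steps r (m + 1) a c

/-! ### Factored form of the pencil -/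

/-- The factored pencil `S = Q₀ R₀ Q₁ R₁ ⋯ Q_{k-1} R_{k-1}` and `T = T₀ T₁ ⋯`, where each `Q_b` is a
descending sequence of core transformations and each `R_b`, like `T`, is a list of stored
triangular factors. -/
structure Factored where
  Q : ℕ → ℕ → Core
  R : ℕ → List Tri
  T : List Tri

/-- The row `r` of the block column `(A₀, A₁, …)`, in its column `j`. -/
def stack {k : ℕ} (A : ℕ → Matrix (Fin k) (Fin k) ℂ) (j : Fin k) (r : ℕ) : ℂ :=
  A (r / k) ⟨r % k, Nat.mod_lt _ j.pos⟩ j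

/-- The descending sequence of `n - 1` swaps, whose product is the cyclic downshift. -/
def shiftSeq (n : ℕ) (i : ℕ) : Core := if i + 1 < n then swapCore else 1

section Algorithm

variable {u : ℝ} (fp : FloatArith u)

/-- Gaussian factorization `R₁ ⋯ R_k` of the upper triangular matrix that is the identity except
for its last block column `(A₀, …, A_{d-1})`: the spike of the factor number `t` is the
column `n - t` (here `t = 1, …, k`). -/
def gaussianFactors (d : ℕ) {k : ℕ} (A : ℕ → Matrix (Fin k) (Fin k) ℂ) : List Tri :=
  List.ofFn fun t : Fin k => storeSpike fp (d * k) (d * k - 1 - t) (stack A t.rev)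

/-- The last column of the Frobenius companion factor `S_{t+1}` is the column `t` of the stacked
matrix `(-M₀; …; -M_{d-1})`, moved up `t` rows.  One has `S_{t+1} = Q R_{t+1}` with the cyclic
downshift `Q`; this is the spike of `R_{t+1}`, which sits in the last column. -/
def frobeniusSpike (d : ℕ) {k : ℕ} (M : ℕ → Matrix (Fin k) (Fin k) ℂ) (t : Fin k) (r : ℕ) : ℂ :=
  let col : ℕ → ℂ := fun i => if i + t < d * k then -stack M t (i + t) else 0
  if r + 1 < d * k then col (r + 1) else col 0

/-- The stored factored form of the pencil.  Frobenius: `S = Q R₁ Q R₂ ⋯ Q R_k`; Gaussian: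
`S = Q^k R₁ ⋯ R_k`, where `R₁ ⋯ R_k` has the last block column `(-M₁, …, -M_{d-1}, -M₀)`. In both
cases `T = T₁ ⋯ T_k`. -/
def factorPencil (d : ℕ) {k : ℕ} (c : Coeffs k) : Factorization → Factored
  | .frobenius =>
    { Q := fun b => if b < k then shiftSeq (d * k) else 1
      R := fun b => if h : b < k then
          [storeSpike fp (d * k) (d * k - 1) (frobeniusSpike d c.M ⟨b, h⟩)] else []
      T := gaussianFactors fp d (fun i => c.N (i + 1)) }
  | .gaussian =>
    { Q := fun b => if b < k then shiftSeq (d * k) else 1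
      R := fun b => if b + 1 = k then
          gaussianFactors fp d (fun i => -c.M (if i + 1 < d then i + 1 else 0)) else []
      T := gaussianFactors fp d (fun i => c.N (i + 1)) }

/-! ### Second step: reduction to Hessenberg-triangular form -/

/-- A core `G_i` that stands to the left of block `b` of `S` gets ready to be moved further to the
left.  If `b > 0` nothing is done.  If `b = 0`, then `G_i` is taken off by a unitary equivalence:
`T` becomes `G_iᴴ T = T̃ V_i`, and `V_iᴴ` is then applied to both matrices from the right, so that
it stands at the right end of `S`, to the right of the block `k - 1`. -/
def wrapAround (k i b : ℕ) (G : Core) (s : Factored) : ℕ × Core × Factored :=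
  if b = 0 then
    let p := passLRs fp i Gᴴ s.T
    (k, p.1ᴴ, { s with T := p.2 })
  else (b, G, s)

/-- The chasing of a core `G_i`, `i = n - 2 - m`, that stands to the left of block `b`: it is passed
through the triangular factors of the previous block; it is then moved by a turnover through the
descending sequence of that block, and so moved down one row; or, at the bottom, fused with the
last core of that sequence. -/
def chase (n k : ℕ) : ℕ → ℕ → Core → Factored → Factored
  | 0, b, G, s =>
    let i := n - 2
    let w := wrapAround fp k i b G s
    let b' := w.1 - 1
    let s' := w.2.2
    let p := passRLs fp i w.2.1 (s'.R b')
    { Q := Function.update s'.Q b' (Function.update (s'.Q b') i (fp.fuse (s'.Q b' i) p.1))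
      R := Function.update s'.R b' p.2
      T := s'.T }
  | m + 1, b, G, s =>
    let i := n - 2 - (m + 1)
    let w := wrapAround fp k i b G s
    let b' := w.1 - 1
    let s' := w.2.2
    let p := passRLs fp i w.2.1 (s'.R b')
    let v := fp.turnRL (s'.Q b' i) (s'.Q b' (i + 1)) p.1
    chase n k m b' v.1
      { Q := Function.update s'.Q b' (update₂ (s'.Q b') i v.2.1 v.2.2)
        R := Function.update s'.R b' p.2
        T := s'.T }

/-- The core number `i` of the sequence `b` (which has become the first core of that sequence) is
removed and chased. -/
def removeCore (n k i b : ℕ) (s : Factored) : Factored :=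
  chase fp n k (n - 2 - i) b (s.Q b i)
    { s with Q := Function.update s.Q b (Function.update (s.Q b) i 1) }

/-- The reduction to Hessenberg-triangular form: in all sequences but the first one, all cores are
removed; first the top ones, from the rightmost sequence to the second one, then those
below them, and so forth. -/
def reduce (n k : ℕ) (s : Factored) : Factored :=
  (List.range (n - 1)).foldl (fun s i =>
    (List.range (k - 1)).foldl (fun s t => removeCore fp n k i (k - 1 - t) s) s) s

/-! ### Third step: the product eigenvalue problem -/

/-- The Hessenberg-triangular pencil `S = Q R`, `T`, with a descending sequence `Q` of core
transformations and products `R` and `T` of stored triangular factors. -/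
structure HessTri where
  Q : ℕ → Core
  R : List Tri
  T : List Tri

/-- The factored pencil after the reduction. -/
def toHessTri (k : ℕ) (s : Factored) : HessTri :=
  { Q := s.Q 0, R := (List.range k).flatMap s.R, T := s.T }

/-- `U_iᴴ` is applied to `T` from the left, `U_iᴴ T = T̃ V_i`; then `V_iᴴ` is applied to both
matrices from the right and passed through the factors of `R`, `R V_iᴴ = X_i R̃`. -/
def transfer (i : ℕ) (U : Core) (s : HessTri) : Core × HessTri :=
  let p := passLRs fp i Uᴴ s.T
  let q := passRLs fp i p.1ᴴ s.R
  (q.1, { s with R := q.2, T := p.2 })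

/-- The misfit `X_i`, which stands between `Q` and `R`, is chased down `m` rows and then fused with
the core at the bottom. -/
def chaseMisfit : ℕ → ℕ → Core → HessTri → HessTri
  | 0, i, X, s => { s with Q := Function.update s.Q i (fp.fuse (s.Q i) X) }
  | m + 1, i, X, s =>
    let v := fp.turnRL (s.Q i) (s.Q (i + 1)) X
    let p := transfer fp (i + 1) v.1 { s with Q := update₂ s.Q i v.2.1 v.2.2 }
    chaseMisfit m (i + 1) p.1 p.2

/-- One implicit single shift QR step on the cores `lo, …, hi`.  The vector `(a, b)` consists of the
two relevant entries of the first column of `S - μ T`, for the shift `μ`. -/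
def francis (lo hi : ℕ) (a b : ℂ) (s : HessTri) : HessTri :=
  let U := fp.givens a b
  let p := transfer fp lo U { s with Q := Function.update s.Q lo (fp.fuse Uᴴ (s.Q lo)) }
  chaseMisfit fp (hi - lo) lo p.1 p.2

/-- The cores `i + m - 1, …, i` of `Q` are passed, one after the other, through `R` to its right, and
then `i, …, i + m - 1` back to its left. -/
def roundTrip (i : ℕ) : ℕ → (ℕ → Core) × List Tri → (ℕ → Core) × List Tri
  | 0, s => s
  | m + 1, s =>
    let p := passLRs fp (i + m) (s.1 (i + m)) s.2
    let s' := roundTrip i m (s.1, p.2)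
    let q := passRLs fp (i + m) p.1 s'.2
    (Function.update s'.1 (i + m) q.1, q.2)

/-- A product of stored triangular factors is multiplied from the left by the diagonal matrix with
the phase of `star a` in the position `i` and ones elsewhere. -/
def scaleRow (i : ℕ) (a : ℂ) : List Tri → List Tri
  | [] => []
  | t :: ts =>
    { t with C := Function.update t.C i (fp.fuse (t.C i) !![fp.phase a, 0; 0, 1]) } :: ts

/-- Deflation at the nearly diagonal core `Q_i ≈ diag(α, β)`, which becomes the identity.  The phase
`α` of row `i` is moved to the right into `R`; the phase `β` of row `i + 1` is taken off by a
unitary equivalence from the left, which multiplies that row of `T` by `star β`. -/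
def deflate (i : ℕ) (s : HessTri) : HessTri :=
  { Q := Function.update s.Q i 1
    R := scaleRow fp i (star (s.Q i 0 0)) s.R
    T := scaleRow fp (i + 1) (s.Q i 1 1) s.T }

/-- The steps of the iterative phase, for the size `n`: deflation at a core that is diagonal up to
`tol * u`; a QR step, with any shift, on a part of the pencil between two deflated cores; and, where
a factor of `R` has a zero at the diagonal position `i` (up to `tol * u` in its `i`-th core of
`B`), the procedure that splits off the corresponding zero eigenvalue. -/
inductive QRStep (tol n : ℕ) : HessTri → HessTri → Prop
  | deflation (s : HessTri) (i : ℕ) (hi : i + 1 < n) (h : ‖s.Q i 1 0‖ ≤ tol * u) :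
      QRStep tol n s (deflate fp i s)
  | sweep (s : HessTri) (lo hi : ℕ) (a b : ℂ) (hlh : lo ≤ hi) (hhi : hi + 1 < n)
      (hbefore : ∀ j, j + 1 = lo → s.Q j = 1) (hafter : s.Q (hi + 1) = 1) :
      QRStep tol n s (francis fp lo hi a b s)
  | zero (s : HessTri) (i hi : ℕ) (hih : i ≤ hi) (hhi : hi + 1 < n)
      (hafter : s.Q (hi + 1) = 1) (h : ∃ t ∈ s.R, ‖t.B i 1 0‖ ≤ tol * u) :
      QRStep tol n s
        { Q := (roundTrip fp i (hi + 1 - i) (s.Q, s.R)).1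
          R := (roundTrip fp i (hi + 1 - i) (s.Q, s.R)).2
          T := s.T }

/-- `Ŝ - λ T̂` is a Schur form computed by the algorithm for the pencil with coefficients `c`: after
at most `ν k²` elementary steps of preprocessing the coefficients are triangular, the
factored pencil is reduced to Hessenberg-triangular form, and after at most `ν n` steps of
the iterative phase all cores of `Q` have been deflated; `Ŝ` and `T̂` are the matrices that
the stored factors represent in the end. -/
def ComputedSchurForm (tol ν d : ℕ) {k : ℕ} (kind : Factorization) (c : Coeffs k)
    (Shat That : Matrix (Fin (d * k)) (Fin (d * k)) ℂ) : Prop :=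
  ∃ (m₁ m₂ : ℕ) (c' : Coeffs k) (s : HessTri),
    m₁ ≤ ν * k ^ 2 ∧ Steps (QZStep fp tol d) m₁ c c' ∧ c'.IsReady d kind ∧
    m₂ ≤ ν * (d * k) ∧
    Steps (QRStep fp tol (d * k)) m₂
      (toHessTri k (reduce fp (d * k) k (factorPencil fp d c' kind))) s ∧
    (∀ i, i + 1 < d * k → s.Q i = 1) ∧
    Shat = seqMatrix (d * k) s.Q * (s.R.map (Tri.toMatrix (d * k))).prod ∧
    That = (s.T.map (Tri.toMatrix (d * k))).prod

end Algorithm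

end CoreChasing

end

/-!
# Backward stability of core chasing for block companion pencils

Every computed core transformation is the result of a rotation or of a renormalization.  It is
therefore within `120 u` of a unitary matrix, no matter how inaccurate its input was (`givens_err`,
`fuse_err`, `turnRL_err`).  For this reason errors do not compound: each fusion, turnover and
pass-through is an *exact* unitary transformation by matrices close to the computed ones, up to a
fresh error of order `u` in the stored unitary sequences (`seqMatrix_turnRL`, `seqMatrix_turnLR`,
`passRL_sim`, `passLR_sim`).  These errors are bookkept by the relations `TriSim` and `ListSim`
between stored triangular factors, and `FSim`, `HSim` between factored pencils.  They add up over
the run, so that reduction (`reduce_sim`) and iteration (`QRSteps.sim`) are unitary equivalences of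
the factored pencil with errors `ε = O(p(n) u)` in the matrices `Q`, `C` and `B` of each factor.

The matrix represented by `C` and `B` is covariant: if `C` and `B` are replaced by `Xᴴ C L̂` and
`Xᴴ B V̂`, where `X e₁ = e₁`, then the represented matrix `R` becomes `Lᴴ R V` (`rep_cov`).  Moving
all errors back into the original factors, one finds that the computed Schur form is exactly
`Uᴴ (⋯) V` with products of perturbed factors of `S` and `T` in between (`exists_pert_of_sims`).
It is exactly upper triangular, since descending sequences are upper Hessenberg matrices of rank
one above the diagonal (`Tri.blockTriangular_toMatrix`).

What remains is to bound the effect of the perturbed factors by `‖S‖² ε`.  The rank one part of a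
represented matrix contains `ρ⁻¹`, which is about as large as the spike of the factor, so that
multiplying norms would give a power of `‖S‖` that grows with `k`.  But the factors are balanced
(`Factor.Bal`, `ListBal`): all partial products from the left and from the right have norm
`O(√n ‖S‖)`, and, moreover, the normalized spike keeps norm at most one when the preceding factors
are applied to it, and so does the spike row when multiplied by the factors that follow.  In the
first order, at most two factors `‖S‖` then meet a perturbation (`norm_rep_sub_le`,
`ListBal.norm_pertProd_sub_le`), and terms of second order are absorbed by taking `u` small in
terms of `d`, `k` and `K`.  Balance is shown for the exact factorizations (`frobenius_listBal`,
`gaussian_listBal`, `spikes_listBal`); the triangular shape of `M₀` and `N_d` enters here, since it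
makes the spike of a factor fit to the unit columns of its neighbours.  The computed storage
differs from the exact one by errors of the kind considered already (`factorPencil_sim`).

The preprocessing applies rotations to all coefficients.  This is a unitary equivalence of the
pencil by block diagonal matrices, with relative errors of order `u` (`QZStep.sim`).  Both parts
are put together in `ComputedSchurForm.exists_backward_error`, with a bounding polynomial
`C (d k)⁶`.
-/

noncomputable section

namespace CoreChasing

set_option linter.unusedSectionVars false

/-! ### The Frobenius norm and isometries -/

section Isometries

variable {m n r s : Type*} [Fintype m] [Fintype n] [Fintype r] [Fintype s]

theorem frobenius_norm_sq (A : Matrix m n ℂ) : ‖A‖ ^ 2 = ∑ i, ∑ j, ‖A i j‖ ^ 2 := by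
  rw [Matrix.frobenius_norm_def, ← Real.sqrt_eq_rpow, Real.sq_sqrt (by positivity)]
  simp

theorem frobenius_norm_sq_eq_trace (A : Matrix m n ℂ) : (‖A‖ ^ 2 : ℝ) = (Aᴴ * A).trace.re := by
  rw [frobenius_norm_sq, Finset.sum_comm]
  simp [Matrix.trace, Matrix.mul_apply, Complex.sq_norm, Complex.normSq_apply]

theorem norm_entry_le (A : Matrix m n ℂ) (i : m) (j : n) : ‖A i j‖ ≤ ‖A‖ := by
  refine le_of_sq_le_sq ?_ (norm_nonneg _)
  rw [frobenius_norm_sq]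
  refine le_trans ?_ (Finset.single_le_sum (f := fun i => ∑ j, ‖A i j‖ ^ 2)
    (fun i _ => by positivity) (Finset.mem_univ i))
  exact Finset.single_le_sum (f := fun j => ‖A i j‖ ^ 2) (fun i _ => by positivity)
    (Finset.mem_univ j)

theorem frobenius_norm_le_sum (A : Matrix m n ℂ) : ‖A‖ ≤ ∑ i, ∑ j, ‖A i j‖ := by
  classical
  refine le_of_sq_le_sq ?_ (by positivity)
  rw [frobenius_norm_sq]
  have h : ∀ i, ∑ j, ‖A i j‖ ^ 2 ≤ (∑ j, ‖A i j‖) ^ 2 := fun i =>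
    Finset.sum_sq_le_sq_sum_of_nonneg (fun j _ => norm_nonneg _)
  exact (Finset.sum_le_sum fun i _ => h i).trans
    (Finset.sum_sq_le_sq_sum_of_nonneg (fun i _ => by positivity))

variable [DecidableEq m] [DecidableEq n] [DecidableEq r] [DecidableEq s]

theorem norm_isometry_mul {W : Matrix m r ℂ} (hW : Wᴴ * W = 1) (A : Matrix r n ℂ) :
    ‖W * A‖ = ‖A‖ := by
  have h : ‖W * A‖ ^ 2 = ‖A‖ ^ 2 := by
    rw [frobenius_norm_sq_eq_trace, frobenius_norm_sq_eq_trace, Matrix.conjTranspose_mul,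
      Matrix.mul_assoc, ← Matrix.mul_assoc Wᴴ, hW, Matrix.one_mul]
  exact (pow_left_inj₀ (norm_nonneg _) (norm_nonneg _) two_ne_zero).1 h

theorem norm_mul_isometry {W : Matrix m r ℂ} (hW : Wᴴ * W = 1) (A : Matrix n r ℂ) :
    ‖A * Wᴴ‖ = ‖A‖ := by
  rw [← Matrix.frobenius_norm_conjTranspose, Matrix.conjTranspose_mul,
    Matrix.conjTranspose_conjTranspose, norm_isometry_mul hW, Matrix.frobenius_norm_conjTranspose]

theorem norm_coisometry_mul_le {W : Matrix m r ℂ} (hW : Wᴴ * W = 1) (A : Matrix m n ℂ) :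
    ‖Wᴴ * A‖ ≤ ‖A‖ := by
  refine le_of_sq_le_sq ?_ (norm_nonneg _)
  have h : (Aᴴ * A).trace.re = ((Wᴴ * A)ᴴ * (Wᴴ * A)).trace.re
      + ((A - W * (Wᴴ * A))ᴴ * (A - W * (Wᴴ * A))).trace.re := by
    rw [← Complex.add_re, ← Matrix.trace_add]
    congr 2
    have h1 : ∀ X : Matrix r n ℂ, Wᴴ * (W * X) = X := fun X => by
      rw [← Matrix.mul_assoc, hW, Matrix.one_mul]
    simp only [Matrix.conjTranspose_sub, Matrix.conjTranspose_mul,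
      Matrix.conjTranspose_conjTranspose, Matrix.sub_mul, Matrix.mul_sub, Matrix.mul_assoc, h1]
    abel
  rw [frobenius_norm_sq_eq_trace, frobenius_norm_sq_eq_trace, h,
    ← frobenius_norm_sq_eq_trace (A - W * (Wᴴ * A))]
  nlinarith [sq_nonneg ‖A - W * (Wᴴ * A)‖]

theorem norm_mul_coisometry_le {W : Matrix m r ℂ} (hW : Wᴴ * W = 1) (A : Matrix n m ℂ) :
    ‖A * W‖ ≤ ‖A‖ := by
  rw [← Matrix.frobenius_norm_conjTranspose, Matrix.conjTranspose_mul,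
    ← Matrix.frobenius_norm_conjTranspose A]
  exact norm_coisometry_mul_le hW _

/-- The predicate `U ∈ Matrix.unitaryGroup m ℂ` in the form in which it is used. -/
abbrev IsUni (U : Matrix m m ℂ) : Prop := U ∈ Matrix.unitaryGroup m ℂ

theorem IsUni.left {U : Matrix m m ℂ} (h : IsUni U) : Uᴴ * U = 1 :=
  Matrix.mem_unitaryGroup_iff'.1 h

theorem IsUni.right {U : Matrix m m ℂ} (h : IsUni U) : U * Uᴴ = 1 :=
  Matrix.mem_unitaryGroup_iff.1 h

theorem isUni_of_left {U : Matrix m m ℂ} (h : Uᴴ * U = 1) : IsUni U :=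
  Matrix.mem_unitaryGroup_iff'.2 h

theorem isUni_one : IsUni (1 : Matrix m m ℂ) := one_mem _

theorem IsUni.mul {U V : Matrix m m ℂ} (h : IsUni U) (h' : IsUni V) : IsUni (U * V) :=
  mul_mem h h'

theorem IsUni.conj {U : Matrix m m ℂ} (h : IsUni U) : IsUni Uᴴ :=
  Matrix.mem_unitaryGroup_iff'.2 (by simpa [Matrix.star_eq_conjTranspose] using h.right)

theorem IsUni.norm_mul {U : Matrix m m ℂ} (h : IsUni U) (A : Matrix m n ℂ) : ‖U * A‖ = ‖A‖ :=
  norm_isometry_mul h.left A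

theorem IsUni.norm_mul' {U : Matrix m m ℂ} (h : IsUni U) (A : Matrix n m ℂ) :
    ‖A * U‖ = ‖A‖ := by
  have := norm_mul_isometry h.conj.left A
  rwa [Matrix.conjTranspose_conjTranspose] at this

theorem IsUni.cancel {U : Matrix m m ℂ} (h : IsUni U) (A : Matrix m n ℂ) : Uᴴ * (U * A) = A := by
  rw [← Matrix.mul_assoc, h.left, Matrix.one_mul]

theorem IsUni.cancel' {U : Matrix m m ℂ} (h : IsUni U) (A : Matrix m n ℂ) : U * (Uᴴ * A) = A := by
  rw [← Matrix.mul_assoc, h.right, Matrix.one_mul]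

/-- The extension of an `r × r` matrix along an isometry `J`: it acts like `A` on the range of `J`
and like the identity on the orthogonal complement of this range. -/
def plug (J : Matrix m r ℂ) (A : Matrix r r ℂ) : Matrix m m ℂ := 1 + J * (A - 1) * Jᴴ

theorem plug_one (J : Matrix m r ℂ) : plug J 1 = 1 := by simp [plug]

theorem plug_conj (J : Matrix m r ℂ) (A : Matrix r r ℂ) : (plug J A)ᴴ = plug J Aᴴ := by
  simp [plug, Matrix.mul_assoc]

theorem plug_mul {J : Matrix m r ℂ} (hJ : Jᴴ * J = 1) (A B : Matrix r r ℂ) :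
    plug J (A * B) = plug J A * plug J B := by
  have h1 : ∀ X : Matrix r m ℂ, Jᴴ * (J * X) = X := fun X => by
    rw [← Matrix.mul_assoc, hJ, Matrix.one_mul]
  simp only [plug, Matrix.mul_add, Matrix.add_mul, Matrix.mul_one, Matrix.one_mul, Matrix.mul_sub,
    Matrix.sub_mul, Matrix.mul_assoc, h1]
  abel

theorem plug_isUni {J : Matrix m r ℂ} (hJ : Jᴴ * J = 1) {A : Matrix r r ℂ} (hA : IsUni A) :
    IsUni (plug J A) :=
  isUni_of_left (by rw [plug_conj, ← plug_mul hJ, hA.left, plug_one])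

theorem plug_plug (J : Matrix m r ℂ) (J' : Matrix r s ℂ) (A : Matrix s s ℂ) :
    plug J (plug J' A) = plug (J * J') A := by
  simp [plug, Matrix.mul_assoc]

/-- A column orthogonal to the range of `J` is fixed by `plug J A`. -/
theorem plug_mul_of_orth {J : Matrix m r ℂ} {N : Matrix m n ℂ} (h : Jᴴ * N = 0)
    (A : Matrix r r ℂ) : plug J A * N = N := by
  simp [plug, Matrix.add_mul, Matrix.mul_assoc, h]

theorem plug_mul_self {J : Matrix m r ℂ} (hJ : Jᴴ * J = 1) (A : Matrix r r ℂ) :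
    plug J A * J = J * A := by
  simp [plug, Matrix.add_mul, Matrix.mul_assoc, hJ, Matrix.mul_sub]

theorem plug_commute {J : Matrix m r ℂ} {J' : Matrix m s ℂ} (h : Jᴴ * J' = 0)
    (A : Matrix r r ℂ) (B : Matrix s s ℂ) : Commute (plug J A) (plug J' B) := by
  have h' : J'ᴴ * J = 0 := by
    have := congrArg Matrix.conjTranspose h
    simpa using this
  have e1 : ∀ X : Matrix s m ℂ, Jᴴ * (J' * X) = 0 := fun X => by
    rw [← Matrix.mul_assoc, h, Matrix.zero_mul]
  have e2 : ∀ X : Matrix r m ℂ, J'ᴴ * (J * X) = 0 := fun X => by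
    rw [← Matrix.mul_assoc, h', Matrix.zero_mul]
  simp only [Commute, SemiconjBy, plug, Matrix.mul_add, Matrix.add_mul, Matrix.mul_one,
    Matrix.one_mul, Matrix.mul_assoc, e1, e2, Matrix.mul_zero]
  abel

theorem norm_plug_sub {J : Matrix m r ℂ} (hJ : Jᴴ * J = 1) (A B : Matrix r r ℂ) :
    ‖plug J A - plug J B‖ = ‖A - B‖ := by
  have : plug J A - plug J B = J * (A - B) * Jᴴ := by
    simp only [plug, Matrix.mul_sub, Matrix.sub_mul]; abel
  rw [this, norm_mul_isometry hJ, norm_isometry_mul hJ]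

end Isometries

/-! ### Coordinate inclusions -/

/-- The matrix `(e_i, …, e_{i+r-1})` of consecutive unit vectors. -/
def incl (m r i : ℕ) : Matrix (Fin m) (Fin r) ℂ := fun a b => if a.val = i + b.val then 1 else 0

theorem incl_isometry {m r i : ℕ} (h : i + r ≤ m) : (incl m r i)ᴴ * incl m r i = 1 := by
  ext a b
  rw [Matrix.mul_apply, Finset.sum_eq_single (⟨i + a, by omega⟩ : Fin m)]
  · by_cases hab : a = b
    · subst hab; simp [incl]
    · have : a.val ≠ b.val := fun h => hab (Fin.ext h)
      simp [incl, hab, this]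
  · intro c _ hc
    have : c.val ≠ i + a.val := fun h => hc (Fin.ext h)
    simp [incl, this]
  · simp

theorem incl_orth {m r s i j : ℕ} (h : i + r ≤ j ∨ j + s ≤ i) :
    (incl m r i)ᴴ * incl m s j = 0 := by
  ext a b
  rw [Matrix.mul_apply]
  refine Finset.sum_eq_zero fun c _ => ?_
  by_cases h1 : c.val = i + a.val
  · have : ¬ c.val = j + b.val := by omega
    simp [incl, this]
  · simp [incl, h1]

theorem incl_mul_incl {m r s i j : ℕ} (h : j + s ≤ r) :
    incl m r i * incl r s j = incl m s (i + j) := by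
  ext a b
  rw [Matrix.mul_apply, Finset.sum_eq_single (⟨j + b, by omega⟩ : Fin r)]
  · simp [incl, add_assoc]
  · intro c _ hc
    have : c.val ≠ j + b.val := fun h => hc (Fin.ext h)
    simp [incl, this]
  · simp

theorem incl_self (m : ℕ) : incl m m 0 = 1 := by
  ext a b
  simp [incl, Matrix.one_apply, Fin.ext_iff]

/-- An embedded core transformation is an extension along a coordinate inclusion, so that all its
algebra follows from that of `plug`. -/
theorem embed_eq_plug (m i : ℕ) (G : Core) :
    embed m i G = plug (incl m 2 i) G := by
  ext a b
  simp only [plug, Matrix.add_apply, Matrix.mul_apply, Fin.sum_univ_two, incl, embed,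
    Matrix.conjTranspose_apply, Matrix.sub_apply, Matrix.one_apply, Fin.ext_iff]
  simp only [Fin.val_zero, Fin.val_one, add_zero]
  by_cases h1 : a.val = i
  · have h1' : ¬ a.val = i + 1 := by omega
    by_cases h2 : b.val = i
    · simp [h1, h2]
    · by_cases h3 : b.val = i + 1
      · simp [h1, h3]
      · simp [h1, h2, h3]
  · by_cases h1' : a.val = i + 1
    · by_cases h2 : b.val = i
      · simp [h1', h2]
      · by_cases h3 : b.val = i + 1
        · simp [h1', h3]
        · simp [h1', h2, h3]
    · simp [h1, h1']

/-! ### Rounding errors of the scalar operations -/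

/-- Exact arithmetic, as an instance of the standard model with unit round-off `0`. -/
def exactFP : FloatArith 0 where
  add := (· + ·)
  sub := (· - ·)
  mul := (· * ·)
  div := (· / ·)
  sqrt := Real.sqrt
  add_err := by simp
  sub_err := by simp
  mul_err := by simp
  div_err := by simp
  sqrt_err := by simp

theorem complex_norm_le_of_re_im {w z : ℂ} {c : ℝ} (hc : 0 ≤ c) (h1 : |w.re| ≤ c * |z.re|)
    (h2 : |w.im| ≤ c * |z.im|) : ‖w‖ ≤ c * ‖z‖ := by
  refine le_of_sq_le_sq ?_ (by positivity)
  rw [mul_pow, Complex.sq_norm, Complex.sq_norm, Complex.normSq_apply, Complex.normSq_apply]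
  have a1 := mul_self_le_mul_self (abs_nonneg _) h1
  have a2 := mul_self_le_mul_self (abs_nonneg _) h2
  have e : ∀ x : ℝ, |x| * |x| = x * x := abs_mul_abs_self
  nlinarith [e w.re, e w.im, e z.re, e z.im]

theorem abs_re_im_mul_le (x y : ℂ) : |x.re * y.re| + |x.im * y.im| ≤ ‖x‖ * ‖y‖ := by
  rw [abs_mul, abs_mul]
  refine le_of_sq_le_sq ?_ (by positivity)
  rw [mul_pow, Complex.sq_norm, Complex.sq_norm, Complex.normSq_apply, Complex.normSq_apply]
  nlinarith [sq_nonneg (|x.re| * |y.im| - |x.im| * |y.re|), sq_abs x.re, sq_abs x.im, sq_abs y.re,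
    sq_abs y.im]

theorem abs_re_im_mul_le' (x y : ℂ) : |x.re * y.im| + |x.im * y.re| ≤ ‖x‖ * ‖y‖ := by
  rw [abs_mul, abs_mul]
  refine le_of_sq_le_sq ?_ (by positivity)
  rw [mul_pow, Complex.sq_norm, Complex.sq_norm, Complex.normSq_apply, Complex.normSq_apply]
  nlinarith [sq_nonneg (|x.re| * |y.re| - |x.im| * |y.im|), sq_abs x.re, sq_abs x.im, sq_abs y.re,
    sq_abs y.im]

namespace FloatArith

variable {u : ℝ} (fp : FloatArith u)

theorem cadd_err (hu : 0 ≤ u) (x y : ℂ) : ‖fp.cadd x y - (x + y)‖ ≤ u * ‖x + y‖ := by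
  apply complex_norm_le_of_re_im hu
  · simpa [cadd] using fp.add_err x.re y.re
  · simpa [cadd] using fp.add_err x.im y.im

theorem csub_err (hu : 0 ≤ u) (x y : ℂ) : ‖fp.csub x y - (x - y)‖ ≤ u * ‖x - y‖ := by
  apply complex_norm_le_of_re_im hu
  · simpa [csub] using fp.sub_err x.re y.re
  · simpa [csub] using fp.sub_err x.im y.im

theorem cdiv_err (hu : 0 ≤ u) (z : ℂ) {r : ℝ} (hr : r ≠ 0) :
    ‖fp.cdiv z r - z / r‖ ≤ u * ‖z / r‖ := by
  apply complex_norm_le_of_re_im hu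
  · simpa [cdiv] using fp.div_err z.re r hr
  · simpa [cdiv] using fp.div_err z.im r hr

theorem sub_mul_mul_err (hu : 0 ≤ u) (hu1 : u ≤ 1) (a b c d : ℝ) :
    |fp.sub (fp.mul a b) (fp.mul c d) - (a * b - c * d)| ≤ 3 * u * (|a * b| + |c * d|) := by
  have h1 := fp.mul_err a b
  have h2 := fp.mul_err c d
  have h3 := fp.sub_err (fp.mul a b) (fp.mul c d)
  have h4 : |fp.mul a b - fp.mul c d| ≤ (1 + u) * (|a * b| + |c * d|) := by
    have e : fp.mul a b - fp.mul c d
        = (fp.mul a b - a * b) - (fp.mul c d - c * d) + (a * b - c * d) := by ring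
    rw [e]
    refine (abs_add_le _ _).trans ?_
    linarith [abs_sub (fp.mul a b - a * b) (fp.mul c d - c * d), abs_sub (a * b) (c * d)]
  have e : fp.sub (fp.mul a b) (fp.mul c d) - (a * b - c * d)
      = (fp.sub (fp.mul a b) (fp.mul c d) - (fp.mul a b - fp.mul c d))
        + ((fp.mul a b - a * b) - (fp.mul c d - c * d)) := by ring
  rw [e]
  refine (abs_add_le _ _).trans ?_
  have h5 := abs_sub (fp.mul a b - a * b) (fp.mul c d - c * d)
  have h6 := mul_le_mul_of_nonneg_left h4 hu
  have h7 : 0 ≤ |a * b| + |c * d| := by positivity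
  nlinarith [mul_nonneg hu h7]

theorem add_mul_mul_err (hu : 0 ≤ u) (hu1 : u ≤ 1) (a b c d : ℝ) :
    |fp.add (fp.mul a b) (fp.mul c d) - (a * b + c * d)| ≤ 3 * u * (|a * b| + |c * d|) := by
  have h1 := fp.mul_err a b
  have h2 := fp.mul_err c d
  have h3 := fp.add_err (fp.mul a b) (fp.mul c d)
  have h4 : |fp.mul a b + fp.mul c d| ≤ (1 + u) * (|a * b| + |c * d|) := by
    have e : fp.mul a b + fp.mul c d
        = (fp.mul a b - a * b) + (fp.mul c d - c * d) + (a * b + c * d) := by ring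
    rw [e]
    refine (abs_add_le _ _).trans ?_
    linarith [abs_add_le (fp.mul a b - a * b) (fp.mul c d - c * d), abs_add_le (a * b) (c * d)]
  have e : fp.add (fp.mul a b) (fp.mul c d) - (a * b + c * d)
      = (fp.add (fp.mul a b) (fp.mul c d) - (fp.mul a b + fp.mul c d))
        + ((fp.mul a b - a * b) + (fp.mul c d - c * d)) := by ring
  rw [e]
  refine (abs_add_le _ _).trans ?_
  have h5 := abs_add_le (fp.mul a b - a * b) (fp.mul c d - c * d)
  have h6 := mul_le_mul_of_nonneg_left h4 hu
  have h7 : 0 ≤ |a * b| + |c * d| := by positivity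
  nlinarith [mul_nonneg hu h7]

theorem cmul_err (hu : 0 ≤ u) (hu1 : u ≤ 1) (x y : ℂ) :
    ‖fp.cmul x y - x * y‖ ≤ 6 * u * (‖x‖ * ‖y‖) := by
  refine (Complex.norm_le_abs_re_add_abs_im _).trans ?_
  have h1 := fp.sub_mul_mul_err hu hu1 x.re y.re x.im y.im
  have h2 := fp.add_mul_mul_err hu hu1 x.re y.im x.im y.re
  have h3 := mul_le_mul_of_nonneg_left (abs_re_im_mul_le x y) (by positivity : 0 ≤ 3 * u)
  have h4 := mul_le_mul_of_nonneg_left (abs_re_im_mul_le' x y) (by positivity : 0 ≤ 3 * u)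
  have e1 : (fp.cmul x y - x * y).re
      = fp.sub (fp.mul x.re y.re) (fp.mul x.im y.im) - (x.re * y.re - x.im * y.im) := by
    simp [cmul]
  have e2 : (fp.cmul x y - x * y).im
      = fp.add (fp.mul x.re y.im) (fp.mul x.im y.re) - (x.re * y.im + x.im * y.re) := by
    simp [cmul]
  rw [e1, e2]
  linarith

theorem normSq_err (hu : 0 ≤ u) (hu1 : u ≤ 1) (z : ℂ) :
    |fp.normSq z - ‖z‖ ^ 2| ≤ 3 * u * ‖z‖ ^ 2 := by
  have h := fp.add_mul_mul_err hu hu1 z.re z.re z.im z.im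
  rw [Complex.sq_norm, Complex.normSq_apply]
  rwa [abs_of_nonneg (mul_self_nonneg z.re), abs_of_nonneg (mul_self_nonneg z.im)] at h

/-- A relative error `δ` of the argument of a square root is not magnified. -/
theorem sqrt_rel_err {x y δ : ℝ} (hu : 0 ≤ u) (hx : 0 ≤ x) (hδ1 : δ ≤ 1)
    (h : |y - x| ≤ δ * x) : |fp.sqrt y - √x| ≤ (δ + u * (1 + δ)) * √x := by
  have hy : 0 ≤ y := by
    have := (abs_le.1 h).1
    nlinarith
  have h1 := fp.sqrt_err y hy
  have h2 : |√y - √x| ≤ δ * √x := by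
    rcases hx.eq_or_lt with rfl | hx0
    · have : y = 0 := by simpa using h
      simp [this]
    · have hs : 0 < √x := Real.sqrt_pos.2 hx0
      have e : (√y - √x) * (√y + √x) = y - x := by
        have := Real.sq_sqrt hy
        have := Real.sq_sqrt hx
        nlinarith
      have : |√y - √x| * (√y + √x) ≤ δ * x := by
        rw [← abs_of_nonneg (by positivity : 0 ≤ √y + √x), ← abs_mul, e]
        exact h
      have h3 : |√y - √x| * √x ≤ δ * √x * √x := by
        rw [mul_assoc, Real.mul_self_sqrt hx]
        exact le_trans (mul_le_mul_of_nonneg_left (by linarith [Real.sqrt_nonneg y])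
          (abs_nonneg _)) this
      exact le_of_mul_le_mul_right h3 hs
  have h3 : √y ≤ (1 + δ) * √x := by linarith [(abs_le.1 h2).2]
  have := abs_sub_le (fp.sqrt y) (√y) √x
  nlinarith [mul_le_mul_of_nonneg_left h3 hu]

theorem norm₂_err (hu : 0 ≤ u) (hu1 : u ≤ 1 / 10) (a b : ℂ) :
    |fp.norm₂ a b - √(‖a‖ ^ 2 + ‖b‖ ^ 2)| ≤ 8 * u * √(‖a‖ ^ 2 + ‖b‖ ^ 2) := by
  have ha := fp.normSq_err hu (by linarith) a
  have hb := fp.normSq_err hu (by linarith) b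
  set N := ‖a‖ ^ 2 + ‖b‖ ^ 2 with hN
  have hN0 : 0 ≤ N := by positivity
  have h1 : |fp.add (fp.normSq a) (fp.normSq b) - N| ≤ 5 * u * N := by
    have h2 := fp.add_err (fp.normSq a) (fp.normSq b)
    have h3 : |fp.normSq a + fp.normSq b - N| ≤ 3 * u * N := by
      have e : fp.normSq a + fp.normSq b - N
        = (fp.normSq a - ‖a‖ ^ 2) + (fp.normSq b - ‖b‖ ^ 2) := by rw [hN]; ring
      rw [e]
      refine (abs_add_le _ _).trans ?_
      rw [hN]; linarith
    have h4 : |fp.normSq a + fp.normSq b| ≤ (1 + 3 * u) * N := by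
      have := abs_add_le (fp.normSq a + fp.normSq b - N) N
      rw [sub_add_cancel, abs_of_nonneg hN0] at this
      linarith
    have h5 := abs_sub_le (fp.add (fp.normSq a) (fp.normSq b)) (fp.normSq a + fp.normSq b) N
    nlinarith [mul_le_mul_of_nonneg_left h4 hu, mul_nonneg hu hN0]
  refine (fp.sqrt_rel_err hu hN0 (by linarith) h1).trans ?_
  refine mul_le_mul_of_nonneg_right ?_ (Real.sqrt_nonneg _)
  nlinarith

/-- Division of a number by a perturbed positive number. -/
theorem cdiv_rel_err (hu : 0 ≤ u) (z : ℂ) {r r' η : ℝ} (hr : 0 < r)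
    (hη : 0 ≤ η) (hη1 : η ≤ 1 / 10) (h : |r' - r| ≤ η * r) :
    ‖fp.cdiv z r' - z / r‖ ≤ (2 * u + 2 * η) * (‖z‖ / r) := by
  have hr' : 9 / 10 * r ≤ r' := by nlinarith [(abs_le.1 h).1]
  have hr'0 : 0 < r' := by linarith
  have h1 := fp.cdiv_err hu z hr'0.ne'
  have e : z / r' - z / r = z * (((r - r') / (r * r') : ℝ) : ℂ) := by
    have : (r : ℂ) ≠ 0 := by exact_mod_cast hr.ne'
    have : (r' : ℂ) ≠ 0 := by exact_mod_cast hr'0.ne'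
    push_cast
    field_simp
  have hq : 1 / r' ≤ 10 / 9 * (1 / r) := by
    rw [div_le_iff₀ hr'0]
    have : 1 / r * r' ≥ 9 / 10 := by
      rw [ge_iff_le, div_mul_eq_mul_div, one_mul, le_div_iff₀ hr]; exact hr'
    linarith
  have h2 : ‖z / r' - z / r‖ ≤ 10 / 9 * η * (‖z‖ / r) := by
    rw [e, norm_mul, Complex.norm_real, Real.norm_eq_abs, abs_div, abs_sub_comm,
      abs_of_pos (mul_pos hr hr'0)]
    have : |r' - r| / (r * r') ≤ 10 / 9 * η * (1 / r) := by
      calc |r' - r| / (r * r') ≤ η * r / (r * r') := by gcongr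
        _ = η * (1 / r') := by field_simp
        _ ≤ η * (10 / 9 * (1 / r)) := by gcongr
        _ = _ := by ring
    calc ‖z‖ * (|r' - r| / (r * r')) ≤ ‖z‖ * (10 / 9 * η * (1 / r)) := by gcongr
      _ = _ := by ring
  have h3 : ‖z / (r' : ℂ)‖ ≤ 10 / 9 * (‖z‖ / r) := by
    rw [norm_div, Complex.norm_real, Real.norm_eq_abs, abs_of_pos hr'0]
    calc ‖z‖ / r' = ‖z‖ * (1 / r') := by ring
      _ ≤ ‖z‖ * (10 / 9 * (1 / r)) := by gcongr
      _ = _ := by ring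
  have h4 := norm_sub_le_norm_sub_add_norm_sub (fp.cdiv z r') (z / r') (z / r)
  have h5 : 0 ≤ ‖z‖ / r := by positivity
  nlinarith [mul_le_mul_of_nonneg_left h3 hu, mul_nonneg hu h5, mul_nonneg hη h5]

theorem phase_err (hu : 0 ≤ u) (hu1 : u ≤ 1 / 100) {z : ℂ} (hz : z ≠ 0) :
    ‖fp.phase z - z / (‖z‖ : ℝ)‖ ≤ 12 * u := by
  have hz0 : 0 < ‖z‖ := norm_pos_iff.2 hz
  have h1 := fp.normSq_err hu (by linarith) z
  have h2 := fp.sqrt_rel_err hu (by positivity) (by linarith) h1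
  rw [Real.sqrt_sq hz0.le] at h2
  rw [phase, if_neg hz]
  have h3 : |fp.sqrt (fp.normSq z) - ‖z‖| ≤ 5 * u * ‖z‖ :=
    h2.trans (mul_le_mul_of_nonneg_right (by nlinarith) hz0.le)
  refine (fp.cdiv_rel_err hu z hz0 (by positivity) (by linarith) h3).trans ?_
  rw [div_self hz0.ne']
  linarith

end FloatArith

/-! ### Rounding errors of rotations, fusions and turnovers -/

theorem norm_le_sum_fin_two (A : Core) :
    ‖A‖ ≤ ‖A 0 0‖ + ‖A 0 1‖ + ‖A 1 0‖ + ‖A 1 1‖ := by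
  have := frobenius_norm_le_sum A
  simp only [Fin.sum_univ_two] at this
  linarith

theorem isUni_rotation {c s φ : ℂ} (h : ‖c‖ ^ 2 + ‖s‖ ^ 2 = 1) (hφ : ‖φ‖ = 1) :
    IsUni (!![c, -(φ * star s); s, φ * star c] : Core) := by
  have h1 : star c * c + star s * s = 1 := by
    have e : ∀ z : ℂ, star z * z = ((‖z‖ ^ 2 : ℝ) : ℂ) := fun z => by
      rw [Complex.sq_norm]; exact Complex.normSq_eq_conj_mul_self.symm
    rw [e, e, ← Complex.ofReal_add, h, Complex.ofReal_one]
  have h2 : star φ * φ = 1 := by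
    have : star φ * φ = ((‖φ‖ ^ 2 : ℝ) : ℂ) := by
      rw [Complex.sq_norm]; exact Complex.normSq_eq_conj_mul_self.symm
    rw [this, hφ]; simp
  apply isUni_of_left
  ext i j
  fin_cases i <;> fin_cases j <;> simp [Matrix.mul_apply, Fin.sum_univ_two] <;>
    simp only [RCLike.star_def] at h1 h2 ⊢
  · exact h1
  · ring
  · ring
  · linear_combination (starRingEnd ℂ φ * φ) * h1 + h2

/-- The exact rotation `G` with `Gᴴ (a, b)ᵀ = (r, 0)ᵀ`. -/
def rot (a b : ℂ) : Core :=
  if a = 0 ∧ b = 0 then 1 else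
    let N : ℂ := ((√(‖a‖ ^ 2 + ‖b‖ ^ 2) : ℝ) : ℂ)
    !![a / N, -star (b / N); b / N, star (a / N)]

theorem sqrt_pos_of_ne {a b : ℂ} (h : ¬(a = 0 ∧ b = 0)) : 0 < √(‖a‖ ^ 2 + ‖b‖ ^ 2) := by
  apply Real.sqrt_pos.2
  by_cases ha : a = 0
  · have hb : b ≠ 0 := fun hb => h ⟨ha, hb⟩
    have := norm_pos_iff.2 hb
    positivity
  · have := norm_pos_iff.2 ha
    positivity

theorem norm_div_sqrt {a : ℂ} {N : ℝ} (hN : 0 < N) : ‖a / (N : ℂ)‖ = ‖a‖ / N := by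
  rw [norm_div, Complex.norm_real, Real.norm_eq_abs, abs_of_pos hN]

theorem normalized_sq {a b : ℂ} (h : ¬(a = 0 ∧ b = 0)) :
    ‖a / ((√(‖a‖ ^ 2 + ‖b‖ ^ 2) : ℝ) : ℂ)‖ ^ 2 + ‖b / ((√(‖a‖ ^ 2 + ‖b‖ ^ 2) : ℝ) : ℂ)‖ ^ 2
      = 1 := by
  have hN := sqrt_pos_of_ne h
  rw [norm_div_sqrt hN, norm_div_sqrt hN, div_pow, div_pow, ← add_div,
    Real.sq_sqrt (by positivity), div_self]
  intro h0
  rw [h0] at hN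
  simp at hN

theorem rot_isUni (a b : ℂ) : IsUni (rot a b) := by
  unfold rot
  split_ifs with h
  · exact isUni_one
  · have := isUni_rotation (φ := 1) (normalized_sq h) (by simp)
    simpa using this

/-- The rotation `rot a b` annihilates the second component of `(a, b)`. -/
theorem rot_annihilates (a b : ℂ) :
    star (rot a b 0 1) * a + star (rot a b 1 1) * b = 0 := by
  unfold rot
  split_ifs with h
  · simp [h]
  · simp
    ring

/-- The rotation `rot a b` makes the first component of `(a, b)` real and nonnegative. -/
theorem rot_first (a b : ℂ) :
    ∃ r : ℝ, 0 ≤ r ∧ star (rot a b 0 0) * a + star (rot a b 1 0) * b = r := by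
  unfold rot
  split_ifs with h
  · exact ⟨0, le_rfl, by simp [h]⟩
  · refine ⟨√(‖a‖ ^ 2 + ‖b‖ ^ 2), Real.sqrt_nonneg _, ?_⟩
    have hN := sqrt_pos_of_ne h
    set N := √(‖a‖ ^ 2 + ‖b‖ ^ 2) with hNd
    have hN2 : N * N = ‖a‖ ^ 2 + ‖b‖ ^ 2 := by rw [hNd]; exact Real.mul_self_sqrt (by positivity)
    have hN0 : (N : ℂ) ≠ 0 := by exact_mod_cast hN.ne'
    have e : ∀ z : ℂ, starRingEnd ℂ z * z = ((‖z‖ ^ 2 : ℝ) : ℂ) := fun z => by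
      rw [Complex.sq_norm]; exact Complex.normSq_eq_conj_mul_self.symm
    simp
    rw [div_mul_eq_mul_div, div_mul_eq_mul_div, e, e, ← add_div, div_eq_iff hN0,
      ← Complex.ofReal_mul, hN2, Complex.ofReal_add]

/-- `G` is within distance `ε` of a unitary core transformation. -/
def NearU (ε : ℝ) (G : Core) : Prop := ∃ W : Core, IsUni W ∧ ‖G - W‖ ≤ ε

theorem NearU.conj {ε : ℝ} {G : Core} (h : NearU ε G) : NearU ε Gᴴ := by
  obtain ⟨W, hW, h⟩ := h
  exact ⟨Wᴴ, hW.conj, by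
    rwa [← Matrix.conjTranspose_sub, Matrix.frobenius_norm_conjTranspose]⟩

theorem nearU_of_isUni {ε : ℝ} (hε : 0 ≤ ε) {G : Core} (h : IsUni G) : NearU ε G :=
  ⟨G, h, by simpa using hε⟩

theorem isUni_norm_sq {m : ℕ} {U : Matrix (Fin m) (Fin m) ℂ} (h : IsUni U) : ‖U‖ ^ 2 = m := by
  rw [frobenius_norm_sq_eq_trace, h.left]
  simp

theorem isUni_norm_le {m : ℕ} (hm : m ≤ 3) {U : Matrix (Fin m) (Fin m) ℂ} (h : IsUni U) :
    ‖U‖ ≤ 7 / 4 := by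
  refine le_of_sq_le_sq ?_ (by norm_num)
  rw [isUni_norm_sq h]
  have : (m : ℝ) ≤ 3 := by exact_mod_cast hm
  linarith

theorem norm_mul_sub_mul_le {m : ℕ} (hm : m ≤ 3) {X X' Y Y' : Matrix (Fin m) (Fin m) ℂ}
    {ε₁ ε₂ : ℝ} (hX' : IsUni X') (hY' : IsUni Y') (h1 : ‖X - X'‖ ≤ ε₁) (h2 : ‖Y - Y'‖ ≤ ε₂)
    (hε : ε₂ ≤ 1 / 4) : ‖X * Y - X' * Y'‖ ≤ 2 * ε₁ + ε₂ := by
  have hY : ‖Y‖ ≤ 2 := by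
    have := norm_sub_norm_le Y Y'
    linarith [isUni_norm_le hm hY']
  have e : X * Y - X' * Y' = (X - X') * Y + X' * (Y - Y') := by
    rw [Matrix.sub_mul, Matrix.mul_sub]; abel
  rw [e]
  refine (norm_add_le _ _).trans ?_
  rw [hX'.norm_mul]
  have h3 := Matrix.frobenius_norm_mul (X - X') Y
  have h4 : ‖X - X'‖ * ‖Y‖ ≤ ε₁ * 2 := by
    apply mul_le_mul h1 hY (norm_nonneg _) ((norm_nonneg _).trans h1)
  linarith

namespace FloatArith

variable {u : ℝ} (fp : FloatArith u)

/-- Normalization by a computed length of `(a, b)`, with an absolute error of order `u` whatever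
the size of `a` and `b`. -/
theorem normalize_err (hu : 0 ≤ u) (hu1 : u ≤ 1 / 1000) {a b : ℂ} (h : ¬(a = 0 ∧ b = 0)) (z : ℂ)
    (hz : ‖z‖ ≤ √(‖a‖ ^ 2 + ‖b‖ ^ 2)) :
    ‖fp.cdiv z (fp.norm₂ a b) - z / ((√(‖a‖ ^ 2 + ‖b‖ ^ 2) : ℝ) : ℂ)‖ ≤ 18 * u := by
  have hN := sqrt_pos_of_ne h
  have h1 := fp.norm₂_err hu (by linarith) a b
  refine (fp.cdiv_rel_err hu z hN (by positivity) (by linarith) h1).trans ?_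
  have : ‖z‖ / √(‖a‖ ^ 2 + ‖b‖ ^ 2) ≤ 1 := (div_le_one hN).2 hz
  nlinarith

theorem le_hypot_left (a b : ℂ) : ‖a‖ ≤ √(‖a‖ ^ 2 + ‖b‖ ^ 2) :=
  Real.le_sqrt_of_sq_le (by nlinarith [sq_nonneg ‖b‖])

theorem le_hypot_right (a b : ℂ) : ‖b‖ ≤ √(‖a‖ ^ 2 + ‖b‖ ^ 2) :=
  Real.le_sqrt_of_sq_le (by nlinarith [sq_nonneg ‖a‖])

/-- A computed rotation is close to the exact rotation for the same, possibly erroneous,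
input. -/
theorem givens_err (hu : 0 ≤ u) (hu1 : u ≤ 1 / 1000) (a b : ℂ) :
    ‖fp.givens a b - rot a b‖ ≤ 120 * u := by
  unfold givens rot
  split_ifs with h
  · simp; positivity
  · have h1 := fp.normalize_err hu hu1 h a (le_hypot_left a b)
    have h2 := fp.normalize_err hu hu1 h b (le_hypot_right a b)
    refine (norm_le_sum_fin_two _).trans ?_
    simp only [Matrix.sub_apply, Matrix.of_apply, Matrix.cons_val', Matrix.cons_val_zero,
      Matrix.cons_val_one, Matrix.cons_val_fin_one, neg_sub_neg, ← star_sub, norm_star]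
    rw [norm_sub_rev _ (fp.cdiv b _)]
    linarith

theorem givens_nearU (hu : 0 ≤ u) (hu1 : u ≤ 1 / 1000) (a b : ℂ) :
    NearU (120 * u) (fp.givens a b) :=
  ⟨rot a b, rot_isUni a b, fp.givens_err hu hu1 a b⟩

/-- The computed phase of `z` is close to a unimodular number `φ` with `z = φ |z|`. -/
theorem exists_phase (hu : 0 ≤ u) (hu1 : u ≤ 1 / 100) (z : ℂ) :
    ∃ φ : ℂ, ‖φ‖ = 1 ∧ ‖fp.phase z - φ‖ ≤ 12 * u ∧ z = φ * (‖z‖ : ℝ) := by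
  by_cases hz : z = 0
  · refine ⟨1, by simp, ?_, by simp [hz]⟩
    simp [phase, hz]
    positivity
  · have hz0 : (‖z‖ : ℝ) ≠ 0 := norm_ne_zero_iff.2 hz
    have hz1 : ((‖z‖ : ℝ) : ℂ) ≠ 0 := by exact_mod_cast hz0
    refine ⟨z / (‖z‖ : ℝ), ?_, fp.phase_err hu hu1 hz, by field_simp⟩
    rw [norm_div, Complex.norm_real, norm_norm, div_self hz0]

theorem cmul_sub_le (hu : 0 ≤ u) (hu1 : u ≤ 1 / 1000) {x y x' y' : ℂ} {ε₁ ε₂ : ℝ}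
    (hx' : ‖x'‖ ≤ 11 / 10) (hy : ‖y‖ ≤ 11 / 10) (hx : ‖x‖ ≤ 11 / 10)
    (h1 : ‖x - x'‖ ≤ ε₁) (h2 : ‖y - y'‖ ≤ ε₂) :
    ‖fp.cmul x y - x' * y'‖ ≤ 8 * u + 11 / 10 * ε₁ + 11 / 10 * ε₂ := by
  have h3 := fp.cmul_err hu (by linarith) x y
  have h4 : ‖x‖ * ‖y‖ ≤ 121 / 100 := by nlinarith [norm_nonneg x, norm_nonneg y]
  have e : fp.cmul x y - x' * y' = (fp.cmul x y - x * y) + (x - x') * y + x' * (y - y') := by ring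
  rw [e]
  refine (norm_add₃_le).trans ?_
  rw [norm_mul, norm_mul]
  have h5 : ‖x - x'‖ * ‖y‖ ≤ ε₁ * (11 / 10) :=
    mul_le_mul h1 hy (norm_nonneg _) ((norm_nonneg _).trans h1)
  have h6 : ‖x'‖ * ‖y - y'‖ ≤ 11 / 10 * ε₂ :=
    mul_le_mul hx' h2 (norm_nonneg _) (by norm_num)
  nlinarith

/-- Renormalization produces a nearly unitary matrix from any input whose first column does not
vanish, whether or not that input is nearly unitary. -/
theorem unitarize_nearU (hu : 0 ≤ u) (hu1 : u ≤ 1 / 1000) {A : Core}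
    (h : ¬(A 0 0 = 0 ∧ A 1 0 = 0)) : NearU (120 * u) (fp.unitarize A) := by
  obtain ⟨φ, hφ, hφe, -⟩ := fp.exists_phase hu (by linarith)
    (fp.csub (fp.cmul (A 0 0) (A 1 1)) (fp.cmul (A 1 0) (A 0 1)))
  refine ⟨_, isUni_rotation (normalized_sq h) hφ, ?_⟩
  have h1 := fp.normalize_err hu hu1 h _ (le_hypot_left (A 0 0) (A 1 0))
  have h2 := fp.normalize_err hu hu1 h _ (le_hypot_right (A 0 0) (A 1 0))
  have hsq := normalized_sq h
  refine (norm_le_sum_fin_two _).trans ?_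
  unfold unitarize
  simp only [Matrix.sub_apply, Matrix.of_apply, Matrix.cons_val', Matrix.cons_val_zero,
      Matrix.cons_val_one, Matrix.cons_val_fin_one, neg_sub_neg]
  set c' := A 0 0 / ((√(‖A 0 0‖ ^ 2 + ‖A 1 0‖ ^ 2) : ℝ) : ℂ)
  set s' := A 1 0 / ((√(‖A 0 0‖ ^ 2 + ‖A 1 0‖ ^ 2) : ℝ) : ℂ)
  set c := fp.cdiv (A 0 0) (fp.norm₂ (A 0 0) (A 1 0))
  set s := fp.cdiv (A 1 0) (fp.norm₂ (A 0 0) (A 1 0))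
  set ψ := fp.phase (fp.csub (fp.cmul (A 0 0) (A 1 1)) (fp.cmul (A 1 0) (A 0 1)))
  have hc' : ‖c'‖ ≤ 1 := by nlinarith [norm_nonneg c', sq_nonneg ‖s'‖]
  have hs' : ‖s'‖ ≤ 1 := by nlinarith [norm_nonneg s', sq_nonneg ‖c'‖]
  have hc : ‖c‖ ≤ 11 / 10 := by linarith [norm_sub_norm_le c c']
  have hs : ‖s‖ ≤ 11 / 10 := by linarith [norm_sub_norm_le s s']
  have hψ : ‖ψ‖ ≤ 11 / 10 := by linarith [norm_sub_norm_le ψ φ]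
  have h3 := fp.cmul_sub_le hu hu1 (x := ψ) (x' := φ) (y := star s) (y' := star s')
    (ε₂ := 18 * u) (by rw [hφ]; norm_num) (by rwa [norm_star]) hψ hφe (by rw [← star_sub, norm_star]; exact h2)
  have h4 := fp.cmul_sub_le hu hu1 (x := ψ) (x' := φ) (y := star c) (y' := star c')
    (ε₂ := 18 * u) (by rw [hφ]; norm_num) (by rwa [norm_star]) hψ hφe (by rw [← star_sub, norm_star]; exact h1)
  rw [norm_sub_rev (φ * star s')]
  linarith

/-- The Gram determinant of two columns. -/
theorem sq_norm_det (a b e f : ℂ) : ‖a * f - e * b‖ ^ 2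
    = (‖a‖ ^ 2 + ‖e‖ ^ 2) * (‖b‖ ^ 2 + ‖f‖ ^ 2) - ‖star a * b + star e * f‖ ^ 2 := by
  simp only [Complex.sq_norm, Complex.normSq_apply, RCLike.star_def, Complex.sub_re,
    Complex.sub_im, Complex.add_re, Complex.add_im, Complex.mul_re, Complex.mul_im,
    Complex.conj_re, Complex.conj_im]
  ring

set_option maxHeartbeats 1000000 in
/-- Renormalization hardly changes a nearly unitary matrix. -/
theorem unitarize_err (hu : 0 ≤ u) (hu1 : u ≤ 1 / 1000) {A : Core} {δ : ℝ} (hδ1 : δ ≤ 1 / 100)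
    (h : ‖Aᴴ * A - 1‖ ≤ δ) :
    ‖fp.unitarize A - A‖ ≤ 40 * δ + 500 * u ∧ NearU (120 * u) (fp.unitarize A) := by
  have hδ : 0 ≤ δ := (norm_nonneg _).trans h
  obtain ⟨a, ha⟩ : ∃ z, A 0 0 = z := ⟨_, rfl⟩
  obtain ⟨b, hb⟩ : ∃ z, A 0 1 = z := ⟨_, rfl⟩
  obtain ⟨e, he⟩ : ∃ z, A 1 0 = z := ⟨_, rfl⟩
  obtain ⟨f, hf⟩ : ∃ z, A 1 1 = z := ⟨_, rfl⟩
  have n00 : ‖star a * a + star e * e - 1‖ ≤ δ := by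
    have := (norm_entry_le (Aᴴ * A - 1) 0 0).trans h
    simpa [Matrix.mul_apply, Fin.sum_univ_two, ha, he] using this
  have n11 : ‖star b * b + star f * f - 1‖ ≤ δ := by
    have := (norm_entry_le (Aᴴ * A - 1) 1 1).trans h
    simpa [Matrix.mul_apply, Fin.sum_univ_two, hb, hf] using this
  have n01 : ‖star a * b + star e * f‖ ≤ δ := by
    have := (norm_entry_le (Aᴴ * A - 1) 0 1).trans h
    simpa [Matrix.mul_apply, Fin.sum_univ_two, ha, hb, he, hf] using this
  have E : ∀ z : ℂ, star z * z = ((‖z‖ ^ 2 : ℝ) : ℂ) := fun z => by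
    rw [Complex.sq_norm]; exact Complex.normSq_eq_conj_mul_self.symm
  have m00 : |‖a‖ ^ 2 + ‖e‖ ^ 2 - 1| ≤ δ := by
    rw [E, E, ← Complex.ofReal_add, ← Complex.ofReal_one, ← Complex.ofReal_sub,
      Complex.norm_real] at n00
    exact n00
  have m11 : |‖b‖ ^ 2 + ‖f‖ ^ 2 - 1| ≤ δ := by
    rw [E, E, ← Complex.ofReal_add, ← Complex.ofReal_one, ← Complex.ofReal_sub,
      Complex.norm_real] at n11
    exact n11
  rw [abs_le] at m00 m11
  have ba : ‖a‖ ≤ 101 / 100 := by nlinarith [norm_nonneg a, sq_nonneg ‖e‖]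
  have be : ‖e‖ ≤ 101 / 100 := by nlinarith [norm_nonneg e, sq_nonneg ‖a‖]
  have bb : ‖b‖ ≤ 101 / 100 := by nlinarith [norm_nonneg b, sq_nonneg ‖f‖]
  have bf : ‖f‖ ≤ 101 / 100 := by nlinarith [norm_nonneg f, sq_nonneg ‖b‖]
  have hne : ¬(a = 0 ∧ e = 0) := by
    rintro ⟨h1, h2⟩
    rw [h1, h2] at m00
    norm_num at m00
    linarith
  refine ⟨?_, fp.unitarize_nearU hu hu1 (by rw [ha, he]; exact hne)⟩
  have hN := sqrt_pos_of_ne hne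
  have h1 := fp.normalize_err hu hu1 hne _ (le_hypot_left a e)
  have h2 := fp.normalize_err hu hu1 hne _ (le_hypot_right a e)
  -- normalization changes the first column by at most its distance from norm one
  obtain ⟨N, hNdef⟩ : ∃ z, √(‖a‖ ^ 2 + ‖e‖ ^ 2) = z := ⟨_, rfl⟩
  rw [hNdef] at hN h1 h2
  have hN2 : N ^ 2 = ‖a‖ ^ 2 + ‖e‖ ^ 2 := by rw [← hNdef]; exact Real.sq_sqrt (by positivity)
  have hN1 : |N - 1| ≤ δ := by
    rw [abs_le]; constructor <;> nlinarith
  have nrm : ∀ z : ℂ, ‖z‖ ≤ N → ‖z / (N : ℂ) - z‖ ≤ δ := fun z hz => by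
    have hN0 : (N : ℂ) ≠ 0 := by exact_mod_cast hN.ne'
    have e1 : z / (N : ℂ) - z = z / (N : ℂ) * (((1 - N : ℝ)) : ℂ) := by
      push_cast; field_simp
    rw [e1, norm_mul, norm_div_sqrt hN, Complex.norm_real, Real.norm_eq_abs, abs_sub_comm]
    have : ‖z‖ / N ≤ 1 := (div_le_one hN).2 hz
    nlinarith [abs_nonneg (N - 1)]
  have na := nrm a (hNdef ▸ le_hypot_left a e)
  have ne := nrm e (hNdef ▸ le_hypot_right a e)
  obtain ⟨c, hcdef⟩ : ∃ z, fp.cdiv a (fp.norm₂ a e) = z := ⟨_, rfl⟩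
  obtain ⟨s, hsdef⟩ : ∃ z, fp.cdiv e (fp.norm₂ a e) = z := ⟨_, rfl⟩
  rw [hcdef] at h1
  rw [hsdef] at h2
  have hca : ‖c - a‖ ≤ 18 * u + δ := by
    linarith [norm_sub_le_norm_sub_add_norm_sub c (a / (N : ℂ)) a]
  have hse : ‖s - e‖ ≤ 18 * u + δ := by
    linarith [norm_sub_le_norm_sub_add_norm_sub s (e / (N : ℂ)) e]
  have hc : ‖c‖ ≤ 11 / 10 := by linarith [norm_sub_norm_le c a]
  have hs : ‖s‖ ≤ 11 / 10 := by linarith [norm_sub_norm_le s e]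
  -- the determinant `D` is nearly unimodular, and so its phase is close to `D` itself
  obtain ⟨D, hD⟩ : ∃ z, z = a * f - e * b := ⟨_, rfl⟩
  obtain ⟨D', hD'⟩ : ∃ z, fp.csub (fp.cmul a f) (fp.cmul e b) = z := ⟨_, rfl⟩
  have hDsq : |‖D‖ ^ 2 - 1| ≤ 3 * δ := by
    have e2 := sq_norm_det a b e f
    have q1 : ‖star a * b + star e * f‖ ^ 2 ≤ δ * (1 / 100) := by
      rw [sq]; exact mul_le_mul n01 (n01.trans hδ1) (norm_nonneg _) hδ
    have q0 := sq_nonneg ‖star a * b + star e * f‖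
    rw [hD, e2, abs_le]
    generalize ‖star a * b + star e * f‖ ^ 2 = q at q0 q1 ⊢
    generalize ‖a‖ ^ 2 + ‖e‖ ^ 2 = p at m00 ⊢
    generalize ‖b‖ ^ 2 + ‖f‖ ^ 2 = t at m11 ⊢
    have r1 : |(p - 1) * (t - 1)| ≤ δ * (1 / 100) := by
      rw [abs_mul]
      exact mul_le_mul (abs_le.2 m00) ((abs_le.2 m11).trans hδ1) (abs_nonneg _) hδ
    have r2 := abs_le.1 r1
    constructor <;> linarith
  have hDn : |‖D‖ - 1| ≤ 3 * δ := by
    have e1 : |‖D‖ - 1| * (‖D‖ + 1) = |‖D‖ ^ 2 - 1| := by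
      rw [← abs_of_nonneg (by positivity : 0 ≤ ‖D‖ + 1), ← abs_mul]
      congr 1; ring
    nlinarith [norm_nonneg D, abs_nonneg (‖D‖ - 1)]
  have bD : ‖D‖ ≤ 11 / 10 := by linarith [(abs_le.1 hDn).2]
  have hDD : ‖D' - D‖ ≤ 20 * u := by
    have c1 := fp.cmul_err hu (by linarith) a f
    have c2 := fp.cmul_err hu (by linarith) e b
    have c3 := fp.csub_err hu (fp.cmul a f) (fp.cmul e b)
    rw [hD'] at c3
    have p1 : ‖a‖ * ‖f‖ ≤ 121 / 100 := by 
      exact (mul_le_mul ba bf (norm_nonneg _) (by norm_num)).trans (by norm_num)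
    have p2 : ‖e‖ * ‖b‖ ≤ 121 / 100 := by
      exact (mul_le_mul be bb (norm_nonneg _) (by norm_num)).trans (by norm_num)
    have p3 := mul_le_mul_of_nonneg_left p1 (by positivity : 0 ≤ 6 * u)
    have p4 := mul_le_mul_of_nonneg_left p2 (by positivity : 0 ≤ 6 * u)
    have c4 : ‖fp.cmul a f - fp.cmul e b - D‖ ≤ 15 * u := by
      have e1 : fp.cmul a f - fp.cmul e b - D
        = (fp.cmul a f - a * f) - (fp.cmul e b - e * b) := by rw [hD]; ring
      rw [e1]
      refine (norm_sub_le _ _).trans ?_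
      linarith
    have c5 : ‖fp.cmul a f - fp.cmul e b‖ ≤ 2 := by
      linarith [norm_sub_norm_le (fp.cmul a f - fp.cmul e b) D]
    have := norm_sub_le_norm_sub_add_norm_sub D' (fp.cmul a f - fp.cmul e b) D
    have := mul_le_mul_of_nonneg_left c5 hu
    linarith
  obtain ⟨φ, hφ, hφe, hφD⟩ := fp.exists_phase hu (by linarith) D'
  have hφD' : ‖φ - D‖ ≤ 40 * u + 3 * δ := by
    have e1 : φ - D = φ * (((1 - ‖D'‖ : ℝ)) : ℂ) + (D' - D) := by
      conv_rhs => rw [hφD]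
      simp only [norm_mul, hφ, one_mul, Complex.norm_real, norm_norm]
      push_cast; ring
    rw [e1]
    refine (norm_add_le _ _).trans ?_
    rw [norm_mul, hφ, one_mul, Complex.norm_real, Real.norm_eq_abs]
    have := abs_norm_sub_norm_le D' D
    have : |1 - ‖D'‖| ≤ 20 * u + 3 * δ := by
      rw [abs_le] at hDn this ⊢
      constructor <;> linarith
    linarith
  obtain ⟨ψ, hψdef⟩ : ∃ z, fp.phase D' = z := ⟨_, rfl⟩
  rw [hψdef] at hφe
  have hψD : ‖ψ - D‖ ≤ 52 * u + 3 * δ := by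
    linarith [norm_sub_le_norm_sub_add_norm_sub ψ φ D]
  have hψ : ‖ψ‖ ≤ 11 / 10 := by linarith [norm_sub_norm_le ψ φ]
  have h3 := fp.cmul_sub_le hu hu1 (x := ψ) (x' := D) (y := star s) (y' := star e)
    (ε₂ := 18 * u + δ) bD (by rwa [norm_star]) hψ hψD (by rw [← star_sub, norm_star]; exact hse)
  have h4 := fp.cmul_sub_le hu hu1 (x := ψ) (x' := D) (y := star c) (y' := star a)
    (ε₂ := 18 * u + δ) bD (by rwa [norm_star]) hψ hψD (by rw [← star_sub, norm_star]; exact hca)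
  -- for a nearly unitary matrix, the second column is nearly the determinant times the conjugated
  -- and reversed first column
  have k1 : ‖D * star e + b‖ ≤ 3 * δ := by
    have e1 : D * star e + b = a * (star a * b + star e * f)
        - b * (star a * a + star e * e - 1) := by rw [hD]; ring
    rw [e1]
    refine (norm_sub_le _ _).trans ?_
    rw [norm_mul, norm_mul]
    have := mul_le_mul ba n01 (norm_nonneg _) (by norm_num)
    have := mul_le_mul bb n00 (norm_nonneg _) (by norm_num)
    linarith
  have k2 : ‖D * star a - f‖ ≤ 3 * δ := by
    have e1 : D * star a - f = f * (star a * a + star e * e - 1)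
        - e * (star a * b + star e * f) := by rw [hD]; ring
    rw [e1]
    refine (norm_sub_le _ _).trans ?_
    rw [norm_mul, norm_mul]
    have := mul_le_mul be n01 (norm_nonneg _) (by norm_num)
    have := mul_le_mul bf n00 (norm_nonneg _) (by norm_num)
    linarith
  refine (norm_le_sum_fin_two _).trans ?_
  unfold unitarize
  simp only [Matrix.sub_apply, Matrix.of_apply, Matrix.cons_val', Matrix.cons_val_zero,
      Matrix.cons_val_one, Matrix.cons_val_fin_one, ha, hb, he, hf, hcdef, hsdef,
      hD', hψdef]
  have h5 : ‖-fp.cmul ψ (star s) - b‖ ≤ 8 * u + 11 / 10 * (52 * u + 3 * δ)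
      + 11 / 10 * (18 * u + δ) + 3 * δ := by
    have e1 : -fp.cmul ψ (star s) - b
        = -(fp.cmul ψ (star s) - D * star e) - (D * star e + b) := by ring
    rw [e1]
    refine (norm_sub_le _ _).trans ?_
    rw [norm_neg]
    linarith
  have h6 : ‖fp.cmul ψ (star c) - f‖ ≤ 8 * u + 11 / 10 * (52 * u + 3 * δ)
      + 11 / 10 * (18 * u + δ) + 3 * δ := by
    linarith [norm_sub_le_norm_sub_add_norm_sub (fp.cmul ψ (star c)) (D * star a) f]
  linarith

end FloatArith

namespace FloatArith

variable {u : ℝ} (fp : FloatArith u)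

/-- The bound on `acc` and the length keeps all intermediate sums bounded, so that each step of the
computed inner product commits an absolute error of at most `50 u`. -/
theorem fold_err (hu : 0 ≤ u) (hu1 : u ≤ 1 / 1000) {ι : Type*} (a b : ι → ℂ)
    (ha : ∀ i, ‖a i‖ ≤ 2) (hb : ∀ i, ‖b i‖ ≤ 2) (l : List ι) (acc : ℂ)
    (h : ‖acc‖ + 5 * l.length ≤ 20) :
    ‖l.foldl (fun acc i => fp.cadd acc (fp.cmul (a i) (b i))) acc
      - (acc + (l.map fun i => a i * b i).sum)‖ ≤ 50 * u * l.length := by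
  induction l generalizing acc with
  | nil => simp
  | cons i l ih =>
    simp only [List.foldl_cons, List.map_cons, List.sum_cons, List.length_cons, Nat.cast_add,
      Nat.cast_one] at h ⊢
    have hl : (0 : ℝ) ≤ l.length := Nat.cast_nonneg _
    have hp : ‖a i‖ * ‖b i‖ ≤ 4 :=
      (mul_le_mul (ha i) (hb i) (norm_nonneg _) (by norm_num)).trans (by norm_num)
    have h1 := fp.cmul_err hu (by linarith) (a i) (b i)
    have h2 := fp.cadd_err hu acc (fp.cmul (a i) (b i))
    have h3 : ‖fp.cmul (a i) (b i) - a i * b i‖ ≤ 24 * u := by nlinarith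
    have h4 : ‖fp.cmul (a i) (b i)‖ ≤ 5 := by
      have := norm_sub_norm_le (fp.cmul (a i) (b i)) (a i * b i)
      rw [norm_mul] at this
      linarith
    have h5 : ‖fp.cadd acc (fp.cmul (a i) (b i)) - (acc + a i * b i)‖ ≤ 50 * u := by
      have h6 : ‖acc + fp.cmul (a i) (b i)‖ ≤ 25 := by
        linarith [norm_add_le acc (fp.cmul (a i) (b i))]
      have e : fp.cadd acc (fp.cmul (a i) (b i)) - (acc + a i * b i)
        = (fp.cadd acc (fp.cmul (a i) (b i)) - (acc + fp.cmul (a i) (b i)))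
          + (fp.cmul (a i) (b i) - a i * b i) := by ring
      rw [e]
      refine (norm_add_le _ _).trans ?_
      nlinarith
    have h6 : ‖fp.cadd acc (fp.cmul (a i) (b i))‖ ≤ ‖acc‖ + 5 := by
      have := norm_sub_norm_le (fp.cadd acc (fp.cmul (a i) (b i))) (acc + a i * b i)
      have := norm_add_le acc (a i * b i)
      rw [norm_mul] at this
      linarith
    have h7 := ih (fp.cadd acc (fp.cmul (a i) (b i))) (by linarith)
    refine (norm_sub_le_norm_sub_add_norm_sub _
      (fp.cadd acc (fp.cmul (a i) (b i)) + (l.map fun i => a i * b i).sum) _).trans ?_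
    have e : fp.cadd acc (fp.cmul (a i) (b i)) + (l.map fun i => a i * b i).sum
        - (acc + (a i * b i + (l.map fun i => a i * b i).sum))
        = fp.cadd acc (fp.cmul (a i) (b i)) - (acc + a i * b i) := by ring
    rw [e]
    linarith

theorem mmul_err (hu : 0 ≤ u) (hu1 : u ≤ 1 / 1000) {m : ℕ} (hm : m ≤ 3)
    {A B : Matrix (Fin m) (Fin m) ℂ} (hA : ‖A‖ ≤ 2) (hB : ‖B‖ ≤ 2) :
    ‖fp.mmul A B - A * B‖ ≤ 1350 * u := by
  have hm' : (m : ℝ) ≤ 3 := by exact_mod_cast hm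
  have key : ∀ i j, ‖(fp.mmul A B - A * B) i j‖ ≤ 150 * u := fun i j => by
    have h := fp.fold_err hu hu1 (fun l => A i l) (fun l => B l j)
      (fun l => (norm_entry_le A i l).trans hA) (fun l => (norm_entry_le B l j).trans hB)
      (List.finRange m) 0 (by simp; linarith)
    have e : (A * B) i j = ((List.finRange m).map fun l => A i l * B l j).sum := by
      rw [Matrix.mul_apply, ← List.ofFn_eq_map, List.sum_ofFn]
    rw [Matrix.sub_apply, e, mmul]
    rw [zero_add, List.length_finRange] at h
    exact h.trans (by nlinarith)
  refine (frobenius_norm_le_sum _).trans ?_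
  calc ∑ i, ∑ j, ‖(fp.mmul A B - A * B) i j‖ ≤ ∑ _i : Fin m, ∑ _j : Fin m, 150 * u :=
        Finset.sum_le_sum fun i _ => Finset.sum_le_sum fun j _ => key i j
    _ = m * (m * (150 * u)) := by simp
    _ ≤ 3 * (3 * (150 * u)) := by gcongr
    _ = _ := by ring

/-- Computed product of two nearly unitary matrices of size at most three. -/
theorem mmul_near (hu : 0 ≤ u) (hu1 : u ≤ 1 / 1000) {m : ℕ} (hm : m ≤ 3)
    {X X' Y Y' : Matrix (Fin m) (Fin m) ℂ} {ε₁ ε₂ : ℝ} (hX' : IsUni X') (hY' : IsUni Y')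
    (h1 : ‖X - X'‖ ≤ ε₁) (h2 : ‖Y - Y'‖ ≤ ε₂) (hε₁ : ε₁ ≤ 1 / 4) (hε : ε₂ ≤ 1 / 4) :
    ‖fp.mmul X Y - X' * Y'‖ ≤ 2 * ε₁ + ε₂ + 1350 * u := by
  have hX : ‖X‖ ≤ 2 := by
    linarith [norm_sub_norm_le X X', isUni_norm_le hm hX']
  have hY : ‖Y‖ ≤ 2 := by
    linarith [norm_sub_norm_le Y Y', isUni_norm_le hm hY']
  have h3 := fp.mmul_err hu hu1 hm hX hY
  have h4 := norm_mul_sub_mul_le hm hX' hY' h1 h2 hε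
  linarith [norm_sub_le_norm_sub_add_norm_sub (fp.mmul X Y) (X * Y) (X' * Y')]

theorem gram_near {m : ℕ} (hm : m ≤ 3) {X W : Matrix (Fin m) (Fin m) ℂ} {ε : ℝ} (hW : IsUni W)
    (h : ‖X - W‖ ≤ ε) (hε : ε ≤ 1 / 4) : ‖Xᴴ * X - 1‖ ≤ 3 * ε := by
  have h1 : ‖Xᴴ - Wᴴ‖ ≤ ε := by
    rwa [← Matrix.conjTranspose_sub, Matrix.frobenius_norm_conjTranspose]
  have := norm_mul_sub_mul_le hm hW.conj hW h1 h hε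
  rw [hW.left] at this
  linarith

/-- A fusion is accurate, and its result is again nearly unitary, with a bound that does not
depend on those of the factors. -/
theorem fuse_err (hu : 0 ≤ u) (hu1 : u ≤ 1 / 10 ^ 8) {F G : Core} (hF : NearU (120 * u) F)
    (hG : NearU (120 * u) G) :
    ‖fp.fuse F G - F * G‖ ≤ 2 * 10 ^ 7 * u ∧ NearU (120 * u) (fp.fuse F G) := by
  obtain ⟨F', hF', h1⟩ := hF
  obtain ⟨G', hG', h2⟩ := hG
  have h3 := fp.mmul_near hu (by linarith) (by norm_num) hF' hG' h1 h2 (by linarith) (by linarith)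
  have h4 := norm_mul_sub_mul_le (by norm_num) hF' hG' h1 h2 (by linarith)
  have h5 := gram_near (by norm_num) (hF'.mul hG') h3 (by linarith)
  obtain ⟨h6, h7⟩ := fp.unitarize_err hu (by linarith) (by linarith) h5
  refine ⟨?_, h7⟩
  have h8 := norm_sub_le_norm_sub_add_norm_sub (fp.fuse F G) (fp.mmul F G) (F * G)
  have h9 := norm_sub_le_norm_sub_add_norm_sub (fp.mmul F G) (F' * G') (F * G)
  rw [norm_sub_rev (F' * G')] at h9
  unfold fuse at *
  linarith

end FloatArith

theorem norm_embed_sub {m i : ℕ} (h : i + 2 ≤ m) (A B : Core) :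
    ‖embed m i A - embed m i B‖ = ‖A - B‖ := by
  rw [embed_eq_plug, embed_eq_plug, norm_plug_sub (incl_isometry h)]

theorem embed_isUni {m i : ℕ} (h : i + 2 ≤ m) {W : Core} (hW : IsUni W) : IsUni (embed m i W) := by
  rw [embed_eq_plug]
  exact plug_isUni (incl_isometry h) hW

theorem embed_conj (m i : ℕ) (G : Core) : (embed m i G)ᴴ = embed m i Gᴴ := by
  rw [embed_eq_plug, embed_eq_plug, plug_conj]

theorem embed_mul {m i : ℕ} (h : i + 2 ≤ m) (A B : Core) :
    embed m i (A * B) = embed m i A * embed m i B := by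
  rw [embed_eq_plug, embed_eq_plug, embed_eq_plug, plug_mul (incl_isometry h)]

theorem embed_one (m i : ℕ) : embed m i 1 = 1 := by
  rw [embed_eq_plug, plug_one]

/-- A unitary matrix whose first column is nearly `(r, 0, 0)ᵀ` with `r ≥ 0` is nearly the direct
sum of `1` and a `2 × 2` block. -/
theorem near_embed_of_first_column {W : Matrix (Fin 3) (Fin 3) ℂ} (hW : IsUni W) {ε r : ℝ}
    (hε : ε ≤ 1 / 2) (hr : 0 ≤ r) (h0 : ‖W 0 0 - r‖ ≤ ε) (h1 : ‖W 1 0‖ ≤ ε) (h2 : ‖W 2 0‖ ≤ ε) :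
    ‖embed 3 1 !![W 1 1, W 1 2; W 2 1, W 2 2] - W‖ ≤ 11 * ε := by
  have E : ∀ z : ℂ, star z * z = ((‖z‖ ^ 2 : ℝ) : ℂ) := fun z => by
    rw [Complex.sq_norm]; exact Complex.normSq_eq_conj_mul_self.symm
  have hε0 : 0 ≤ ε := (norm_nonneg _).trans h1
  have col : ‖W 0 0‖ ^ 2 + ‖W 1 0‖ ^ 2 + ‖W 2 0‖ ^ 2 = 1 := by
    have := congrFun (congrFun hW.left 0) 0
    simp only [Matrix.mul_apply, Fin.sum_univ_three, Matrix.conjTranspose_apply,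
      Matrix.one_apply_eq, E] at this
    exact_mod_cast this
  have row : ‖W 0 0‖ ^ 2 + ‖W 0 1‖ ^ 2 + ‖W 0 2‖ ^ 2 = 1 := by
    have := congrFun (congrFun hW.right 0) 0
    simp only [Matrix.mul_apply, Fin.sum_univ_three, Matrix.conjTranspose_apply,
      Matrix.one_apply_eq, mul_comm _ (star _), E] at this
    exact_mod_cast this
  have s1 : ‖W 1 0‖ ^ 2 ≤ ε ^ 2 := pow_le_pow_left₀ (norm_nonneg _) h1 2
  have s2 : ‖W 2 0‖ ^ 2 ≤ ε ^ 2 := pow_le_pow_left₀ (norm_nonneg _) h2 2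
  have h01 : ‖W 0 1‖ ≤ 2 * ε :=
    le_of_sq_le_sq (by nlinarith [sq_nonneg ‖W 0 2‖]) (by positivity)
  have h02 : ‖W 0 2‖ ≤ 2 * ε :=
    le_of_sq_le_sq (by nlinarith [sq_nonneg ‖W 0 1‖]) (by positivity)
  have a0 : |‖W 0 0‖ - 1| ≤ 2 * ε ^ 2 := by
    rw [abs_le]
    constructor <;> nlinarith [norm_nonneg (W 0 0), sq_nonneg ‖W 1 0‖, sq_nonneg ‖W 2 0‖]
  have a1 : |‖W 0 0‖ - r| ≤ ε := by
    have := abs_norm_sub_norm_le (W 0 0) (r : ℂ)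
    rw [Complex.norm_real, Real.norm_eq_abs, abs_of_nonneg hr] at this
    linarith
  have h00 : ‖1 - W 0 0‖ ≤ 3 * ε := by
    have e : 1 - W 0 0 = -(W 0 0 - r) + ((1 - r : ℝ) : ℂ) := by push_cast; ring
    rw [e]
    refine (norm_add_le _ _).trans ?_
    rw [norm_neg, Complex.norm_real, Real.norm_eq_abs]
    have : |1 - r| ≤ 2 * ε ^ 2 + ε := by
      rw [abs_le] at a0 a1 ⊢
      constructor <;> linarith
    nlinarith
  refine (frobenius_norm_le_sum _).trans ?_
  simp only [Fin.sum_univ_three]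
  simp [embed]
  linarith

namespace FloatArith

variable {u : ℝ} (fp : FloatArith u)

/-- A computed turnover is accurate, and its results are nearly unitary, with bounds that do not
depend on those of the three given core transformations. -/
theorem turnRL_err (hu : 0 ≤ u) (hu1 : u ≤ 1 / 10 ^ 8) {F G H : Core} (hF : NearU (120 * u) F)
    (hG : NearU (120 * u) G) (hH : NearU (120 * u) H) :
    (NearU (120 * u) (fp.turnRL F G H).1 ∧ NearU (120 * u) (fp.turnRL F G H).2.1 ∧
      NearU (120 * u) (fp.turnRL F G H).2.2) ∧
    ‖embed 3 0 F * embed 3 1 G * embed 3 0 H - embed 3 1 (fp.turnRL F G H).1 *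
      embed 3 0 (fp.turnRL F G H).2.1 * embed 3 1 (fp.turnRL F G H).2.2‖
      ≤ 2 * 10 ^ 7 * u := by
  have hu2 : u ≤ 1 / 1000 := by linarith
  have h3 : (3 : ℕ) ≤ 3 := le_rfl
  obtain ⟨F₀, hF₀, eF⟩ := hF
  obtain ⟨G₀, hG₀, eG⟩ := hG
  obtain ⟨H₀, hH₀, eH⟩ := hH
  rw [← norm_embed_sub (m := 3) (i := 0) (by norm_num)] at eF eH
  rw [← norm_embed_sub (m := 3) (i := 1) (by norm_num)] at eG
  replace hF₀ := embed_isUni (m := 3) (i := 0) (by norm_num) hF₀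
  replace hG₀ := embed_isUni (m := 3) (i := 1) (by norm_num) hG₀
  replace hH₀ := embed_isUni (m := 3) (i := 0) (by norm_num) hH₀
  -- the product of the three given cores, with a unitary matrix `W` that is close to it
  have a1 := fp.mmul_near hu hu2 h3 hF₀ hG₀ eF eG (by linarith) (by linarith)
  have a2 := fp.mmul_near hu hu2 h3 (hF₀.mul hG₀) hH₀ a1 eH (by linarith) (by linarith)
  have a3 := norm_mul_sub_mul_le h3 hF₀ hG₀ eF eG (by linarith)
  have a4 := norm_mul_sub_mul_le h3 (hF₀.mul hG₀) hH₀ a3 eH (by linarith)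
  obtain ⟨W, hWdef⟩ : ∃ W, embed 3 0 F₀ * embed 3 1 G₀ * embed 3 0 H₀ = W := ⟨_, rfl⟩
  have hW : IsUni W := hWdef ▸ (hF₀.mul hG₀).mul hH₀
  rw [hWdef] at a2 a4
  unfold turnRL
  obtain ⟨A, hA⟩ : ∃ A, fp.mmul (fp.mmul (embed 3 0 F) (embed 3 1 G)) (embed 3 0 H) = A := ⟨_, rfl⟩
  rw [hA] at a2 ⊢
  -- the first rotation: the exact one that belongs to it annihilates the entry `(2, 0)` of `A`,
  -- hence nearly annihilates that of `W`
  obtain ⟨F', hF'⟩ : ∃ F', fp.givens (A 1 0) (A 2 0) = F' := ⟨_, rfl⟩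
  have b1 : ‖F' - rot (A 1 0) (A 2 0)‖ ≤ 120 * u := hF' ▸ fp.givens_err hu hu2 _ _
  simp only [hF']
  obtain ⟨F₁, hF₁⟩ : ∃ F₁, rot (A 1 0) (A 2 0) = F₁ := ⟨_, rfl⟩
  have F₁u : IsUni F₁ := hF₁ ▸ rot_isUni _ _
  have z1 : (((embed 3 1 F₁)ᴴ * A : Matrix (Fin 3) (Fin 3) ℂ)) 2 0 = 0 := by
    have := rot_annihilates (A 1 0) (A 2 0)
    rw [hF₁] at this
    rw [Matrix.mul_apply, Fin.sum_univ_three]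
    simpa [embed] using this
  rw [hF₁] at b1
  have F'n : NearU (120 * u) F' := ⟨F₁, F₁u, b1⟩
  rw [← norm_embed_sub (m := 3) (i := 1) (by norm_num)] at b1
  replace F₁u := embed_isUni (m := 3) (i := 1) (by norm_num) F₁u
  have b1' : ‖(embed 3 1 F')ᴴ - (embed 3 1 F₁)ᴴ‖ ≤ 120 * u := by
    rwa [← Matrix.conjTranspose_sub, Matrix.frobenius_norm_conjTranspose]
  have b2 := fp.mmul_near hu hu2 h3 F₁u.conj hW b1' a2 (by linarith) (by linarith)
  obtain ⟨A₁, hA₁⟩ : ∃ A₁, fp.mmul (embed 3 1 F')ᴴ A = A₁ := ⟨_, rfl⟩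
  simp only [hA₁] at b2 ⊢
  have z1' : ‖((embed 3 1 F₁)ᴴ * W : Matrix (Fin 3) (Fin 3) ℂ) 2 0‖ ≤ 5000 * u := by
    have h := norm_entry_le ((embed 3 1 F₁)ᴴ * (A - W)) 2 0
    rw [F₁u.conj.norm_mul, Matrix.mul_sub, Matrix.sub_apply, z1, zero_sub, norm_neg] at h
    linarith
  obtain ⟨W₁, hW₁⟩ : ∃ W₁, (embed 3 1 F₁)ᴴ * W = W₁ := ⟨_, rfl⟩
  have W₁u : IsUni W₁ := hW₁ ▸ F₁u.conj.mul hW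
  rw [hW₁] at b2 z1'
  -- the second rotation, likewise: the first column of the unitary matrix `W₂` is nearly
  -- `(r, 0, 0)ᵀ`
  obtain ⟨G', hG'⟩ : ∃ G', fp.givens (A₁ 0 0) (A₁ 1 0) = G' := ⟨_, rfl⟩
  have c1 : ‖G' - rot (A₁ 0 0) (A₁ 1 0)‖ ≤ 120 * u := hG' ▸ fp.givens_err hu hu2 _ _
  simp only [hG']
  obtain ⟨G₁, hG₁⟩ : ∃ G₁, rot (A₁ 0 0) (A₁ 1 0) = G₁ := ⟨_, rfl⟩
  have G₁u : IsUni G₁ := hG₁ ▸ rot_isUni _ _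
  have z2 : (((embed 3 0 G₁)ᴴ * A₁ : Matrix (Fin 3) (Fin 3) ℂ)) 1 0 = 0 := by
    have := rot_annihilates (A₁ 0 0) (A₁ 1 0)
    rw [hG₁] at this
    rw [Matrix.mul_apply, Fin.sum_univ_three]
    simpa [embed] using this
  obtain ⟨r, hr, z3⟩ : ∃ r : ℝ, 0 ≤ r ∧
      (((embed 3 0 G₁)ᴴ * A₁ : Matrix (Fin 3) (Fin 3) ℂ)) 0 0 = r := by
    obtain ⟨r, hr, h⟩ := rot_first (A₁ 0 0) (A₁ 1 0)
    rw [hG₁] at h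
    refine ⟨r, hr, ?_⟩
    rw [Matrix.mul_apply, Fin.sum_univ_three]
    simpa [embed] using h
  rw [hG₁] at c1
  have G'n : NearU (120 * u) G' := ⟨G₁, G₁u, c1⟩
  rw [← norm_embed_sub (m := 3) (i := 0) (by norm_num)] at c1
  replace G₁u := embed_isUni (m := 3) (i := 0) (by norm_num) G₁u
  have c1' : ‖(embed 3 0 G')ᴴ - (embed 3 0 G₁)ᴴ‖ ≤ 120 * u := by
    rwa [← Matrix.conjTranspose_sub, Matrix.frobenius_norm_conjTranspose]
  have c2 := fp.mmul_near hu hu2 h3 G₁u.conj W₁u c1' b2 (by linarith) (by linarith)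
  obtain ⟨A₂, hA₂⟩ : ∃ A₂, fp.mmul (embed 3 0 G')ᴴ A₁ = A₂ := ⟨_, rfl⟩
  simp only [hA₂] at c2 ⊢
  obtain ⟨W₂, hW₂⟩ : ∃ W₂, (embed 3 0 G₁)ᴴ * W₁ = W₂ := ⟨_, rfl⟩
  have W₂u : IsUni W₂ := hW₂ ▸ G₁u.conj.mul W₁u
  have d0 : ∀ i j, ‖W₂ i j - ((embed 3 0 G₁)ᴴ * A₁ : Matrix (Fin 3) (Fin 3) ℂ) i j‖
      ≤ 6500 * u := fun i j => by
    have h := norm_entry_le ((embed 3 0 G₁)ᴴ * (W₁ - A₁)) i j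
    rw [G₁u.conj.norm_mul, Matrix.mul_sub, Matrix.sub_apply, hW₂, norm_sub_rev W₁] at h
    linarith
  have z2' : ‖W₂ 1 0‖ ≤ 6500 * u := by simpa [z2] using d0 1 0
  have z3' : ‖W₂ 0 0 - r‖ ≤ 6500 * u := by simpa [z3] using d0 0 0
  have z4 : ‖W₂ 2 0‖ ≤ 6500 * u := by
    have : W₂ 2 0 = W₁ 2 0 := by
      rw [← hW₂, Matrix.mul_apply, Fin.sum_univ_three]
      simp [embed]
    rw [this]; linarith
  rw [hW₂] at c2
  have e1 := near_embed_of_first_column W₂u (by linarith) hr z3' z2' z4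
  -- the third core is the trailing block of `A₂`, renormalized; the rest of `W₂` is nearly trivial
  obtain ⟨B, hB⟩ : ∃ B : Core, !![A₂ 1 1, A₂ 1 2; A₂ 2 1, A₂ 2 2] = B := ⟨_, rfl⟩
  rw [hB]
  have e2 : ‖embed 3 1 B - embed 3 1 !![W₂ 1 1, W₂ 1 2; W₂ 2 1, W₂ 2 2]‖ ≤ 33000 * u := by
    rw [norm_embed_sub (by norm_num)]
    refine (norm_le_sum_fin_two _).trans ?_
    rw [← hB]
    have f := fun i j => (norm_entry_le (A₂ - W₂) i j).trans c2
    simp only [Matrix.sub_apply] at f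
    simp only [Matrix.sub_apply, Matrix.of_apply, Matrix.cons_val', Matrix.cons_val_zero,
      Matrix.cons_val_one, Matrix.cons_val_fin_one]
    linarith [f 1 1, f 1 2, f 2 1, f 2 2]
  have e3 : ‖embed 3 1 B - W₂‖ ≤ 110000 * u := by
    linarith [norm_sub_le_norm_sub_add_norm_sub (embed 3 1 B)
      (embed 3 1 !![W₂ 1 1, W₂ 1 2; W₂ 2 1, W₂ 2 2]) W₂]
  have e4 : ‖Bᴴ * B - 1‖ ≤ 330000 * u := by
    have h := gram_near h3 W₂u e3 (by linarith)
    rw [embed_conj, ← embed_mul (by norm_num), ← embed_one 3 1, norm_embed_sub (by norm_num)] at h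
    linarith
  obtain ⟨e5, e6⟩ := fp.unitarize_err hu hu2 (by linarith) e4
  refine ⟨⟨F'n, G'n, e6⟩, ?_⟩
  rw [← norm_embed_sub (m := 3) (i := 1) (by norm_num)] at e5
  have e7 : ‖embed 3 1 (fp.unitarize B) - W₂‖ ≤ 140 * 10 ^ 5 * u := by
    linarith [norm_sub_le_norm_sub_add_norm_sub (embed 3 1 (fp.unitarize B)) (embed 3 1 B) W₂]
  have e8 := norm_mul_sub_mul_le h3 F₁u G₁u b1 c1 (by linarith)
  have e9 := norm_mul_sub_mul_le h3 (F₁u.mul G₁u) W₂u e8 e7 (by linarith)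
  have e10 : embed 3 1 F₁ * embed 3 0 G₁ * W₂ = W := by
    rw [← hW₂, ← hW₁, Matrix.mul_assoc, G₁u.cancel', F₁u.cancel']
  rw [e10, norm_sub_rev] at e9
  linarith [norm_sub_le_norm_sub_add_norm_sub (embed 3 0 F * embed 3 1 G * embed 3 0 H) W
    (embed 3 1 F' * embed 3 0 G' * embed 3 1 (fp.unitarize B))]

end FloatArith

theorem norm_submatrix_rev {m : ℕ} (A : Matrix (Fin m) (Fin m) ℂ) :
    ‖A.submatrix Fin.rev Fin.rev‖ = ‖A‖ := by
  have h : ‖A.submatrix Fin.rev Fin.rev‖ ^ 2 = ‖A‖ ^ 2 := by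
    rw [frobenius_norm_sq, frobenius_norm_sq, ← Equiv.sum_comp Fin.revPerm]
    refine Finset.sum_congr rfl fun i _ => ?_
    rw [← Equiv.sum_comp Fin.revPerm]
    simp
  exact (pow_left_inj₀ (norm_nonneg _) (norm_nonneg _) two_ne_zero).1 h

theorem submatrix_rev_mul {m : ℕ} (A B : Matrix (Fin m) (Fin m) ℂ) :
    (A * B).submatrix Fin.rev Fin.rev = A.submatrix Fin.rev Fin.rev * B.submatrix Fin.rev Fin.rev :=
  (Matrix.submatrix_mul_equiv A B _ Fin.revPerm _).symm

theorem NearU.flip {ε : ℝ} {G : Core} (h : NearU ε G) : NearU ε (flip G) := by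
  obtain ⟨W, hW, h⟩ := h
  refine ⟨CoreChasing.flip W, isUni_of_left ?_, ?_⟩
  · rw [CoreChasing.flip, Matrix.conjTranspose_submatrix, ← submatrix_rev_mul, hW.left]
    ext i j
    fin_cases i <;> fin_cases j <;> simp
  · change ‖(G - W).submatrix Fin.rev Fin.rev‖ ≤ ε
    rwa [norm_submatrix_rev]

theorem flip_flip (G : Core) : flip (flip G) = G := by
  ext i j
  simp [flip]

theorem embed_flip_zero (G : Core) :
    embed 3 0 (flip G) = (embed 3 1 G).submatrix Fin.rev Fin.rev := by
  ext i j
  fin_cases i <;> fin_cases j <;> simp [embed, flip, Fin.rev]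

theorem embed_flip_one (G : Core) :
    embed 3 1 (flip G) = (embed 3 0 G).submatrix Fin.rev Fin.rev := by
  ext i j
  fin_cases i <;> fin_cases j <;> simp [embed, flip, Fin.rev]

/-- The converse turnover is the first one with the three coordinates in reversed order. -/
theorem FloatArith.turnLR_err {u : ℝ} (fp : FloatArith u) (hu : 0 ≤ u) (hu1 : u ≤ 1 / 10 ^ 8)
    {F G H : Core} (hF : NearU (120 * u) F)
    (hG : NearU (120 * u) G) (hH : NearU (120 * u) H) :
    (NearU (120 * u) (fp.turnLR F G H).1 ∧ NearU (120 * u) (fp.turnLR F G H).2.1 ∧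
      NearU (120 * u) (fp.turnLR F G H).2.2) ∧
    ‖embed 3 1 F * embed 3 0 G * embed 3 1 H - embed 3 0 (fp.turnLR F G H).1 *
      embed 3 1 (fp.turnLR F G H).2.1 * embed 3 0 (fp.turnLR F G H).2.2‖
      ≤ 2 * 10 ^ 7 * u := by
  obtain ⟨⟨h1, h2, h3⟩, h4⟩ := fp.turnRL_err hu hu1 hF.flip hG.flip hH.flip
  refine ⟨⟨h1.flip, h2.flip, h3.flip⟩, ?_⟩
  rw [← norm_submatrix_rev]
  simp only [Matrix.submatrix_sub, Pi.sub_apply, submatrix_rev_mul, ← embed_flip_zero,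
    ← embed_flip_one, turnLR, flip_flip]
  exact h4

/-! ### Turnovers inside descending sequences -/

/-- The part of a descending sequence that consists of the core transformations number
`a, …, a + l - 1`. -/
def seg (m : ℕ) (q : ℕ → Core) (a l : ℕ) : Matrix (Fin m) (Fin m) ℂ :=
  ((List.range' a l).map fun i => embed m i (q i)).prod

theorem seg_zero (m : ℕ) (q : ℕ → Core) (a : ℕ) : seg m q a 0 = 1 := by simp [seg]

theorem seg_succ (m : ℕ) (q : ℕ → Core) (a l : ℕ) :
    seg m q a (l + 1) = embed m a (q a) * seg m q (a + 1) l := by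
  simp [seg, List.range'_succ]

theorem seg_add (m : ℕ) (q : ℕ → Core) (a l l' : ℕ) :
    seg m q a (l + l') = seg m q a l * seg m q (a + l) l' := by
  simp [seg, ← List.range'_append_1]

theorem seqMatrix_eq_seg (m : ℕ) (q : ℕ → Core) : seqMatrix m q = seg m q 0 (m - 1) := by
  simp [seqMatrix, seg, List.range_eq_range']

theorem seg_congr {m : ℕ} {q q' : ℕ → Core} {a l : ℕ}
    (h : ∀ i, a ≤ i → i < a + l → q i = q' i) : seg m q a l = seg m q' a l := by
  unfold seg
  congr 1
  apply List.map_congr_left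
  intro i hi
  rw [List.mem_range'_1] at hi
  rw [h i hi.1 hi.2]

theorem seg_commute {m : ℕ} {q : ℕ → Core} {a l : ℕ} {X : Matrix (Fin m) (Fin m) ℂ}
    (h : ∀ i, a ≤ i → i < a + l → Commute X (embed m i (q i))) : Commute X (seg m q a l) := by
  unfold seg
  apply Commute.list_prod_right
  intro x hx
  obtain ⟨i, hi, rfl⟩ := List.mem_map.1 hx
  rw [List.mem_range'_1] at hi
  exact h i hi.1 hi.2

theorem embed_commute {m i j : ℕ} (h : i + 2 ≤ j ∨ j + 2 ≤ i) (A B : Core) :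
    Commute (embed m i A) (embed m j B) := by
  rw [embed_eq_plug, embed_eq_plug]
  exact plug_commute (incl_orth h) A B

/-- All core transformations of a sequence are unitary up to a small multiple of `u`. -/
def GoodSeq (u : ℝ) (q : ℕ → Core) : Prop := ∀ j, NearU (120 * u) (q j)

/-- The unit round-off `u` is small in comparison with the size `m`. -/
structure SmallFor (u : ℝ) (m : ℕ) : Prop where
  nonneg : 0 ≤ u
  le : u ≤ 1 / 10 ^ 8
  mul_le : 240 * (m * u) ≤ 1

theorem norm_embed_mul_le {m i : ℕ} {ε : ℝ} (hi : i + 2 ≤ m) {G : Core} (hG : NearU ε G)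
    {n : Type*} [Fintype n] (A : Matrix (Fin m) n ℂ) : ‖embed m i G * A‖ ≤ (1 + ε) * ‖A‖ := by
  classical
  obtain ⟨W, hW, h⟩ := hG
  rw [← norm_embed_sub hi] at h
  have e : embed m i G * A = embed m i W * A + (embed m i G - embed m i W) * A := by
    rw [Matrix.sub_mul]; abel
  rw [e]
  refine (norm_add_le _ _).trans ?_
  rw [(embed_isUni hi hW).norm_mul]
  have := Matrix.frobenius_norm_mul (embed m i G - embed m i W) A
  nlinarith [norm_nonneg A]

theorem norm_seg_mul_le_pow {m : ℕ} {ε : ℝ} (hε : 0 ≤ ε) {q : ℕ → Core} {a l : ℕ}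
    (hq : ∀ j, NearU ε (q j)) (h : a + l + 1 ≤ m) {n : Type*} [Fintype n]
    (A : Matrix (Fin m) n ℂ) : ‖seg m q a l * A‖ ≤ (1 + ε) ^ l * ‖A‖ := by
  induction l generalizing a with
  | zero => classical simp [seg_zero]
  | succ l ih =>
    rw [seg_succ, Matrix.mul_assoc, pow_succ', mul_assoc]
    refine (norm_embed_mul_le (by omega) (hq a) _).trans ?_
    exact mul_le_mul_of_nonneg_left (ih (by omega)) (by positivity)

theorem norm_mul_embed_le {m i : ℕ} {ε : ℝ} (hi : i + 2 ≤ m) {G : Core} (hG : NearU ε G)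
    {n : Type*} [Fintype n] (A : Matrix n (Fin m) ℂ) : ‖A * embed m i G‖ ≤ (1 + ε) * ‖A‖ := by
  have h := norm_embed_mul_le hi hG.conj Aᴴ
  rwa [← embed_conj, ← Matrix.conjTranspose_mul, Matrix.frobenius_norm_conjTranspose,
    Matrix.frobenius_norm_conjTranspose] at h

theorem norm_mul_seg_le_pow {m : ℕ} {ε : ℝ} (hε : 0 ≤ ε) {q : ℕ → Core} {a l : ℕ}
    (hq : ∀ j, NearU ε (q j)) (h : a + l + 1 ≤ m) {n : Type*} [Fintype n]
    (A : Matrix n (Fin m) ℂ) : ‖A * seg m q a l‖ ≤ (1 + ε) ^ l * ‖A‖ := by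
  induction l generalizing a A with
  | zero => classical simp [seg_zero]
  | succ l ih =>
    rw [seg_succ, ← Matrix.mul_assoc, pow_succ, mul_assoc]
    refine (ih (a := a + 1) (by omega) _).trans ?_
    exact mul_le_mul_of_nonneg_left (norm_mul_embed_le (by omega) (hq a) _) (by positivity)

/-- A product of at most `m` nearly unitary core transformations increases norms at most by a
factor of two. -/
theorem SmallFor.pow_le {u : ℝ} {m l : ℕ} (h : SmallFor u m) (hl : l ≤ m) :
    (1 + 120 * u) ^ l ≤ 2 := by
  have h0 := h.nonneg
  have hl' : (l : ℝ) ≤ m := by exact_mod_cast hl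
  calc (1 + 120 * u) ^ l ≤ Real.exp (120 * u) ^ l := by
        refine pow_le_pow_left₀ (by positivity) ?_ l
        linarith [Real.add_one_le_exp (120 * u)]
    _ = Real.exp (l * (120 * u)) := by rw [← Real.exp_nat_mul]
    _ ≤ Real.exp (1 / 2) := by
        apply Real.exp_le_exp.2
        nlinarith [h.mul_le, mul_le_mul_of_nonneg_right hl' h0]
    _ ≤ 2 := by
        have h1 : Real.exp (1 / 2) ^ 2 ≤ 2 ^ 2 := by
          rw [← Real.exp_nat_mul]
          norm_num
          linarith [Real.exp_one_lt_d9]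
        exact le_of_sq_le_sq h1 (by norm_num)

theorem norm_seg_mul_le {u : ℝ} {m : ℕ} (hs : SmallFor u m) {q : ℕ → Core} {a l : ℕ}
    (hq : GoodSeq u q) (h : a + l + 1 ≤ m) {n : Type*} [Fintype n] (A : Matrix (Fin m) n ℂ) :
    ‖seg m q a l * A‖ ≤ 2 * ‖A‖ :=
  (norm_seg_mul_le_pow (by have := hs.nonneg; positivity) hq h A).trans
    (mul_le_mul_of_nonneg_right (hs.pow_le (by omega)) (norm_nonneg _))

theorem norm_mul_seg_le {u : ℝ} {m : ℕ} (hs : SmallFor u m) {q : ℕ → Core} {a l : ℕ}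
    (hq : GoodSeq u q) (h : a + l + 1 ≤ m) {n : Type*} [Fintype n] (A : Matrix n (Fin m) ℂ) :
    ‖A * seg m q a l‖ ≤ 2 * ‖A‖ :=
  (norm_mul_seg_le_pow (by have := hs.nonneg; positivity) hq h A).trans
    (mul_le_mul_of_nonneg_right (hs.pow_le (by omega)) (norm_nonneg _))

theorem seqMatrix_split {m i : ℕ} (hi : i + 2 ≤ m) (q : ℕ → Core) :
    seqMatrix m q = seg m q 0 i * embed m i (q i) * seg m q (i + 1) (m - 2 - i) := by
  rw [seqMatrix_eq_seg, show m - 1 = i + ((m - 2 - i) + 1) by omega, seg_add, seg_succ, zero_add,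
    Matrix.mul_assoc]

theorem seqMatrix_split₂ {m i : ℕ} (hi : i + 3 ≤ m) (q : ℕ → Core) :
    seqMatrix m q = seg m q 0 i * (embed m i (q i) * embed m (i + 1) (q (i + 1)))
      * seg m q (i + 2) (m - 3 - i) := by
  rw [seqMatrix_split (i := i) (by omega), show m - 2 - i = (m - 3 - i) + 1 by omega, seg_succ]
  simp only [Matrix.mul_assoc]

theorem GoodSeq.update {u : ℝ} {q : ℕ → Core} (h : GoodSeq u q) {i : ℕ} {a : Core}
    (ha : NearU (120 * u) a) : GoodSeq u (Function.update q i a) := fun j => by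
  by_cases hj : j = i
  · subst hj; simpa using ha
  · simpa [hj] using h j

theorem GoodSeq.update₂ {u : ℝ} {q : ℕ → Core} (h : GoodSeq u q) {i : ℕ} {a b : Core}
    (ha : NearU (120 * u) a) (hb : NearU (120 * u) b) : GoodSeq u (update₂ q i a b) :=
  (h.update ha).update hb

theorem update₂_left (q : ℕ → Core) (i : ℕ) (a b : Core) : update₂ q i a b i = a := by
  simp [update₂]

theorem update₂_right (q : ℕ → Core) (i : ℕ) (a b : Core) : update₂ q i a b (i + 1) = b := by
  simp [update₂]

theorem update₂_of_ne (q : ℕ → Core) {i j : ℕ} (a b : Core) (h : j ≠ i) (h' : j ≠ i + 1) :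
    update₂ q i a b j = q j := by
  simp [update₂, h, h']

theorem seqMatrix_update₂ {m i : ℕ} (hi : i + 3 ≤ m) (q : ℕ → Core) (a b : Core) :
    seqMatrix m (update₂ q i a b) = seg m q 0 i * (embed m i a * embed m (i + 1) b)
      * seg m q (i + 2) (m - 3 - i) := by
  rw [seqMatrix_split₂ hi, update₂_left, update₂_right,
    seg_congr (q' := q) fun j _ hj => update₂_of_ne _ _ _ (by omega) (by omega),
    seg_congr (q' := q) fun j hj _ => update₂_of_ne _ _ _ (by omega) (by omega)]

theorem seqMatrix_update {m i : ℕ} (hi : i + 2 ≤ m) (q : ℕ → Core) (a : Core) :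
    seqMatrix m (Function.update q i a) = seg m q 0 i * embed m i a
      * seg m q (i + 1) (m - 2 - i) := by
  rw [seqMatrix_split hi, Function.update_self,
    seg_congr (q := Function.update q i a) (q' := q) (a := 0)
      fun j _ hj => Function.update_of_ne (by omega) _ _,
    seg_congr (q := Function.update q i a) (q' := q) (a := i + 1)
      fun j hj _ => Function.update_of_ne (by omega) _ _]

theorem norm_seg_mul_mul_seg_le {u : ℝ} {m : ℕ} (hs : SmallFor u m) {q : ℕ → Core}
    {a l a' l' : ℕ} (hq : GoodSeq u q) (h : a + l + 1 ≤ m) (h' : a' + l' + 1 ≤ m)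
    (A : Matrix (Fin m) (Fin m) ℂ) :
    ‖seg m q a l * A * seg m q a' l'‖ ≤ 4 * ‖A‖ := by
  refine (norm_mul_seg_le hs hq h' _).trans ?_
  linarith [norm_seg_mul_le hs hq h A]

theorem norm_seqMatrix_mul_le {u : ℝ} {m : ℕ} (hs : SmallFor u m) (hm : 1 ≤ m) {q : ℕ → Core}
    (hq : GoodSeq u q) (A : Matrix (Fin m) (Fin m) ℂ) : ‖seqMatrix m q * A‖ ≤ 2 * ‖A‖ := by
  rw [seqMatrix_eq_seg]
  exact norm_seg_mul_le hs hq (by omega) A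

theorem norm_mul_seqMatrix_le {u : ℝ} {m : ℕ} (hs : SmallFor u m) (hm : 1 ≤ m) {q : ℕ → Core}
    (hq : GoodSeq u q) (A : Matrix (Fin m) (Fin m) ℂ) : ‖A * seqMatrix m q‖ ≤ 2 * ‖A‖ := by
  rw [seqMatrix_eq_seg]
  exact norm_mul_seg_le hs hq (by omega) A

theorem plug_embed₃_zero {m i : ℕ} (G : Core) :
    plug (incl m 3 i) (embed 3 0 G) = embed m i G := by
  rw [embed_eq_plug, embed_eq_plug, plug_plug, incl_mul_incl (by norm_num), add_zero]

theorem plug_embed₃_one {m i : ℕ} (G : Core) :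
    plug (incl m 3 i) (embed 3 1 G) = embed m (i + 1) G := by
  rw [embed_eq_plug, embed_eq_plug, plug_plug, incl_mul_incl (by norm_num)]

/-- Replacing the computed core transformations on both sides of an approximate identity
`W A' ≈ A K` by unitary ones. -/
theorem norm_conj_sub_le {u : ℝ} {m : ℕ} {A A' W K W' K' : Matrix (Fin m) (Fin m) ℂ}
    (hW' : IsUni W') (hK : ‖K - K'‖ ≤ 120 * u) (hW : ‖W - W'‖ ≤ 120 * u)
    (hA : ∀ X, ‖A * X‖ ≤ 2 * ‖X‖) (hA' : ∀ X, ‖X * A'‖ ≤ 2 * ‖X‖) (hu : 0 ≤ u)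
    (h : ‖A * K - W * A'‖ ≤ 8 * 10 ^ 7 * u) : ‖A' - W'ᴴ * A * K'‖ ≤ 10 ^ 8 * u := by
  have e : A' - W'ᴴ * A * K' = W'ᴴ * (A * (K - K') - (A * K - W * A') - (W - W') * A') := by
    simp only [Matrix.mul_sub, Matrix.sub_mul, ← Matrix.mul_assoc, hW'.left, Matrix.one_mul]
    abel
  rw [e, hW'.conj.norm_mul]
  have h1 := norm_sub_le (A * (K - K') - (A * K - W * A')) ((W - W') * A')
  have h2 := norm_sub_le (A * (K - K')) (A * K - W * A')
  linarith [hA (K - K'), hA' (W - W')]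

/-- A turnover moves the core transformation `K`, at row `i` on the right of a descending sequence
`q`, to row `i + 1` on its left. In terms of the unitary matrices close to the computed ones, the
updated sequence is `W'ᴴ q K'` up to an error of order `u`. -/
theorem seqMatrix_turnRL {u : ℝ} (fp : FloatArith u) {m i : ℕ} (hs : SmallFor u m)
    (hi : i + 3 ≤ m) {q : ℕ → Core} (hq : GoodSeq u q) {K K' W' : Core} (hK' : IsUni K')
    (hK : ‖K - K'‖ ≤ 120 * u) (hW' : IsUni W')
    (hW : ‖(fp.turnRL (q i) (q (i + 1)) K).1 - W'‖ ≤ 120 * u) :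
    ‖seqMatrix m (update₂ q i (fp.turnRL (q i) (q (i + 1)) K).2.1
        (fp.turnRL (q i) (q (i + 1)) K).2.2)
      - (embed m (i + 1) W')ᴴ * seqMatrix m q * embed m i K'‖ ≤ 10 ^ 8 * u := by
  obtain ⟨⟨h1, h2, h3⟩, h4⟩ := fp.turnRL_err hs.nonneg hs.le (hq i) (hq (i + 1)) ⟨K', hK', hK⟩
  generalize fp.turnRL (q i) (q (i + 1)) K = w at *
  have hq' := hq.update₂ (i := i) h2 h3
  refine norm_conj_sub_le (K := embed m i K) (W := embed m (i + 1) w.1)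
    (embed_isUni (by omega) hW') (by rwa [norm_embed_sub (by omega)])
    (by rwa [norm_embed_sub (by omega)]) (norm_seqMatrix_mul_le hs (by omega) hq)
    (norm_mul_seqMatrix_le hs (by omega) hq') hs.nonneg ?_
  -- the entering core commutes with the part of the sequence below, the leaving one with the part
  -- above, which leaves the local identity of three cores
  have c1 : Commute (embed m i K) (seg m q (i + 2) (m - 3 - i)) :=
    seg_commute fun j hj _ => embed_commute (by omega) _ _
  have c2 : Commute (embed m (i + 1) w.1) (seg m q 0 i) :=
    seg_commute fun j _ hj => embed_commute (by omega) _ _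
  have e : seqMatrix m q * embed m i K - embed m (i + 1) w.1 * seqMatrix m (update₂ q i w.2.1 w.2.2)
      = seg m q 0 i * (plug (incl m 3 i) (embed 3 0 (q i) * embed 3 1 (q (i + 1)) * embed 3 0 K)
        - plug (incl m 3 i) (embed 3 1 w.1 * embed 3 0 w.2.1 * embed 3 1 w.2.2))
        * seg m q (i + 2) (m - 3 - i) := by
    rw [seqMatrix_split₂ hi, seqMatrix_update₂ hi]
    simp only [plug_mul (incl_isometry hi), plug_embed₃_zero, plug_embed₃_one]
    rw [Matrix.mul_assoc _ (seg m q (i + 2) _), ← c1.eq, ← Matrix.mul_assoc (embed m (i + 1) w.1),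
      ← Matrix.mul_assoc (embed m (i + 1) w.1), c2.eq]
    simp only [Matrix.mul_sub, Matrix.sub_mul, Matrix.mul_assoc]
  rw [e]
  refine (norm_seg_mul_mul_seg_le hs hq (by omega) (by omega) _).trans ?_
  rw [norm_plug_sub (incl_isometry hi)]
  linarith

/-- The converse move, from row `i + 1` on the left of a descending sequence to row `i` on its
right. It is reduced to `norm_conj_sub_le` by taking adjoints. -/
theorem seqMatrix_turnLR {u : ℝ} (fp : FloatArith u) {m i : ℕ} (hs : SmallFor u m)
    (hi : i + 3 ≤ m) {q : ℕ → Core} (hq : GoodSeq u q) {K K' W' : Core} (hK' : IsUni K')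
    (hK : ‖K - K'‖ ≤ 120 * u) (hW' : IsUni W')
    (hW : ‖(fp.turnLR K (q i) (q (i + 1))).2.2 - W'‖ ≤ 120 * u) :
    ‖seqMatrix m (update₂ q i (fp.turnLR K (q i) (q (i + 1))).1
        (fp.turnLR K (q i) (q (i + 1))).2.1)
      - embed m (i + 1) K' * seqMatrix m q * (embed m i W')ᴴ‖ ≤ 10 ^ 8 * u := by
  obtain ⟨⟨h1, h2, h3⟩, h4⟩ := fp.turnLR_err hs.nonneg hs.le ⟨K', hK', hK⟩ (hq i) (hq (i + 1))
  generalize fp.turnLR K (q i) (q (i + 1)) = w at *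
  have hq' := hq.update₂ (i := i) h1 h2
  have conj2 : ∀ X : Matrix (Fin m) (Fin m) ℂ, ‖Xᴴ‖ = ‖X‖ :=
    Matrix.frobenius_norm_conjTranspose
  rw [← conj2]
  simp only [Matrix.conjTranspose_sub, Matrix.conjTranspose_mul, Matrix.conjTranspose_conjTranspose]
  have flip1 : ∀ A X : Matrix (Fin m) (Fin m) ℂ, ‖Aᴴ * X‖ = ‖Xᴴ * A‖ := fun A X => by
    rw [← conj2, Matrix.conjTranspose_mul, Matrix.conjTranspose_conjTranspose]
  have flip2 : ∀ A X : Matrix (Fin m) (Fin m) ℂ, ‖X * Aᴴ‖ = ‖A * Xᴴ‖ := fun A X => by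
    rw [← conj2, Matrix.conjTranspose_mul, Matrix.conjTranspose_conjTranspose]
  have key := norm_conj_sub_le (A := (seqMatrix m q)ᴴ) (A' := (seqMatrix m (update₂ q i w.1 w.2.1))ᴴ)
    (K := (embed m (i + 1) K)ᴴ) (K' := (embed m (i + 1) K')ᴴ) (W := (embed m i w.2.2)ᴴ)
    (W' := (embed m i W')ᴴ) (u := u) (embed_isUni (by omega) hW').conj
    (by rw [← Matrix.conjTranspose_sub, conj2]; rwa [norm_embed_sub (by omega)])
    (by rw [← Matrix.conjTranspose_sub, conj2]; rwa [norm_embed_sub (by omega)])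
    (fun X => by
      rw [flip1, ← conj2 X]; exact norm_mul_seqMatrix_le hs (by omega) hq _)
    (fun X => by
      rw [flip2, ← conj2 X]; exact norm_seqMatrix_mul_le hs (by omega) hq' _) hs.nonneg ?_
  · rwa [Matrix.conjTranspose_conjTranspose, Matrix.mul_assoc] at key
  rw [← Matrix.conjTranspose_mul, ← Matrix.conjTranspose_mul, ← Matrix.conjTranspose_sub, conj2]
  -- the leaving core commutes with the part of the sequence below, the entering one with the part
  -- above, which leaves the local identity of three cores
  have c1 : Commute (embed m i w.2.2) (seg m q (i + 2) (m - 3 - i)) :=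
    seg_commute fun j hj _ => embed_commute (by omega) _ _
  have c2 : Commute (embed m (i + 1) K) (seg m q 0 i) :=
    seg_commute fun j _ hj => embed_commute (by omega) _ _
  have e : embed m (i + 1) K * seqMatrix m q
        - seqMatrix m (update₂ q i w.1 w.2.1) * embed m i w.2.2
      = seg m q 0 i * (plug (incl m 3 i) (embed 3 1 K * embed 3 0 (q i) * embed 3 1 (q (i + 1)))
        - plug (incl m 3 i) (embed 3 0 w.1 * embed 3 1 w.2.1 * embed 3 0 w.2.2))
        * seg m q (i + 2) (m - 3 - i) := by
    rw [seqMatrix_split₂ hi, seqMatrix_update₂ hi]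
    simp only [plug_mul (incl_isometry hi), plug_embed₃_zero, plug_embed₃_one]
    rw [Matrix.mul_assoc _ (seg m q (i + 2) _) (embed m i w.2.2), ← c1.eq,
      ← Matrix.mul_assoc (embed m (i + 1) K), ← Matrix.mul_assoc (embed m (i + 1) K), c2.eq]
    simp only [Matrix.mul_sub, Matrix.sub_mul, Matrix.mul_assoc]
  rw [e]
  refine (norm_seg_mul_mul_seg_le hs hq (by omega) (by omega) _).trans ?_
  rw [norm_plug_sub (incl_isometry hi)]
  linarith

/-! ### Unitary similarity of stored triangular factors -/

/-- The extension of an `n × n` matrix to size `n + 1`, with the last unit vector fixed. -/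
def hat (n : ℕ) (L : Matrix (Fin n) (Fin n) ℂ) : Matrix (Fin (n + 1)) (Fin (n + 1)) ℂ :=
  plug (incl (n + 1) n 0) L

theorem hat_mul {n : ℕ} (L M : Matrix (Fin n) (Fin n) ℂ) : hat n (L * M) = hat n L * hat n M :=
  plug_mul (incl_isometry (by omega)) L M

theorem hat_one (n : ℕ) : hat n 1 = 1 := plug_one _

theorem hat_isUni {n : ℕ} {L : Matrix (Fin n) (Fin n) ℂ} (h : IsUni L) : IsUni (hat n L) :=
  plug_isUni (incl_isometry (by omega)) h

theorem hat_embed {n i : ℕ} (h : i + 2 ≤ n) (G : Core) : hat n (embed n i G) = embed (n + 1) i G := by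
  rw [hat, embed_eq_plug, embed_eq_plug, plug_plug, incl_mul_incl h, zero_add]

/-- The stored factor `t'` represents, up to errors of size `ε` in the two stored unitary matrices,
the matrix `Lᴴ R V`, where `R` is represented by `t`.  The unitary matrix `X`, which fixes the first
unit vector, cancels in the represented matrix. -/
def TriSim (n : ℕ) (ε : ℝ) (L V : Matrix (Fin n) (Fin n) ℂ) (t t' : Tri) : Prop :=
  ∃ X : Matrix (Fin (n + 1)) (Fin (n + 1)) ℂ, IsUni X ∧ X * incl (n + 1) 1 0 = incl (n + 1) 1 0 ∧
    ‖seqMatrix (n + 1) t'.C - Xᴴ * seqMatrix (n + 1) t.C * hat n L‖ ≤ ε ∧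
    ‖seqMatrix (n + 1) t'.B - Xᴴ * seqMatrix (n + 1) t.B * hat n V‖ ≤ ε

theorem TriSim.mono {n : ℕ} {ε ε' : ℝ} {L V : Matrix (Fin n) (Fin n) ℂ} {t t' : Tri}
    (h : TriSim n ε L V t t') (hε : ε ≤ ε') : TriSim n ε' L V t t' := by
  obtain ⟨X, h1, h2, h3, h4⟩ := h
  exact ⟨X, h1, h2, h3.trans hε, h4.trans hε⟩

theorem TriSim.refl {n : ℕ} (t : Tri) : TriSim n 0 1 1 t t :=
  ⟨1, isUni_one, by simp, by simp [hat_one], by simp [hat_one]⟩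

/-- Errors of successive unitary equivalences add up. -/
theorem norm_conj_trans {m : ℕ} {A A' A'' X X' L L' : Matrix (Fin m) (Fin m) ℂ} {ε ε' : ℝ}
    (hX' : IsUni X') (hL' : IsUni L') (h : ‖A' - Xᴴ * A * L‖ ≤ ε)
    (h' : ‖A'' - X'ᴴ * A' * L'‖ ≤ ε') : ‖A'' - (X * X')ᴴ * A * (L * L')‖ ≤ ε + ε' := by
  have e : A'' - (X * X')ᴴ * A * (L * L')
      = (A'' - X'ᴴ * A' * L') + X'ᴴ * (A' - Xᴴ * A * L) * L' := by
    simp only [Matrix.conjTranspose_mul, Matrix.mul_sub, Matrix.sub_mul, Matrix.mul_assoc]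
    abel
  rw [e]
  refine (norm_add_le _ _).trans ?_
  rw [hL'.norm_mul', hX'.conj.norm_mul]
  linarith

theorem TriSim.trans {n : ℕ} {ε ε' : ℝ} {L V L' V' : Matrix (Fin n) (Fin n) ℂ} {t t' t'' : Tri}
    (h : TriSim n ε L V t t') (h' : TriSim n ε' L' V' t' t'') (hL' : IsUni L') (hV' : IsUni V') :
    TriSim n (ε + ε') (L * L') (V * V') t t'' := by
  obtain ⟨X, h1, h2, h3, h4⟩ := h
  obtain ⟨X', h1', h2', h3', h4'⟩ := h'
  refine ⟨X * X', h1.mul h1', by rw [Matrix.mul_assoc, h2', h2], ?_, ?_⟩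
  · rw [hat_mul]
    exact norm_conj_trans h1' (hat_isUni hL') h3 h3'
  · rw [hat_mul]
    exact norm_conj_trans h1' (hat_isUni hV') h4 h4'

/-- Unitary similarity of products of stored factors: `R₁ ⋯ R_l` becomes
`Lᴴ R₁ N₁ · N₁ᴴ R₂ N₂ ⋯ N_{l-1}ᴴ R_l V`, up to errors `ε` in each stored factor. -/
inductive ListSim (n : ℕ) (ε : ℝ) :
    Matrix (Fin n) (Fin n) ℂ → Matrix (Fin n) (Fin n) ℂ → List Tri → List Tri → Prop
  | nil (L : Matrix (Fin n) (Fin n) ℂ) : ListSim n ε L L [] []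
  | cons {L N V : Matrix (Fin n) (Fin n) ℂ} {t t' : Tri} {ts ts' : List Tri} (hN : IsUni N)
      (h : TriSim n ε L N t t') (hs : ListSim n ε N V ts ts') : ListSim n ε L V (t :: ts) (t' :: ts')

theorem ListSim.mono {n : ℕ} {ε ε' : ℝ} {L V : Matrix (Fin n) (Fin n) ℂ} {ts ts' : List Tri}
    (h : ListSim n ε L V ts ts') (hε : ε ≤ ε') : ListSim n ε' L V ts ts' := by
  induction h with
  | nil L => exact .nil L
  | cons hN h _ ih => exact .cons hN (h.mono hε) ih

theorem ListSim.refl {n : ℕ} (ts : List Tri) : ListSim n 0 1 1 ts ts := by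
  induction ts with
  | nil => exact .nil _
  | cons t ts ih => exact .cons isUni_one (TriSim.refl t) ih

theorem ListSim.trans {n : ℕ} {ε ε' : ℝ} {L V L' V' : Matrix (Fin n) (Fin n) ℂ}
    {ts ts' ts'' : List Tri} (h : ListSim n ε L V ts ts') (h' : ListSim n ε' L' V' ts' ts'')
    (hL' : IsUni L') : ListSim n (ε + ε') (L * L') (V * V') ts ts'' := by
  induction h generalizing L' ts'' with
  | nil L => cases h'; exact .nil _
  | cons hN h _ ih =>
    cases h' with
    | cons hN' g gs => exact .cons (hN.mul hN') (h.trans g hL' hN') (ih gs hN')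

theorem ListSim.length_eq {n : ℕ} {ε : ℝ} {L V : Matrix (Fin n) (Fin n) ℂ} {ts ts' : List Tri}
    (h : ListSim n ε L V ts ts') : ts.length = ts'.length := by
  induction h with
  | nil => rfl
  | cons _ _ _ ih => simp [ih]

/-- A similarity of a concatenated product is one of its two parts, joined by some unitary matrix
`N` between them. -/
theorem ListSim.split {n : ℕ} {ε : ℝ} {L V : Matrix (Fin n) (Fin n) ℂ} {ts us ts' : List Tri}
    (hL : IsUni L) (h : ListSim n ε L V (ts ++ us) ts') :
    ∃ (N : Matrix (Fin n) (Fin n) ℂ) (ts₁ us₁ : List Tri), IsUni N ∧ ts' = ts₁ ++ us₁ ∧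
      ListSim n ε L N ts ts₁ ∧ ListSim n ε N V us us₁ := by
  induction ts generalizing L ts' with
  | nil => exact ⟨L, [], ts', hL, rfl, .nil L, h⟩
  | cons t ts ih =>
    cases h with
    | cons hN h hs =>
      obtain ⟨N', ts₁, us₁, h1, rfl, h2, h3⟩ := ih hN hs
      exact ⟨N', _ :: ts₁, us₁, h1, rfl, .cons hN h h2, h3⟩

/-- All stored core transformations of a factor are nearly unitary. -/
def GoodTri (u : ℝ) (t : Tri) : Prop := GoodSeq u t.C ∧ GoodSeq u t.B

/-! ### Pass-through operations -/

theorem NearU.uni_conj {ε : ℝ} {G W : Core} (h : ‖G - W‖ ≤ ε) : ‖Gᴴ - Wᴴ‖ ≤ ε := by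
  rwa [← Matrix.conjTranspose_sub, Matrix.frobenius_norm_conjTranspose]

/-- A core transformation on rows below the first one fixes the first unit vector. -/
theorem embed_mul_e₀ {n i : ℕ} (W : Core) :
    embed (n + 1) (i + 1) W * incl (n + 1) 1 0 = incl (n + 1) 1 0 := by
  rw [embed_eq_plug]
  exact plug_mul_of_orth (incl_orth (by omega)) W

section

variable {u : ℝ} (fp : FloatArith u) {n i : ℕ}

/-- Pass-through from right to left: `K'` enters from the right and `W` leaves on the left, `R K' ≈
W R'`. -/
theorem passRL_sim (hs : SmallFor u (n + 1)) (hi : i + 2 ≤ n) {t : Tri} (ht : GoodTri u t)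
    {K K' : Core} (hK' : IsUni K') (hK : ‖K - K'‖ ≤ 120 * u) :
    GoodTri u (passRL fp i K t).2 ∧ ∃ W : Core, IsUni W ∧ ‖(passRL fp i K t).1 - W‖ ≤ 120 * u ∧
      TriSim n (10 ^ 8 * u) (embed n i W) (embed n i K') t (passRL fp i K t).2 := by
  obtain ⟨⟨h1, h2, h3⟩, -⟩ := fp.turnRL_err hs.nonneg hs.le (ht.2 i) (ht.2 (i + 1)) ⟨K', hK', hK⟩
  obtain ⟨X, hX, hX'⟩ := h1
  obtain ⟨⟨g1, g2, g3⟩, -⟩ := fp.turnLR_err hs.nonneg hs.le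
    (⟨Xᴴ, hX.conj, NearU.uni_conj hX'⟩ : NearU (120 * u) (fp.turnRL (t.B i) (t.B (i + 1)) K).1ᴴ)
    (ht.1 i) (ht.1 (i + 1))
  obtain ⟨W, hW, hW'⟩ := g3
  have e1 := seqMatrix_turnRL fp hs (i := i) (by omega) ht.2 hK' hK hX hX'
  have e2 := seqMatrix_turnLR fp hs (i := i) (by omega) ht.1 hX.conj (NearU.uni_conj hX') hW hW'
  -- the core `X` that leaves `B` on the left is absorbed by `C` and cancels in `Cᴴ B`; as it acts
  -- on the rows `i + 1`, `i + 2`, it does not touch `e₁`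
  refine ⟨⟨ht.1.update₂ g1 g2, ht.2.update₂ h2 h3⟩, Wᴴ, hW.conj, NearU.uni_conj hW',
    embed (n + 1) (i + 1) X, embed_isUni (by omega) hX, embed_mul_e₀ X, ?_, ?_⟩
  · rw [hat_embed hi, embed_conj, ← embed_conj (n + 1) i]
    exact e2
  · rw [hat_embed hi]
    exact e1

/-- Pass-through from left to right: `K'` enters from the left and `W` leaves on the right, `K' R ≈
R' W`. -/
theorem passLR_sim (hs : SmallFor u (n + 1)) (hi : i + 2 ≤ n) {t : Tri} (ht : GoodTri u t)
    {K K' : Core} (hK' : IsUni K') (hK : ‖K - K'‖ ≤ 120 * u) :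
    GoodTri u (passLR fp i K t).2 ∧ ∃ W : Core, IsUni W ∧ ‖(passLR fp i K t).1 - W‖ ≤ 120 * u ∧
      TriSim n (10 ^ 8 * u) (embed n i K')ᴴ (embed n i W)ᴴ t (passLR fp i K t).2 := by
  obtain ⟨⟨h1, h2, h3⟩, -⟩ := fp.turnRL_err hs.nonneg hs.le (ht.1 i) (ht.1 (i + 1))
    ⟨K'ᴴ, hK'.conj, NearU.uni_conj hK⟩
  obtain ⟨X, hX, hX'⟩ := h1
  obtain ⟨⟨g1, g2, g3⟩, -⟩ := fp.turnLR_err hs.nonneg hs.le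
    (⟨Xᴴ, hX.conj, NearU.uni_conj hX'⟩ : NearU (120 * u) (fp.turnRL (t.C i) (t.C (i + 1)) Kᴴ).1ᴴ)
    (ht.2 i) (ht.2 (i + 1))
  obtain ⟨W, hW, hW'⟩ := g3
  have e1 := seqMatrix_turnRL fp hs (i := i) (by omega) ht.1 hK'.conj (NearU.uni_conj hK) hX hX'
  have e2 := seqMatrix_turnLR fp hs (i := i) (by omega) ht.2 hX.conj (NearU.uni_conj hX') hW hW'
  refine ⟨⟨ht.1.update₂ h2 h3, ht.2.update₂ g1 g2⟩, W, hW, hW',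
    embed (n + 1) (i + 1) X, embed_isUni (by omega) hX, embed_mul_e₀ X, ?_, ?_⟩
  · rw [embed_conj n, hat_embed hi]
    exact e1
  · rw [embed_conj n, hat_embed hi, embed_conj, ← embed_conj (n + 1) i]
    exact e2

/-- Pass-through from right to left through a product of triangular factors. -/
theorem passRLs_sim (hs : SmallFor u (n + 1)) (hi : i + 2 ≤ n) {ts : List Tri}
    (ht : ∀ t ∈ ts, GoodTri u t) {K K' : Core} (hK' : IsUni K') (hK : ‖K - K'‖ ≤ 120 * u) :
    (∀ t ∈ (passRLs fp i K ts).2, GoodTri u t) ∧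
      ∃ W : Core, IsUni W ∧ ‖(passRLs fp i K ts).1 - W‖ ≤ 120 * u ∧
      ListSim n (10 ^ 8 * u) (embed n i W) (embed n i K') ts (passRLs fp i K ts).2 := by
  induction ts with
  | nil => exact ⟨by simp [passRLs], K', hK', hK, .nil _⟩
  | cons t ts ih =>
    obtain ⟨h1, W, hW, hW', h2⟩ := ih fun t h => ht t (by simp [h])
    obtain ⟨g1, Z, hZ, hZ', g2⟩ := passRL_sim fp hs hi (ht t (by simp)) hW hW'
    refine ⟨?_, Z, hZ, hZ', .cons (embed_isUni hi hW) g2 h2⟩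
    intro t' h'
    simp only [passRLs, List.mem_cons] at h'
    rcases h' with rfl | h'
    · exact g1
    · exact h1 t' h'

/-- Pass-through from left to right through a product of triangular factors. -/
theorem passLRs_sim (hs : SmallFor u (n + 1)) (hi : i + 2 ≤ n) {ts : List Tri}
    (ht : ∀ t ∈ ts, GoodTri u t) {K K' : Core} (hK' : IsUni K') (hK : ‖K - K'‖ ≤ 120 * u) :
    (∀ t ∈ (passLRs fp i K ts).2, GoodTri u t) ∧
      ∃ W : Core, IsUni W ∧ ‖(passLRs fp i K ts).1 - W‖ ≤ 120 * u ∧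
      ListSim n (10 ^ 8 * u) (embed n i K')ᴴ (embed n i W)ᴴ ts (passLRs fp i K ts).2 := by
  induction ts generalizing K K' with
  | nil => exact ⟨by simp [passLRs], K', hK', hK, .nil _⟩
  | cons t ts ih =>
    obtain ⟨g1, Z, hZ, hZ', g2⟩ := passLR_sim fp hs hi (ht t (by simp)) hK' hK
    obtain ⟨h1, W, hW, hW', h2⟩ := ih (fun t h => ht t (by simp [h])) hZ hZ'
    refine ⟨?_, W, hW, hW', .cons (embed_isUni hi hZ).conj g2 h2⟩
    intro t' h'
    simp only [passLRs, List.mem_cons] at h'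
    rcases h' with rfl | h'
    · exact g1
    · exact h1 t' h'

end

/-! ### Backward errors of the reduction to Hessenberg-triangular form -/

/-- All stored core transformations of a factored pencil are nearly unitary. -/
structure GoodFactored (u : ℝ) (s : Factored) : Prop where
  Q : ∀ b, GoodSeq u (s.Q b)
  R : ∀ b, ∀ t ∈ s.R b, GoodTri u t
  T : ∀ t ∈ s.T, GoodTri u t

/-- The factored pencil `s` is, up to errors `ε` in each stored factor, unitarily equivalent to `s₀`,
where `Q_b` is multiplied by `(L'_b)ᴴ` and `M_b`, `R_b` by `M_bᴴ` and `L_{b+1}`, and `T` by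
`L₀ᴴ` and `L'_k`.  With `L' = L` the two pencils are equivalent; if `L'_b = L_b G` for one `b`, then
they are equivalent once the core transformation `G` is inserted to the left of block `b`. -/
structure FSim (n k : ℕ) (ε : ℝ) (L L' M : ℕ → Matrix (Fin n) (Fin n) ℂ) (s₀ s : Factored) :
    Prop where
  Q : ∀ b < k, ‖seqMatrix n (s.Q b) - (L' b)ᴴ * seqMatrix n (s₀.Q b) * M b‖ ≤ ε
  R : ∀ b < k, ListSim n ε (M b) (L (b + 1)) (s₀.R b) (s.R b)
  T : ListSim n ε (L 0) (L' k) s₀.T s.T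

theorem FSim.mono {n k : ℕ} {ε ε' : ℝ} {L L' M : ℕ → Matrix (Fin n) (Fin n) ℂ} {s₀ s : Factored}
    (h : FSim n k ε L L' M s₀ s) (hε : ε ≤ ε') : FSim n k ε' L L' M s₀ s :=
  ⟨fun b hb => (h.Q b hb).trans hε, fun b hb => (h.R b hb).mono hε, h.T.mono hε⟩

theorem isUni_update {n : ℕ} {L : ℕ → Matrix (Fin n) (Fin n) ℂ} (hL : ∀ b, IsUni (L b)) (b : ℕ)
    {X : Matrix (Fin n) (Fin n) ℂ} (hX : IsUni X) (c : ℕ) : IsUni (Function.update L b X c) := by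
  by_cases h : c = b
  · subst h; simpa using hX
  · simpa [h] using hL c

section

variable {u : ℝ} (fp : FloatArith u) {n k : ℕ}

/-- The first half of a chasing step: the core transformation is passed, if necessary, to the right
end of `S` by a unitary equivalence, and then through the triangular factors of a block. -/
theorem wrap_pass_sim (hs : SmallFor u (n + 1)) {i b : ℕ} (hi : i + 2 ≤ n) (hb : b < k) {ε : ℝ}
    {L L' M : ℕ → Matrix (Fin n) (Fin n) ℂ} (hL : ∀ c, IsUni (L c)) {G G' : Core}
    (hG' : IsUni G') (hG : ‖G - G'‖ ≤ 120 * u)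
    (hLL : L' = Function.update L b (L b * embed n i G')) {s₀ s : Factored}
    (hgood : GoodFactored u s) (h : FSim n k ε L L' M s₀ s) :
    let w := wrapAround fp k i b G s
    let b' := w.1 - 1
    let p := passRLs fp i w.2.1 (w.2.2.R b')
    (b' < k ∧ w.2.2.Q = s.Q ∧ (∀ c, ∀ t ∈ Function.update w.2.2.R b' p.2 c, GoodTri u t) ∧
      (∀ t ∈ w.2.2.T, GoodTri u t)) ∧
    ∃ (L₁ : ℕ → Matrix (Fin n) (Fin n) ℂ) (Z : Core), (∀ c, IsUni (L₁ c)) ∧ IsUni Z ∧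
      ‖p.1 - Z‖ ≤ 120 * u ∧
      (∀ c < k, ‖seqMatrix n (s.Q c) - (L₁ c)ᴴ * seqMatrix n (s₀.Q c) * M c‖ ≤ ε) ∧
      (∀ c < k, ListSim n (ε + 10 ^ 8 * u) (Function.update M b' (M b' * embed n i Z) c) (L₁ (c + 1))
        (s₀.R c) (Function.update w.2.2.R b' p.2 c)) ∧
      ListSim n (ε + 10 ^ 8 * u) (L₁ 0) (L₁ k) s₀.T w.2.2.T := by
  intro w b' p
  have hu := hs.nonneg
  have hε : ε ≤ ε + 10 ^ 8 * u := by linarith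
  have hk : k ≠ 0 := by omega
  have hL' : ∀ c, IsUni (L' c) := by
    rw [hLL]; exact isUni_update hL b ((hL b).mul (embed_isUni hi hG'))
  -- for `b = 0` the core is taken off by an equivalence: it passes through `T`, and its image `W`
  -- comes in at the right end of `S`; for `b > 0` it just moves to the block on its left
  by_cases hb0 : b = 0
  · obtain ⟨g1, W, hW, hW', h1⟩ := passLRs_sim fp hs hi hgood.T hG'.conj (NearU.uni_conj hG)
    have hw : w = (k, (passLRs fp i Gᴴ s.T).1ᴴ, { s with T := (passLRs fp i Gᴴ s.T).2 }) := by
      simp [w, wrapAround, hb0]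
    have hb' : b' = k - 1 := by simp [b', hw]
    have hk' : k - 1 + 1 = k := by omega
    obtain ⟨g2, Z, hZ, hZ', h2⟩ := passRLs_sim fp hs hi (hgood.R (k - 1)) hW.conj
      (NearU.uni_conj hW')
    have hp : p = passRLs fp i (passLRs fp i Gᴴ s.T).1ᴴ (s.R (k - 1)) := by
      simp [p, hw, hb']
    rw [← hp] at g2 hZ' h2
    rw [hb', hw]
    refine ⟨⟨by omega, rfl, ?_, g1⟩,
      Function.update (Function.update L 0 (L 0 * embed n i G')) k (L k * embed n i Wᴴ), Z,
      isUni_update (isUni_update hL 0 ((hL 0).mul (embed_isUni hi hG'))) k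
        ((hL k).mul (embed_isUni hi hW.conj)), hZ, hZ', ?_, ?_, ?_⟩
    · intro c t ht
      by_cases hc : c = k - 1
      · subst hc
        simp only [Function.update_self] at ht
        exact g2 t ht
      · simp only [Function.update_of_ne hc] at ht
        exact hgood.R c t ht
    · intro c hc
      have := h.Q c hc
      rw [hLL, hb0] at this
      rwa [Function.update_of_ne (show c ≠ k by omega)]
    · intro c hc
      have h3 := h.R c hc
      by_cases hc' : c = k - 1
      · subst hc'
        rw [Function.update_self, Function.update_self, hk', Function.update_self]
        rw [hk'] at h3
        exact h3.trans h2 (embed_isUni hi hZ)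
      · rw [Function.update_of_ne hc', Function.update_of_ne hc',
          Function.update_of_ne (show c + 1 ≠ k by omega), Function.update_of_ne (by omega)]
        exact h3.mono hε
    · have h3 := h.T
      rw [hLL, hb0, Function.update_of_ne hk] at h3
      have h4 := h3.trans h1 (embed_isUni hi hG'.conj).conj
      rw [embed_conj, embed_conj, Matrix.conjTranspose_conjTranspose] at h4
      rwa [Function.update_of_ne (Ne.symm hk), Function.update_self, Function.update_self]
  · have hw : w = (b, G, s) := by simp [w, wrapAround, hb0]
    have hb' : b' = b - 1 := by simp [b', hw]
    have hk' : b - 1 + 1 = b := by omega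
    obtain ⟨g2, Z, hZ, hZ', h2⟩ := passRLs_sim fp hs hi (hgood.R (b - 1)) hG' hG
    have hp : p = passRLs fp i G (s.R (b - 1)) := by simp [p, hw, hb']
    rw [← hp] at g2 hZ' h2
    rw [hb', hw]
    refine ⟨⟨by omega, rfl, ?_, hgood.T⟩, L', Z, hL', hZ, hZ', h.Q, ?_, ?_⟩
    · intro c t ht
      by_cases hc : c = b - 1
      · subst hc
        simp only [Function.update_self] at ht
        exact g2 t ht
      · simp only [Function.update_of_ne hc] at ht
        exact hgood.R c t ht
    · intro c hc
      have h3 := h.R c hc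
      by_cases hc' : c = b - 1
      · subst hc'
        rw [Function.update_self, Function.update_self, hk', hLL, Function.update_self]
        rw [hk'] at h3
        exact h3.trans h2 (embed_isUni hi hZ)
      · rw [Function.update_of_ne hc', Function.update_of_ne hc', hLL,
          Function.update_of_ne (show c + 1 ≠ b by omega)]
        exact h3.mono hε
    · have h3 := h.T
      have : L' 0 = L 0 := by rw [hLL, Function.update_of_ne (Ne.symm hb0)]
      rw [this]
      exact h3.mono hε

/-- The special case of `norm_conj_trans` in which the second transformation acts from the right
only. -/
theorem norm_trans_right {m : ℕ} {A A' A'' L M Z : Matrix (Fin m) (Fin m) ℂ} {ε ε' : ℝ}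
    (hZ : IsUni Z) (h : ‖A' - Lᴴ * A * M‖ ≤ ε) (h' : ‖A'' - A' * Z‖ ≤ ε') :
    ‖A'' - Lᴴ * A * (M * Z)‖ ≤ ε + ε' := by
  have := norm_conj_trans (A'' := A'') (ε' := ε') isUni_one hZ h
    (by rwa [Matrix.conjTranspose_one, Matrix.one_mul])
  rwa [Matrix.mul_one] at this

/-- Fusion from the right with the core number `i` of a sequence, where the core transformations
below commute with the fused one or are trivial. -/
theorem seqMatrix_fuse_right {m i : ℕ} (hs : SmallFor u m) (hi : i + 2 ≤ m) {q : ℕ → Core}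
    (hq : GoodSeq u q) {X X' : Core} (hX' : IsUni X') (hX : ‖X - X'‖ ≤ 120 * u)
    (hc : Commute (embed m i X') (seg m q (i + 1) (m - 2 - i))) :
    ‖seqMatrix m (Function.update q i (fp.fuse (q i) X)) - seqMatrix m q * embed m i X'‖
      ≤ 10 ^ 8 * u := by
  have hu := hs.nonneg
  obtain ⟨h1, -⟩ := fp.fuse_err hs.nonneg hs.le (hq i) ⟨X', hX', hX⟩
  have e : seqMatrix m (Function.update q i (fp.fuse (q i) X)) - seqMatrix m q * embed m i X'
      = seg m q 0 i * (embed m i (fp.fuse (q i) X) - embed m i (q i * X'))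
        * seg m q (i + 1) (m - 2 - i) := by
    rw [seqMatrix_update hi, seqMatrix_split hi, Matrix.mul_assoc _ (seg m q (i + 1) _), ← hc.eq,
      embed_mul hi]
    simp only [Matrix.mul_sub, Matrix.sub_mul, Matrix.mul_assoc]
  rw [e]
  refine (norm_seg_mul_mul_seg_le hs hq (by omega) (by omega) _).trans ?_
  rw [norm_embed_sub hi]
  have h2 : ‖q i * X - q i * X'‖ ≤ 240 * u := by
    obtain ⟨W, hW, hqW⟩ := hq i
    have hn : ‖q i‖ ≤ 2 := by
      linarith [norm_sub_norm_le (q i) W, isUni_norm_le (by norm_num) hW, hs.le]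
    rw [← Matrix.mul_sub]
    refine (Matrix.frobenius_norm_mul _ _).trans ?_
    nlinarith [norm_nonneg (X - X'), norm_nonneg (q i)]
  linarith [norm_sub_le_norm_sub_add_norm_sub (fp.fuse (q i) X) (q i * X) (q i * X')]

theorem GoodFactored.of_update {s : Factored} {b : ℕ} {q : ℕ → Core} {R : ℕ → List Tri}
    {T : List Tri} (h : GoodFactored u s) (hq : GoodSeq u q)
    (hR : ∀ c, ∀ t ∈ R c, GoodTri u t) (hT : ∀ t ∈ T, GoodTri u t) :
    GoodFactored u { Q := Function.update s.Q b q, R := R, T := T } := by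
  refine ⟨fun c => ?_, hR, hT⟩
  by_cases hc : c = b
  · subst hc; simpa using hq
  · simpa [hc] using h.Q c

/-- A chase takes up the core transformation `G`, which stands to the left of block `b`, and turns
the similarity that needs it (`L' = L` except for `L'_b = L_b G`) into a unitary equivalence, with
an error proportional to the number of rows passed. -/
theorem chase_sim (hs : SmallFor u (n + 1)) (hn : 2 ≤ n) {m b : ℕ} (hm : m + 2 ≤ n) (hb : b < k)
    {ε : ℝ} {L L' M : ℕ → Matrix (Fin n) (Fin n) ℂ} (hL : ∀ c, IsUni (L c))
    (hM : ∀ c, IsUni (M c)) {G G' : Core} (hG' : IsUni G') (hG : ‖G - G'‖ ≤ 120 * u)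
    (hLL : L' = Function.update L b (L b * embed n (n - 2 - m) G')) {s₀ s : Factored}
    (hgood : GoodFactored u s) (h : FSim n k ε L L' M s₀ s) :
    GoodFactored u (chase fp n k m b G s) ∧ ∃ L₁ M₁ : ℕ → Matrix (Fin n) (Fin n) ℂ,
      (∀ c, IsUni (L₁ c)) ∧ (∀ c, IsUni (M₁ c)) ∧
      FSim n k (ε + (m + 1) * (10 ^ 8 * u)) L₁ L₁ M₁ s₀ (chase fp n k m b G s) := by
  have hu := hs.nonneg
  have hs' : SmallFor u n := ⟨hs.nonneg, hs.le, by
    have := hs.mul_le; push_cast at this; nlinarith⟩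
  induction m generalizing b ε L L' M G G' s with
  | zero =>
    obtain ⟨⟨hb', hQ, g1, g2⟩, L₁, Z, hL₁, hZ, hZ', h1, h2, h3⟩ :=
      wrap_pass_sim fp hs (i := n - 2) (by omega) hb hL hG' hG (by simpa using hLL) hgood h
    rw [chase]
    generalize wrapAround fp k (n - 2) b G s = w at *
    generalize passRLs fp (n - 2) w.2.1 (w.2.2.R (w.1 - 1)) = p at *
    rw [hQ]
    refine ⟨hgood.of_update ((hgood.Q _).update (fp.fuse_err hs.nonneg hs.le (hgood.Q _ _)
      ⟨Z, hZ, hZ'⟩).2) g1 g2, L₁, Function.update M (w.1 - 1) (M (w.1 - 1) * embed n (n - 2) Z), hL₁,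
      isUni_update hM _ ((hM _).mul (embed_isUni (by omega) hZ)), ?_, ?_, ?_⟩
    · intro c hc
      by_cases hc' : c = w.1 - 1
      · subst hc'
        simp only [Function.update_self]
        refine (norm_trans_right (embed_isUni (by omega) hZ) (h1 _ hc)
          (seqMatrix_fuse_right fp hs' (by omega) (hgood.Q _) hZ hZ' ?_)).trans (by simp)
        rw [show n - 2 - (n - 2) = 0 by omega, seg_zero]
        -- at the bottom there are no cores below
        exact Commute.one_right _
      · simp only [Function.update_of_ne hc']
        refine (h1 c hc).trans ?_
        simp; positivity
    · intro c hc
      simpa using h2 c hc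
    · simpa using h3
  | succ m ih =>
    obtain ⟨⟨hb', hQ, g1, g2⟩, L₁, Z, hL₁, hZ, hZ', h1, h2, h3⟩ :=
      wrap_pass_sim fp hs (i := n - 2 - (m + 1)) (by omega) hb hL hG' hG hLL hgood h
    rw [chase]
    generalize wrapAround fp k (n - 2 - (m + 1)) b G s = w at *
    generalize passRLs fp (n - 2 - (m + 1)) w.2.1 (w.2.2.R (w.1 - 1)) = p at *
    rw [hQ]
    have hi : n - 2 - m = n - 2 - (m + 1) + 1 := by omega
    obtain ⟨⟨⟨X, hX, hX'⟩, t2, t3⟩, -⟩ := fp.turnRL_err hs.nonneg hs.le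
      (hgood.Q (w.1 - 1) (n - 2 - (m + 1))) (hgood.Q (w.1 - 1) (n - 2 - (m + 1) + 1)) ⟨Z, hZ, hZ'⟩
    have t4 := seqMatrix_turnRL fp hs' (i := n - 2 - (m + 1)) (by omega) (hgood.Q (w.1 - 1)) hZ hZ'
      hX hX'
    generalize fp.turnRL (s.Q (w.1 - 1) (n - 2 - (m + 1))) (s.Q (w.1 - 1) (n - 2 - (m + 1) + 1)) p.1
      = v at *
    -- the turnover leaves the core `v.1`, close to `X`, to the left of the block, one row further
    -- down
    have hfin := ih (by omega) hb' (ε := ε + 10 ^ 8 * u) (L := L₁)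
      (L' := Function.update L₁ (w.1 - 1) (L₁ (w.1 - 1) * embed n (n - 2 - m) X))
      (M := Function.update M (w.1 - 1) (M (w.1 - 1) * embed n (n - 2 - (m + 1)) Z)) (G := v.1)
      (s := { Q := Function.update s.Q (w.1 - 1)
                (update₂ (s.Q (w.1 - 1)) (n - 2 - (m + 1)) v.2.1 v.2.2)
              R := Function.update w.2.2.R (w.1 - 1) p.2
              T := w.2.2.T }) hL₁
      (isUni_update hM _ ((hM _).mul (embed_isUni (by omega) hZ))) hX hX' rfl
      (hgood.of_update ((hgood.Q _).update₂ t2 t3) g1 g2) ?_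
    · obtain ⟨f1, L₂, M₂, f2, f3, f4⟩ := hfin
      refine ⟨f1, L₂, M₂, f2, f3, f4.mono ?_⟩
      push_cast
      linarith
    refine ⟨?_, h2, ?_⟩
    · intro c hc
      by_cases hc' : c = w.1 - 1
      · subst hc'
        simp only [Function.update_self]
        have := norm_conj_trans (embed_isUni (by omega) hX) (embed_isUni (by omega) hZ) (h1 _ hc) t4
        rwa [hi]
      · simp only [Function.update_of_ne hc']
        exact (h1 c hc).trans (by linarith)
    · rw [Function.update_of_ne (show k ≠ w.1 - 1 by omega)]
      exact h3

theorem wrapAround_fst (i b : ℕ) (G : Core) (s : Factored) :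
    (wrapAround fp k i b G s).1 = if b = 0 then k else b := by
  unfold wrapAround
  split_ifs <;> rfl

theorem wrapAround_Q (i b : ℕ) (G : Core) (s : Factored) :
    (wrapAround fp k i b G s).2.2.Q = s.Q := by
  unfold wrapAround
  split_ifs <;> rfl

/-- A chase leaves all core transformations above its starting row unchanged. -/
theorem chase_Q_of_lt {m b : ℕ} (hm : m + 2 ≤ n) (G : Core) (s : Factored) {j : ℕ}
    (hj : j < n - 2 - m) (c : ℕ) : (chase fp n k m b G s).Q c j = s.Q c j := by
  induction m generalizing b G s with
  | zero =>
    simp only [chase, wrapAround_Q]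
    by_cases hc : c = (wrapAround fp k (n - 2) b G s).1 - 1
    · subst hc
      rw [Function.update_self, Function.update_of_ne (by omega)]
    · rw [Function.update_of_ne hc]
  | succ m ih =>
    rw [chase]
    rw [ih (by omega) _ _ (by omega)]
    dsimp only
    rw [wrapAround_Q]
    by_cases hc : c = (wrapAround fp k (n - 2 - (m + 1)) b G s).1 - 1
    · subst hc
      rw [Function.update_self, update₂_of_ne _ _ _ (by omega) (by omega)]
    · rw [Function.update_of_ne hc]

/-- In its starting row, a chase changes only the sequence of the previous block. -/
theorem chase_Q_of_ne {m b : ℕ} (hm : m + 2 ≤ n) (hb : b ≠ 0) (G : Core) (s : Factored) {c : ℕ}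
    (hc : c ≠ b - 1) : (chase fp n k m b G s).Q c (n - 2 - m) = s.Q c (n - 2 - m) := by
  cases m with
  | zero =>
    simp only [chase, wrapAround_Q, wrapAround_fst, if_neg hb]
    rw [Function.update_of_ne hc]
  | succ m =>
    rw [chase]
    rw [chase_Q_of_lt fp (by omega) _ _ (by omega)]
    dsimp only
    rw [wrapAround_Q, wrapAround_fst, if_neg hb, Function.update_of_ne hc]

/-- Removal of the core `i` of the sequence `b`, all cores above it being trivial already. -/
theorem removeCore_sim (hs : SmallFor u (n + 1)) {i b : ℕ} (hi : i + 2 ≤ n) (hb : b < k)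
    {ε : ℝ} {L M : ℕ → Matrix (Fin n) (Fin n) ℂ} (hL : ∀ c, IsUni (L c))
    (hM : ∀ c, IsUni (M c)) {s₀ s : Factored}
    (hgood : GoodFactored u s) (h : FSim n k ε L L M s₀ s) (hone : ∀ j < i, s.Q b j = 1) :
    GoodFactored u (removeCore fp n k i b s) ∧ ∃ L₁ M₁ : ℕ → Matrix (Fin n) (Fin n) ℂ,
      (∀ c, IsUni (L₁ c)) ∧ (∀ c, IsUni (M₁ c)) ∧
      FSim n k (ε + n * (10 ^ 8 * u)) L₁ L₁ M₁ s₀ (removeCore fp n k i b s) := by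
  have hu := hs.nonneg
  have hs' : SmallFor u n := ⟨hs.nonneg, hs.le, by
    have := hs.mul_le; push_cast at this; nlinarith⟩
  obtain ⟨G', hG', hG⟩ := hgood.Q b i
  have hone' : NearU (120 * u) (1 : Core) := nearU_of_isUni (by positivity) isUni_one
  have hgood' : GoodFactored u { s with Q := Function.update s.Q b (Function.update (s.Q b) i 1) } :=
    hgood.of_update ((hgood.Q b).update hone') hgood.R hgood.T
  have hseg : seg n (s.Q b) 0 i = 1 := by
    rw [seg_congr (q' := fun _ => 1) fun j _ hj => hone j (by omega)]
    simp [seg, embed_one]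
  -- as the cores above are trivial, the removed core is a factor on the left of its sequence
  have e1 : seqMatrix n (s.Q b)
      = embed n i (s.Q b i) * seqMatrix n (Function.update (s.Q b) i 1) := by
    rw [seqMatrix_update hi, seqMatrix_split hi, hseg, embed_one, Matrix.one_mul, Matrix.one_mul,
      Matrix.one_mul]
  -- the removed core is only nearly unitary; the unitary `G'` takes its place in the equivalence
  have e2 : ‖seqMatrix n (Function.update (s.Q b) i 1) - (embed n i G')ᴴ * seqMatrix n (s.Q b)‖
      ≤ 240 * u := by
    have e3 : seqMatrix n (Function.update (s.Q b) i 1) - (embed n i G')ᴴ * seqMatrix n (s.Q b)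
        = (embed n i G')ᴴ * ((embed n i G' - embed n i (s.Q b i)) *
          seqMatrix n (Function.update (s.Q b) i 1)) := by
      rw [Matrix.sub_mul, Matrix.mul_sub, (embed_isUni hi hG').cancel, ← e1]
    rw [e3, (embed_isUni hi hG').conj.norm_mul]
    refine (norm_mul_seqMatrix_le hs' (by omega) ((hgood.Q b).update hone') _).trans ?_
    rw [norm_embed_sub hi, norm_sub_rev]
    linarith
  have hi' : n - 2 - (n - 2 - i) = i := by omega
  have hF : FSim n k (ε + 240 * u) L (Function.update L b (L b * embed n (n - 2 - (n - 2 - i)) G'))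
      M s₀ { s with Q := Function.update s.Q b (Function.update (s.Q b) i 1) } := by
    rw [hi']
    refine ⟨fun c hc => ?_, fun c hc => (h.R c hc).mono (by linarith), ?_⟩
    · by_cases hc' : c = b
      · subst hc'
        simp only [Function.update_self]
        have := norm_conj_trans (embed_isUni hi hG') isUni_one (h.Q c hc) (ε' := 240 * u) (A'' :=
          seqMatrix n (Function.update (s.Q c) i 1)) (by rw [Matrix.mul_one]; exact e2)
        rwa [Matrix.mul_one] at this
      · simp only [Function.update_of_ne hc']
        exact (h.Q c hc).trans (by linarith)
    · rw [Function.update_of_ne (by omega)]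
      exact h.T.mono (by linarith)
  obtain ⟨g, L₁, M₁, hL₁, hM₁, h₁⟩ := chase_sim fp hs (by omega) (m := n - 2 - i) (by omega) hb
    hL hM hG' hG rfl hgood' hF
  refine ⟨g, L₁, M₁, hL₁, hM₁, h₁.mono ?_⟩
  have : ((n - 2 - i : ℕ) : ℝ) + 2 ≤ n := by
    have : n - 2 - i + 2 ≤ n := by omega
    exact_mod_cast this
  nlinarith

theorem removeCore_Q_of_lt {i b : ℕ} (hi : i + 2 ≤ n) (s : Factored) {j : ℕ}
    (hj : j < i) (c : ℕ) : (removeCore fp n k i b s).Q c j = s.Q c j := by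
  rw [removeCore, chase_Q_of_lt fp (by omega) _ _ (by omega)]
  by_cases hc : c = b
  · subst hc
    simp only [Function.update_self]
    rw [Function.update_of_ne (by omega)]
  · simp only [Function.update_of_ne hc]

/-- In row `i`, the removal of a core from the sequence `b` affects only this sequence and the one
before it. -/
theorem removeCore_Q {i b : ℕ} (hi : i + 2 ≤ n) (hb : b ≠ 0) (s : Factored) {c : ℕ}
    (hc : c ≠ b - 1) : (removeCore fp n k i b s).Q c i = if c = b then 1 else s.Q c i := by
  have := chase_Q_of_ne fp (n := n) (k := k) (m := n - 2 - i) (by omega) hb (s.Q b i)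
    { s with Q := Function.update s.Q b (Function.update (s.Q b) i 1) } hc
  rw [show n - 2 - (n - 2 - i) = i by omega] at this
  rw [removeCore, this]
  split_ifs with h
  · subst h
    simp
  · simp [Function.update_of_ne h]

/-- Invariants of a loop. -/
theorem foldl_range_induct {α : Type*} (f : α → ℕ → α) (P : ℕ → α → Prop) (N : ℕ) (a : α)
    (h0 : P 0 a) (hstep : ∀ i < N, ∀ x, P i x → P (i + 1) (f x i)) :
    P N ((List.range N).foldl f a) := by
  induction N with
  | zero => simpa using h0
  | succ N ih =>
    rw [List.range_succ, List.foldl_append]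
    exact hstep N (by omega) _ (ih fun i hi => hstep i (by omega))

/-- The reduction leaves trivial sequences except for the first one, and it is a unitary
equivalence up to errors of order `n² k u` in each stored factor. -/
theorem reduce_sim (hs : SmallFor u (n + 1)) (hn : 2 ≤ n) (hk : 1 ≤ k)
    {ε : ℝ} {s₀ s : Factored} (hgood : GoodFactored u s)
    (h : FSim n k ε (fun _ => 1) (fun _ => 1) (fun _ => 1) s₀ s) :
    GoodFactored u (reduce fp n k s) ∧
      (∀ c, 1 ≤ c → c < k → ∀ j, j + 1 < n → (reduce fp n k s).Q c j = 1) ∧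
      ∃ L M : ℕ → Matrix (Fin n) (Fin n) ℂ, (∀ c, IsUni (L c)) ∧ (∀ c, IsUni (M c)) ∧
        FSim n k (ε + (n - 1 : ℕ) * (k - 1 : ℕ) * (n * (10 ^ 8 * u))) L L M s₀ (reduce fp n k s) := by
  have hu := hs.nonneg
  -- outer loop: after `i` rounds the first `i` cores of all sequences but the first one are
  -- trivial
  have key := foldl_range_induct (fun s i =>
    (List.range (k - 1)).foldl (fun s t => removeCore fp n k i (k - 1 - t) s) s)
    (fun i s => GoodFactored u s ∧ (∀ c, 1 ≤ c → c < k → ∀ j < i, s.Q c j = 1) ∧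
      ∃ L M : ℕ → Matrix (Fin n) (Fin n) ℂ, (∀ c, IsUni (L c)) ∧ (∀ c, IsUni (M c)) ∧
        FSim n k (ε + i * (k - 1 : ℕ) * (n * (10 ^ 8 * u))) L L M s₀ s) (n - 1) s
    ⟨hgood, by omega, fun _ => 1, fun _ => 1, fun _ => isUni_one, fun _ => isUni_one, by
      simpa using h⟩ ?_
  · obtain ⟨h1, h2, h3⟩ := key
    exact ⟨h1, fun c hc hc' j hj => h2 c hc hc' j (by omega), h3⟩
  intro i hi s₁ hs₁
  -- inner loop: after `t` removals also the core `i` of the last `t` sequences is trivial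
  have key2 := foldl_range_induct (fun s t => removeCore fp n k i (k - 1 - t) s)
    (fun t s => GoodFactored u s ∧ (∀ c, 1 ≤ c → c < k → ∀ j < i, s.Q c j = 1) ∧
      (∀ c, c < k → k ≤ c + t → s.Q c i = 1) ∧
      ∃ L M : ℕ → Matrix (Fin n) (Fin n) ℂ, (∀ c, IsUni (L c)) ∧ (∀ c, IsUni (M c)) ∧
        FSim n k (ε + i * (k - 1 : ℕ) * (n * (10 ^ 8 * u)) + t * (n * (10 ^ 8 * u))) L L M s₀ s)
      (k - 1) s₁
    ⟨hs₁.1, hs₁.2.1, by omega, by simpa using hs₁.2.2⟩ ?_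
  · obtain ⟨h1, h2, h3, h4⟩ := key2
    refine ⟨h1, fun c hc hc' j hj => ?_, ?_⟩
    · rcases Nat.lt_succ_iff_lt_or_eq.1 hj with hj | rfl
      · exact h2 c hc hc' j hj
      · exact h3 c hc' (by omega)
    · obtain ⟨L, M, hL, hM, h4⟩ := h4
      refine ⟨L, M, hL, hM, h4.mono (le_of_eq ?_)⟩
      push_cast
      ring
  rintro t ht s₂ ⟨h1, h2, h3, L, M, hL, hM, h4⟩
  obtain ⟨f1, L₁, M₁, f2, f3, f4⟩ := removeCore_sim fp hs (i := i) (b := k - 1 - t) (by omega)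
    (by omega) hL hM h1 h4 (h2 _ (by omega) (by omega))
  refine ⟨f1, fun c hc hc' j hj => ?_, fun c hc hc' => ?_, L₁, M₁, f2, f3, f4.mono (le_of_eq ?_)⟩
  · rw [removeCore_Q_of_lt fp (by omega) _ hj]
    exact h2 c hc hc' j hj
  · rw [removeCore_Q fp (by omega) (by omega) _ (by omega)]
    split_ifs with h
    · rfl
    · exact h3 c hc (by omega)
  · push_cast
    ring

end

/-! ### Backward errors of QR steps -/

/-- All stored core transformations of a Hessenberg-triangular pencil are nearly unitary. -/
structure GoodHess (u : ℝ) (s : HessTri) : Prop where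
  Q : GoodSeq u s.Q
  R : ∀ t ∈ s.R, GoodTri u t
  T : ∀ t ∈ s.T, GoodTri u t

/-- The pencil `s` is, up to errors `ε` in each stored factor, obtained from `s₀` by replacing
`Q`, `R`, `T` by `U'ᴴ Q M'`, `Mᴴ R V` and `Uᴴ T V`.  For `U' = U` and `M' = M` this is a unitary
equivalence; otherwise a core transformation has still to be inserted to the left of `Q` or between
`Q` and `R`. -/
structure HSim (n : ℕ) (ε : ℝ) (U' U M' M V : Matrix (Fin n) (Fin n) ℂ) (s₀ s : HessTri) :
    Prop where
  Q : ‖seqMatrix n s.Q - U'ᴴ * seqMatrix n s₀.Q * M'‖ ≤ ε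
  R : ListSim n ε M V s₀.R s.R
  T : ListSim n ε U V s₀.T s.T

theorem HSim.mono {n : ℕ} {ε ε' : ℝ} {U' U M' M V : Matrix (Fin n) (Fin n) ℂ} {s₀ s : HessTri}
    (h : HSim n ε U' U M' M V s₀ s) (hε : ε ≤ ε') : HSim n ε' U' U M' M V s₀ s :=
  ⟨h.Q.trans hε, h.R.mono hε, h.T.mono hε⟩

section

variable {u : ℝ} (fp : FloatArith u) {n : ℕ}

theorem SmallFor.pred {u : ℝ} {n : ℕ} (hs : SmallFor u (n + 1)) : SmallFor u n :=
  ⟨hs.nonneg, hs.le, by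
    have := hs.mul_le
    have := hs.nonneg
    push_cast at *
    nlinarith⟩

/-- If `Gᴴ` has been applied to `Q` from the left, then `transfer` applies it to `T` as well, and
compensates this from the right; a misfit `Z` between `Q` and `R` remains. -/
theorem transfer_sim (hs : SmallFor u (n + 1)) {i : ℕ} (hi : i + 2 ≤ n) {ε : ℝ}
    {U M V : Matrix (Fin n) (Fin n) ℂ} (hV : IsUni V) {G G' : Core} (hG' : IsUni G')
    (hG : ‖G - G'‖ ≤ 120 * u) {s₀ s : HessTri} (hgood : GoodHess u s)
    (h : HSim n ε (U * embed n i G') U M M V s₀ s) :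
    GoodHess u (transfer fp i G s).2 ∧ (transfer fp i G s).2.Q = s.Q ∧
      ∃ (Z : Core) (V₁ : Matrix (Fin n) (Fin n) ℂ), IsUni Z ∧ IsUni V₁ ∧
        ‖(transfer fp i G s).1 - Z‖ ≤ 120 * u ∧
        HSim n (ε + 10 ^ 8 * u) (U * embed n i G') (U * embed n i G') M (M * embed n i Z) V₁ s₀
          (transfer fp i G s).2 := by
  have hu := hs.nonneg
  obtain ⟨g1, W, hW, hW', h1⟩ := passLRs_sim fp hs hi hgood.T hG'.conj (NearU.uni_conj hG)
  obtain ⟨g2, Z, hZ, hZ', h2⟩ := passRLs_sim fp hs hi hgood.R hW.conj (NearU.uni_conj hW')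
  rw [embed_conj, embed_conj, Matrix.conjTranspose_conjTranspose] at h1
  exact ⟨⟨hgood.Q, g2, g1⟩, rfl, Z, V * embed n i Wᴴ, hZ, hV.mul (embed_isUni hi hW.conj), hZ',
    h.Q.trans (by linarith), h.R.trans h2 (embed_isUni hi hZ), h.T.trans h1 (embed_isUni hi hG')⟩

theorem seg_commute_of_one {m i l : ℕ} {q : ℕ → Core} {X : Matrix (Fin m) (Fin m) ℂ}
    (h1 : q i = 1) (h : ∀ j, i + 1 ≤ j → Commute X (embed m j (q j))) :
    Commute X (seg m q i l) := by
  refine seg_commute fun j hj _ => ?_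
  rcases hj.eq_or_lt with rfl | hj
  · rw [h1, embed_one]; exact Commute.one_right _
  · exact h j hj

/-- Chasing the misfit `X` down to a deflated position restores a unitary equivalence. -/
theorem chaseMisfit_sim (hs : SmallFor u (n + 1)) {m i : ℕ} (hi : i + m + 2 ≤ n) {ε : ℝ}
    {U M V : Matrix (Fin n) (Fin n) ℂ} (hU : IsUni U) (hM : IsUni M) (hV : IsUni V) {X X' : Core}
    (hX' : IsUni X') (hX : ‖X - X'‖ ≤ 120 * u) {s₀ s : HessTri} (hgood : GoodHess u s)
    (hafter : s.Q (i + m + 1) = 1) (h : HSim n ε U U M (M * embed n i X') V s₀ s) :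
    GoodHess u (chaseMisfit fp m i X s) ∧ ∃ U₁ M₁ V₁ : Matrix (Fin n) (Fin n) ℂ,
      IsUni U₁ ∧ IsUni M₁ ∧ IsUni V₁ ∧
      HSim n (ε + (m + 1) * (2 * 10 ^ 8 * u)) U₁ U₁ M₁ M₁ V₁ s₀ (chaseMisfit fp m i X s) := by
  have hu := hs.nonneg
  induction m generalizing i ε U M V X X' s with
  | zero =>
    rw [chaseMisfit]
    have hi' : i + 2 ≤ n := by omega
    refine ⟨⟨hgood.Q.update (fp.fuse_err hs.nonneg hs.le (hgood.Q i) ⟨X', hX', hX⟩).2, hgood.R,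
      hgood.T⟩, U, M * embed n i X', V, hU, hM.mul (embed_isUni hi' hX'), hV, ?_,
      h.R.mono ?_, h.T.mono ?_⟩
    · refine (norm_trans_right (embed_isUni hi' hX') h.Q
        (seqMatrix_fuse_right fp hs.pred hi' hgood.Q hX' hX ?_)).trans ?_
      -- the next core is deflated, and those further below act on other rows
      · exact seg_commute_of_one (by simpa using hafter) fun j hj => embed_commute (by omega) _ _
      · simp
        nlinarith
    · simp; positivity
    · simp; positivity
  | succ m ih =>
    rw [chaseMisfit]
    obtain ⟨⟨⟨W, hW, hW'⟩, t2, t3⟩, -⟩ := fp.turnRL_err hs.nonneg hs.le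
      (hgood.Q i) (hgood.Q (i + 1)) ⟨X', hX', hX⟩
    have t4 := seqMatrix_turnRL fp hs.pred (i := i) (by omega) hgood.Q hX' hX hW hW'
    generalize fp.turnRL (s.Q i) (s.Q (i + 1)) X = v at *
    have hi' : i + 2 ≤ n := by omega
    -- the turnover moves the misfit to the left of `Q`, one row further down; `transfer` takes it
    -- round to the right of `Q`
    obtain ⟨g1, g2, Z, V₁, hZ, hV₁, hZ', h1⟩ := transfer_sim fp hs (i := i + 1) (by omega) hV hW hW'
      (s₀ := s₀) (s := { s with Q := update₂ s.Q i v.2.1 v.2.2 }) (ε := ε + 10 ^ 8 * u) (U := U)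
      (M := M * embed n i X') ⟨hgood.Q.update₂ t2 t3, hgood.R, hgood.T⟩
      ⟨norm_conj_trans (embed_isUni (by omega) hW) (embed_isUni hi' hX') h.Q t4,
        h.R.mono (by linarith), h.T.mono (by linarith)⟩
    obtain ⟨f1, U₂, M₂, V₂, f2, f3, f4, f5⟩ := ih (i := i + 1) (by omega)
      (hU.mul (embed_isUni (by omega) hW)) (hM.mul (embed_isUni hi' hX')) hV₁ hZ hZ' g1
      (by
        rw [g2]
        dsimp only
        rw [update₂_of_ne _ _ _ (by omega) (by omega), show i + 1 + m + 1 = i + (m + 1) + 1 by omega]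
        exact hafter) h1
    refine ⟨f1, U₂, M₂, V₂, f2, f3, f4, f5.mono ?_⟩
    push_cast
    linarith

/-- Fusion from the left with the core number `i` of a sequence, where the core transformations
above commute with the fused one or are trivial. -/
theorem seqMatrix_fuse_left {m i : ℕ} (hs : SmallFor u m) (hi : i + 2 ≤ m) {q : ℕ → Core}
    (hq : GoodSeq u q) {X X' : Core} (hX' : IsUni X') (hX : ‖X - X'‖ ≤ 120 * u)
    (hc : Commute (embed m i X') (seg m q 0 i)) :
    ‖seqMatrix m (Function.update q i (fp.fuse X (q i))) - embed m i X' * seqMatrix m q‖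
      ≤ 10 ^ 8 * u := by
  have hu := hs.nonneg
  obtain ⟨h1, -⟩ := fp.fuse_err hs.nonneg hs.le ⟨X', hX', hX⟩ (hq i)
  have e : seqMatrix m (Function.update q i (fp.fuse X (q i))) - embed m i X' * seqMatrix m q
      = seg m q 0 i * (embed m i (fp.fuse X (q i)) - embed m i (X' * q i))
        * seg m q (i + 1) (m - 2 - i) := by
    rw [seqMatrix_update hi, seqMatrix_split hi, ← Matrix.mul_assoc (embed m i X'),
      ← Matrix.mul_assoc (embed m i X'), hc.eq, embed_mul hi]
    simp only [Matrix.mul_sub, Matrix.sub_mul, Matrix.mul_assoc]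
  rw [e]
  refine (norm_seg_mul_mul_seg_le hs hq (by omega) (by omega) _).trans ?_
  rw [norm_embed_sub hi]
  have h2 : ‖X * q i - X' * q i‖ ≤ 240 * u := by
    obtain ⟨W, hW, hqW⟩ := hq i
    have hn : ‖q i‖ ≤ 2 := by
      linarith [norm_sub_norm_le (q i) W, isUni_norm_le (by norm_num) hW, hs.le]
    rw [← Matrix.sub_mul]
    refine (Matrix.frobenius_norm_mul _ _).trans ?_
    nlinarith [norm_nonneg (X - X'), norm_nonneg (q i)]
  linarith [norm_sub_le_norm_sub_add_norm_sub (fp.fuse X (q i)) (X * q i) (X' * q i)]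

/-- A QR step is a unitary equivalence up to errors of order `n u`, whatever the shift. -/
theorem francis_sim (hs : SmallFor u (n + 1)) {lo hi : ℕ} (hlh : lo ≤ hi) (hhi : hi + 1 < n)
    {ε : ℝ} {U M V : Matrix (Fin n) (Fin n) ℂ} (hU : IsUni U) (hM : IsUni M) (hV : IsUni V)
    (a b : ℂ) {s₀ s : HessTri} (hgood : GoodHess u s) (hbefore : ∀ j, j + 1 = lo → s.Q j = 1)
    (hafter : s.Q (hi + 1) = 1) (h : HSim n ε U U M M V s₀ s) :
    GoodHess u (francis fp lo hi a b s) ∧ ∃ U₁ M₁ V₁ : Matrix (Fin n) (Fin n) ℂ,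
      IsUni U₁ ∧ IsUni M₁ ∧ IsUni V₁ ∧
      HSim n (ε + n * (10 ^ 9 * u)) U₁ U₁ M₁ M₁ V₁ s₀ (francis fp lo hi a b s) := by
  have hu := hs.nonneg
  obtain ⟨G, hG, hG'⟩ := fp.givens_nearU hs.nonneg (by linarith [hs.le]) a b
  have hlo : lo + 2 ≤ n := by omega
  unfold francis
  dsimp only
  generalize fp.givens a b = F at *
  -- the core above `lo` is deflated, and those further above act on other rows, so the first
  -- rotation can be fused with the core `lo`
  have hc : Commute (embed n lo Gᴴ) (seg n s.Q 0 lo) := by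
    refine seg_commute fun j _ hj => ?_
    by_cases hj' : j + 1 = lo
    · rw [hbefore j hj', embed_one]; exact Commute.one_right _
    · exact embed_commute (by omega) _ _
  have h1 := seqMatrix_fuse_left fp hs.pred hlo hgood.Q hG.conj (NearU.uni_conj hG') hc
  rw [← embed_conj] at h1
  have h2 := norm_conj_trans (A'' := seqMatrix n (Function.update s.Q lo (fp.fuse Fᴴ (s.Q lo))))
    (ε' := 10 ^ 8 * u) (embed_isUni hlo hG) isUni_one h.Q (by rwa [Matrix.mul_one])
  rw [Matrix.mul_one] at h2
  obtain ⟨g1, g2, Z, V₁, hZ, hV₁, hZ', h3⟩ := transfer_sim fp hs hlo hV hG hG'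
    (s₀ := s₀) (s := { s with Q := Function.update s.Q lo (fp.fuse Fᴴ (s.Q lo)) })
    (ε := ε + 10 ^ 8 * u) (U := U) (M := M)
    ⟨hgood.Q.update (fp.fuse_err hs.nonneg hs.le ⟨Gᴴ, hG.conj, NearU.uni_conj hG'⟩ (hgood.Q lo)).2,
      hgood.R, hgood.T⟩
    ⟨h2, h.R.mono (by linarith), h.T.mono (by linarith)⟩
  obtain ⟨f1, U₂, M₂, V₂, f2, f3, f4, f5⟩ := chaseMisfit_sim fp hs (m := hi - lo) (i := lo)
    (by omega) (hU.mul (embed_isUni hlo hG)) hM hV₁ hZ hZ' g1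
    (by
      rw [g2, show lo + (hi - lo) + 1 = hi + 1 by omega]
      dsimp only
      rw [Function.update_of_ne (by omega)]
      exact hafter) h3
  refine ⟨f1, U₂, M₂, V₂, f2, f3, f4, f5.mono ?_⟩
  have : ((hi - lo : ℕ) : ℝ) + 2 ≤ n := by
    have : hi - lo + 2 ≤ n := by omega
    exact_mod_cast this
  nlinarith

/-! ### Deflation of a nearly diagonal core transformation -/

/-- The diagonal matrix with the entry `φ` in position `i` and ones elsewhere. -/
def diagAt (m i : ℕ) (φ : ℂ) : Matrix (Fin m) (Fin m) ℂ := plug (incl m 1 i) !![φ]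

theorem diagAt_isUni {m i : ℕ} (hi : i + 1 ≤ m) {φ : ℂ} (hφ : ‖φ‖ = 1) : IsUni (diagAt m i φ) := by
  refine plug_isUni (incl_isometry hi) (isUni_of_left ?_)
  ext a b
  fin_cases a
  fin_cases b
  have : (starRingEnd ℂ φ) * φ = ((‖φ‖ ^ 2 : ℝ) : ℂ) := by
    rw [Complex.sq_norm]; exact Complex.normSq_eq_conj_mul_self.symm
  simp [Matrix.mul_apply, this, hφ]

theorem diagAt_conj (m i : ℕ) (φ : ℂ) : (diagAt m i φ)ᴴ = diagAt m i (star φ) := by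
  rw [diagAt, plug_conj, diagAt]
  congr 1
  ext a b
  fin_cases a
  fin_cases b
  simp

theorem hat_diagAt {i : ℕ} (hi : i + 1 ≤ n) (φ : ℂ) : hat n (diagAt n i φ) = diagAt (n + 1) i φ := by
  rw [hat, diagAt, plug_plug, incl_mul_incl hi, zero_add, diagAt]

theorem embed_diag_left (m i : ℕ) (φ : ℂ) : embed m i !![φ, 0; 0, 1] = diagAt m i φ := by
  have e : (!![φ, 0; 0, 1] : Core) = plug (incl 2 1 0) !![φ] := by
    ext a b
    fin_cases a <;> fin_cases b <;> simp [plug, incl, Matrix.mul_apply]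
  rw [e, embed_eq_plug, plug_plug, incl_mul_incl (by norm_num), add_zero, diagAt]

theorem embed_diag_right (m i : ℕ) (φ : ℂ) : embed m i !![1, 0; 0, φ] = diagAt m (i + 1) φ := by
  have e : (!![1, 0; 0, φ] : Core) = plug (incl 2 1 1) !![φ] := by
    ext a b
    fin_cases a <;> fin_cases b <;> simp [plug, incl, Matrix.mul_apply]
  rw [e, embed_eq_plug, plug_plug, incl_mul_incl (by norm_num), diagAt]

theorem diagAt_commute {m i j : ℕ} (h : i + 1 ≤ j ∨ j + 2 ≤ i) (φ : ℂ) (G : Core) :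
    Commute (diagAt m i φ) (embed m j G) := by
  rw [embed_eq_plug]
  exact plug_commute (incl_orth h) _ _

theorem isUni_diag {φ : ℂ} (hφ : ‖φ‖ = 1) : IsUni (!![φ, 0; 0, 1] : Core) := by
  have h := diagAt_isUni (m := 2) (i := 0) (by norm_num) hφ
  rw [← embed_diag_left, embed_eq_plug, incl_self] at h
  simpa [plug] using h

/-- Multiplication of a row of a product of stored factors by a phase. It is applied to the first
factor only, where it is fused into `C`; the cores of `C` below commute with it. -/
theorem scaleRow_sim (hs : SmallFor u (n + 1)) {i : ℕ} (hi : i + 1 ≤ n) {a φ : ℂ} (hφ : ‖φ‖ = 1)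
    (ha : ‖fp.phase a - φ‖ ≤ 12 * u) {ts : List Tri} (hts : ts ≠ []) (hgood : ∀ t ∈ ts, GoodTri u t) :
    (∀ t ∈ scaleRow fp i a ts, GoodTri u t) ∧
      ListSim n (10 ^ 8 * u) (diagAt n i φ) 1 ts (scaleRow fp i a ts) := by
  have hu := hs.nonneg
  cases ts with
  | nil => exact absurd rfl hts
  | cons t ts =>
    have h1 : ‖(!![fp.phase a, 0; 0, 1] : Core) - !![φ, 0; 0, 1]‖ ≤ 120 * u := by
      refine (norm_le_sum_fin_two _).trans ?_
      simp
      linarith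
    have hd := isUni_diag hφ
    have ht := hgood t (by simp)
    refine ⟨?_, .cons isUni_one ⟨1, isUni_one, by simp, ?_, ?_⟩ ((ListSim.refl ts).mono (by positivity))⟩
    · intro t' h'
      simp only [scaleRow, List.mem_cons] at h'
      rcases h' with rfl | h'
      · exact ⟨ht.1.update (fp.fuse_err hs.nonneg hs.le (ht.1 i) ⟨_, hd, h1⟩).2, ht.2⟩
      · exact hgood t' (by simp [h'])
    · have h2 := seqMatrix_fuse_right fp hs (i := i) (by omega) ht.1 hd h1 (by
        rw [embed_diag_left]
        exact seg_commute fun j hj _ => diagAt_commute (by omega) _ _)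
      rw [embed_diag_left] at h2
      rwa [hat_diagAt hi, Matrix.conjTranspose_one, Matrix.one_mul]
    · simp [hat_one]
      positivity

/-- A nearly unitary core transformation with a small off-diagonal entry is nearly diagonal, with
unimodular diagonal entries. -/
theorem near_diag {tol : ℝ} {G : Core} (hG : NearU (120 * u) G)
    (h : ‖G 1 0‖ ≤ tol * u) {α β : ℂ} (hα : ‖α‖ = 1) (hβ : ‖β‖ = 1)
    (h0 : G 0 0 = α * (‖G 0 0‖ : ℝ)) (h1 : G 1 1 = β * (‖G 1 1‖ : ℝ)) :
    ‖G - !![1, 0; 0, β] * !![α, 0; 0, 1]‖ ≤ (4 * tol + 720) * u := by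
  obtain ⟨W, hW, hGW⟩ := hG
  have E : ∀ z : ℂ, star z * z = ((‖z‖ ^ 2 : ℝ) : ℂ) := fun z => by
    rw [Complex.sq_norm]; exact Complex.normSq_eq_conj_mul_self.symm
  have c0 : ‖W 0 0‖ ^ 2 + ‖W 1 0‖ ^ 2 = 1 := by
    have := congrFun (congrFun hW.left 0) 0
    simp only [Matrix.mul_apply, Fin.sum_univ_two, Matrix.conjTranspose_apply,
      Matrix.one_apply_eq, E] at this
    exact_mod_cast this
  have r0 : ‖W 0 0‖ ^ 2 + ‖W 0 1‖ ^ 2 = 1 := by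
    have := congrFun (congrFun hW.right 0) 0
    simp only [Matrix.mul_apply, Fin.sum_univ_two, Matrix.conjTranspose_apply,
      Matrix.one_apply_eq, mul_comm _ (star _), E] at this
    exact_mod_cast this
  have r1 : ‖W 1 0‖ ^ 2 + ‖W 1 1‖ ^ 2 = 1 := by
    have := congrFun (congrFun hW.right 1) 1
    simp only [Matrix.mul_apply, Fin.sum_univ_two, Matrix.conjTranspose_apply,
      Matrix.one_apply_eq, mul_comm _ (star _), E] at this
    exact_mod_cast this
  have d := fun i j => (norm_entry_le (G - W) i j).trans hGW
  simp only [Matrix.sub_apply] at d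
  have w10 : ‖W 1 0‖ ≤ (tol + 120) * u := by
    have := norm_sub_norm_le (W 1 0) (G 1 0)
    rw [norm_sub_rev] at this
    linarith [d 1 0]
  -- in a unitary `2 × 2` matrix the off-diagonal entries have equal moduli, and so have the
  -- diagonal ones
  have w01 : ‖W 0 1‖ = ‖W 1 0‖ :=
    (pow_left_inj₀ (norm_nonneg _) (norm_nonneg _) two_ne_zero).1 (by linarith)
  have w11 : ‖W 1 1‖ = ‖W 0 0‖ :=
    (pow_left_inj₀ (norm_nonneg _) (norm_nonneg _) two_ne_zero).1 (by linarith)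
  have w10' : ‖W 1 0‖ ≤ 1 := by nlinarith [norm_nonneg (W 1 0), sq_nonneg ‖W 0 0‖]
  have w00 : |‖W 0 0‖ - 1| ≤ ‖W 1 0‖ := by
    rw [abs_le]
    constructor <;> nlinarith [norm_nonneg (W 0 0), norm_nonneg (W 1 0)]
  have g : ∀ i, ‖W i i‖ = ‖W 0 0‖ → |‖G i i‖ - 1| ≤ (tol + 240) * u := fun i hi => by
    have h2 := (abs_norm_sub_norm_le (G i i) (W i i)).trans (d i i)
    rw [hi] at h2
    have := abs_sub_le ‖G i i‖ ‖W 0 0‖ 1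
    linarith
  have g01 : ‖G 0 1‖ ≤ (tol + 240) * u := by
    linarith [norm_sub_norm_le (G 0 1) (W 0 1), d 0 1]
  have k : ∀ (z φ : ℂ), ‖φ‖ = 1 → z = φ * (‖z‖ : ℝ) → ‖z - φ‖ = |‖z‖ - 1| := fun z φ h1 h2 => by
    have e : z - φ = φ * ((‖z‖ - 1 : ℝ) : ℂ) := by
      conv_lhs => rw [h2]
      push_cast; ring
    rw [e, norm_mul, h1, one_mul, Complex.norm_real, Real.norm_eq_abs]
  have g00 := g 0 rfl
  have g11 := g 1 w11
  rw [← k _ α hα h0] at g00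
  rw [← k _ β hβ h1] at g11
  have e : (!![1, 0; 0, β] : Core) * !![α, 0; 0, 1] = !![α, 0; 0, β] := by
    ext a b
    fin_cases a <;> fin_cases b <;> simp
  rw [e]
  refine (norm_le_sum_fin_two _).trans ?_
  simp only [Matrix.sub_apply, Matrix.of_apply, Matrix.cons_val', Matrix.cons_val_zero,
      Matrix.cons_val_one, Matrix.cons_val_fin_one, sub_zero]
  linarith

/-- Deflation moves the two phases of a nearly diagonal core into `R` and `T`, and drops
off-diagonal entries of order `u`. -/
theorem deflate_sim (hs : SmallFor u (n + 1)) {i : ℕ} (hi : i + 1 < n) {tol : ℝ} (htol : 0 ≤ tol)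
    {ε : ℝ} {U M V : Matrix (Fin n) (Fin n) ℂ} (hU : IsUni U) (hM : IsUni M) (hV : IsUni V)
    {s₀ s : HessTri} (hgood : GoodHess u s) (hR : s₀.R ≠ []) (hT : s₀.T ≠ [])
    (hsmall : ‖s.Q i 1 0‖ ≤ tol * u) (h : HSim n ε U U M M V s₀ s) :
    GoodHess u (deflate fp i s) ∧ ∃ U₁ M₁ V₁ : Matrix (Fin n) (Fin n) ℂ,
      IsUni U₁ ∧ IsUni M₁ ∧ IsUni V₁ ∧
      HSim n (ε + (10 ^ 9 + 16 * tol) * u) U₁ U₁ M₁ M₁ V₁ s₀ (deflate fp i s) := by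
  have hu := hs.nonneg
  have hu1 : u ≤ 1 / 100 := by linarith [hs.le]
  have hne : ∀ {ts ts' : List Tri} {L V : Matrix (Fin n) (Fin n) ℂ}, ListSim n ε L V ts ts' →
      ts ≠ [] → ts' ≠ [] := fun h h' h'' => by
    have := h.length_eq
    rw [h''] at this
    exact h' (List.length_eq_zero_iff.1 this)
  obtain ⟨φ, hφ, hφe, hφ0⟩ := fp.exists_phase hu hu1 (star (s.Q i 0 0))
  obtain ⟨β, hβ, hβe, hβ0⟩ := fp.exists_phase hu hu1 (s.Q i 1 1)
  have hα0 : s.Q i 0 0 = star φ * (‖s.Q i 0 0‖ : ℝ) := by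
    have := congrArg star hφ0
    rw [star_star, star_mul', norm_star] at this
    refine this.trans ?_
    simp
  obtain ⟨g1, h1⟩ := scaleRow_sim fp hs (by omega : i + 1 ≤ n) hφ hφe (hne h.R hR) hgood.R
  obtain ⟨g2, h2⟩ := scaleRow_sim fp hs (by omega : i + 1 + 1 ≤ n) hβ hβe (hne h.T hT) hgood.T
  have uφ := diagAt_isUni (m := n) (i := i) (by omega) hφ
  have uβ := diagAt_isUni (m := n) (i := i + 1) (by omega) hβ
  have h3 := h.R.trans h1 uφ
  have h4 := h.T.trans h2 uβ
  rw [Matrix.mul_one] at h3 h4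
  refine ⟨⟨hgood.Q.update (nearU_of_isUni (by positivity) isUni_one), g1, g2⟩,
    U * diagAt n (i + 1) β, M * diagAt n i φ, V, hU.mul uβ, hM.mul uφ, hV, ?_,
    h3.mono (by nlinarith), h4.mono (by nlinarith)⟩
  refine (norm_conj_trans uβ uφ h.Q (A'' := seqMatrix n (deflate fp i s).Q)
    (ε' := (16 * tol + 2880) * u) ?_).trans (by nlinarith)
  have hi' : i + 2 ≤ n := by omega
  have hd := near_diag (hgood.Q i) hsmall (α := star φ) (by rwa [norm_star]) hβ hα0 hβ0
  have c1 : Commute (diagAt n i φ) (seg n s.Q (i + 1) (n - 2 - i)) :=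
    seg_commute fun j hj _ => diagAt_commute (by omega) _ _
  have c2 : Commute (diagAt n (i + 1) β)ᴴ (seg n s.Q 0 i) := by
    rw [diagAt_conj]
    exact seg_commute fun j _ hj => diagAt_commute (by omega) _ _
  -- the two phases commute with the remaining parts of `Q`, so that the error is local: it is the
  -- distance of the core from the diagonal matrix of its phases
  have e : seqMatrix n (deflate fp i s).Q
      - (diagAt n (i + 1) β)ᴴ * seqMatrix n s.Q * diagAt n i φ
      = seg n s.Q 0 i * ((diagAt n (i + 1) β)ᴴ *
        (embed n i (!![1, 0; 0, β] * !![star φ, 0; 0, 1]) - embed n i (s.Q i)) * diagAt n i φ)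
        * seg n s.Q (i + 1) (n - 2 - i) := by
    have e1 : (diagAt n (i + 1) β)ᴴ * embed n i (!![1, 0; 0, β] * !![star φ, 0; 0, 1])
        * diagAt n i φ = 1 := by
      rw [embed_mul hi', embed_diag_right, embed_diag_left, uβ.cancel, ← diagAt_conj, uφ.left]
    have e2 : (diagAt n (i + 1) β)ᴴ * seqMatrix n s.Q * diagAt n i φ
        = seg n s.Q 0 i * ((diagAt n (i + 1) β)ᴴ * embed n i (s.Q i) * diagAt n i φ)
          * seg n s.Q (i + 1) (n - 2 - i) := by
      rw [seqMatrix_split hi', ← Matrix.mul_assoc (diagAt n (i + 1) β)ᴴ,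
        ← Matrix.mul_assoc (diagAt n (i + 1) β)ᴴ, c2.eq,
        Matrix.mul_assoc _ (seg n s.Q (i + 1) _), ← c1.eq]
      simp only [Matrix.mul_assoc]
    rw [e2, Matrix.mul_sub, Matrix.sub_mul, e1, deflate]
    dsimp only
    rw [seqMatrix_update hi', embed_one]
    simp only [Matrix.mul_sub, Matrix.sub_mul]
  rw [e]
  refine (norm_seg_mul_mul_seg_le hs.pred hgood.Q (by omega) (by omega) _).trans ?_
  rw [uφ.norm_mul', uβ.conj.norm_mul, norm_embed_sub hi', norm_sub_rev]
  linarith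

/-- The cores `i, …, i + m - 1` of a sequence pass through the factors and come back: up to
rounding errors, `Q` is multiplied by a unitary matrix `Y` from the right, and the product of the
factors by `Yᴴ` from the left. -/
theorem roundTrip_sim (hs : SmallFor u (n + 1)) {i m : ℕ} (hi : i + m + 1 ≤ n) {q : ℕ → Core}
    {ts : List Tri} (hq : GoodSeq u q) (hts : ∀ t ∈ ts, GoodTri u t) :
    GoodSeq u (roundTrip fp i m (q, ts)).1 ∧ (∀ t ∈ (roundTrip fp i m (q, ts)).2, GoodTri u t) ∧
      (∀ j, j < i ∨ i + m ≤ j → (roundTrip fp i m (q, ts)).1 j = q j) ∧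
      ∃ Y : Matrix (Fin n) (Fin n) ℂ, IsUni Y ∧
        (∀ j, i + m + 1 ≤ j → ∀ W, Commute Y (embed n j W)) ∧
        ListSim n (m * (2 * 10 ^ 8 * u)) Y 1 ts (roundTrip fp i m (q, ts)).2 ∧
        ‖seg n (roundTrip fp i m (q, ts)).1 i m - seg n q i m * Y‖ ≤ m * (500 * u) := by
  have hu := hs.nonneg
  induction m generalizing ts with
  | zero =>
    simp only [roundTrip]
    refine ⟨hq, hts, fun _ _ => trivial, 1, isUni_one, fun _ _ _ => Commute.one_left _, ?_, by simp⟩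
    simpa using ListSim.refl ts
  | succ m ih =>
    have him : i + m + 2 ≤ n := by omega
    obtain ⟨G, hG, hG'⟩ := hq (i + m)
    obtain ⟨g1, K, hK, hK', h1⟩ := passLRs_sim fp hs him hts hG hG'
    rw [roundTrip]
    dsimp only
    generalize passLRs fp (i + m) (q (i + m)) ts = p at *
    obtain ⟨f1, f2, f3, Y, hY, f4, f5, f6⟩ := ih (by omega) g1
    generalize roundTrip fp i m (q, p.2) = s' at *
    obtain ⟨g2, Z, hZ, hZ', h2⟩ := passRLs_sim fp hs him f2 hK hK'
    generalize passRLs fp (i + m) p.1 s'.2 = r at *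
    have uG := embed_isUni him hG
    have uZ := embed_isUni him hZ
    have uK := embed_isUni him hK
    -- the lowest core leaves first, as `G`, and comes back last, as `Z`; in between the others
    -- contribute their own matrix `Y`
    refine ⟨f1.update ⟨Z, hZ, hZ'⟩, g2, ?_, (embed n (i + m) G)ᴴ * Y * embed n (i + m) Z,
      (uG.conj.mul hY).mul uZ, ?_, ?_, ?_⟩
    · intro j hj
      rw [Function.update_of_ne (by omega)]
      exact f3 j (by omega)
    · intro j hj W
      refine ((Commute.mul_left ?_ (f4 j (by omega) W)).mul_left (embed_commute (by omega) _ _))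
      rw [embed_conj]
      exact embed_commute (by omega) _ _
    · have h3 := (h1.trans f5 hY).trans h2 uZ
      rw [Matrix.mul_one, uK.left] at h3
      refine h3.mono (le_of_eq ?_)
      push_cast
      ring
    · have hq1 : seg n (Function.update s'.1 (i + m) r.1) i m = seg n s'.1 i m :=
        seg_congr fun j _ hj => Function.update_of_ne (by omega) _ _
      have hs1 : ∀ q' : ℕ → Core, seg n q' i (m + 1) = seg n q' i m * embed n (i + m) (q' (i + m)) :=
        fun q' => by rw [seg_add, seg_succ, seg_zero, Matrix.mul_one]
      rw [hs1, hs1, hq1, Function.update_self]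
      have e : seg n s'.1 i m * embed n (i + m) r.1
            - seg n q i m * embed n (i + m) (q (i + m)) *
              ((embed n (i + m) G)ᴴ * Y * embed n (i + m) Z)
          = seg n s'.1 i m * (embed n (i + m) r.1 - embed n (i + m) Z)
            + (seg n s'.1 i m - seg n q i m * Y) * embed n (i + m) Z
            - seg n q i m * ((embed n (i + m) (q (i + m)) - embed n (i + m) G)
              * ((embed n (i + m) G)ᴴ * Y * embed n (i + m) Z)) := by
        simp only [Matrix.mul_sub, Matrix.sub_mul, Matrix.mul_assoc, uG.cancel']
        abel
      rw [e]
      refine (norm_sub_le _ _).trans ?_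
      refine (add_le_add_left (norm_add_le _ _) _).trans ?_
      have b1 := norm_seg_mul_le hs.pred f1 (a := i) (l := m) (by omega)
        (embed n (i + m) r.1 - embed n (i + m) Z)
      have b2 := norm_seg_mul_le hs.pred hq (a := i) (l := m) (by omega)
        ((embed n (i + m) (q (i + m)) - embed n (i + m) G)
              * ((embed n (i + m) G)ᴴ * Y * embed n (i + m) Z))
      rw [((uG.conj.mul hY).mul uZ).norm_mul', norm_embed_sub him] at b2
      rw [norm_embed_sub him] at b1
      rw [uZ.norm_mul']
      push_cast
      linarith

/-- The round trip that splits off a zero eigenvalue inserts `Y Yᴴ` between `Q` and `R`. -/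
theorem zero_sim (hs : SmallFor u (n + 1)) {i hi : ℕ} (hih : i ≤ hi) (hhi : hi + 1 < n)
    {ε : ℝ} {U M V : Matrix (Fin n) (Fin n) ℂ} (hU : IsUni U) (hM : IsUni M) (hV : IsUni V)
    {s₀ s : HessTri} (hgood : GoodHess u s) (hafter : s.Q (hi + 1) = 1)
    (h : HSim n ε U U M M V s₀ s) :
    GoodHess u { Q := (roundTrip fp i (hi + 1 - i) (s.Q, s.R)).1
                 R := (roundTrip fp i (hi + 1 - i) (s.Q, s.R)).2
                 T := s.T } ∧ ∃ U₁ M₁ V₁ : Matrix (Fin n) (Fin n) ℂ,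
      IsUni U₁ ∧ IsUni M₁ ∧ IsUni V₁ ∧
      HSim n (ε + n * (10 ^ 9 * u)) U₁ U₁ M₁ M₁ V₁ s₀
        { Q := (roundTrip fp i (hi + 1 - i) (s.Q, s.R)).1
          R := (roundTrip fp i (hi + 1 - i) (s.Q, s.R)).2
          T := s.T } := by
  have hu := hs.nonneg
  obtain ⟨m, rfl⟩ : ∃ m, hi = i + m := ⟨hi - i, by omega⟩
  have hm : i + m + 1 - i = m + 1 := by omega
  rw [hm]
  obtain ⟨f1, f2, f3, Y, hY, f4, f5, f6⟩ := roundTrip_sim fp hs (i := i) (m := m + 1) (by omega)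
    hgood.Q hgood.R
  generalize roundTrip fp i (m + 1) (s.Q, s.R) = r at *
  have hmn : ((m + 1 : ℕ) : ℝ) ≤ n := by exact_mod_cast (by omega : m + 1 ≤ n)
  have hmu := mul_le_mul_of_nonneg_right hmn hu
  have h3 := h.R.trans f5 hY
  rw [Matrix.mul_one] at h3
  have hnu : 0 ≤ (n : ℝ) * u := by positivity
  refine ⟨⟨f1, f2, hgood.T⟩, U, M * Y, V, hU, hM.mul hY, hV, ?_, h3.mono ?_, h.T.mono ?_⟩
  · refine (norm_trans_right (ε' := n * (10 ^ 9 * u)) hY h.Q ?_)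
    have split : ∀ q : ℕ → Core, seqMatrix n q = seg n q 0 i * seg n q i (m + 1)
        * seg n q (i + m + 1) (n - 1 - (i + m + 1)) := fun q => by
      rw [seqMatrix_eq_seg]
      conv_lhs => rw [show n - 1 = i + ((m + 1) + (n - 1 - (i + m + 1))) by omega]
      rw [seg_add, seg_add, Matrix.mul_assoc]
      simp only [zero_add, add_assoc]
    -- the core below the moved part is deflated, so the cores further below commute with `Y`
    have c : Commute Y (seg n s.Q (i + m + 1) (n - 1 - (i + m + 1))) :=
      seg_commute_of_one hafter fun j hj => f4 j (by omega) _
    have e : seqMatrix n r.1 - seqMatrix n s.Q * Y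
        = seg n s.Q 0 i * (seg n r.1 i (m + 1) - seg n s.Q i (m + 1) * Y)
          * seg n s.Q (i + m + 1) (n - 1 - (i + m + 1)) := by
      rw [split, split s.Q, seg_congr (q := r.1) (q' := s.Q) (a := 0) fun j _ hj => f3 j (by omega),
        seg_congr (q := r.1) (q' := s.Q) (a := i + m + 1) fun j hj _ => f3 j (by omega),
        Matrix.mul_assoc _ _ Y, ← c.eq]
      simp only [Matrix.mul_sub, Matrix.sub_mul, Matrix.mul_assoc]
    rw [e]
    refine (norm_seg_mul_mul_seg_le hs.pred hgood.Q (by omega) (by omega) _).trans ?_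
    linarith
  · linarith
  · linarith

/-- Every step of the iterative phase is a unitary equivalence, up to errors of size `n u`. -/
theorem QRStep.sim (hs : SmallFor u (n + 1)) {tol : ℕ} {ε : ℝ} {U M V : Matrix (Fin n) (Fin n) ℂ}
    (hU : IsUni U) (hM : IsUni M) (hV : IsUni V) {s₀ s s' : HessTri} (hgood : GoodHess u s)
    (hR : s₀.R ≠ []) (hT : s₀.T ≠ []) (h : HSim n ε U U M M V s₀ s)
    (hstep : QRStep fp tol n s s') :
    GoodHess u s' ∧ ∃ U₁ M₁ V₁ : Matrix (Fin n) (Fin n) ℂ,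
      IsUni U₁ ∧ IsUni M₁ ∧ IsUni V₁ ∧
      HSim n (ε + n * ((10 ^ 9 + 16 * tol) * u)) U₁ U₁ M₁ M₁ V₁ s₀ s' := by
  have hu := hs.nonneg
  have h1 : (n : ℝ) * (10 ^ 9 * u) ≤ n * ((10 ^ 9 + 16 * tol) * u) := by gcongr; simp
  cases hstep with
  | deflation i hi hsmall =>
    obtain ⟨g, U₁, M₁, V₁, a, b, c, d⟩ := deflate_sim fp hs hi (Nat.cast_nonneg tol) hU hM hV hgood
      hR hT hsmall h
    refine ⟨g, U₁, M₁, V₁, a, b, c, d.mono ?_⟩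
    have hn : (1 : ℝ) ≤ n := by exact_mod_cast (by omega : 1 ≤ n)
    have : 0 ≤ (10 ^ 9 + 16 * (tol : ℝ)) * u := by positivity
    nlinarith
  | sweep lo hi a b hlh hhi hbefore hafter =>
    obtain ⟨g, U₁, M₁, V₁, a, b, c, d⟩ := francis_sim fp hs hlh hhi hU hM hV a b hgood hbefore
      hafter h
    exact ⟨g, U₁, M₁, V₁, a, b, c, d.mono (by linarith)⟩
  | zero i hi hih hhi hafter _ =>
    obtain ⟨g, U₁, M₁, V₁, a, b, c, d⟩ := zero_sim fp hs hih hhi hU hM hV hgood hafter h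
    exact ⟨g, U₁, M₁, V₁, a, b, c, d.mono (by linarith)⟩

/-- The errors of the steps of the iterative phase add up. -/
theorem QRSteps.sim (hs : SmallFor u (n + 1)) {tol m : ℕ} {s₀ s : HessTri} (hgood : GoodHess u s₀)
    (hR : s₀.R ≠ []) (hT : s₀.T ≠ []) (hsteps : Steps (QRStep fp tol n) m s₀ s) :
    GoodHess u s ∧ ∃ U M V : Matrix (Fin n) (Fin n) ℂ, IsUni U ∧ IsUni M ∧ IsUni V ∧
      HSim n (m * (n * ((10 ^ 9 + 16 * tol) * u))) U U M M V s₀ s := by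
  induction hsteps with
  | refl a =>
    refine ⟨hgood, 1, 1, 1, isUni_one, isUni_one, isUni_one, by simp, ?_, ?_⟩
    · simpa using ListSim.refl a.R
    · simpa using ListSim.refl a.T
  | tail _ hstep ih =>
    obtain ⟨g, U, M, V, hU, hM, hV, h⟩ := ih hgood hR hT
    obtain ⟨g, U₁, M₁, V₁, a, b, c, d⟩ := hstep.sim fp hs hU hM hV g hR hT h
    refine ⟨g, U₁, M₁, V₁, a, b, c, d.mono (le_of_eq ?_)⟩
    push_cast
    ring

end

/-! ### The matrix represented by a stored triangular factor -/

/-- The scalar `ρ = e_{n+1}ᵀ Cᴴ e₁`. -/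
def rho (n : ℕ) (C : Matrix (Fin (n + 1)) (Fin (n + 1)) ℂ) : ℂ :=
  ((incl (n + 1) 1 n)ᴴ * Cᴴ * incl (n + 1) 1 0) 0 0

/-- The column `Pᵀ Cᴴ e₁`. -/
def spikeCol (n : ℕ) (C : Matrix (Fin (n + 1)) (Fin (n + 1)) ℂ) : Matrix (Fin n) (Fin 1) ℂ :=
  (incl (n + 1) n 0)ᴴ * Cᴴ * incl (n + 1) 1 0

/-- The row `e_{n+1}ᵀ Cᴴ B P`. -/
def spikeRow (n : ℕ) (C B : Matrix (Fin (n + 1)) (Fin (n + 1)) ℂ) : Matrix (Fin 1) (Fin n) ℂ :=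
  (incl (n + 1) 1 n)ᴴ * (Cᴴ * B) * incl (n + 1) n 0

/-- The matrix `Pᵀ Cᴴ (B + e₁ yᵀ) P` with `yᵀ = - ρ⁻¹ e_{n+1}ᵀ Cᴴ B`, for any `C` and `B`. -/
def rep (n : ℕ) (C B : Matrix (Fin (n + 1)) (Fin (n + 1)) ℂ) : Matrix (Fin n) (Fin n) ℂ :=
  (incl (n + 1) n 0)ᴴ * (Cᴴ * B) * incl (n + 1) n 0 - (rho n C)⁻¹ • (spikeCol n C * spikeRow n C B)

theorem mul_incl_apply {m r i : ℕ} {ι : Type*} (A : Matrix ι (Fin m) ℂ) (a : ι) (b : Fin r)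
    {c : Fin m} (h : c.val = i + b.val) : (A * incl m r i) a b = A a c := by
  rw [Matrix.mul_apply, Finset.sum_eq_single c]
  · simp [incl, h]
  · intro c' _ hc
    rw [incl, if_neg (fun h' => hc (Fin.ext (h'.trans h.symm))), mul_zero]
  · simp

theorem incl_conj_mul_apply {m r i : ℕ} {ι : Type*} (A : Matrix (Fin m) ι ℂ) (a : ι) (b : Fin r)
    {c : Fin m} (h : c.val = i + b.val) : ((incl m r i)ᴴ * A) b a = A c a := by
  rw [Matrix.mul_apply, Finset.sum_eq_single c]
  · simp [incl, h]
  · intro c' _ hc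
    rw [Matrix.conjTranspose_apply, incl, if_neg (fun h' => hc (Fin.ext (h'.trans h.symm))),
      star_zero, zero_mul]
  · simp

theorem rho_eq (n : ℕ) (C : Matrix (Fin (n + 1)) (Fin (n + 1)) ℂ) :
    rho n C = Cᴴ (Fin.last n) 0 := by
  rw [rho, mul_incl_apply _ _ _ (c := 0) (by simp),
    incl_conj_mul_apply _ _ _ (c := Fin.last n) (by simp)]

theorem spikeCol_apply (n : ℕ) (C : Matrix (Fin (n + 1)) (Fin (n + 1)) ℂ) (i : Fin n) (j : Fin 1) :
    spikeCol n C i j = Cᴴ i.castSucc 0 := by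
  rw [spikeCol, mul_incl_apply _ _ _ (c := 0) (by simp),
    incl_conj_mul_apply _ _ _ (c := i.castSucc) (by simp)]

theorem spikeRow_apply (n : ℕ) (C B : Matrix (Fin (n + 1)) (Fin (n + 1)) ℂ) (i : Fin 1)
    (j : Fin n) : spikeRow n C B i j = (Cᴴ * B) (Fin.last n) j.castSucc := by
  rw [spikeRow, mul_incl_apply _ _ _ (c := j.castSucc) (by simp),
    incl_conj_mul_apply _ _ _ (c := Fin.last n) (by simp)]

theorem rep_apply (n : ℕ) (C B : Matrix (Fin (n + 1)) (Fin (n + 1)) ℂ) (i j : Fin n) :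
    rep n C B i j = (Cᴴ * B) i.castSucc j.castSucc
      - (Cᴴ (Fin.last n) 0)⁻¹ * (Cᴴ i.castSucc 0 * (Cᴴ * B) (Fin.last n) j.castSucc) := by
  have h : ((incl (n + 1) n 0)ᴴ * (Cᴴ * B) * incl (n + 1) n 0) i j
      = (Cᴴ * B) i.castSucc j.castSucc := by
    rw [mul_incl_apply _ _ _ (c := j.castSucc) (by simp),
      incl_conj_mul_apply _ _ _ (c := i.castSucc) (by simp)]
  have h2 : (spikeCol n C * spikeRow n C B) i j
      = Cᴴ i.castSucc 0 * (Cᴴ * B) (Fin.last n) j.castSucc := by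
    rw [Matrix.mul_apply, Fin.sum_univ_one, spikeCol_apply, spikeRow_apply]
  rw [rep, Matrix.sub_apply, h, Matrix.smul_apply, h2, rho_eq, smul_eq_mul]

theorem toMatrix_eq_rep (n : ℕ) (t : Tri) :
    t.toMatrix n = rep n (seqMatrix (n + 1) t.C) (seqMatrix (n + 1) t.B) := by
  ext i j
  rw [rep_apply]
  simp only [Tri.toMatrix, Matrix.submatrix_apply, Matrix.mul_add, Matrix.add_apply]
  rw [sub_eq_add_neg]
  congr 1
  rw [Matrix.mul_apply, Finset.sum_eq_single 0]
  · simp [Matrix.vecMulVec_apply]; ring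
  · intro b _ hb
    simp [Matrix.vecMulVec_apply, hb]
  · simp

theorem incl_last_hat (n : ℕ) (L : Matrix (Fin n) (Fin n) ℂ) :
    hat n L * incl (n + 1) 1 n = incl (n + 1) 1 n :=
  plug_mul_of_orth (incl_orth (by omega)) L

theorem hat_mul_incl (n : ℕ) (L : Matrix (Fin n) (Fin n) ℂ) :
    hat n L * incl (n + 1) n 0 = incl (n + 1) n 0 * L :=
  plug_mul_self (incl_isometry (by omega)) L

section Covariance

variable {n : ℕ} {X C B : Matrix (Fin (n + 1)) (Fin (n + 1)) ℂ} {L V : Matrix (Fin n) (Fin n) ℂ}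

theorem rho_cov (hE : X * incl (n + 1) 1 0 = incl (n + 1) 1 0) :
    rho n (Xᴴ * C * hat n L) = rho n C := by
  have h2 : (incl (n + 1) 1 n)ᴴ * (hat n L)ᴴ = (incl (n + 1) 1 n)ᴴ := by
    rw [← Matrix.conjTranspose_mul, incl_last_hat]
  rw [rho, rho]
  rw [Matrix.conjTranspose_mul, ← Matrix.mul_assoc, h2, Matrix.conjTranspose_mul,
    Matrix.conjTranspose_conjTranspose, Matrix.mul_assoc, Matrix.mul_assoc, hE, Matrix.mul_assoc]

theorem spikeCol_cov (hE : X * incl (n + 1) 1 0 = incl (n + 1) 1 0) :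
    spikeCol n (Xᴴ * C * hat n L) = Lᴴ * spikeCol n C := by
  have h2 : (incl (n + 1) n 0)ᴴ * (hat n L)ᴴ = Lᴴ * (incl (n + 1) n 0)ᴴ := by
    rw [← Matrix.conjTranspose_mul, hat_mul_incl, Matrix.conjTranspose_mul]
  rw [spikeCol, spikeCol, Matrix.conjTranspose_mul, ← Matrix.mul_assoc, h2,
    Matrix.conjTranspose_mul, Matrix.conjTranspose_conjTranspose]
  simp only [Matrix.mul_assoc, hE]

theorem cov_mid (hX : IsUni X) : (Xᴴ * C * hat n L)ᴴ * (Xᴴ * B * hat n V)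
    = (hat n L)ᴴ * (Cᴴ * B) * hat n V := by
  simp only [Matrix.conjTranspose_mul, Matrix.conjTranspose_conjTranspose, Matrix.mul_assoc]
  rw [hX.cancel']

theorem spikeRow_cov (hX : IsUni X) :
    spikeRow n (Xᴴ * C * hat n L) (Xᴴ * B * hat n V) = spikeRow n C B * V := by
  have h2 : (incl (n + 1) 1 n)ᴴ * (hat n L)ᴴ = (incl (n + 1) 1 n)ᴴ := by
    rw [← Matrix.conjTranspose_mul, incl_last_hat]
  rw [spikeRow, spikeRow, cov_mid hX, Matrix.mul_assoc, Matrix.mul_assoc, hat_mul_incl,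
    Matrix.mul_assoc (hat n L)ᴴ, ← Matrix.mul_assoc _ (hat n L)ᴴ, h2]
  simp only [Matrix.mul_assoc]

/-- Covariance of the represented matrix: multiplying `C` and `B` by `hat L` and `hat V` from the
right multiplies it by `Lᴴ` and `V`, and a common left factor `Xᴴ` that fixes `e₁` has no
effect. -/
theorem rep_cov (hX : IsUni X) (hE : X * incl (n + 1) 1 0 = incl (n + 1) 1 0) :
    rep n (Xᴴ * C * hat n L) (Xᴴ * B * hat n V) = Lᴴ * rep n C B * V := by
  have h2 : (incl (n + 1) n 0)ᴴ * (hat n L)ᴴ = Lᴴ * (incl (n + 1) n 0)ᴴ := by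
    rw [← Matrix.conjTranspose_mul, hat_mul_incl, Matrix.conjTranspose_mul]
  rw [rep, rep, rho_cov hE, spikeCol_cov hE, spikeRow_cov hX, cov_mid hX]
  rw [Matrix.mul_sub, Matrix.sub_mul, Matrix.mul_smul, Matrix.smul_mul]
  congr 1
  · rw [← Matrix.mul_assoc, ← Matrix.mul_assoc, h2]
    simp only [Matrix.mul_assoc]
    rw [hat_mul_incl]
  · simp only [Matrix.mul_assoc]

end Covariance

/-! ### Represented matrices are upper triangular -/

/-- A segment of a sequence acts only on the rows and columns that its cores touch. -/
theorem seg_eq_plug {m : ℕ} (q : ℕ → Core) (a : ℕ) {l : ℕ} (h : a + (l + 1) ≤ m) :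
    ∃ A, seg m q a l = plug (incl m (l + 1) a) A := by
  have key : ∀ l' b, b + l' ≤ l → ∃ A, seg m q (a + b) l' = plug (incl m (l + 1) a) A := by
    intro l'
    induction l' with
    | zero => exact fun b _ => ⟨1, by rw [seg_zero, plug_one]⟩
    | succ l' ih =>
      intro b hb
      obtain ⟨A, hA⟩ := ih (b + 1) (by omega)
      refine ⟨plug (incl (l + 1) 2 b) (q (a + b)) * A, ?_⟩
      rw [seg_succ, show a + b + 1 = a + (b + 1) by omega, hA, embed_eq_plug,
        plug_mul (incl_isometry h), plug_plug, incl_mul_incl (by omega)]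
  simpa using key l 0 (by omega)

theorem seg_apply_of_row {m : ℕ} (q : ℕ → Core) {a l : ℕ} (h : a + (l + 1) ≤ m) {i : Fin m}
    (hi : i.val < a ∨ a + l < i.val) (j : Fin m) :
    seg m q a l i j = (1 : Matrix (Fin m) (Fin m) ℂ) i j := by
  obtain ⟨A, hA⟩ := seg_eq_plug q a h
  rw [hA, plug, Matrix.add_apply, Matrix.mul_assoc, Matrix.mul_apply, add_eq_left]
  refine Finset.sum_eq_zero fun c _ => ?_
  rw [incl, if_neg (by omega), zero_mul]

theorem seg_apply_of_col {m : ℕ} (q : ℕ → Core) {a l : ℕ} (h : a + (l + 1) ≤ m) {j : Fin m}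
    (hj : j.val < a ∨ a + l < j.val) (i : Fin m) :
    seg m q a l i j = (1 : Matrix (Fin m) (Fin m) ℂ) i j := by
  obtain ⟨A, hA⟩ := seg_eq_plug q a h
  rw [hA, plug, Matrix.add_apply, Matrix.mul_apply, add_eq_left]
  refine Finset.sum_eq_zero fun c _ => ?_
  rw [Matrix.conjTranspose_apply, incl, if_neg (by omega), star_zero, mul_zero]

/-- Across the diagonal, a descending sequence has the entries of a matrix of rank one. -/
theorem seqMatrix_apply_of_le (n : ℕ) (q : ℕ → Core) {a m r : Fin (n + 1)} (ham : a ≤ m)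
    (hmr : m ≤ r) : seqMatrix (n + 1) q a r
      = seg (n + 1) q 0 m a m * seg (n + 1) q m (n - m) m r := by
  have ha : a.val ≤ m.val := ham
  have hr : m.val ≤ r.val := hmr
  rw [seqMatrix_eq_seg, show n + 1 - 1 = m.val + (n - m.val) by omega, seg_add, Matrix.mul_apply,
    Finset.sum_eq_single m]
  · simp
  · intro c _ hc
    rcases lt_or_gt_of_ne hc with h | h
    · have h' : c.val < m.val := h
      rw [zero_add, seg_apply_of_row (i := c) q (by omega) (Or.inl h'),
        Matrix.one_apply_ne (by rintro rfl; omega), mul_zero]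
    · have h' : m.val < c.val := h
      rw [seg_apply_of_col (j := c) q (by omega) (Or.inr (by omega)),
        Matrix.one_apply_ne (by rintro rfl; omega), zero_mul]
  · simp

/-- A descending sequence is upper Hessenberg. -/
theorem seqMatrix_upper_hessenberg (n : ℕ) (q : ℕ → Core) {m j : Fin (n + 1)}
    (h : j.val + 1 < m.val) : seqMatrix (n + 1) q m j = 0 := by
  rw [seqMatrix_eq_seg, show n + 1 - 1 = (m.val - 1) + (n - (m.val - 1)) by omega, seg_add,
    Matrix.mul_apply]
  refine Finset.sum_eq_zero fun c _ => ?_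
  by_cases hc : c = m
  · subst hc
    rw [seg_apply_of_col (j := j) q (by omega) (Or.inl (by omega)),
      Matrix.one_apply_ne (by rintro rfl; omega), mul_zero]
  · rw [seg_apply_of_row (i := m) q (by omega) (Or.inr (by omega)),
      Matrix.one_apply_ne (fun h => hc h.symm), zero_mul]

/-- The represented matrix is exactly upper triangular, for any stored cores with `ρ ≠ 0`: below the
diagonal, the rank one part cancels the unitary part. -/
theorem Tri.blockTriangular_toMatrix (n : ℕ) (t : Tri) (h : rho n (seqMatrix (n + 1) t.C) ≠ 0) :
    (t.toMatrix n).BlockTriangular id := by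
  intro i j hij
  have hij' : j.val < i.val := hij
  rw [rho_eq] at h
  -- for the sum over `m` in both entries of `Cᴴ B`: the terms with `m > j + 1` vanish as `B` is
  -- upper Hessenberg; for `m ≤ j + 1 ≤ i` the rank one structure of `C` makes corresponding
  -- products of entries of `C` equal
  have key : (seqMatrix (n + 1) t.C)ᴴ (Fin.last n) 0
        * ((seqMatrix (n + 1) t.C)ᴴ * seqMatrix (n + 1) t.B) i.castSucc j.castSucc
      = (seqMatrix (n + 1) t.C)ᴴ i.castSucc 0
        * ((seqMatrix (n + 1) t.C)ᴴ * seqMatrix (n + 1) t.B) (Fin.last n) j.castSucc := by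
    rw [Matrix.mul_apply, Matrix.mul_apply, Finset.mul_sum, Finset.mul_sum]
    refine Finset.sum_congr rfl fun m _ => ?_
    rcases Nat.lt_or_ge (j.val + 1) m.val with hm | hm
    · rw [seqMatrix_upper_hessenberg n t.B (m := m) (j := j.castSucc) (by simpa using hm)]
      simp
    · rw [← mul_assoc, ← mul_assoc]
      congr 1
      simp only [Matrix.conjTranspose_apply, ← star_mul']
      congr 1
      have hmi : m ≤ i.castSucc := by rw [Fin.le_def, Fin.val_castSucc]; omega
      rw [seqMatrix_apply_of_le n t.C (Fin.zero_le m) (Fin.le_last m),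
        seqMatrix_apply_of_le n t.C (le_refl m) (Fin.le_last m),
        seqMatrix_apply_of_le n t.C (Fin.zero_le m) hmi,
        seqMatrix_apply_of_le n t.C (le_refl m) hmi]
      ring
  rw [toMatrix_eq_rep, rep_apply, ← key, inv_mul_cancel_left₀ h, sub_self]

/-! ### Sensitivity of the represented matrix -/

theorem norm_incl_mul_le {m r i : ℕ} {ι : Type*} [Fintype ι] (h : i + r ≤ m)
    (A : Matrix (Fin m) ι ℂ) : ‖(incl m r i)ᴴ * A‖ ≤ ‖A‖ := by
  classical exact norm_coisometry_mul_le (incl_isometry h) A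

theorem norm_mul_incl_le {m r i : ℕ} {ι : Type*} [Fintype ι] (h : i + r ≤ m)
    (A : Matrix ι (Fin m) ℂ) : ‖A * incl m r i‖ ≤ ‖A‖ := by
  classical exact norm_mul_coisometry_le (incl_isometry h) A

theorem norm_rho_sub_le (n : ℕ) (C C' : Matrix (Fin (n + 1)) (Fin (n + 1)) ℂ) :
    ‖rho n C' - rho n C‖ ≤ ‖C' - C‖ := by
  rw [rho_eq, rho_eq, ← Matrix.sub_apply, ← Matrix.conjTranspose_sub]
  exact (norm_entry_le _ _ _).trans_eq (Matrix.frobenius_norm_conjTranspose _)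

theorem norm_conj_mul_sub_le {m : ℕ} {C B C' B' : Matrix (Fin m) (Fin m) ℂ} {ε : ℝ}
    (hC : IsUni C) (hB : IsUni B) (hε : 0 ≤ ε) (hε1 : ε ≤ 1) (h : ‖C' - C‖ ≤ ε)
    (h' : ‖B' - B‖ ≤ ε) : ‖C'ᴴ * B' - Cᴴ * B‖ ≤ 3 * ε := by
  have e : C'ᴴ * B' - Cᴴ * B
      = (C' - C)ᴴ * (B' - B) + (C' - C)ᴴ * B + Cᴴ * (B' - B) := by
    rw [Matrix.conjTranspose_sub]
    noncomm_ring
  have h1 : ‖(C' - C)ᴴ‖ ≤ ε := by rwa [Matrix.frobenius_norm_conjTranspose]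
  have h2 : ‖(C' - C)ᴴ * (B' - B)‖ ≤ ε * ε :=
    (Matrix.frobenius_norm_mul _ _).trans (mul_le_mul h1 h' (norm_nonneg _) hε)
  rw [e]
  refine (norm_add₃_le).trans ?_
  rw [hB.norm_mul', hC.conj.norm_mul]
  nlinarith

/-- First-order sensitivity of the represented matrix, multiplied by `A` and `Z`, to perturbations
of size `ε` in the two stored unitary matrices.  The factor `ρ⁻¹`, which is as large as the norm of
the spike, enters only with the power that `A`, `Z` leave to it. -/
theorem norm_rep_sub_le {n : ℕ} {ι κ : Type*} [Fintype ι] [Fintype κ]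
    {C B C' B' : Matrix (Fin (n + 1)) (Fin (n + 1)) ℂ} {A : Matrix ι (Fin n) ℂ}
    {Z : Matrix (Fin n) κ ℂ} {ε σ β : ℝ} (hC : IsUni C) (hB : IsUni B) (hε : 0 ≤ ε)
    (h : ‖C' - C‖ ≤ ε) (h' : ‖B' - B‖ ≤ ε) (hσ : 1 ≤ σ) (hβ : 1 ≤ β) (hεσ : 3 * (σ * ε) ≤ 1)
    (hA : ‖A‖ ≤ σ) (hZ : ‖Z‖ ≤ σ) (hρ0 : rho n C ≠ 0) (hρ : ‖rho n C‖⁻¹ ≤ σ)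
    (ha : ‖A * spikeCol n C‖ ≤ β) (he : ‖spikeRow n C B * Z‖ ≤ β) :
    rho n C' ≠ 0 ∧ ‖A * (rep n C' B' - rep n C B) * Z‖ ≤ 21 * (β ^ 2 * (σ ^ 2 * ε)) := by
  have hσε : ε ≤ σ * ε := by nlinarith
  have hε1 : ε ≤ 1 := by linarith
  have hW := norm_conj_mul_sub_le hC hB hε hε1 h h'
  have hr := (norm_rho_sub_le n C C').trans h
  have hρpos : 0 < ‖rho n C‖ := norm_pos_iff.2 hρ0
  have h1 : 1 ≤ σ * ‖rho n C‖ := by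
    rw [inv_le_iff_one_le_mul₀ hρpos] at hρ; exact hρ
  -- `ρ` stays away from zero, and its inverse changes by `O(σ² ε)`
  have hρ' : 1 ≤ 2 * σ * ‖rho n C'‖ := by
    have : ‖rho n C‖ - ‖rho n C'‖ ≤ ε :=
      (norm_sub_norm_le _ _).trans (by rw [norm_sub_rev]; exact hr)
    nlinarith
  have hρ'pos : 0 < ‖rho n C'‖ := by
    by_contra hc
    nlinarith [norm_nonneg (rho n C')]
  have hρ'0 : rho n C' ≠ 0 := norm_pos_iff.1 hρ'pos
  have hinv : ‖(rho n C')⁻¹‖ ≤ 2 * σ := by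
    rw [norm_inv, inv_le_iff_one_le_mul₀ hρ'pos]; exact hρ'
  have hdinv : ‖(rho n C')⁻¹ - (rho n C)⁻¹‖ ≤ 2 * (σ ^ 2 * ε) := by
    rw [inv_sub_inv hρ'0 hρ0, norm_div, norm_mul, div_eq_mul_inv, mul_inv, norm_sub_rev,
      ← norm_inv]
    calc ‖rho n C' - rho n C‖ * (‖(rho n C')⁻¹‖ * ‖rho n C‖⁻¹)
        ≤ ε * ((2 * σ) * σ) := by gcongr
      _ = 2 * (σ ^ 2 * ε) := by ring
  have hcol : ‖spikeCol n C' - spikeCol n C‖ ≤ ε := by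
    have e : spikeCol n C' - spikeCol n C
        = (incl (n + 1) n 0)ᴴ * (C' - C)ᴴ * incl (n + 1) 1 0 := by
      rw [spikeCol, spikeCol, Matrix.conjTranspose_sub, Matrix.mul_sub, Matrix.sub_mul]
    rw [e]
    refine (norm_mul_incl_le (by omega) _).trans ((norm_incl_mul_le (by omega) _).trans ?_)
    rwa [Matrix.frobenius_norm_conjTranspose]
  have hrow : ‖spikeRow n C' B' - spikeRow n C B‖ ≤ 3 * ε := by
    have e : spikeRow n C' B' - spikeRow n C B
        = (incl (n + 1) 1 n)ᴴ * (C'ᴴ * B' - Cᴴ * B) * incl (n + 1) n 0 := by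
      rw [spikeRow, spikeRow, Matrix.mul_sub, Matrix.sub_mul]
    rw [e]
    exact (norm_mul_incl_le (by omega) _).trans ((norm_incl_mul_le (by omega) _).trans hW)
  have hmid : ‖A * ((incl (n + 1) n 0)ᴴ * (C'ᴴ * B' - Cᴴ * B) * incl (n + 1) n 0) * Z‖
      ≤ 3 * (σ ^ 2 * ε) := by
    refine (Matrix.frobenius_norm_mul _ _).trans ?_
    have := (Matrix.frobenius_norm_mul A _).trans (mul_le_mul hA
      ((norm_mul_incl_le (m := n + 1) (r := n) (i := 0) (by omega) _).trans
        ((norm_incl_mul_le (m := n + 1) (r := n) (i := 0) (by omega) _).trans hW))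
      (norm_nonneg _) (by linarith))
    calc _ ≤ (σ * (3 * ε)) * σ := mul_le_mul this hZ (norm_nonneg _) (by positivity)
      _ = 3 * (σ ^ 2 * ε) := by ring
  have hda : ‖A * (spikeCol n C' - spikeCol n C)‖ ≤ σ * ε :=
    (Matrix.frobenius_norm_mul _ _).trans (mul_le_mul hA hcol (norm_nonneg _) (by linarith))
  have hde : ‖(spikeRow n C' B' - spikeRow n C B) * Z‖ ≤ 3 * ε * σ :=
    (Matrix.frobenius_norm_mul _ _).trans (mul_le_mul hrow hZ (norm_nonneg _) (by linarith))
  have ha' : ‖A * spikeCol n C'‖ ≤ 2 * β := by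
    have : A * spikeCol n C' = A * spikeCol n C + A * (spikeCol n C' - spikeCol n C) := by
      rw [Matrix.mul_sub]; abel
    rw [this]
    exact (norm_add_le _ _).trans (by linarith)
  refine ⟨hρ'0, ?_⟩
  -- expansion such that the change of `ρ⁻¹`, of order `σ² ε`, meets only `A a` and `eᵀ Z`, which
  -- are bounded by `β`, while `ρ⁻¹` itself meets one further factor `σ` and one change of order
  -- `ε`
  have e : A * (rep n C' B' - rep n C B) * Z
      = A * ((incl (n + 1) n 0)ᴴ * (C'ᴴ * B' - Cᴴ * B) * incl (n + 1) n 0) * Z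
        - (((rho n C')⁻¹ - (rho n C)⁻¹) • ((A * spikeCol n C) * (spikeRow n C B * Z))
          + (rho n C')⁻¹ • ((A * (spikeCol n C' - spikeCol n C)) * (spikeRow n C B * Z)
            + (A * spikeCol n C') * ((spikeRow n C' B' - spikeRow n C B) * Z))) := by
    rw [rep, rep]
    simp only [Matrix.mul_sub, Matrix.sub_mul, sub_smul, smul_add, Matrix.mul_smul,
      Matrix.smul_mul, Matrix.mul_assoc, smul_sub]
    abel
  rw [e]
  have t1 : ‖((rho n C')⁻¹ - (rho n C)⁻¹) • ((A * spikeCol n C) * (spikeRow n C B * Z))‖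
      ≤ 2 * (σ ^ 2 * ε) * (β * β) := by
    rw [norm_smul]
    refine mul_le_mul hdinv ((Matrix.frobenius_norm_mul _ _).trans ?_) (norm_nonneg _)
      (by positivity)
    exact mul_le_mul ha he (norm_nonneg _) (by linarith)
  have t2 : ‖(A * (spikeCol n C' - spikeCol n C)) * (spikeRow n C B * Z)‖ ≤ σ * ε * β :=
    (Matrix.frobenius_norm_mul _ _).trans (mul_le_mul hda he (norm_nonneg _) (by positivity))
  have t3 : ‖(A * spikeCol n C') * ((spikeRow n C' B' - spikeRow n C B) * Z)‖
      ≤ 2 * β * (3 * ε * σ) :=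
    (Matrix.frobenius_norm_mul _ _).trans (mul_le_mul ha' hde (norm_nonneg _) (by positivity))
  have t4 : ‖(rho n C')⁻¹ • ((A * (spikeCol n C' - spikeCol n C)) * (spikeRow n C B * Z)
            + (A * spikeCol n C') * ((spikeRow n C' B' - spikeRow n C B) * Z))‖
      ≤ 2 * σ * (σ * ε * β + 2 * β * (3 * ε * σ)) := by
    rw [norm_smul]
    exact mul_le_mul hinv ((norm_add_le _ _).trans (add_le_add t2 t3)) (norm_nonneg _)
      (by positivity)
  refine (norm_sub_le _ _).trans ((add_le_add hmid ((norm_add_le _ _).trans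
    (add_le_add t1 t4))).trans ?_)
  have hb2 : β ≤ β ^ 2 := by nlinarith
  have hb1 : 1 ≤ β ^ 2 := by nlinarith
  have hs : 0 ≤ σ ^ 2 * ε := by positivity
  have m1 := mul_le_mul_of_nonneg_right hb2 hs
  have m2 := mul_le_mul_of_nonneg_right hb1 hs
  nlinarith

/-! ### Sensitivity of products of factors -/

/-- A factor of one of the two matrices of a factored pencil: a unitary matrix, or a stored
triangular factor. -/
inductive Factor (n : ℕ) : Type
  | unitary (Q : Matrix (Fin n) (Fin n) ℂ)
  | tri (t : Tri)

theorem IsUni.norm_le_card {m : ℕ} {U : Matrix (Fin m) (Fin m) ℂ} (h : IsUni U) : ‖U‖ ≤ m := by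
  refine le_of_sq_le_sq ?_ (Nat.cast_nonneg _)
  rw [isUni_norm_sq h, sq]
  exact_mod_cast Nat.le_mul_self m

theorem norm_spikeCol_le {n : ℕ} {C : Matrix (Fin (n + 1)) (Fin (n + 1)) ℂ} (hC : IsUni C) :
    ‖spikeCol n C‖ ≤ n + 1 := by
  refine (norm_mul_incl_le (by omega) _).trans ((norm_incl_mul_le (by omega) _).trans ?_)
  exact_mod_cast hC.conj.norm_le_card

theorem norm_spikeRow_le {n : ℕ} {C B : Matrix (Fin (n + 1)) (Fin (n + 1)) ℂ} (hC : IsUni C)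
    (hB : IsUni B) : ‖spikeRow n C B‖ ≤ n + 1 := by
  refine (norm_mul_incl_le (by omega) _).trans ((norm_incl_mul_le (by omega) _).trans ?_)
  exact_mod_cast (hC.conj.mul hB).norm_le_card

namespace Factor

variable {n : ℕ}

/-- The matrix that a factor represents. -/
def val : Factor n → Matrix (Fin n) (Fin n) ℂ
  | unitary Q => Q
  | tri t => t.toMatrix n

/-- `Y` is obtained from the factor by perturbations of size `ε` in the stored data. -/
def Pert (ε : ℝ) : Factor n → Matrix (Fin n) (Fin n) ℂ → Prop
  | unitary Q, Y => ‖Y - Q‖ ≤ ε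
  | tri t, Y => ∃ C B, ‖C - seqMatrix (n + 1) t.C‖ ≤ ε ∧ ‖B - seqMatrix (n + 1) t.B‖ ≤ ε ∧
      Y = rep n C B

/-- The factor stands between `A` and `Z`, and these, as well as the spike of the factor, have norm
at most `σ`; the products of `A` with the spike, and of the spike row with `Z`, have only norm `1`.
This prevents the growth of perturbations in the factors of a product. -/
def Bal (σ : ℝ) (A : Matrix (Fin n) (Fin n) ℂ) : Factor n → Matrix (Fin n) (Fin n) ℂ → Prop
  | unitary Q, Z => IsUni Q ∧ ‖A‖ ≤ σ ∧ ‖Z‖ ≤ σ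
  | tri t, Z => (IsUni (seqMatrix (n + 1) t.C) ∧ IsUni (seqMatrix (n + 1) t.B)) ∧
      (rho n (seqMatrix (n + 1) t.C) ≠ 0 ∧ ‖rho n (seqMatrix (n + 1) t.C)‖⁻¹ ≤ σ) ∧
      ‖A‖ ≤ σ ∧ ‖Z‖ ≤ σ ∧ ‖A * spikeCol n (seqMatrix (n + 1) t.C)‖ ≤ 1 ∧
      ‖spikeRow n (seqMatrix (n + 1) t.C) (seqMatrix (n + 1) t.B) * Z‖ ≤ 1

/-- Effect of a perturbed factor on a balanced product, where the product `Z'` of the following,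
already perturbed, factors may differ from the exact one `Z`. -/
theorem Bal.norm_sub_le {σ ε : ℝ} {A Z Z' Y : Matrix (Fin n) (Fin n) ℂ} {x : Factor n}
    (h : x.Bal σ A Z) (hy : x.Pert ε Y) (hσ : 1 ≤ σ) (hε : 0 ≤ ε) (hεσ : 6 * (σ * ε) ≤ 1)
    (hZ : (n + 1) * ‖Z' - Z‖ ≤ 1) : ‖A * (Y - x.val) * Z'‖ ≤ 336 * (σ ^ 2 * ε) := by
  have hd : ‖Z' - Z‖ ≤ 1 := by nlinarith [norm_nonneg (Z' - Z), n.cast_nonneg (α := ℝ)]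
  have hz : ‖Z'‖ ≤ ‖Z' - Z‖ + ‖Z‖ := by simpa using norm_add_le (Z' - Z) Z
  cases x with
  | unitary Q =>
    obtain ⟨-, hA, hZσ⟩ := h
    change ‖Y - Q‖ ≤ ε at hy
    have h1 := (Matrix.frobenius_norm_mul A (Y - Q)).trans
      (mul_le_mul hA hy (norm_nonneg _) (by linarith))
    have h2 := (Matrix.frobenius_norm_mul (A * (Y - Q)) Z').trans
      (mul_le_mul h1 (show ‖Z'‖ ≤ 2 * σ by linarith) (norm_nonneg _) (by positivity))
    have h3 : 0 ≤ σ ^ 2 * ε := by positivity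
    refine h2.trans ?_
    nlinarith
  | tri t =>
    obtain ⟨⟨hC, hB⟩, ⟨hρ0, hρ⟩, hA, hZσ, ha, he⟩ := h
    obtain ⟨C', B', hC', hB', rfl⟩ := hy
    have hrow := norm_spikeRow_le hC hB
    -- the spike row times `Z'` is bounded by two instead of one, hence the constants `β = 2` and
    -- `2 σ` below
    have he' : ‖spikeRow n (seqMatrix (n + 1) t.C) (seqMatrix (n + 1) t.B) * Z'‖ ≤ 2 := by
      have e : spikeRow n (seqMatrix (n + 1) t.C) (seqMatrix (n + 1) t.B) * Z'
          = spikeRow n (seqMatrix (n + 1) t.C) (seqMatrix (n + 1) t.B) * (Z' - Z)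
            + spikeRow n (seqMatrix (n + 1) t.C) (seqMatrix (n + 1) t.B) * Z := by
        rw [Matrix.mul_sub]; abel
      rw [e]
      have h1 := (Matrix.frobenius_norm_mul
        (spikeRow n (seqMatrix (n + 1) t.C) (seqMatrix (n + 1) t.B)) (Z' - Z)).trans
        (mul_le_mul_of_nonneg_right hrow (norm_nonneg _))
      exact (norm_add_le _ _).trans (by linarith)
    have := (norm_rep_sub_le (σ := 2 * σ) (β := 2) (A := A) (Z := Z') hC hB hε hC' hB'
      (by linarith) (by norm_num) (by linarith) (by linarith) (by linarith) hρ0 (by linarith)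
      (by linarith) he').2
    rw [val, toMatrix_eq_rep]
    refine this.trans (le_of_eq ?_)
    ring

theorem Bal.norm_val_le {σ : ℝ} {A Z : Matrix (Fin n) (Fin n) ℂ} {x : Factor n}
    (h : x.Bal σ A Z) (hσ : 1 ≤ σ) : ‖x.val‖ ≤ 2 * (σ * (n + 1) ^ 2) := by
  have hn : (0 : ℝ) ≤ n := n.cast_nonneg
  have h1 : (n + 1 : ℝ) ≤ (n + 1) ^ 2 := by nlinarith
  have h2 : ((n : ℝ) + 1) ^ 2 ≤ σ * (n + 1) ^ 2 := le_mul_of_one_le_left (by positivity) hσ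
  cases x with
  | unitary Q =>
    have := h.1.norm_le_card
    change ‖Q‖ ≤ _
    linarith
  | tri t =>
    obtain ⟨⟨hC, hB⟩, ⟨hρ0, hρ⟩, -⟩ := h
    rw [val, toMatrix_eq_rep, rep]
    have e1 : ‖(incl (n + 1) n 0)ᴴ * ((seqMatrix (n + 1) t.C)ᴴ * seqMatrix (n + 1) t.B)
        * incl (n + 1) n 0‖ ≤ n + 1 := by
      refine (norm_mul_incl_le (by omega) _).trans ((norm_incl_mul_le (by omega) _).trans ?_)
      exact_mod_cast (hC.conj.mul hB).norm_le_card
    have e2 := (Matrix.frobenius_norm_mul (spikeCol n (seqMatrix (n + 1) t.C))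
      (spikeRow n (seqMatrix (n + 1) t.C) (seqMatrix (n + 1) t.B))).trans
      (mul_le_mul (norm_spikeCol_le hC) (norm_spikeRow_le hC hB) (norm_nonneg _) (by positivity))
    refine (_root_.norm_sub_le _ _).trans ?_
    rw [norm_smul, norm_inv]
    have e3 := mul_le_mul hρ e2 (norm_nonneg _) (by linarith)
    linarith

/-- A bound on the perturbation of a single factor, without its neighbours. -/
theorem Bal.norm_sub_le_coarse {σ ε : ℝ} {A Z Y : Matrix (Fin n) (Fin n) ℂ} {x : Factor n}
    (h : x.Bal σ A Z) (hy : x.Pert ε Y) (hσ : 1 ≤ σ) (hε : 0 ≤ ε)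
    (hεσ : 3 * (n + 1) * (σ * ε) ≤ 1) : ‖Y - x.val‖ ≤ 21 * ((n + 1) ^ 4 * σ ^ 2 * ε) := by
  have hn : (0 : ℝ) ≤ n := n.cast_nonneg
  have hn1 : (1 : ℝ) ≤ n + 1 := by linarith
  cases x with
  | unitary Q =>
    change ‖Y - Q‖ ≤ ε at hy
    have h1 : (1 : ℝ) ≤ (n + 1) ^ 4 * σ ^ 2 :=
      one_le_mul_of_one_le_of_one_le (one_le_pow₀ hn1) (one_le_pow₀ hσ)
    change ‖Y - Q‖ ≤ _
    nlinarith
  | tri t =>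
    obtain ⟨⟨hC, hB⟩, ⟨hρ0, hρ⟩, -⟩ := h
    obtain ⟨C', B', hC', hB', rfl⟩ := hy
    have h1 : ‖(1 : Matrix (Fin n) (Fin n) ℂ)‖ ≤ (n + 1) * σ := by
      have := (isUni_one (m := Fin n)).norm_le_card
      nlinarith
    have := (norm_rep_sub_le (σ := (n + 1) * σ) (β := n + 1) (A := 1) (Z := 1) hC hB hε hC' hB'
      (by nlinarith) hn1 (by linarith) h1 h1 hρ0 (by nlinarith)
      (by rw [Matrix.one_mul]; exact norm_spikeCol_le hC)
      (by rw [Matrix.mul_one]; exact norm_spikeRow_le hC hB)).2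
    rw [Matrix.one_mul, Matrix.mul_one] at this
    rw [val, toMatrix_eq_rep]
    refine this.trans (le_of_eq ?_)
    ring

end Factor

/-- The product of the matrices represented by a list of factors. -/
def valProd {n : ℕ} (xs : List (Factor n)) : Matrix (Fin n) (Fin n) ℂ := (xs.map Factor.val).prod

theorem valProd_cons {n : ℕ} (x : Factor n) (xs : List (Factor n)) :
    valProd (x :: xs) = x.val * valProd xs := by simp [valProd]

/-- Every factor of the list is balanced between the product of the preceding ones, multiplied by
`A` from the left, and the product of those that follow. -/
def ListBal {n : ℕ} (σ : ℝ) : Matrix (Fin n) (Fin n) ℂ → List (Factor n) → Prop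
  | _, [] => True
  | A, x :: xs => x.Bal σ A (valProd xs) ∧ ListBal σ (A * x.val) xs

section Products

variable {n : ℕ} {σ ε : ℝ}

/-- A bound on the perturbation of a product by the norms of all factors. It is exponential in
their number, and serves only for terms of second order. -/
theorem norm_pertProd_sub_le_coarse {η : ℝ} {xs : List (Factor n)}
    {ys : List (Matrix (Fin n) (Fin n) ℂ)} (hσ : 1 ≤ σ) (hη0 : 0 ≤ η) (hη : η ≤ 1)
    (h : List.Forall₂ (fun x Y => ‖x.val‖ ≤ 2 * (σ * (n + 1) ^ 2) ∧ ‖Y - x.val‖ ≤ η) xs ys) :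
    ‖ys.prod‖ ≤ (n + 1) * (2 * (σ * (n + 1) ^ 2) + 1) ^ xs.length ∧
      ‖ys.prod - valProd xs‖
        ≤ xs.length * ((n + 1) * (2 * (σ * (n + 1) ^ 2) + 1) ^ xs.length * η) := by
  obtain ⟨D, hD⟩ : ∃ D, 2 * (σ * ((n : ℝ) + 1) ^ 2) = D := ⟨_, rfl⟩
  have hD0 : 0 ≤ D := by rw [← hD]; positivity
  rw [hD] at h ⊢
  induction h with
  | nil =>
    have := (isUni_one (m := Fin n)).norm_le_card
    simp only [List.prod_nil, List.length_nil, pow_zero, valProd, List.map_nil, sub_self, norm_zero,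
      Nat.cast_zero, zero_mul, le_refl, and_true, mul_one]
    linarith
  | @cons x Y xs ys hxy _ ih =>
    obtain ⟨h1, h2⟩ := hxy
    obtain ⟨ih1, ih2⟩ := ih
    have hY : ‖Y‖ ≤ D + 1 := by
      have := norm_add_le x.val (Y - x.val)
      rw [add_sub_cancel] at this
      linarith
    have hp : 0 ≤ ((n : ℝ) + 1) * (D + 1) ^ xs.length := by positivity
    obtain ⟨p, hp'⟩ : ∃ p, ((n : ℝ) + 1) * (D + 1) ^ xs.length = p := ⟨_, rfl⟩
    have e2 : ((n : ℝ) + 1) * (D + 1) ^ (xs.length + 1) = (D + 1) * p := by rw [← hp']; ring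
    rw [hp'] at ih1 ih2 hp
    rw [List.prod_cons, List.length_cons, e2, valProd_cons]
    constructor
    · exact (Matrix.frobenius_norm_mul _ _).trans (mul_le_mul hY ih1 (norm_nonneg _) (by linarith))
    · have e : Y * ys.prod - x.val * valProd xs
          = (Y - x.val) * ys.prod + x.val * (ys.prod - valProd xs) := by
        rw [Matrix.sub_mul, Matrix.mul_sub]; abel
      rw [e]
      have t1 := (Matrix.frobenius_norm_mul (Y - x.val) ys.prod).trans
        (mul_le_mul h2 ih1 (norm_nonneg _) hη0)
      have t2 := (Matrix.frobenius_norm_mul x.val (ys.prod - valProd xs)).trans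
        (mul_le_mul h1 ih2 (norm_nonneg _) hD0)
      refine (norm_add_le _ _).trans ((add_le_add t1 t2).trans ?_)
      push_cast
      have l0 : (0 : ℝ) ≤ xs.length := Nat.cast_nonneg _
      have m1 : 0 ≤ p * η := by positivity
      have m2 : 0 ≤ (xs.length : ℝ) * (p * η) := by positivity
      nlinarith

/-- The constant that controls second-order terms in a product of at most `N` factors; `ε` times it
is required to be at most one. -/
def secondOrder (n : ℕ) (σ : ℝ) (N : ℕ) : ℝ :=
  21 * ((N + 1) * (n + 1) ^ 6 * (2 * (σ * (n + 1) ^ 2) + 1) ^ N * σ ^ 2)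

theorem secondOrder_mono {N N' : ℕ} (hσ : 1 ≤ σ) (h : N ≤ N') :
    secondOrder n σ N ≤ secondOrder n σ N' := by
  unfold secondOrder
  have h1 : (1 : ℝ) ≤ 2 * (σ * (n + 1) ^ 2) + 1 := by
    have : 0 ≤ 2 * (σ * ((n : ℝ) + 1) ^ 2) := by positivity
    linarith
  gcongr

/-- In a balanced product, the error caused by perturbations of size `ε` in the stored data of the
factors grows only with the square of `σ`. -/
theorem ListBal.norm_pertProd_sub_le {A : Matrix (Fin n) (Fin n) ℂ} {xs : List (Factor n)}
    {ys : List (Matrix (Fin n) (Fin n) ℂ)} (hσ : 1 ≤ σ) (hε : 0 ≤ ε) (hb : ListBal σ A xs)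
    (h : List.Forall₂ (Factor.Pert ε) xs ys) (hs : secondOrder n σ xs.length * ε ≤ 1) :
    List.Forall₂ (fun x Y => ‖x.val‖ ≤ 2 * (σ * (n + 1) ^ 2) ∧
        ‖Y - x.val‖ ≤ 21 * ((n + 1) ^ 4 * σ ^ 2 * ε)) xs ys ∧
      ‖A * (ys.prod - valProd xs)‖ ≤ xs.length * (336 * (σ ^ 2 * ε)) := by
  induction h generalizing A with
  | nil => exact ⟨.nil, by simp [valProd]⟩
  | @cons x Y xs ys hxy hxs ih =>
    obtain ⟨hx, hb'⟩ := hb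
    have hs' := (mul_le_mul_of_nonneg_right
      (secondOrder_mono (n := n) (N := xs.length) (N' := xs.length + 1) hσ (by omega)) hε).trans hs
    obtain ⟨ih1, ih2⟩ := ih hb' hs'
    have hn : (0 : ℝ) ≤ n := n.cast_nonneg
    have hn1 : (1 : ℝ) ≤ n + 1 := by linarith
    have l0 : (0 : ℝ) ≤ xs.length := Nat.cast_nonneg _
    have hD : (1 : ℝ) ≤ (2 * (σ * (n + 1) ^ 2) + 1) ^ xs.length := by
      refine one_le_pow₀ ?_
      have : 0 ≤ 2 * (σ * ((n : ℝ) + 1) ^ 2) := by positivity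
      linarith
    have hσ2 : 1 ≤ σ ^ 2 := one_le_pow₀ hσ
    have hη : 21 * (((n : ℝ) + 1) ^ 4 * σ ^ 2 * ε) ≤ 1 := by
      refine le_trans ?_ hs'
      unfold secondOrder
      have : ((n : ℝ) + 1) ^ 4 ≤
          (xs.length + 1) * (n + 1) ^ 6 * (2 * (σ * (n + 1) ^ 2) + 1) ^ xs.length := by
        calc ((n : ℝ) + 1) ^ 4 ≤ (n + 1) ^ 6 := pow_le_pow_right₀ hn1 (by norm_num)
          _ = 1 * (n + 1) ^ 6 * 1 := by ring
          _ ≤ _ := by gcongr; linarith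
      rw [mul_assoc 21]
      gcongr
    have h4 : (n + 1 : ℝ) * σ ≤ (n + 1) ^ 4 * σ ^ 2 := by
      have a1 : (n + 1 : ℝ) ≤ (n + 1) ^ 4 := le_self_pow₀ hn1 (by norm_num)
      have a2 : σ ≤ σ ^ 2 := le_self_pow₀ hσ (by norm_num)
      gcongr
    have hεσ : 3 * ((n : ℝ) + 1) * (σ * ε) ≤ 1 / 7 := by
      have := mul_le_mul_of_nonneg_right h4 hε
      linarith
    have hc := hx.norm_sub_le_coarse hxy hσ hε (by linarith)
    -- the coarse bound shows that the perturbed product of the following factors is close enough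
    -- to the exact one for `Bal.norm_sub_le`
    have hκ := (norm_pertProd_sub_le_coarse hσ (by positivity) hη ih1).2
    have hκ' : (n + 1) * ‖ys.prod - valProd xs‖ ≤ 1 := by
      have e1 : ((n : ℝ) + 1) * (xs.length * ((n + 1) * (2 * (σ * (n + 1) ^ 2) + 1) ^ xs.length
            * (21 * ((n + 1) ^ 4 * σ ^ 2 * ε))))
          = secondOrder n σ xs.length * ε * (xs.length / (xs.length + 1)) := by
        unfold secondOrder
        rw [mul_div_assoc', eq_div_iff (by positivity)]
        ring
      have e2 : (xs.length : ℝ) / (xs.length + 1) ≤ 1 := by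
        rw [div_le_one (by positivity)]; linarith
      exact (mul_le_mul_of_nonneg_left hκ (by positivity)).trans
        (e1.trans_le (mul_le_one₀ hs' (by positivity) e2))
    have h6 : 6 * (σ * ε) ≤ 1 := by
      have : 0 ≤ (n : ℝ) * (σ * ε) := by positivity
      nlinarith
    have hm := hx.norm_sub_le hxy hσ hε h6 hκ'
    refine ⟨.cons ⟨hx.norm_val_le hσ, hc⟩ ih1, ?_⟩
    -- telescoping: the first factor is replaced by its perturbation after all those that follow it
    have e : A * ((Y :: ys).prod - valProd (x :: xs))
        = A * (Y - x.val) * ys.prod + A * x.val * (ys.prod - valProd xs) := by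
      rw [List.prod_cons, valProd_cons]
      noncomm_ring
    rw [e]
    refine (norm_add_le _ _).trans ((add_le_add hm ih2).trans (le_of_eq ?_))
    rw [List.length_cons]
    push_cast
    ring

end Products

/-! ### From unitary similarity of the stored factors to a perturbation of the pencil -/

/-- An error of a unitary equivalence is moved into the original matrix. -/
theorem exists_pert_of_sim {m : ℕ} {Q Q' A B : Matrix (Fin m) (Fin m) ℂ} {ε : ℝ} (hA : IsUni A)
    (hB : IsUni B) (h : ‖Q' - Aᴴ * Q * B‖ ≤ ε) : ∃ Y, ‖Y - Q‖ ≤ ε ∧ Q' = Aᴴ * Y * B := by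
  refine ⟨A * Q' * Bᴴ, ?_, ?_⟩
  · have e : A * Q' * Bᴴ - Q = A * (Q' - Aᴴ * Q * B) * Bᴴ := by
      simp only [Matrix.mul_sub, Matrix.sub_mul, Matrix.mul_assoc, hB.right, Matrix.mul_one]
      rw [hA.cancel']
    rwa [e, hB.conj.norm_mul', hA.norm_mul]
  · simp only [Matrix.mul_assoc, hB.left, Matrix.mul_one]
    rw [hA.cancel]

/-- A matrix represented by a transformed factor is an exact unitary equivalence of a perturbation
of the original factor. -/
theorem TriSim.exists_pert {n : ℕ} {ε : ℝ} {L V : Matrix (Fin n) (Fin n) ℂ} {t t' : Tri}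
    (hL : IsUni L) (hV : IsUni V) (h : TriSim n ε L V t t') :
    ∃ Y, (Factor.tri t : Factor n).Pert ε Y ∧ t'.toMatrix n = Lᴴ * Y * V := by
  obtain ⟨X, hX, hE, h1, h2⟩ := h
  obtain ⟨C, hC, eC⟩ := exists_pert_of_sim hX (hat_isUni hL) h1
  obtain ⟨B, hB, eB⟩ := exists_pert_of_sim hX (hat_isUni hV) h2
  refine ⟨rep n C B, ⟨C, B, hC, hB, rfl⟩, ?_⟩
  rw [toMatrix_eq_rep, eC, eB, rep_cov hX hE]

/-- The scalar `ρ` is invariant under exact similarity, and so stays nonzero under small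
errors. -/
theorem TriSim.rho_ne_zero {n : ℕ} {ε : ℝ} {L V : Matrix (Fin n) (Fin n) ℂ} {t t' : Tri}
    (h : TriSim n ε L V t t') (hρ : ε < ‖rho n (seqMatrix (n + 1) t.C)‖) :
    rho n (seqMatrix (n + 1) t'.C) ≠ 0 := by
  obtain ⟨X, -, hE, h1, -⟩ := h
  have := (norm_rho_sub_le n _ _).trans h1
  rw [rho_cov hE] at this
  intro h0
  rw [h0, zero_sub, norm_neg] at this
  linarith

/-- The products of `TriSim.exists_pert` telescope. -/
theorem ListSim.exists_pert {n : ℕ} {ε : ℝ} {L V : Matrix (Fin n) (Fin n) ℂ} {ts ts' : List Tri}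
    (h : ListSim n ε L V ts ts') (hL : IsUni L)
    (hρ : ∀ t ∈ ts, ε < ‖rho n (seqMatrix (n + 1) t.C)‖) :
    IsUni V ∧ (∀ t ∈ ts', rho n (seqMatrix (n + 1) t.C) ≠ 0) ∧
      ∃ ys, List.Forall₂ (Factor.Pert ε) (ts.map (Factor.tri (n := n))) ys ∧
        (ts'.map (Tri.toMatrix n)).prod = Lᴴ * ys.prod * V := by
  induction h with
  | nil L => exact ⟨hL, by simp, [], .nil, by simp [hL.left]⟩
  | @cons L N V t t' ts ts' hN h _ ih =>
    obtain ⟨hV, h1, ys, h2, h3⟩ := ih hN fun t ht => hρ t (by simp [ht])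
    obtain ⟨Y, hY, eY⟩ := h.exists_pert hL hN
    refine ⟨hV, ?_, Y :: ys, .cons hY h2, ?_⟩
    · intro s hs
      rcases List.mem_cons.1 hs with rfl | hs
      · exact h.rho_ne_zero (hρ t (by simp))
      · exact h1 s hs
    · rw [List.map_cons, List.prod_cons, h3, eY, List.prod_cons]
      simp only [Matrix.mul_assoc]
      rw [hN.cancel']

/-- The factors of the blocks `b, …, b + l - 1` of `S`. -/
def blockFactors (n : ℕ) (s : Factored) (b : ℕ) : ℕ → List (Factor n)
  | 0 => []
  | l + 1 => Factor.unitary (seqMatrix n (s.Q b)) ::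
      ((s.R b).map Factor.tri ++ blockFactors n s (b + 1) l)

theorem seqMatrix_of_eq_one {m : ℕ} {q : ℕ → Core} (h : ∀ i, i + 1 < m → q i = 1) :
    seqMatrix m q = 1 := by
  unfold seqMatrix
  apply List.prod_eq_one
  intro x hx
  obtain ⟨i, hi, rfl⟩ := List.mem_map.1 hx
  rw [h i (by have := List.mem_range.1 hi; omega), embed_one]

section Pencil

variable {n k : ℕ} {ε₁ ε₂ : ℝ} {e red : Factored} {L M : ℕ → Matrix (Fin n) (Fin n) ℂ}

/-- The blocks `b, …, b + l - 1` of `S`, whose sequences are trivial after the reduction, so that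
only their triangular factors are left in the Hessenberg-triangular pencil. -/
theorem exists_pert_blocks (hL : ∀ b, IsUni (L b)) (hM : ∀ b, IsUni (M b))
    (hε₂ : 0 ≤ ε₂) (h : FSim n k ε₁ L L M e red)
    (hQ : ∀ b, 1 ≤ b → b < k → ∀ i, i + 1 < n → red.Q b i = 1)
    (hρ : ∀ b < k, ∀ t ∈ e.R b, ε₁ + ε₂ < ‖rho n (seqMatrix (n + 1) t.C)‖)
    {V : Matrix (Fin n) (Fin n) ℂ} (l b : ℕ) (hb : 1 ≤ b) (hbk : b + l ≤ k)
    {N : Matrix (Fin n) (Fin n) ℂ} (hN : IsUni N) {us : List Tri}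
    (hs : ListSim n ε₂ N V ((List.range' b l).flatMap red.R) us) :
    IsUni V ∧ (∀ t ∈ us, rho n (seqMatrix (n + 1) t.C) ≠ 0) ∧
      ∃ ys, List.Forall₂ (Factor.Pert (ε₁ + ε₂)) (blockFactors n e b l) ys ∧
        (us.map (Tri.toMatrix n)).prod = (L b * N)ᴴ * ys.prod * (L (b + l) * V) := by
  induction l generalizing b N us with
  | zero =>
    cases hs
    exact ⟨hN, by simp, [], .nil, by
      rw [List.prod_nil, Matrix.mul_one]; exact ((hL b).mul hN).left.symm⟩
  | succ l ih =>
    rw [List.range'_succ, List.flatMap_cons] at hs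
    obtain ⟨N', us₁, us₂, hN', rfl, h1, h2⟩ := hs.split hN
    obtain ⟨hV, hρ2, ys₂, hy₂, e₂⟩ := ih (b + 1) (by omega) (by omega) hN' h2
    obtain ⟨-, hρ1, ys₁, hy₁, e₁⟩ := ((h.R b (by omega)).trans h1 hN).exists_pert
      ((hM b).mul hN) (hρ b (by omega))
    have hq := h.Q b (by omega)
    rw [seqMatrix_of_eq_one (hQ b hb (by omega))] at hq
    obtain ⟨Y, hY, eY⟩ := exists_pert_of_sim (hL b) (hM b) hq
    refine ⟨hV, ?_, Y :: (ys₁ ++ ys₂), .cons (show ‖Y - _‖ ≤ ε₁ + ε₂ by linarith)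
      (List.rel_append hy₁ hy₂), ?_⟩
    · intro t ht
      exact (List.mem_append.1 ht).elim (hρ1 t) (hρ2 t)
    -- the trivial sequence is an equivalence of a perturbation `Y` of the original one, `1 = L_bᴴ
    -- Y M_b`
    · have e3 : (L b)ᴴ * Y = (M b)ᴴ := by
        calc (L b)ᴴ * Y = (L b)ᴴ * Y * M b * (M b)ᴴ := by
              rw [Matrix.mul_assoc _ (M b), (hM b).right, Matrix.mul_one]
          _ = (M b)ᴴ := by rw [← eY, Matrix.one_mul]
      rw [List.map_append, List.prod_append, e₁, e₂, List.prod_cons, List.prod_append,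
        Matrix.conjTranspose_mul, Matrix.conjTranspose_mul, ← e3,
        show b + (l + 1) = b + 1 + l by omega]
      simp only [Matrix.mul_assoc]
      have := ((hL (b + 1)).mul hN').cancel' (ys₂.prod * (L (b + 1 + l) * V))
      rw [Matrix.conjTranspose_mul] at this
      simp only [Matrix.mul_assoc] at this
      rw [this, Matrix.conjTranspose_mul, Matrix.mul_assoc]

theorem blockTriangular_prod {ts : List Tri}
    (h : ∀ t ∈ ts, rho n (seqMatrix (n + 1) t.C) ≠ 0) :
    ((ts.map (Tri.toMatrix n)).prod).BlockTriangular id := by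
  induction ts with
  | nil => simpa using Matrix.blockTriangular_one
  | cons t ts ih =>
    rw [List.map_cons, List.prod_cons]
    exact (t.blockTriangular_toMatrix n (h t (by simp))).mul (ih fun t ht => h t (by simp [ht]))

/-- The backward error of the two phases that work on the factored pencil: the computed Schur form
is the exact one of the pencil with perturbed factors. -/
theorem exists_pert_of_sims (hk : 1 ≤ k) (hL : ∀ b, IsUni (L b)) (hM : ∀ b, IsUni (M b))
    (hε₂ : 0 ≤ ε₂) (h : FSim n k ε₁ L L M e red)
    (hQ : ∀ b, 1 ≤ b → b < k → ∀ i, i + 1 < n → red.Q b i = 1)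
    (hρ : ∀ b < k, ∀ t ∈ e.R b, ε₁ + ε₂ < ‖rho n (seqMatrix (n + 1) t.C)‖)
    (hρT : ∀ t ∈ e.T, ε₁ + ε₂ < ‖rho n (seqMatrix (n + 1) t.C)‖)
    {U M' V : Matrix (Fin n) (Fin n) ℂ} (hU : IsUni U) (hM' : IsUni M') {s : HessTri}
    (h' : HSim n ε₂ U U M' M' V (toHessTri k red) s) (hs : ∀ i, i + 1 < n → s.Q i = 1) :
    (seqMatrix n s.Q * (s.R.map (Tri.toMatrix n)).prod).BlockTriangular id ∧
      ((s.T.map (Tri.toMatrix n)).prod).BlockTriangular id ∧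
      ∃ U' V' : Matrix (Fin n) (Fin n) ℂ, IsUni U' ∧ IsUni V' ∧ ∃ ys zs,
        List.Forall₂ (Factor.Pert (ε₁ + ε₂)) (blockFactors n e 0 k) ys ∧
        List.Forall₂ (Factor.Pert (ε₁ + ε₂)) (e.T.map Factor.tri) zs ∧
        seqMatrix n s.Q * (s.R.map (Tri.toMatrix n)).prod = U'ᴴ * ys.prod * V' ∧
        (s.T.map (Tri.toMatrix n)).prod = U'ᴴ * zs.prod * V' := by
  obtain ⟨hV, hρT', zs, hzs, eT⟩ := (h.T.trans h'.T hU).exists_pert ((hL 0).mul hU) hρT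
  have hR := h'.R
  obtain ⟨k, rfl⟩ : ∃ k', k = k' + 1 := ⟨k - 1, by omega⟩
  simp only [toHessTri, List.range_eq_range', List.range'_succ, List.flatMap_cons] at hR
  obtain ⟨N', us₁, us₂, hN', hsR, h1, h2⟩ := hR.split hM'
  obtain ⟨-, hρ2, ys₂, hy₂, e₂⟩ := exists_pert_blocks hL hM hε₂ h hQ hρ k 1 le_rfl (by omega) hN' h2
  obtain ⟨-, hρ1, ys₁, hy₁, e₁⟩ := ((h.R 0 (by omega)).trans h1 hM').exists_pert
    ((hM 0).mul hM') (hρ 0 (by omega))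
  -- the first sequence of `S` has been transformed in both phases
  have hq := norm_conj_trans hU hM' (h.Q 0 (by omega)) h'.Q
  obtain ⟨Y, hY, eY⟩ := exists_pert_of_sim ((hL 0).mul hU) ((hM 0).mul hM') hq
  have hρR : ∀ t ∈ s.R, rho n (seqMatrix (n + 1) t.C) ≠ 0 := by
    rw [hsR]
    intro t ht
    exact (List.mem_append.1 ht).elim (hρ1 t) (hρ2 t)
  refine ⟨?_, blockTriangular_prod hρT', L 0 * U, L (k + 1) * V, (hL 0).mul hU, hV,
    Y :: (ys₁ ++ ys₂), zs, ?_, hzs, ?_, eT⟩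
  · rw [seqMatrix_of_eq_one hs, Matrix.one_mul]
    exact blockTriangular_prod hρR
  · exact .cons hY (List.rel_append hy₁ hy₂)
  · rw [hsR, eY, List.map_append, List.prod_append, e₁, e₂, List.prod_cons, List.prod_append,
      show k + 1 = 1 + k by omega]
    simp only [Matrix.mul_assoc]
    have c1 := ((hL 1).mul hN').cancel' (ys₂.prod * (L (1 + k) * V))
    have c2 := fun X : Matrix (Fin n) (Fin n) ℂ => ((hM 0).mul hM').cancel' X
    simp only [Matrix.mul_assoc, Matrix.conjTranspose_mul] at c1 c2 ⊢
    rw [c1, c2]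

end Pencil

/-! ### Swaps and cyclic shifts -/

/-- Equality of matrices is checked on the unit vectors. -/
theorem ext_unit_cols {m : ℕ} {ι : Type*} {A B : Matrix ι (Fin m) ℂ}
    (h : ∀ j, j < m → A * incl m 1 j = B * incl m 1 j) : A = B := by
  ext i j
  have := congrFun (congrFun (h j j.2) i) 0
  rwa [mul_incl_apply A i 0 (c := j) (by simp), mul_incl_apply B i 0 (c := j) (by simp)] at this

theorem embed_mul_unit_of_ne {m i j : ℕ} (G : Core) (h : j < i ∨ i + 1 < j) :
    embed m i G * incl m 1 j = incl m 1 j := by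
  rw [embed_eq_plug]
  exact plug_mul_of_orth (incl_orth (by omega)) G

theorem embed_mul_unit_left {m i : ℕ} (hi : i + 2 ≤ m) (G : Core) :
    embed m i G * incl m 1 i = G 0 0 • incl m 1 i + G 1 0 • incl m 1 (i + 1) := by
  have h0 : incl m 1 i = incl m 2 i * incl 2 1 0 := by rw [incl_mul_incl (by omega), add_zero]
  have h1 : incl m 1 (i + 1) = incl m 2 i * incl 2 1 1 := by rw [incl_mul_incl (by omega)]
  rw [h0, h1, embed_eq_plug, ← Matrix.mul_assoc, plug_mul_self (incl_isometry hi),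
    Matrix.mul_assoc, ← Matrix.mul_smul, ← Matrix.mul_smul, ← Matrix.mul_add]
  congr 1
  ext a b
  fin_cases a <;> simp [Matrix.mul_apply, incl]

theorem embed_mul_unit_right {m i : ℕ} (hi : i + 2 ≤ m) (G : Core) :
    embed m i G * incl m 1 (i + 1) = G 0 1 • incl m 1 i + G 1 1 • incl m 1 (i + 1) := by
  have h0 : incl m 1 i = incl m 2 i * incl 2 1 0 := by rw [incl_mul_incl (by omega), add_zero]
  have h1 : incl m 1 (i + 1) = incl m 2 i * incl 2 1 1 := by rw [incl_mul_incl (by omega)]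
  rw [h0, h1, embed_eq_plug, ← Matrix.mul_assoc, plug_mul_self (incl_isometry hi),
    Matrix.mul_assoc, ← Matrix.mul_smul, ← Matrix.mul_smul, ← Matrix.mul_add]
  congr 1
  ext a b
  fin_cases a <;> simp [Matrix.mul_apply, incl, Fin.sum_univ_two]

theorem swapCore_isUni : IsUni swapCore := by
  apply isUni_of_left
  ext i j
  fin_cases i <;> fin_cases j <;> simp [swapCore, Matrix.mul_apply, Fin.sum_univ_two]

theorem seg_mul_unit_of_ne {m a l j : ℕ} {q : ℕ → Core} (h : j < a ∨ a + l < j) :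
    seg m q a l * incl m 1 j = incl m 1 j := by
  induction l generalizing a with
  | zero => rw [seg_zero, Matrix.one_mul]
  | succ l ih =>
    rw [seg_succ, Matrix.mul_assoc, ih (by omega), embed_mul_unit_of_ne _ (by omega)]

/-- A descending sequence of swaps is a cyclic shift of the unit vectors. -/
theorem seg_swap_mul_unit {m a l : ℕ} {q : ℕ → Core} (hm : a + l < m)
    (hq : ∀ j, a ≤ j → j < a + l → q j = swapCore) :
    (seg m q a l * incl m 1 (a + l) = incl m 1 a) ∧
      ∀ j, a ≤ j → j < a + l → seg m q a l * incl m 1 j = incl m 1 (j + 1) := by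
  induction l generalizing a with
  | zero => exact ⟨by rw [seg_zero, Matrix.one_mul, add_zero], fun j h1 h2 => by omega⟩
  | succ l ih =>
    obtain ⟨h1, h2⟩ := ih (a := a + 1) (by omega) fun j h h' => hq j (by omega) (by omega)
    have hs := hq a le_rfl (by omega)
    refine ⟨?_, fun j hj hj' => ?_⟩
    · rw [seg_succ, Matrix.mul_assoc, show a + (l + 1) = a + 1 + l by omega, h1, hs,
        embed_mul_unit_right (by omega)]
      simp [swapCore]
    · rw [seg_succ, Matrix.mul_assoc]
      rcases Nat.eq_or_lt_of_le hj with rfl | hj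
      · rw [seg_mul_unit_of_ne (by omega), hs, embed_mul_unit_left (by omega)]
        simp [swapCore]
      · rw [h2 j (by omega) (by omega), embed_mul_unit_of_ne _ (by omega)]

theorem seg_isUni {m a l : ℕ} {q : ℕ → Core} (h : a + l + 1 ≤ m) (hq : ∀ j, IsUni (q j)) :
    IsUni (seg m q a l) := by
  induction l generalizing a with
  | zero => rw [seg_zero]; exact isUni_one
  | succ l ih => rw [seg_succ]; exact (embed_isUni (by omega) (hq a)).mul (ih (by omega))

theorem seqMatrix_isUni {m : ℕ} (hm : 1 ≤ m) {q : ℕ → Core} (hq : ∀ j, IsUni (q j)) :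
    IsUni (seqMatrix m q) := by
  rw [seqMatrix_eq_seg]
  exact seg_isUni (by omega) hq

theorem IsUni.eq_conj_mul {m r : Type*} [Fintype m] [Fintype r] [DecidableEq m] [DecidableEq r]
    {U : Matrix m m ℂ} (h : IsUni U) {A B : Matrix m r ℂ} (e : U * A = B) : Uᴴ * B = A := by
  rw [← e, h.cancel]

/-! ### Compact storage of a spike -/

/-- The column `(x₀, …, x_ℓ, 0, …, 0)ᵀ`. -/
def spikeVec (n ℓ : ℕ) (x : ℕ → ℂ) : Matrix (Fin n) (Fin 1) ℂ :=
  fun i _ => if i.val ≤ ℓ then x i else 0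

/-- The identity matrix with the column `ℓ` replaced by `(x₀, …, x_ℓ, 0, …, 0)ᵀ`. -/
def spikeMat (n ℓ : ℕ) (x : ℕ → ℂ) : Matrix (Fin n) (Fin n) ℂ :=
  1 + (spikeVec n ℓ x - incl n 1 ℓ) * (incl n 1 ℓ)ᴴ

theorem exactFP_norm₂ (a b : ℂ) : exactFP.norm₂ a b = √(‖a‖ ^ 2 + ‖b‖ ^ 2) := by
  have := exactFP.norm₂_err le_rfl (by norm_num) a b
  simpa only [mul_zero, zero_mul, abs_nonpos_iff, sub_eq_zero] using this

theorem exactFP_givens (a b : ℂ) : exactFP.givens a b = rot a b := by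
  have := exactFP.givens_err le_rfl (by norm_num) a b
  simpa only [mul_zero, norm_le_zero_iff, sub_eq_zero] using this

theorem one_le_norm_spikeTail_exact (ℓ : ℕ) (x : ℕ → ℂ) (s : ℕ) :
    1 ≤ ‖spikeTail exactFP ℓ x s‖ := by
  induction s with
  | zero => simp [spikeTail]
  | succ s ih =>
    rw [spikeTail, exactFP_norm₂, Complex.norm_real, Real.norm_eq_abs,
      abs_of_nonneg (Real.sqrt_nonneg _)]
    exact ih.trans (FloatArith.le_hypot_right _ _)

theorem rot_conj_apply (a b : ℂ) :
    (rot a b)ᴴ 0 0 * a + (rot a b)ᴴ 0 1 * b = ((√(‖a‖ ^ 2 + ‖b‖ ^ 2) : ℝ) : ℂ) := by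
  rw [Matrix.conjTranspose_apply, Matrix.conjTranspose_apply]
  unfold rot
  split_ifs with h
  · simp [h.1, h.2]
  · have hN := sqrt_pos_of_ne h
    have hN2 : √(‖a‖ ^ 2 + ‖b‖ ^ 2) * √(‖a‖ ^ 2 + ‖b‖ ^ 2) = ‖a‖ ^ 2 + ‖b‖ ^ 2 :=
      Real.mul_self_sqrt (by positivity)
    obtain ⟨N, hNd⟩ : ∃ N, √(‖a‖ ^ 2 + ‖b‖ ^ 2) = N := ⟨_, rfl⟩
    rw [hNd] at hN hN2 ⊢
    have hN0 : (N : ℂ) ≠ 0 := by exact_mod_cast hN.ne'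
    have e : ∀ z : ℂ, starRingEnd ℂ z * z = ((‖z‖ ^ 2 : ℝ) : ℂ) := fun z => by
      rw [Complex.sq_norm]; exact Complex.normSq_eq_conj_mul_self.symm
    simp
    rw [div_mul_eq_mul_div, div_mul_eq_mul_div, e, e, ← add_div, div_eq_iff hN0,
      ← Complex.ofReal_mul, hN2, Complex.ofReal_add]

section Spike

variable {n ℓ : ℕ} {x : ℕ → ℂ}

theorem spikeC_exact_isUni (j : ℕ) : IsUni (spikeC exactFP n ℓ x j) := by
  unfold spikeC
  split_ifs
  · rw [exactFP_givens]; exact (rot_isUni _ _).conj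
  · exact swapCore_isUni
  · exact isUni_one

theorem storeSpike_exact_B_isUni (j : ℕ) : IsUni ((storeSpike exactFP n ℓ x).B j) := by
  by_cases h : j = ℓ
  · subst h
    simp only [storeSpike, Function.update_self]
    exact (spikeC_exact_isUni _).mul swapCore_isUni
  · simp only [storeSpike, Function.update_of_ne h]
    exact spikeC_exact_isUni _

/-- The upper cores of `C` collect the spike, from the bottom to the top, in its first entry. -/
theorem spikeC_collect (hℓ : ℓ < n) (s : ℕ) (hs : s ≤ ℓ + 1) :
    seg (n + 1) (spikeC exactFP n ℓ x) (ℓ + 1 - s) s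
        * ((∑ j ∈ Finset.range (ℓ + 1), x j • incl (n + 1) 1 j) - incl (n + 1) 1 (ℓ + 1))
      = (∑ j ∈ Finset.range (ℓ + 1 - s), x j • incl (n + 1) 1 j)
        + spikeTail exactFP ℓ x s • incl (n + 1) 1 (ℓ + 1 - s) := by
  induction s with
  | zero => simp [seg_zero, spikeTail, sub_eq_add_neg]
  | succ s ih =>
    obtain ⟨i, hi⟩ : ∃ i, ℓ - s = i := ⟨_, rfl⟩
    have e1 : ℓ + 1 - (s + 1) = i := by omega
    have e2 : ℓ + 1 - s = i + 1 := by omega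
    rw [e2] at ih
    have hq : spikeC exactFP n ℓ x i = (rot (x i) (spikeTail exactFP ℓ x s))ᴴ := by
      rw [spikeC, if_pos (by omega), exactFP_givens, show ℓ - i = s by omega]
    have ha := rot_annihilates (x i) (spikeTail exactFP ℓ x s)
    have hf := rot_conj_apply (x i) (spikeTail exactFP ℓ x s)
    rw [e1, seg_succ, Matrix.mul_assoc, ih (by omega), Finset.sum_range_succ, Matrix.mul_add,
      Matrix.mul_add, Matrix.mul_sum, Matrix.mul_smul, Matrix.mul_smul,
      embed_mul_unit_left (by omega), embed_mul_unit_right (by omega), add_assoc]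
    congr 1
    · refine Finset.sum_congr rfl fun j hj => ?_
      have := Finset.mem_range.1 hj
      rw [Matrix.mul_smul, embed_mul_unit_of_ne _ (by omega)]
    · rw [spikeTail, hi, exactFP_norm₂, ← hf, hq]
      have ha' : (rot (x i) (spikeTail exactFP ℓ x s))ᴴ 1 0 * x i
          + (rot (x i) (spikeTail exactFP ℓ x s))ᴴ 1 1 * spikeTail exactFP ℓ x s = 0 := ha
      have key : ∀ (a b c d y t : ℂ) (E F : Matrix (Fin (n + 1)) (Fin 1) ℂ),
          c * y + d * t = 0 → y • (a • E + c • F) + t • (b • E + d • F) = (a * y + b * t) • E := by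
        intro a b c d y t E F h
        have : y • (a • E + c • F) + t • (b • E + d • F)
            = (a * y + b * t) • E + (c * y + d * t) • F := by module
        rw [this, h, zero_smul, add_zero]
      exact key _ _ _ _ _ _ _ _ ha'

theorem incl_mul_spikeVec (hℓ : ℓ < n) :
    incl (n + 1) n 0 * spikeVec n ℓ x = ∑ j ∈ Finset.range (ℓ + 1), x j • incl (n + 1) 1 j := by
  ext i b
  rw [Matrix.sum_apply, Matrix.mul_apply]
  by_cases hi : i.val ≤ ℓ
  · rw [Finset.sum_eq_single (⟨i.val, by omega⟩ : Fin n), Finset.sum_eq_single i.val]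
    · simp [incl, spikeVec, hi]
    · intro j _ hj
      simp [incl, Ne.symm hj]
    · intro h
      exact absurd (Finset.mem_range.2 (by omega)) h
    · intro j _ hj
      have : i.val ≠ 0 + j.val := fun h => hj (Fin.ext (by simp; omega))
      rw [incl, if_neg this, zero_mul]
    · simp
  · rw [Finset.sum_eq_zero, Finset.sum_eq_zero]
    · intro j hj
      have := Finset.mem_range.1 hj
      have : i.val ≠ j := by omega
      simp [incl, this]
    · intro j _
      by_cases h : i.val = j.val
      · have : ¬ j.val ≤ ℓ := by omega
        simp [spikeVec, this]
      · simp [incl, h]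

/-- What is needed about the stored data of a spike, in exact arithmetic: the number `α` is the norm
of the vector `(x₀, …, x_ℓ, -1)`, and `ρ = -α⁻¹`. -/
theorem storeSpike_exact_C (hℓ : ℓ < n) : ∃ α : ℂ, α ≠ 0 ∧ ‖α‖ ^ 2 = ‖spikeVec n ℓ x‖ ^ 2 + 1 ∧
    rho n (seqMatrix (n + 1) (storeSpike exactFP n ℓ x).C) = -α⁻¹ ∧
    spikeCol n (seqMatrix (n + 1) (storeSpike exactFP n ℓ x).C) = α⁻¹ • spikeVec n ℓ x := by
  have hU : IsUni (seqMatrix (n + 1) (spikeC exactFP n ℓ x)) :=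
    seqMatrix_isUni (by omega) fun j => spikeC_exact_isUni j
  -- `C` maps `(x₀, …, x_ℓ, 0, …, 0, -1)ᵀ` to `α e₁`: the swaps bring the last entry up to position
  -- `ℓ + 1`, the rotations then collect everything in the first entry
  have hCX : seqMatrix (n + 1) (spikeC exactFP n ℓ x)
        * (incl (n + 1) n 0 * spikeVec n ℓ x - incl (n + 1) 1 n)
      = spikeTail exactFP ℓ x (ℓ + 1) • incl (n + 1) 1 0 := by
    rw [incl_mul_spikeVec hℓ, seqMatrix_eq_seg, show n + 1 - 1 = (ℓ + 1) + (n - ℓ - 1) by omega,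
      seg_add, Matrix.mul_assoc, Matrix.mul_sub, Matrix.mul_sum]
    have h1 := (seg_swap_mul_unit (m := n + 1) (a := ℓ + 1) (l := n - ℓ - 1)
      (q := spikeC exactFP n ℓ x) (by omega) (fun j h h' => by
        rw [spikeC, if_neg (by omega), if_pos (by omega)])).1
    rw [show ℓ + 1 + (n - ℓ - 1) = n by omega] at h1
    rw [zero_add, h1]
    have h2 : ∑ j ∈ Finset.range (ℓ + 1), seg (n + 1) (spikeC exactFP n ℓ x) (ℓ + 1) (n - ℓ - 1)
          * (x j • incl (n + 1) 1 j) = ∑ j ∈ Finset.range (ℓ + 1), x j • incl (n + 1) 1 j := by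
      refine Finset.sum_congr rfl fun j hj => ?_
      have := Finset.mem_range.1 hj
      rw [Matrix.mul_smul, seg_mul_unit_of_ne (by omega)]
    have h3 := spikeC_collect (x := x) hℓ (ℓ + 1) le_rfl
    rw [Nat.sub_self] at h3
    rw [h2, h3]
    simp
  have hα0 : spikeTail exactFP ℓ x (ℓ + 1) ≠ 0 := by
    have := one_le_norm_spikeTail_exact ℓ x (ℓ + 1)
    intro h
    rw [h, norm_zero] at this
    linarith
  obtain ⟨α, hα⟩ : ∃ α, spikeTail exactFP ℓ x (ℓ + 1) = α := ⟨_, rfl⟩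
  rw [hα] at hCX hα0
  have hcol : (seqMatrix (n + 1) (spikeC exactFP n ℓ x))ᴴ * incl (n + 1) 1 0
      = α⁻¹ • (incl (n + 1) n 0 * spikeVec n ℓ x - incl (n + 1) 1 n) := by
    have := hU.eq_conj_mul hCX
    rw [← this, Matrix.mul_smul, smul_smul, inv_mul_cancel₀ hα0, one_smul]
  refine ⟨α, hα0, ?_, ?_, ?_⟩
  · have h1 := hU.norm_mul (incl (n + 1) n 0 * spikeVec n ℓ x - incl (n + 1) 1 n)
    rw [hCX, norm_smul] at h1
    have h2 : ‖(incl (n + 1) 1 0 : Matrix (Fin (n + 1)) (Fin 1) ℂ)‖ ^ 2 = 1 := by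
      have := norm_isometry_mul (incl_isometry (m := n + 1) (r := 1) (i := 0) (by omega))
        (1 : Matrix (Fin 1) (Fin 1) ℂ)
      rw [Matrix.mul_one] at this
      rw [this, isUni_norm_sq isUni_one, Nat.cast_one]
    have h3 : ‖α‖ ^ 2 = ‖incl (n + 1) n 0 * spikeVec n ℓ x - incl (n + 1) 1 n‖ ^ 2 := by
      rw [← h1, mul_pow, h2, mul_one]
    have h4 : ∀ i : Fin n, ∀ b, (incl (n + 1) n 0 * spikeVec n ℓ x) i.castSucc b
        = spikeVec n ℓ x i b := fun i b => by
      rw [← incl_conj_mul_apply (i := 0) (incl (n + 1) n 0 * spikeVec n ℓ x) b i (by simp),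
        ← Matrix.mul_assoc, incl_isometry (by omega), Matrix.one_mul]
    have h5 : ∀ b, (incl (n + 1) n 0 * spikeVec n ℓ x) (Fin.last n) b = 0 := fun b => by
      rw [← incl_conj_mul_apply (i := n) (incl (n + 1) n 0 * spikeVec n ℓ x) b (0 : Fin 1)
        (by simp), ← Matrix.mul_assoc, incl_orth (by omega), Matrix.zero_mul, Matrix.zero_apply]
    rw [h3, frobenius_norm_sq, Fin.sum_univ_castSucc, frobenius_norm_sq]
    congr 1
    · refine Finset.sum_congr rfl fun i _ => Finset.sum_congr rfl fun b _ => ?_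
      have := i.2
      have h6 : i.val ≠ n + b.val := by omega
      rw [Matrix.sub_apply, h4, incl, Fin.val_castSucc, if_neg h6, sub_zero]
    · rw [Fin.sum_univ_one, Matrix.sub_apply, h5]
      simp [incl]
  · rw [rho, Matrix.mul_assoc]
    change ((incl (n + 1) 1 n)ᴴ * ((seqMatrix (n + 1) (spikeC exactFP n ℓ x))ᴴ
      * incl (n + 1) 1 0)) 0 0 = _
    rw [hcol, Matrix.mul_smul, Matrix.mul_sub, ← Matrix.mul_assoc,
      incl_orth (by omega), Matrix.zero_mul, incl_isometry (by omega)]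
    simp
  · rw [spikeCol, Matrix.mul_assoc]
    change (incl (n + 1) n 0)ᴴ * ((seqMatrix (n + 1) (spikeC exactFP n ℓ x))ᴴ
      * incl (n + 1) 1 0) = _
    rw [hcol, Matrix.mul_smul, Matrix.mul_sub, ← Matrix.mul_assoc,
      incl_isometry (by omega), Matrix.one_mul, incl_orth (by omega), sub_zero]

/-- In exact arithmetic, `Cᴴ B` swaps the coordinates `ℓ` and `n`. -/
theorem storeSpike_exact_CB (hℓ : ℓ < n) :
    (seqMatrix (n + 1) (storeSpike exactFP n ℓ x).C)ᴴ
        * seqMatrix (n + 1) (storeSpike exactFP n ℓ x).B * incl (n + 1) n 0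
      = incl (n + 1) n 0 * (1 - incl n 1 ℓ * (incl n 1 ℓ)ᴴ)
        + incl (n + 1) 1 n * (incl n 1 ℓ)ᴴ := by
  obtain ⟨q, hq⟩ : ∃ q, spikeC exactFP n ℓ x = q := ⟨_, rfl⟩
  have hqU : ∀ j, IsUni (q j) := fun j => hq ▸ spikeC_exact_isUni j
  have hC : seqMatrix (n + 1) (storeSpike exactFP n ℓ x).C
      = seg (n + 1) q 0 ℓ * embed (n + 1) ℓ (q ℓ) * seg (n + 1) q (ℓ + 1) (n - 1 - ℓ) := by
    simp only [storeSpike, hq]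
    rw [seqMatrix_split (i := ℓ) (by omega), show n + 1 - 2 - ℓ = n - 1 - ℓ by omega]
  have hB : seqMatrix (n + 1) (storeSpike exactFP n ℓ x).B
      = seg (n + 1) q 0 ℓ * (embed (n + 1) ℓ (q ℓ) * embed (n + 1) ℓ swapCore)
        * seg (n + 1) q (ℓ + 1) (n - 1 - ℓ) := by
    simp only [storeSpike, hq]
    rw [seqMatrix_split (i := ℓ) (by omega), show n + 1 - 2 - ℓ = n - 1 - ℓ by omega,
      Function.update_self, embed_mul (by omega)]
    congr 1
    · congr 1
      exact seg_congr (q := Function.update q ℓ (q ℓ * swapCore)) (q' := q) fun i _ h =>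
        Function.update_of_ne (by omega) _ _
    · exact seg_congr (q := Function.update q ℓ (q ℓ * swapCore)) (q' := q) fun i h _ =>
        Function.update_of_ne (by omega) _ _
  obtain ⟨W, hW⟩ : ∃ W, seg (n + 1) q (ℓ + 1) (n - 1 - ℓ) = W := ⟨_, rfl⟩
  have hWU : IsUni W := hW ▸ seg_isUni (by omega) hqU
  obtain ⟨hs1, hs2⟩ := seg_swap_mul_unit (m := n + 1) (a := ℓ + 1) (l := n - 1 - ℓ) (q := q)
    (by omega) (fun j h h' => by rw [← hq, spikeC, if_neg (by omega), if_pos (by omega)])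
  rw [show ℓ + 1 + (n - 1 - ℓ) = n by omega, hW] at hs1
  -- `B` differs from `C` by one swap in the middle, and the upper parts cancel in `Cᴴ B`
  have hCB : (seqMatrix (n + 1) (storeSpike exactFP n ℓ x).C)ᴴ
      * seqMatrix (n + 1) (storeSpike exactFP n ℓ x).B = Wᴴ * embed (n + 1) ℓ swapCore * W := by
    have h1 : IsUni (seg (n + 1) q 0 ℓ) := seg_isUni (by omega) hqU
    have h2 : IsUni (embed (n + 1) ℓ (q ℓ)) := embed_isUni (by omega) (hqU ℓ)
    rw [hC, hB, hW]
    simp only [Matrix.conjTranspose_mul, Matrix.mul_assoc]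
    rw [h1.cancel, h2.cancel]
  rw [hCB]
  apply ext_unit_cols
  intro j hj
  have hcol : incl (n + 1) n 0 * incl n 1 j = incl (n + 1) 1 j := by
    rw [incl_mul_incl (by omega), zero_add]
  simp only [Matrix.add_mul, Matrix.mul_assoc, Matrix.sub_mul, Matrix.one_mul, Matrix.mul_sub]
  rw [hcol]
  by_cases h : j = ℓ
  · subst h
    have h1 : W * incl (n + 1) 1 j = incl (n + 1) 1 j := by
      rw [← hW, seg_mul_unit_of_ne (by omega)]
    rw [h1, embed_mul_unit_left (by omega), incl_isometry (by omega), Matrix.mul_one, Matrix.mul_one,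
      hcol, sub_self, zero_add]
    simp only [swapCore, Matrix.of_apply, Matrix.cons_val', Matrix.cons_val_zero,
      Matrix.cons_val_fin_one, zero_smul, Matrix.cons_val_one, one_smul, zero_add]
    exact hWU.eq_conj_mul hs1
  · rw [incl_orth (by omega)]
    simp only [Matrix.mul_zero, sub_zero, add_zero]
    rcases lt_or_gt_of_ne h with h | h
    · have h1 : W * incl (n + 1) 1 j = incl (n + 1) 1 j := by
        rw [← hW, seg_mul_unit_of_ne (by omega)]
      rw [h1, embed_mul_unit_of_ne _ (by omega)]
      exact hWU.eq_conj_mul h1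
    · have h1 : W * incl (n + 1) 1 j = incl (n + 1) 1 (j + 1) := by
        rw [← hW]; exact hs2 j (by omega) (by omega)
      rw [h1, embed_mul_unit_of_ne _ (by omega)]
      exact hWU.eq_conj_mul h1

/-- The spike row is a unit vector: it does not depend on the size of the spike. -/
theorem storeSpike_exact_row (hℓ : ℓ < n) :
    spikeRow n (seqMatrix (n + 1) (storeSpike exactFP n ℓ x).C)
      (seqMatrix (n + 1) (storeSpike exactFP n ℓ x).B) = (incl n 1 ℓ)ᴴ := by
  rw [spikeRow, Matrix.mul_assoc, storeSpike_exact_CB hℓ, Matrix.mul_add, ← Matrix.mul_assoc,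
    incl_orth (by omega), ← Matrix.mul_assoc, incl_isometry (by omega), Matrix.zero_mul,
    Matrix.one_mul, zero_add]

/-- In exact arithmetic, the compact storage represents the identity-plus-spike matrix. -/
theorem storeSpike_exact_toMatrix (hℓ : ℓ < n) :
    (storeSpike exactFP n ℓ x).toMatrix n = spikeMat n ℓ x := by
  obtain ⟨α, hα0, -, hρ, hcol⟩ := storeSpike_exact_C (x := x) hℓ
  rw [toMatrix_eq_rep, rep, storeSpike_exact_row hℓ, hρ, hcol, Matrix.mul_assoc,
    storeSpike_exact_CB hℓ, Matrix.mul_add, ← Matrix.mul_assoc, incl_isometry (by omega),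
    ← Matrix.mul_assoc, incl_orth (by omega), Matrix.one_mul, Matrix.zero_mul, add_zero,
    Matrix.smul_mul, smul_smul, neg_inv, inv_inv, neg_mul, mul_inv_cancel₀ hα0, spikeMat,
    Matrix.sub_mul]
  module

end Spike

/-! ### Rounding errors of the compact storage -/

theorem abs_hypot_sub_le (a b b' : ℂ) :
    |√(‖a‖ ^ 2 + ‖b'‖ ^ 2) - √(‖a‖ ^ 2 + ‖b‖ ^ 2)| ≤ ‖b' - b‖ := by
  have e : ∀ c : ℂ, √(‖a‖ ^ 2 + ‖c‖ ^ 2) = ‖WithLp.toLp 2 ![a, c]‖ := fun c => by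
    rw [EuclideanSpace.norm_eq]; simp
  rw [e, e]
  refine (abs_norm_sub_norm_le _ _).trans (le_of_eq ?_)
  rw [← WithLp.toLp_sub, EuclideanSpace.norm_eq]
  simp

/-- Sensitivity of the rotation to a relative perturbation of the second component. -/
theorem norm_rot_sub_le {η : ℝ} (hη : η ≤ 1 / 2) (a : ℂ) {b b' : ℂ} (hb : b ≠ 0)
    (h : ‖b' - b‖ ≤ η * ‖b‖) : ‖rot a b' - rot a b‖ ≤ 12 * η := by
  have hb0 : 0 < ‖b‖ := norm_pos_iff.2 hb
  have hη0 : 0 ≤ η := by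
    by_contra hc
    nlinarith [norm_nonneg (b' - b)]
  have hbb : ‖b‖ ≤ 2 * ‖b'‖ := by
    have := norm_sub_norm_le b b'
    rw [norm_sub_rev] at this
    nlinarith
  have hb' : b' ≠ 0 := fun h => by rw [h, norm_zero] at hbb; linarith
  have hN := sqrt_pos_of_ne (a := a) (b := b) (fun h => hb h.2)
  have hN' := sqrt_pos_of_ne (a := a) (b := b') (fun h => hb' h.2)
  have hd := (abs_hypot_sub_le a b b').trans h
  have ha := FloatArith.le_hypot_left a b
  have hbN := FloatArith.le_hypot_right a b
  have hbN' := FloatArith.le_hypot_right a b'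
  unfold rot
  rw [if_neg (fun h => hb' h.2), if_neg (fun h => hb h.2)]
  obtain ⟨N, hNd⟩ : ∃ N, √(‖a‖ ^ 2 + ‖b‖ ^ 2) = N := ⟨_, rfl⟩
  obtain ⟨N', hNd'⟩ : ∃ N, √(‖a‖ ^ 2 + ‖b'‖ ^ 2) = N := ⟨_, rfl⟩
  rw [hNd] at hN hd ha hbN ⊢
  rw [hNd'] at hN' hd hbN' ⊢
  have hNc : (N : ℂ) ≠ 0 := by exact_mod_cast hN.ne'
  have hNc' : (N' : ℂ) ≠ 0 := by exact_mod_cast hN'.ne'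
  have key : ∀ z z' : ℂ, ‖z‖ ≤ N → ‖z' / (N' : ℂ) - z / (N : ℂ)‖ ≤ (‖z' - z‖ + η * ‖b‖) / N' := by
    intro z z' hz
    have e : z' / (N' : ℂ) - z / (N : ℂ) = ((z' - z) - z * ((N' - N : ℝ) : ℂ) / N) / N' := by
      push_cast
      field_simp
      ring
    rw [e, norm_div, Complex.norm_real, Real.norm_eq_abs, abs_of_pos hN']
    gcongr
    refine (norm_sub_le _ _).trans ?_
    gcongr
    rw [norm_div, norm_mul, Complex.norm_real, Complex.norm_real, Real.norm_eq_abs,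
      Real.norm_eq_abs, abs_of_pos hN, div_le_iff₀ hN]
    calc ‖z‖ * |N' - N| ≤ N * (η * ‖b‖) := by gcongr
      _ = η * ‖b‖ * N := by ring
  have k1 : ‖a / (N' : ℂ) - a / (N : ℂ)‖ ≤ 2 * η := by
    refine (key a a ha).trans ?_
    rw [sub_self, norm_zero, zero_add, div_le_iff₀ hN']
    nlinarith
  have k2 : ‖b' / (N' : ℂ) - b / (N : ℂ)‖ ≤ 4 * η := by
    refine (key b b' hbN).trans ?_
    rw [div_le_iff₀ hN']
    nlinarith
  refine (norm_le_sum_fin_two _).trans ?_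
  simp only [Matrix.sub_apply, Matrix.of_apply, Matrix.cons_val', Matrix.cons_val_zero,
    Matrix.cons_val_one, Matrix.cons_val_fin_one, neg_sub_neg, ← star_sub, norm_star]
  rw [norm_sub_rev (b / (N : ℂ))]
  linarith

section SpikeErrors

variable {u : ℝ} (fp : FloatArith u) {n ℓ : ℕ} {x : ℕ → ℂ}

/-- The relative error of the accumulated length grows linearly. -/
theorem spikeTail_err (hu : 0 ≤ u) (hu1 : u ≤ 1 / 10) (s : ℕ) (hs : 72 * (s * u) ≤ 1) :
    ‖spikeTail fp ℓ x s - spikeTail exactFP ℓ x s‖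
      ≤ 9 * (s * u) * ‖spikeTail exactFP ℓ x s‖ := by
  induction s with
  | zero => simp [spikeTail]
  | succ s ih =>
    push_cast at hs ⊢
    have ih := ih (by nlinarith)
    have h1 := fp.norm₂_err hu hu1 (x (ℓ - s)) (spikeTail fp ℓ x s)
    have h2 := abs_hypot_sub_le (x (ℓ - s)) (spikeTail exactFP ℓ x s) (spikeTail fp ℓ x s)
    have h3 := FloatArith.le_hypot_right (x (ℓ - s)) (spikeTail exactFP ℓ x s)
    rw [spikeTail, spikeTail, exactFP_norm₂, ← Complex.ofReal_sub, Complex.norm_real,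
      Complex.norm_real, Real.norm_eq_abs, Real.norm_eq_abs, abs_of_nonneg (Real.sqrt_nonneg _)]
    obtain ⟨N, hN⟩ : ∃ N, √(‖x (ℓ - s)‖ ^ 2 + ‖spikeTail exactFP ℓ x s‖ ^ 2) = N := ⟨_, rfl⟩
    obtain ⟨N', hN'⟩ : ∃ N, √(‖x (ℓ - s)‖ ^ 2 + ‖spikeTail fp ℓ x s‖ ^ 2) = N := ⟨_, rfl⟩
    obtain ⟨F, hF⟩ : ∃ F, fp.norm₂ (x (ℓ - s)) (spikeTail fp ℓ x s) = F := ⟨_, rfl⟩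
    rw [hN] at h2 h3 ⊢
    rw [hN'] at h1 h2
    rw [hF] at h1 ⊢
    have hN0 : 0 ≤ N := by rw [← hN]; exact Real.sqrt_nonneg _
    have hsu : 0 ≤ (s : ℝ) * u := by positivity
    have h4 : |N' - N| ≤ 9 * (s * u) * N :=
      h2.trans (ih.trans (mul_le_mul_of_nonneg_left h3 (by positivity)))
    have h5 : N' ≤ 9 / 8 * N := by
      have := (abs_le.1 h4).2
      nlinarith
    calc |F - N| ≤ |F - N'| + |N' - N| := abs_sub_le _ _ _
      _ ≤ 8 * u * (9 / 8 * N) + 9 * (s * u) * N := by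
          gcongr
          exact h1.trans (by gcongr)
      _ = 9 * ((s + 1) * u) * N := by ring

theorem spikeC_err (hs : SmallFor u (n + 1)) (hℓ : ℓ < n) (j : ℕ) :
    ‖spikeC fp n ℓ x j - spikeC exactFP n ℓ x j‖ ≤ 228 * ((n + 1) * u) := by
  have hu := hs.nonneg
  have hu1 := hs.le
  have hm := hs.mul_le
  push_cast at hm
  unfold spikeC
  split_ifs with h1 h2
  · rw [← Matrix.conjTranspose_sub, Matrix.frobenius_norm_conjTranspose, exactFP_givens]
    have hl : ((ℓ - j : ℕ) : ℝ) ≤ n + 1 := by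
      exact_mod_cast (by omega : ℓ - j ≤ n + 1)
    have hlu : ((ℓ - j : ℕ) : ℝ) * u ≤ (n + 1) * u := by gcongr
    have e1 := fp.givens_err hu (by linarith) (x j) (spikeTail fp ℓ x (ℓ - j))
    have e2 := spikeTail_err fp (ℓ := ℓ) (x := x) hu (by linarith) (ℓ - j) (by linarith)
    have hne : spikeTail exactFP ℓ x (ℓ - j) ≠ 0 := by
      have := one_le_norm_spikeTail_exact ℓ x (ℓ - j)
      intro h
      rw [h, norm_zero] at this
      linarith
    have e3 := norm_rot_sub_le (by linarith) (x j) hne e2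
    have hnu : u ≤ (n + 1) * u := by
      have : 0 ≤ (n : ℝ) * u := by positivity
      linarith
    refine (norm_sub_le_norm_sub_add_norm_sub _ _ _).trans ((add_le_add e1 e3).trans ?_)
    linarith
  · simp; positivity
  · simp; positivity

theorem spikeC_good (hs : SmallFor u (n + 1)) : GoodSeq u (spikeC fp n ℓ x) := by
  intro j
  have hu := hs.nonneg
  have hu1 := hs.le
  unfold spikeC
  split_ifs
  · exact (fp.givens_nearU hu (by linarith) _ _).conj
  · exact nearU_of_isUni (by positivity) swapCore_isUni
  · exact nearU_of_isUni (by positivity) isUni_one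

theorem NearU.mul_isUni {ε : ℝ} {G W : Core} (h : NearU ε G) (hW : IsUni W) : NearU ε (G * W) := by
  obtain ⟨V, hV, h⟩ := h
  exact ⟨V * W, hV.mul hW, by rwa [← Matrix.sub_mul, hW.norm_mul']⟩

theorem storeSpike_good (hs : SmallFor u (n + 1)) : GoodTri u (storeSpike fp n ℓ x) :=
  ⟨spikeC_good fp hs, (spikeC_good fp hs).update ((spikeC_good fp hs ℓ).mul_isUni swapCore_isUni)⟩

/-- Perturbation of a unitary descending sequence core by core. -/
theorem norm_seg_sub_le {m a l : ℕ} (hs : SmallFor u m) {q q' : ℕ → Core} {δ : ℝ}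
    (hq : ∀ j, IsUni (q j)) (hq' : GoodSeq u q') (h : a + l + 1 ≤ m)
    (hδ : ∀ j, ‖q' j - q j‖ ≤ δ) : ‖seg m q' a l - seg m q a l‖ ≤ 2 * (l * δ) := by
  induction l generalizing a with
  | zero => simp [seg_zero]
  | succ l ih =>
    have e : seg m q' a (l + 1) - seg m q a (l + 1)
        = (embed m a (q' a) - embed m a (q a)) * seg m q' (a + 1) l
          + embed m a (q a) * (seg m q' (a + 1) l - seg m q (a + 1) l) := by
      rw [seg_succ, seg_succ, Matrix.sub_mul, Matrix.mul_sub]; abel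
    rw [e]
    have h1 := norm_mul_seg_le hs hq' (a := a + 1) (l := l) (by omega)
      (embed m a (q' a) - embed m a (q a))
    rw [norm_embed_sub (by omega)] at h1
    refine (norm_add_le _ _).trans ((add_le_add h1 (le_of_eq
      ((embed_isUni (by omega) (hq a)).norm_mul _))).trans ?_)
    have h2 := ih (a := a + 1) (by omega)
    have h3 := hδ a
    push_cast
    linarith

/-- Computed and exact compact storage differ by errors of order `n² u` in the two unitary
matrices, uniformly in the spike. -/
theorem storeSpike_sim (hs : SmallFor u (n + 1)) (hℓ : ℓ < n) :
    TriSim n (456 * ((n + 1) ^ 2 * u)) 1 1 (storeSpike exactFP n ℓ x) (storeSpike fp n ℓ x) := by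
  have hu := hs.nonneg
  have hB : ∀ j, ‖(storeSpike fp n ℓ x).B j - (storeSpike exactFP n ℓ x).B j‖
      ≤ 228 * ((n + 1) * u) := by
    intro j
    by_cases h : j = ℓ
    · subst h
      simp only [storeSpike, Function.update_self]
      rw [← Matrix.sub_mul, swapCore_isUni.norm_mul']
      exact spikeC_err fp hs hℓ j
    · simp only [storeSpike, Function.update_of_ne h]
      exact spikeC_err fp hs hℓ j
  have hle : 2 * (((n + 1 - 1 : ℕ) : ℝ) * (228 * ((n + 1) * u))) ≤ 456 * ((n + 1) ^ 2 * u) := by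
    rw [Nat.add_sub_cancel]
    have : 0 ≤ ((n : ℝ) + 1) * u := by positivity
    nlinarith
  refine ⟨1, isUni_one, by rw [Matrix.one_mul], ?_, ?_⟩
  · rw [hat_one, Matrix.conjTranspose_one, Matrix.one_mul, Matrix.mul_one, seqMatrix_eq_seg,
      seqMatrix_eq_seg]
    exact (norm_seg_sub_le hs (fun j => spikeC_exact_isUni j) (storeSpike_good fp hs).1 (by omega)
      (spikeC_err fp hs hℓ)).trans hle
  · rw [hat_one, Matrix.conjTranspose_one, Matrix.one_mul, Matrix.mul_one, seqMatrix_eq_seg,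
      seqMatrix_eq_seg]
    exact (norm_seg_sub_le hs storeSpike_exact_B_isUni (storeSpike_good fp hs).2 (by omega)
      hB).trans hle

end SpikeErrors

/-! ### Balance of the triangular factors of a block column -/

theorem spikeMat_apply {n ℓ : ℕ} {x : ℕ → ℂ} (i c : Fin n) :
    spikeMat n ℓ x i c = if c.val = ℓ then spikeVec n ℓ x i 0
      else (1 : Matrix (Fin n) (Fin n) ℂ) i c := by
  rw [spikeMat, Matrix.add_apply, Matrix.mul_apply, Fin.sum_univ_one, Matrix.conjTranspose_apply,
    Matrix.sub_apply]
  by_cases h : c.val = ℓ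
  · have h1 : incl n 1 ℓ c 0 = 1 := by simp [incl, h]
    have h2 : incl n 1 ℓ i 0 = (1 : Matrix (Fin n) (Fin n) ℂ) i c := by
      simp [incl, Matrix.one_apply, Fin.ext_iff, h]
    rw [if_pos h, h1, h2, star_one, mul_one, add_sub_cancel]
  · have h1 : incl n 1 ℓ c 0 = 0 := by simp [incl, h]
    rw [if_neg h, h1, star_zero, mul_zero, add_zero]

theorem norm_sq_le_of_cols {m n : ℕ} {X : Matrix (Fin m) (Fin n) ℂ} {b : ℝ}
    (h : ∀ c, ∑ i, ‖X i c‖ ^ 2 ≤ b) : ‖X‖ ^ 2 ≤ n * b := by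
  rw [frobenius_norm_sq, Finset.sum_comm]
  refine (Finset.sum_le_sum fun c _ => h c).trans (le_of_eq ?_)
  simp

theorem col_sum_le {m n : ℕ} (X : Matrix (Fin m) (Fin n) ℂ) (c : Fin n) :
    ∑ i, ‖X i c‖ ^ 2 ≤ ‖X‖ ^ 2 := by
  rw [frobenius_norm_sq, Finset.sum_comm]
  exact Finset.single_le_sum (f := fun c => ∑ i, ‖X i c‖ ^ 2) (fun c _ => by positivity)
    (Finset.mem_univ c)

theorem unit_sum_le {n : ℕ} (p : ℕ) :
    ∑ i : Fin n, ‖(if i.val = p then 1 else 0 : ℂ)‖ ^ 2 ≤ 1 := by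
  by_cases hp : p < n
  · rw [Finset.sum_eq_single (⟨p, hp⟩ : Fin n)]
    · simp
    · intro i _ hi
      rw [if_neg (fun h => hi (Fin.ext h))]
      simp
    · simp
  · rw [Finset.sum_eq_zero]
    · exact zero_le_one
    · intro i _
      rw [if_neg (by omega)]
      simp

/-- The columns `c` of `G` with `P c`, and the columns of the identity matrix otherwise. -/
def pickCols {n : ℕ} (P : ℕ → Prop) [DecidablePred P] (G : Matrix (Fin n) (Fin n) ℂ) :
    Matrix (Fin n) (Fin n) ℂ :=
  fun i c => if P c.val then G i c else (1 : Matrix (Fin n) (Fin n) ℂ) i c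

section PickCols

variable {n : ℕ} {G : Matrix (Fin n) (Fin n) ℂ}

theorem pickCols_congr {P P' : ℕ → Prop} [DecidablePred P] [DecidablePred P']
    (h : ∀ c < n, P c ↔ P' c) : pickCols P G = pickCols P' G := by
  ext i c
  simp only [pickCols, h c c.2]

/-- Columns of an upper triangular matrix, in the order from the right to the left. -/
theorem pickCols_mul {P P' : ℕ → Prop} [DecidablePred P] [DecidablePred P']
    (hG : G.BlockTriangular id) (h : ∀ c c', P c → P' c' → c' < c) :
    pickCols P G * pickCols P' G = pickCols (fun c => P c ∨ P' c) G := by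
  ext r c
  rw [Matrix.mul_apply]
  by_cases hc : P' c.val
  · rw [show pickCols (fun c => P c ∨ P' c) G r c = G r c by simp [pickCols, hc],
      Finset.sum_eq_single r]
    · by_cases hr : P r.val
      · have h0 : G r c = 0 := hG (show c < r from h _ _ hr hc)
        simp [pickCols, hc, h0]
      · simp [pickCols, hc, hr]
    · intro i _ hi
      by_cases hP : P i.val
      · have h0 : G i c = 0 := hG (show c < i from h _ _ hP hc)
        simp [pickCols, hc, h0]
      · simp [pickCols, hP, Matrix.one_apply_ne (Ne.symm hi)]
    · simp
  · rw [Finset.sum_eq_single c]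
    · simp [pickCols, hc]
    · intro i _ hi
      simp [pickCols, hc, Matrix.one_apply_ne hi]
    · simp

/-- A choice of columns of `G` is no larger than `G`, up to the unit columns. -/
theorem norm_pickCols_le {P : ℕ → Prop} [DecidablePred P] :
    ‖pickCols P G‖ ^ 2 ≤ n * (1 + ‖G‖ ^ 2) := by
  refine norm_sq_le_of_cols fun c => ?_
  by_cases hc : P c.val
  · simp only [pickCols, hc, if_true]
    linarith [col_sum_le G c]
  · simp only [pickCols, hc, if_false]
    have := unit_sum_le (n := n) c.val
    simp only [Matrix.one_apply, Fin.ext_iff]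
    nlinarith [sq_nonneg ‖G‖]

/-- In exact arithmetic, the list of the stored factors of a block column of width `m` has the
product that it should have, and it is balanced. -/
theorem spikes_listBal (hG : G.BlockTriangular id) {A : Matrix (Fin n) (Fin n) ℂ} (hA : IsUni A)
    {σ : ℝ} (hσ0 : 0 ≤ σ) (hσ : n * (1 + ‖G‖ ^ 2) ≤ σ ^ 2) (m s : ℕ) (hs : s + m ≤ n)
    (f : Fin m → ℕ → ℂ)
    (hf : ∀ t : Fin m, spikeVec n (n - 1 - (s + t)) (f t) = G * incl n 1 (n - 1 - (s + t))) :
    valProd (List.ofFn fun t : Fin m =>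
        (Factor.tri (storeSpike exactFP n (n - 1 - (s + t)) (f t)) : Factor n))
      = pickCols (fun c => n ≤ c + s + m ∧ c + s < n) G ∧
    ListBal σ (A * pickCols (fun c => n ≤ c + s) G) (List.ofFn fun t : Fin m =>
        (Factor.tri (storeSpike exactFP n (n - 1 - (s + t)) (f t)) : Factor n)) := by
  induction m generalizing s with
  | zero =>
    refine ⟨?_, by simp [ListBal]⟩
    ext i c
    rw [List.ofFn_zero, pickCols, if_neg (by omega)]
    rfl
  | succ m ih =>
    have ih := ih (s + 1) (by omega) (fun t => f t.succ) (fun t => by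
      have := hf t.succ
      rw [Fin.val_succ, show s + (t.val + 1) = s + 1 + t.val by omega] at this
      exact this)
    have hlist : (List.ofFn fun t : Fin (m + 1) =>
          (Factor.tri (storeSpike exactFP n (n - 1 - (s + t)) (f t)) : Factor n))
        = Factor.tri (storeSpike exactFP n (n - 1 - s) (f 0)) :: List.ofFn fun t : Fin m =>
          Factor.tri (storeSpike exactFP n (n - 1 - (s + 1 + t)) (f t.succ)) := by
      rw [List.ofFn_succ]
      simp only [Fin.val_zero, add_zero, Fin.val_succ]
      congr 2
      funext t
      rw [show s + (t.val + 1) = s + 1 + t.val by omega]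
    obtain ⟨ℓ, hℓ⟩ : ∃ ℓ, n - 1 - s = ℓ := ⟨_, rfl⟩
    have hf0 := hf 0
    rw [Fin.val_zero, add_zero] at hf0
    rw [hℓ] at hf0 hlist
    have hℓn : ℓ < n := by omega
    -- the factors are the columns of `G` one by one, from the right to the left
    have hval : (Factor.tri (storeSpike exactFP n ℓ (f 0)) : Factor n).val
        = pickCols (fun c => c = ℓ) G := by
      rw [Factor.val, storeSpike_exact_toMatrix hℓn]
      ext i c
      rw [spikeMat_apply, pickCols, hf0]
      by_cases h : c.val = ℓ
      · rw [if_pos h, if_pos h, mul_incl_apply G i 0 (c := c) (by simp [h])]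
      · rw [if_neg h, if_neg h]
    have hA2 : A * pickCols (fun c => n ≤ c + s) G * pickCols (fun c => c = ℓ) G
        = A * pickCols (fun c => n ≤ c + (s + 1)) G := by
      rw [Matrix.mul_assoc, pickCols_mul hG (fun c c' h h' => by omega)]
      congr 1
      exact pickCols_congr fun c _ => by omega
    rw [hlist]
    refine ⟨?_, ?_, ?_⟩
    · rw [valProd_cons, ih.1, hval, pickCols_mul hG (fun c c' h h' => by omega)]
      exact pickCols_congr fun c _ => by omega
    · rw [ih.1]
      obtain ⟨α, hα0, hα, hρ, hcol⟩ := storeSpike_exact_C (n := n) (x := f 0) hℓn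
      have hx : ‖spikeVec n ℓ (f 0)‖ ^ 2 ≤ ‖G‖ ^ 2 := by
        rw [hf0]
        exact pow_le_pow_left₀ (norm_nonneg _) (norm_mul_incl_le (by omega) _) 2
      have hn1 : (1 : ℝ) ≤ n := by exact_mod_cast (by omega : 1 ≤ n)
      refine ⟨⟨seqMatrix_isUni (by omega) fun j => spikeC_exact_isUni j,
        seqMatrix_isUni (by omega) storeSpike_exact_B_isUni⟩, ⟨?_, ?_⟩, ?_, ?_, ?_, ?_⟩
      · rw [hρ]
        exact neg_ne_zero.2 (inv_ne_zero hα0)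
      · rw [hρ, norm_neg, norm_inv, inv_inv]
        refine le_of_sq_le_sq ?_ hσ0
        nlinarith [sq_nonneg ‖G‖]
      · rw [hA.norm_mul]
        exact le_of_sq_le_sq (norm_pickCols_le.trans hσ) hσ0
      · exact le_of_sq_le_sq (norm_pickCols_le.trans hσ) hσ0
      -- the preceding factors fix the spike, as it ends above the rows in which they differ from
      -- the identity; so its product with `A` is a unitary image of the spike, of norm at most
      -- `|α|`
      · have h1 : pickCols (fun c => n ≤ c + s) G * spikeVec n ℓ (f 0) = spikeVec n ℓ (f 0) := by
          have e : spikeVec n ℓ (f 0) = pickCols (fun c => c = ℓ) G * incl n 1 ℓ := by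
            rw [hf0]
            ext i b
            rw [mul_incl_apply G i b (c := ⟨ℓ, hℓn⟩) (by simp),
              mul_incl_apply _ i b (c := ⟨ℓ, hℓn⟩) (by simp)]
            simp [pickCols]
          rw [e, ← Matrix.mul_assoc, pickCols_mul hG (fun c c' h h' => by omega)]
          ext i b
          rw [mul_incl_apply _ i b (c := ⟨ℓ, hℓn⟩) (by simp),
            mul_incl_apply _ i b (c := ⟨ℓ, hℓn⟩) (by simp)]
          simp [pickCols]
        rw [hcol, Matrix.mul_smul, Matrix.mul_assoc, h1, norm_smul, hA.norm_mul, norm_inv,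
          inv_mul_le_iff₀ (norm_pos_iff.2 hα0), mul_one]
        refine le_of_sq_le_sq ?_ (norm_nonneg _)
        rw [hα]
        linarith
      · rw [storeSpike_exact_row hℓn]
        -- the spike row `e_ℓᵀ` is fixed by the following factors, whose spikes end above row `ℓ`
        have h1 : (incl n 1 ℓ)ᴴ * pickCols (fun c => n ≤ c + (s + 1) + m ∧ c + (s + 1) < n) G
            = (incl n 1 ℓ)ᴴ := by
          ext b c
          rw [incl_conj_mul_apply _ c b (c := ⟨ℓ, hℓn⟩) (by simp),
            Matrix.conjTranspose_apply, pickCols, incl]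
          split_ifs with h1 h2 h2
          · omega
          · rw [hG (show c < ⟨ℓ, hℓn⟩ by rw [Fin.lt_def]; simp only; omega), star_zero]
          · rw [star_one, Matrix.one_apply, if_pos]
            ext; simp; omega
          · rw [star_zero, Matrix.one_apply_ne]
            intro h; apply h2; rw [← h]; simp
        rw [h1, Matrix.frobenius_norm_conjTranspose]
        refine le_of_sq_le_sq ?_ zero_le_one
        rw [frobenius_norm_sq]
        simpa [incl] using unit_sum_le (n := n) ℓ
    · rw [hval, hA2]
      exact ih.2

end PickCols

/-! ### Balance of the factorizations of `S` -/

section Shift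

variable {n : ℕ}

theorem shiftSeq_isUni (hn : 1 ≤ n) : IsUni (seqMatrix n (shiftSeq n)) :=
  seqMatrix_isUni hn fun j => by
    unfold shiftSeq
    split_ifs
    exacts [swapCore_isUni, isUni_one]

/-- The cyclic downshift acts on rows. -/
theorem shift_mul_apply {ι : Type*} (X : Matrix (Fin n) ι ℂ) (i : Fin n) (b : ι) :
    (seqMatrix n (shiftSeq n) * X) i b
      = X ⟨if i.val = 0 then n - 1 else i.val - 1, by have := i.2; split_ifs <;> omega⟩ b := by
  have hn : 1 ≤ n := i.pos
  have hQ : ∀ c : Fin n, seqMatrix n (shiftSeq n) i c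
      = if i.val = (if c.val + 1 < n then c.val + 1 else 0) then 1 else 0 := by
    intro c
    obtain ⟨h1, h2⟩ := seg_swap_mul_unit (m := n) (a := 0) (l := n - 1) (q := shiftSeq n) (by omega)
      (fun j _ h => by rw [shiftSeq, if_pos (by omega)])
    rw [← mul_incl_apply (seqMatrix n (shiftSeq n)) i (0 : Fin 1) (i := c.val) (by simp),
      seqMatrix_eq_seg]
    by_cases hc : c.val + 1 < n
    · rw [h2 c (by omega) (by omega), if_pos hc]
      simp [incl]
    · rw [zero_add] at h1
      rw [if_neg hc, show c.val = n - 1 by omega, h1]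
      simp [incl]
  rw [Matrix.mul_apply,
    Finset.sum_eq_single ⟨if i.val = 0 then n - 1 else i.val - 1, by have := i.2; split_ifs <;> omega⟩]
  · rw [hQ, if_pos, one_mul]
    simp only
    split_ifs <;> omega
  · intro c _ hc
    rw [hQ, if_neg, zero_mul]
    intro h
    apply hc
    ext
    simp only
    split_ifs at h ⊢ <;> omega
  · simp

theorem shift_pow_mul_apply {ι : Type*} (l : ℕ) (hl : l ≤ n) (X : Matrix (Fin n) ι ℂ) (r : Fin n)
    (b : ι) : (seqMatrix n (shiftSeq n) ^ l * X) r b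
      = X ⟨if l ≤ r.val then r.val - l else r.val + n - l, by have := r.2; split_ifs <;> omega⟩ b := by
  induction l generalizing X with
  | zero => simp
  | succ l ih =>
    rw [pow_succ, Matrix.mul_assoc, ih (by omega), shift_mul_apply]
    congr 1
    ext
    simp only
    split_ifs <;> omega

/-- The product of the first `j` Frobenius factors with the columns `m 0, m 1, …`. -/
def frobPrefix (n : ℕ) (m : ℕ → ℕ → ℂ) (j : ℕ) : Matrix (Fin n) (Fin n) ℂ := fun r c =>
  if c.val + j < n then (if r.val = c.val + j then 1 else 0) else m (c.val + j - n) r.val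

/-- The product of the Frobenius factors `j, …, k - 1`. -/
def frobSuffix (n k : ℕ) (m : ℕ → ℕ → ℂ) (j : ℕ) : Matrix (Fin n) (Fin n) ℂ := fun r c =>
  if c.val + (k - j) < n then (if r.val = c.val + (k - j) then 1 else 0)
  else if r.val + j < n then m (c.val + k - n) (r.val + j) else 0

/-- The Frobenius factor `j`. -/
def frobStep (n : ℕ) (m : ℕ → ℕ → ℂ) (j : ℕ) : Matrix (Fin n) (Fin n) ℂ := fun r c =>
  if c.val + 1 < n then (if r.val = c.val + 1 then 1 else 0)
  else if r.val + j < n then m j (r.val + j) else 0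

theorem frobPrefix_zero (m : ℕ → ℕ → ℂ) : frobPrefix n m 0 = 1 := by
  ext r c
  rw [frobPrefix, if_pos (by omega)]
  simp [Matrix.one_apply, Fin.ext_iff]

theorem frobSuffix_self (k : ℕ) (m : ℕ → ℕ → ℂ) : frobSuffix n k m k = 1 := by
  ext r c
  rw [frobSuffix, if_pos (by omega)]
  simp [Matrix.one_apply, Fin.ext_iff]

theorem frobSuffix_zero (k : ℕ) (m : ℕ → ℕ → ℂ) : frobSuffix n k m 0 = frobPrefix n m k := by
  ext r c
  simp only [frobSuffix, frobPrefix, Nat.sub_zero, add_zero, r.2, if_true]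

variable {m : ℕ → ℕ → ℂ} {j : ℕ}

/-- A column of the Frobenius companion matrix with its zeros at the top is reproduced by the
preceding factors. -/
theorem frobPrefix_mul_col (hm : ∀ i, i < j → m j i = 0) (r : Fin n) :
    ∑ i : Fin n, frobPrefix n m j r i * (if i.val + j < n then m j (i.val + j) else 0) = m j r := by
  by_cases hr : j ≤ r.val
  · rw [Finset.sum_eq_single (⟨r.val - j, by omega⟩ : Fin n)]
    · have h1 : r.val - j + j < n := by omega
      have h2 : r.val = r.val - j + j := by omega
      simp only [frobPrefix, h1, if_true]
      rw [← h2, if_pos rfl, one_mul]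
    · intro i _ hi
      split_ifs with h
      · rw [frobPrefix, if_pos h, if_neg, zero_mul]
        intro h'
        apply hi
        ext
        simp only
        omega
      · rw [mul_zero]
    · simp
  · rw [hm r (by omega), Finset.sum_eq_zero]
    intro i _
    split_ifs with h
    · rw [frobPrefix, if_pos h, if_neg (by omega), zero_mul]
    · rw [mul_zero]

theorem frobPrefix_mul_step (hm : ∀ i, i < j → m j i = 0) :
    frobPrefix n m j * frobStep n m j = frobPrefix n m (j + 1) := by
  ext r c
  rw [Matrix.mul_apply]
  by_cases hc : c.val + 1 < n
  · rw [Finset.sum_eq_single (⟨c.val + 1, hc⟩ : Fin n)]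
    · simp only [frobPrefix, frobStep, hc, if_true, mul_one]
      rw [show c.val + 1 + j = c.val + (j + 1) by omega]
    · intro i _ hi
      rw [frobStep, if_pos hc, if_neg (fun h => hi (Fin.ext h)), mul_zero]
    · simp
  · have h1 : ¬ c.val + (j + 1) < n := by omega
    have h2 : c.val + (j + 1) - n = j := by omega
    rw [frobPrefix, if_neg h1, h2, ← frobPrefix_mul_col hm r]
    refine Finset.sum_congr rfl fun i _ => ?_
    rw [frobStep, if_neg hc]

/-- The product of the last Frobenius factors, built up from the right. Moving the columns up by
`j` rows loses nothing, as the entries lost are zero. -/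
theorem frobStep_mul_suffix {k : ℕ} (hjk : j < k)
    (hm : ∀ t i, t < k → i < t → m t i = 0) :
    frobStep n m j * frobSuffix n k m (j + 1) = frobSuffix n k m j := by
  ext r c
  rw [Matrix.mul_apply]
  by_cases hc : c.val + (k - (j + 1)) < n
  · rw [Finset.sum_eq_single (⟨c.val + (k - (j + 1)), hc⟩ : Fin n)]
    · simp only [frobSuffix, frobStep, hc, if_true, mul_one]
      rw [show c.val + (k - (j + 1)) + 1 = c.val + (k - j) by omega]
      split_ifs with h1 h2 h3 <;> try rfl
      rw [show c.val + k - n = j by omega]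
    · intro i _ hi
      rw [frobSuffix, if_pos hc, if_neg (fun h => hi (Fin.ext h)), mul_zero]
    · simp
  · have hS : ∀ i : Fin n, frobSuffix n k m (j + 1) i c
        = if i.val + (j + 1) < n then m (c.val + k - n) (i.val + (j + 1)) else 0 := fun i => by
      rw [frobSuffix, if_neg hc]
    rw [frobSuffix, if_neg (by omega)]
    by_cases hr : r.val = 0
    · rw [Finset.sum_eq_zero]
      · split_ifs with h
        · rw [hm _ _ (by omega) (by omega)]
        · rfl
      · intro i _
        by_cases hi : i.val + 1 < n
        · rw [frobStep, if_pos hi, if_neg (by omega), zero_mul]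
        · rw [hS, if_neg (by omega), mul_zero]
    · rw [Finset.sum_eq_single (⟨r.val - 1, by omega⟩ : Fin n)]
      · have h1 : r.val - 1 + 1 < n := by omega
        have h2 : r.val = r.val - 1 + 1 := by omega
        rw [hS]
        simp only [frobStep, h1, if_true]
        rw [if_pos h2, one_mul, show r.val - 1 + (j + 1) = r.val + j by omega]
      · intro i _ hi
        by_cases h1 : i.val + 1 < n
        · rw [frobStep, if_pos h1, if_neg, zero_mul]
          intro h
          apply hi
          ext
          simp only
          omega
        · rw [hS, if_neg (by omega), mul_zero]
      · simp

/-- Moving a column up by `j` rows does not change its norm if its first `j` entries are zero. -/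
theorem sum_shift_eq {f : ℕ → ℝ} {j : ℕ} (hf : ∀ i, i < j → f i = 0) :
    ∑ i : Fin n, (if i.val + j < n then f (i.val + j) else 0) = ∑ i : Fin n, f i := by
  rw [Fin.sum_univ_eq_sum_range (fun i => if i + j < n then f (i + j) else 0),
    Fin.sum_univ_eq_sum_range (fun i => f i), ← Finset.sum_filter]
  have : ∑ i ∈ (Finset.range n).filter (fun i => i + j < n), f (i + j)
      = ∑ i ∈ ((Finset.range n).filter (fun i => i + j < n)).map (addRightEmbedding j), f i := by
    rw [Finset.sum_map]; rfl
  rw [this]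
  refine Finset.sum_subset ?_ fun i hi hi' => hf i ?_
  · intro i hi
    simp only [Finset.mem_map, Finset.mem_filter, Finset.mem_range, addRightEmbedding_apply] at hi ⊢
    obtain ⟨a, ⟨-, h⟩, rfl⟩ := hi
    exact h
  · by_contra hc
    apply hi'
    simp only [Finset.mem_map, Finset.mem_filter, Finset.mem_range, addRightEmbedding_apply] at hi ⊢
    exact ⟨i - j, by omega, by omega⟩

theorem frob_col_le {k : ℕ} (hk : k ≤ n) {t : ℕ} (ht : t < k) :
    ∑ i : Fin n, ‖m t i‖ ^ 2 ≤ ‖frobPrefix n m k‖ ^ 2 := by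
  have := col_sum_le (frobPrefix n m k) ⟨n - k + t, by omega⟩
  refine le_trans (le_of_eq (Finset.sum_congr rfl fun i _ => ?_)) this
  rw [frobPrefix, if_neg (by simp only; omega)]
  simp only
  rw [show n - k + t + k - n = t by omega]

/-- Partial products of the Frobenius factors are no larger than the full one, up to a factor `√n`:
their columns are unit vectors or columns of the full product. -/
theorem norm_frobPrefix_le {k : ℕ} (hk : k ≤ n) (hj : j ≤ k) :
    ‖frobPrefix n m j‖ ^ 2 ≤ n * (1 + ‖frobPrefix n m k‖ ^ 2) := by
  refine norm_sq_le_of_cols fun c => ?_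
  by_cases hc : c.val + j < n
  · simp only [frobPrefix, hc, if_true]
    nlinarith [unit_sum_le (n := n) (c.val + j), sq_nonneg ‖frobPrefix n m k‖]
  · have h1 : ∀ i : Fin n, frobPrefix n m j i c = m (c.val + j - n) i := fun i => by
      rw [frobPrefix, if_neg hc]
    simp only [h1]
    have := c.2
    linarith [frob_col_le (m := m) hk (t := c.val + j - n) (by omega)]

theorem norm_frobSuffix_le {k : ℕ} (hk : k ≤ n) (hk0 : 0 < k)
    (hm : ∀ t i, t < k → i < t → m t i = 0) :
    ‖frobSuffix n k m j‖ ^ 2 ≤ n * (1 + ‖frobPrefix n m k‖ ^ 2) := by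
  refine norm_sq_le_of_cols fun c => ?_
  by_cases hc : c.val + (k - j) < n
  · simp only [frobSuffix, hc, if_true]
    nlinarith [unit_sum_le (n := n) (c.val + (k - j)), sq_nonneg ‖frobPrefix n m k‖]
  · have h1 : ∀ i : Fin n, ‖frobSuffix n k m j i c‖ ^ 2
        = if i.val + j < n then ‖m (c.val + k - n) (i.val + j)‖ ^ 2 else 0 := fun i => by
      rw [frobSuffix, if_neg hc]
      split_ifs <;> simp
    simp only [h1]
    have := c.2
    have h2 := sum_shift_eq (n := n) (j := j) (f := fun i => ‖m (c.val + k - n) i‖ ^ 2)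
      (fun i hi => by rw [hm _ _ (by omega) (by omega)]; simp)
    linarith [frob_col_le (m := m) hk (t := c.val + k - n) (by omega)]

end Shift

section ExactFactors

variable {n k : ℕ}

/-- The cyclic downshift times a triangular factor is a Frobenius factor. -/
theorem shift_mul_spikeMat {m : ℕ → ℕ → ℂ} {j : ℕ} {x : ℕ → ℂ}
    (hx : ∀ i, x i = if i + 1 < n then (if i + 1 + j < n then m j (i + 1 + j) else 0)
      else if j < n then m j j else 0) :
    seqMatrix n (shiftSeq n) * spikeMat n (n - 1) x = frobStep n m j := by
  ext i c
  rw [shift_mul_apply, spikeMat_apply, frobStep]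
  by_cases hc : c.val + 1 < n
  · rw [if_neg (by omega), if_pos hc, Matrix.one_apply]
    simp only [Fin.ext_iff]
    congr 1
    apply propext
    split_ifs <;> omega
  · rw [if_pos (by omega), if_neg hc, spikeVec, hx]
    have := i.2
    rw [if_pos (by simp only; split_ifs <;> omega)]
    simp only
    by_cases h0 : i.val = 0
    · rw [if_pos h0, if_neg (by omega), h0, zero_add]
    · rw [if_neg h0, if_pos (by omega), show i.val - 1 + 1 = i.val by omega]

/-- The exact Frobenius factorization has the product that it should have, and is balanced. -/
theorem frobenius_listBal {e : Factored} {m : ℕ → ℕ → ℂ} {σ : ℝ} (hkn : k ≤ n)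
    (hm : ∀ t i, t < k → i < t → m t i = 0) (hσ0 : 0 ≤ σ)
    (hσ : n * (1 + ‖frobPrefix n m k‖ ^ 2) ≤ σ ^ 2) (hQ : ∀ b < k, e.Q b = shiftSeq n)
    (hR : ∀ b < k, ∃ x : ℕ → ℂ, e.R b = [storeSpike exactFP n (n - 1) x] ∧
      ∀ i, x i = if i + 1 < n then (if i + 1 + b < n then m b (i + 1 + b) else 0)
        else if b < n then m b b else 0) (l j : ℕ) (hl : j + l = k) :
    (blockFactors n e j l).length = 2 * l ∧ valProd (blockFactors n e j l) = frobSuffix n k m j ∧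
      ListBal σ (frobPrefix n m j) (blockFactors n e j l) := by
  induction l generalizing j with
  | zero =>
    rw [add_zero] at hl
    subst hl
    exact ⟨rfl, by rw [frobSuffix_self]; rfl, by simp [blockFactors, ListBal]⟩
  | succ l ih =>
    obtain ⟨ih0, ih1, ih2⟩ := ih (j + 1) (by omega)
    obtain ⟨x, hRx, hx⟩ := hR j (by omega)
    have hn : 1 ≤ n := by omega
    have hn1 : (1 : ℝ) ≤ n := by exact_mod_cast hn
    have hval : (Factor.tri (storeSpike exactFP n (n - 1) x) : Factor n).val
        = spikeMat n (n - 1) x := storeSpike_exact_toMatrix (by omega)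
    have hQU := shiftSeq_isUni hn
    have hmj : ∀ i, i < j → m j i = 0 := fun i => hm j i (by omega)
    have hstep := shift_mul_spikeMat (n := n) hx
    have hZ : seqMatrix n (shiftSeq n) * (spikeMat n (n - 1) x * frobSuffix n k m (j + 1))
        = frobSuffix n k m j := by
      rw [← Matrix.mul_assoc, hstep, frobStep_mul_suffix (by omega) hm]
    have nS : ∀ j, ‖frobSuffix n k m j‖ ≤ σ := fun j =>
      le_of_sq_le_sq ((norm_frobSuffix_le hkn (by omega) hm).trans hσ) hσ0
    have nP : ‖frobPrefix n m j‖ ≤ σ :=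
      le_of_sq_le_sq ((norm_frobPrefix_le hkn (by omega)).trans hσ) hσ0
    obtain ⟨α, hα0, hα, hρ, hcol⟩ := storeSpike_exact_C (n := n) (ℓ := n - 1) (x := x) (by omega)
    -- the shifted spike is a column of the Frobenius factor
    have hQx : ∀ (i : Fin n) (b : Fin 1),
        (seqMatrix n (shiftSeq n) * spikeVec n (n - 1) x) i b
          = if i.val + j < n then m j (i.val + j) else 0 := by
      intro i b
      have e1 : spikeVec n (n - 1) x = spikeMat n (n - 1) x * incl n 1 (n - 1) := by
        ext a b
        rw [mul_incl_apply _ a b (c := ⟨n - 1, by omega⟩) (by simp), spikeMat_apply, if_pos rfl]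
        rfl
      rw [e1, ← Matrix.mul_assoc, hstep,
        mul_incl_apply _ i b (c := ⟨n - 1, by omega⟩) (by simp), frobStep, if_neg (by simp only; omega)]
    -- the spike has the norm of the column `j` of the stacked coefficients, a column of `S`
    have hnx : ‖spikeVec n (n - 1) x‖ ^ 2 = ∑ i : Fin n, ‖m j i‖ ^ 2 := by
      rw [← hQU.norm_mul, frobenius_norm_sq, ← sum_shift_eq (n := n) (j := j)
        (f := fun i => ‖m j i‖ ^ 2) (fun i hi => by rw [hmj i hi]; simp)]
      refine Finset.sum_congr rfl fun i _ => ?_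
      rw [Fin.sum_univ_one, hQx]
      split_ifs <;> simp
    have hαS : ‖α‖ ^ 2 ≤ ‖frobPrefix n m k‖ ^ 2 + 1 := by
      rw [hα, hnx]
      linarith [frob_col_le (m := m) hkn (t := j) (by omega)]
    have hlist : blockFactors n e j (l + 1)
        = Factor.unitary (seqMatrix n (shiftSeq n)) :: Factor.tri (storeSpike exactFP n (n - 1) x)
          :: blockFactors n e (j + 1) l := by
      rw [blockFactors, hQ j (by omega), hRx]
      rfl
    rw [hlist]
    refine ⟨by rw [List.length_cons, List.length_cons, ih0]; ring, ?_, ?_, ?_, ?_⟩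
    · rw [valProd_cons, valProd_cons, ih1, hval]
      exact hZ
    · refine ⟨hQU, nP, ?_⟩
      rw [valProd_cons, ih1, hval, ← hQU.norm_mul, hZ]
      exact nS j
    · rw [ih1]
      refine ⟨⟨seqMatrix_isUni (by omega) fun j => spikeC_exact_isUni j,
        seqMatrix_isUni (by omega) storeSpike_exact_B_isUni⟩, ⟨?_, ?_⟩, ?_, nS _, ?_, ?_⟩
      · rw [hρ]
        exact neg_ne_zero.2 (inv_ne_zero hα0)
      · rw [hρ, norm_neg, norm_inv, inv_inv]
        refine le_of_sq_le_sq ?_ hσ0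
        nlinarith [sq_nonneg ‖frobPrefix n m k‖]
      · rw [Factor.val, hQU.norm_mul']
        exact nP
      -- the product of the preceding factors with the spike is the column `j` of the stacked
      -- coefficients itself, and thus has norm at most `|α|`
      · rw [hcol, Matrix.mul_smul, norm_smul, norm_inv, inv_mul_le_iff₀ (norm_pos_iff.2 hα0),
          mul_one, Factor.val, Matrix.mul_assoc]
        refine le_of_sq_le_sq ?_ (norm_nonneg _)
        rw [hα, hnx, frobenius_norm_sq]
        refine le_trans (le_of_eq ?_) (le_add_of_nonneg_right zero_le_one)
        refine Finset.sum_congr rfl fun r _ => ?_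
        rw [Fin.sum_univ_one, Matrix.mul_apply, ← frobPrefix_mul_col hmj r]
        simp only [hQx]
      -- the spike row picks the last row of the following product, which is a unit vector
      · rw [storeSpike_exact_row (by omega)]
        refine le_of_sq_le_sq ?_ zero_le_one
        rw [frobenius_norm_sq, Fin.sum_univ_one, one_pow]
        refine le_trans (le_of_eq ?_) (unit_sum_le (n := n) (n - 1 - (k - (j + 1))))
        refine Finset.sum_congr rfl fun c _ => ?_
        rw [incl_conj_mul_apply _ c (0 : Fin 1) (c := ⟨n - 1, by omega⟩) (by simp), frobSuffix]
        have hcn := c.2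
        simp only
        congr 2
        split_ifs <;> first | rfl | omega
    · rw [hval, Factor.val, Matrix.mul_assoc, hstep, frobPrefix_mul_step hmj]
      exact ih2

/-- The factorization `Q^k R₁ ⋯ R_k`, where the product of the triangular factors is balanced. -/
theorem gaussian_listBal {e : Factored} {σ : ℝ} {G : Matrix (Fin n) (Fin n) ℂ} {ts : List Tri}
    (hn : 1 ≤ n) (hσ0 : 0 ≤ σ) (hσ : n * (1 + ‖G‖ ^ 2) ≤ σ ^ 2) (hQ : ∀ b < k, e.Q b = shiftSeq n)
    (hR : ∀ b, b + 1 < k → e.R b = []) (hR' : ∀ b, b + 1 = k → e.R b = ts)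
    (hts : valProd (ts.map Factor.tri) = G)
    (hb : ListBal σ (seqMatrix n (shiftSeq n) ^ k) (ts.map (Factor.tri (n := n))))
    (l j : ℕ) (hl : j + (l + 1) = k) :
    (blockFactors n e j (l + 1)).length = l + 1 + ts.length ∧
      valProd (blockFactors n e j (l + 1)) = seqMatrix n (shiftSeq n) ^ (l + 1) * G ∧
      ListBal σ (seqMatrix n (shiftSeq n) ^ j) (blockFactors n e j (l + 1)) := by
  have hQU := shiftSeq_isUni hn
  have hn1 : (1 : ℝ) ≤ n := by exact_mod_cast hn
  have hQσ : ∀ j, ‖seqMatrix n (shiftSeq n) ^ j‖ ≤ σ := fun j => by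
    refine le_of_sq_le_sq ?_ hσ0
    rw [isUni_norm_sq (pow_mem hQU j)]
    nlinarith [sq_nonneg ‖G‖]
  have hGσ : ‖G‖ ≤ σ := le_of_sq_le_sq (by nlinarith [sq_nonneg ‖G‖]) hσ0
  induction l generalizing j with
  | zero =>
    have hlist : blockFactors n e j (0 + 1)
        = Factor.unitary (seqMatrix n (shiftSeq n)) :: ts.map Factor.tri := by
      rw [blockFactors, hQ j (by omega), hR' j (by omega), blockFactors, List.append_nil]
    rw [hlist]
    refine ⟨by simp; omega, ?_, ⟨hQU, hQσ j, by rwa [hts]⟩, ?_⟩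
    · rw [valProd_cons, hts, zero_add, pow_one]
      rfl
    · rw [Factor.val, ← pow_succ, show j + 1 = k by omega]
      exact hb
  | succ l ih =>
    obtain ⟨ih0, ih1, ih2⟩ := ih (j + 1) (by omega)
    have hlist : blockFactors n e j (l + 1 + 1)
        = Factor.unitary (seqMatrix n (shiftSeq n)) :: blockFactors n e (j + 1) (l + 1) := by
      rw [blockFactors, hQ j (by omega), hR j (by omega)]
      rfl
    rw [hlist]
    refine ⟨by rw [List.length_cons, ih0]; ring, ?_, ⟨hQU, hQσ j, ?_⟩, ?_⟩
    · rw [valProd_cons, ih1, pow_succ' _ (l + 1), Matrix.mul_assoc]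
      rfl
    · rw [ih1, (show IsUni (seqMatrix n (shiftSeq n) ^ (l + 1)) from pow_mem hQU _).norm_mul]
      exact hGσ
    · rw [Factor.val, ← pow_succ]
      exact ih2

end ExactFactors

/-! ### The block companion pencil and its factorizations -/

section Pencil

variable {d k : ℕ}

/-- The identity matrix with the block column `(A₀; …; A_{d-1})` as its last block column. -/
def gaussMat (d : ℕ) {k : ℕ} (A : ℕ → Matrix (Fin k) (Fin k) ℂ) :
    Matrix (Fin (d * k)) (Fin (d * k)) ℂ := fun i c =>
  if h : d * k ≤ c.val + k then stack A ⟨c.val + k - d * k, by omega⟩ i.val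
  else (1 : Matrix (Fin (d * k)) (Fin (d * k)) ℂ) i c

/-- Division of an index in the last block. -/
theorem div_mod_last {d k c : ℕ} (hc : c < d * k) (h : d * k ≤ c + k) :
    c / k + 1 = d ∧ c % k = c + k - d * k := by
  obtain ⟨d, rfl⟩ : ∃ d', d = d' + 1 := ⟨d - 1, by
    rcases d with _ | d
    · simp at hc
    · omega⟩
  rw [Nat.add_mul, one_mul] at hc h ⊢
  have hk : 0 < k := by omega
  have h1 : c / k = d := by
    apply Nat.div_eq_of_lt_le
    · omega
    · rw [Nat.succ_mul]; omega
  refine ⟨by omega, ?_⟩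
  have := Nat.div_add_mod c k
  rw [h1, mul_comm] at this
  omega

theorem div_of_lt {d k c : ℕ} (h : c + k < d * k) : c / k + 1 < d := by
  have hk : 0 < k := by
    rcases Nat.eq_zero_or_pos k with rfl | h0
    · simp at h
    · exact h0
  have h1 : (c + k) / k < d := Nat.div_lt_of_lt_mul (by rwa [mul_comm])
  rwa [Nat.add_div_right _ hk] at h1

theorem pencilT_eq (N : ℕ → Matrix (Fin k) (Fin k) ℂ) :
    pencilT d k N = gaussMat d (fun i => N (i + 1)) := by
  ext i c
  simp only [pencilT, Matrix.reindex_apply, Matrix.submatrix_apply, Matrix.of_apply,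
    finProdFinEquiv_symm_apply, gaussMat]
  by_cases h : d * k ≤ c.val + k
  · obtain ⟨h1, h2⟩ := div_mod_last c.2 h
    rw [if_pos (by simpa [Fin.divNat] using h1), dif_pos h]
    have : (c.modNat : Fin k) = ⟨c.val + k - d * k, by omega⟩ := Fin.ext (by simpa using h2)
    rw [this]
    rfl
  · have h1 := div_of_lt (d := d) (k := k) (c := c.val) (by omega)
    rw [if_neg (by simp [Fin.divNat]; omega), dif_neg h, Matrix.one_apply]
    congr 1
    rw [← finProdFinEquiv_symm_apply, ← finProdFinEquiv_symm_apply,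
      finProdFinEquiv.symm.injective.eq_iff]

/-- The columns of `(-M₀; …; -M_{d-1})`. -/
def companionCol {k : ℕ} (M : ℕ → Matrix (Fin k) (Fin k) ℂ) (t i : ℕ) : ℂ :=
  if h : t < k then -stack M ⟨t, h⟩ i else 0

theorem pencilS_eq (M : ℕ → Matrix (Fin k) (Fin k) ℂ) :
    pencilS d k M = frobPrefix (d * k) (companionCol M) k := by
  ext i c
  simp only [pencilS, Matrix.reindex_apply, Matrix.submatrix_apply, Matrix.of_apply,
    finProdFinEquiv_symm_apply, frobPrefix]
  by_cases h : d * k ≤ c.val + k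
  · obtain ⟨h1, h2⟩ := div_mod_last c.2 h
    have hlt : c.val + k - d * k < k := by omega
    rw [if_pos (by simpa [Fin.divNat] using h1), if_neg (by omega), companionCol, dif_pos hlt]
    have : (c.modNat : Fin k) = ⟨c.val + k - d * k, hlt⟩ := Fin.ext (by simpa using h2)
    rw [this]
    rfl
  · have h1 := div_of_lt (d := d) (k := k) (c := c.val) (by omega)
    have h2 : ¬ (((c.divNat : Fin d) : ℕ) + 1 = d) := h1.ne
    rw [if_neg h2, if_pos (c := c.val + k < d * k) (by omega)]
    have hk : 0 < k := by
      rcases Nat.eq_zero_or_pos k with rfl | h0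
      · simp at h
      · exact h0
    refine if_congr ?_ rfl rfl
    rw [Fin.ext_iff]
    change (i.val / k = c.val / k + 1 ∧ i.val % k = c.val % k) ↔ (i.val = c.val + k)
    constructor
    · rintro ⟨h2, h3⟩
      rw [← Nat.div_add_mod i.val k, h2, h3, ← Nat.div_add_mod c.val k]
      simp [Nat.mul_add, Nat.mul_add_div hk]
      ring
    · intro h2
      rw [h2, Nat.add_div_right _ hk, Nat.add_mod_right]
      exact ⟨rfl, rfl⟩

theorem stack_eq {A : ℕ → Matrix (Fin k) (Fin k) ℂ} {j : Fin k} {r q i : ℕ} (hi : i < k)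
    (h : r = q * k + i) : stack A j r = A q ⟨i, hi⟩ j := by
  subst h
  have h1 : (q * k + i) / k = q := by
    rw [mul_comm, Nat.mul_add_div (by omega), Nat.div_eq_of_lt hi, add_zero]
  have h2 : (q * k + i) % k = i := by
    rw [Nat.add_comm, Nat.add_mul_mod_self_right, Nat.mod_eq_of_lt hi]
  unfold stack
  simp only [h1, h2]

theorem gaussMat_blockTriangular {A : ℕ → Matrix (Fin k) (Fin k) ℂ} (hd : 1 ≤ d)
    (hA : (A (d - 1)).BlockTriangular id) : (gaussMat d A).BlockTriangular id := by
  intro i c hic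
  have hic' : c.val < i.val := hic
  rw [gaussMat]
  split_ifs with h
  · obtain ⟨d, rfl⟩ : ∃ d', d = d' + 1 := ⟨d - 1, by omega⟩
    have hi := i.2
    have e : (d + 1) * k = d * k + k := by ring
    rw [stack_eq (q := d) (i := i.val - d * k) (by omega) (by omega)]
    apply hA
    change c.val + k - (d + 1) * k < i.val - d * k
    omega
  · exact Matrix.one_apply_ne (by rintro rfl; omega)

/-- The exact Gaussian factors have the product that they should have, and are balanced, after any
unitary matrix `B`. -/
theorem gaussianFactors_listBal {A : ℕ → Matrix (Fin k) (Fin k) ℂ} (hd : 1 ≤ d)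
    (hA : (A (d - 1)).BlockTriangular id) {B : Matrix (Fin (d * k)) (Fin (d * k)) ℂ}
    (hB : IsUni B) {σ : ℝ} (hσ0 : 0 ≤ σ)
    (hσ : ((d * k : ℕ) : ℝ) * (1 + ‖gaussMat d A‖ ^ 2) ≤ σ ^ 2) :
    valProd ((gaussianFactors exactFP d A).map (Factor.tri (n := d * k))) = gaussMat d A ∧
      ListBal σ B ((gaussianFactors exactFP d A).map (Factor.tri (n := d * k))) := by
  have hkn : k ≤ d * k := Nat.le_mul_of_pos_left k (by omega)
  have hG := gaussMat_blockTriangular hd hA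
  have hcol : ∀ t : Fin k, spikeVec (d * k) (d * k - 1 - (0 + t)) (stack A t.rev)
      = gaussMat d A * incl (d * k) 1 (d * k - 1 - (0 + t)) := by
    intro t
    have ht := t.2
    ext i b
    rw [mul_incl_apply _ i b (c := ⟨d * k - 1 - (0 + t), by omega⟩) (by simp), spikeVec]
    split_ifs with h
    · rw [gaussMat, dif_pos (by simp only; omega)]
      congr 1
      ext
      simp only [Fin.val_rev]
      omega
    · exact (hG (show (⟨d * k - 1 - (0 + t), by omega⟩ : Fin (d * k)) < i by
        rw [Fin.lt_def]; simp only; omega)).symm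
  obtain ⟨h1, h2⟩ := spikes_listBal hG hB hσ0 hσ k 0 (by omega) (fun t => stack A t.rev) hcol
  have e : (gaussianFactors exactFP d A).map (Factor.tri (n := d * k))
      = List.ofFn fun t : Fin k => (Factor.tri (storeSpike exactFP (d * k)
        (d * k - 1 - (0 + t)) (stack A t.rev)) : Factor (d * k)) := by
    rw [gaussianFactors, List.map_ofFn]
    congr 1
    funext t
    simp
  have p1 : pickCols (fun c => d * k ≤ c + 0) (gaussMat d A) = 1 := by
    ext i c
    rw [pickCols, if_neg (by omega)]
  have p2 : pickCols (fun c => d * k ≤ c + 0 + k ∧ c + 0 < d * k) (gaussMat d A)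
      = gaussMat d A := by
    ext i c
    rw [pickCols]
    split_ifs with h
    · rfl
    · rw [gaussMat, dif_neg (by omega)]
  rw [p1, Matrix.mul_one] at h2
  rw [p2] at h1
  rw [e]
  exact ⟨h1, h2⟩

/-- The block column of the Gaussian factorization of `S`. -/
def gaussColS {k : ℕ} (d : ℕ) (M : ℕ → Matrix (Fin k) (Fin k) ℂ) (i : ℕ) :
    Matrix (Fin k) (Fin k) ℂ := -M (if i + 1 < d then i + 1 else 0)

/-- The `k`-th power of the cyclic downshift moves the block `-M₀` from the bottom to the top. -/
theorem shift_pow_mul_gaussMat (hd : 1 ≤ d) (M : ℕ → Matrix (Fin k) (Fin k) ℂ) :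
    seqMatrix (d * k) (shiftSeq (d * k)) ^ k * gaussMat d (gaussColS d M) = pencilS d k M := by
  have hkn : k ≤ d * k := Nat.le_mul_of_pos_left k (by omega)
  rw [pencilS_eq]
  ext r c
  rw [shift_pow_mul_apply k hkn, frobPrefix, gaussMat]
  have hr := r.2
  have hc := c.2
  by_cases h1 : d * k ≤ c.val + k
  · rw [dif_pos h1, if_neg (c := c.val + k < d * k) (by omega)]
    have hk : 0 < k := by omega
    have hlt : c.val + k - d * k < k := by omega
    have e0 : companionCol M (c.val + k - d * k) r.val = -stack M ⟨_, hlt⟩ r.val := dif_pos hlt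
    rw [e0]
    obtain ⟨q, i, hi, hri⟩ : ∃ q i, i < k ∧ r.val = q * k + i :=
      ⟨r.val / k, r.val % k, Nat.mod_lt _ hk, (Nat.div_add_mod' _ _).symm⟩
    have e1 : stack M ⟨_, hlt⟩ r.val = M q ⟨i, hi⟩ ⟨_, hlt⟩ := stack_eq hi hri
    rw [e1]
    by_cases hq : q = 0
    · subst hq
      have : ¬ k ≤ r.val := by omega
      simp only [this, if_false]
      obtain ⟨d, rfl⟩ : ∃ d', d = d' + 1 := ⟨d - 1, by omega⟩
      have e : (d + 1) * k = d * k + k := by ring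
      rw [stack_eq (q := d) (i := i) hi (by omega), gaussColS, if_neg (by omega)]
      rfl
    · obtain ⟨q, rfl⟩ : ∃ q', q = q' + 1 := ⟨q - 1, by omega⟩
      have e : (q + 1) * k = q * k + k := by ring
      have : k ≤ r.val := by omega
      simp only [this, if_true]
      have hqd : q + 1 < d := by
        by_contra hcon
        have := Nat.mul_le_mul_right k (not_lt.1 hcon)
        omega
      rw [stack_eq (q := q) (i := i) hi (by omega), gaussColS, if_pos hqd]
      rfl
  · rw [dif_neg h1, if_pos (c := c.val + k < d * k) (by omega), Matrix.one_apply]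
    refine if_congr ?_ rfl rfl
    rw [Fin.ext_iff]
    simp only
    split_ifs <;> omega

end Pencil

/-! ### The stored pencil and its exact counterpart -/

section StoredPencil

variable {d k : ℕ} {c : Coeffs k} {kind : Factorization}

theorem factorPencil_T {u : ℝ} (fp : FloatArith u) :
    (factorPencil fp d c kind).T = gaussianFactors fp d (fun i => c.N (i + 1)) := by
  cases kind <;> rfl

theorem factorPencil_Q {u : ℝ} (fp : FloatArith u) (b : ℕ) :
    (factorPencil fp d c kind).Q b = if b < k then shiftSeq (d * k) else 1 := by
  cases kind <;> rfl

theorem length_gaussianFactors {u : ℝ} (fp : FloatArith u)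
    (A : ℕ → Matrix (Fin k) (Fin k) ℂ) : (gaussianFactors fp d A).length = k := by
  simp [gaussianFactors]

theorem Coeffs.IsReady.triangular_N (h : c.IsReady d kind) : (c.N d).BlockTriangular id := by
  cases kind <;> exact h.1

/-- The exact factorization of `T` is balanced. -/
theorem factorPencil_T_listBal (hd : 1 ≤ d) (hc : c.IsReady d kind) {σ : ℝ} (hσ0 : 0 ≤ σ)
    (hσ : ((d * k : ℕ) : ℝ) * (1 + ‖pencilT d k c.N‖ ^ 2) ≤ σ ^ 2) :
    ((factorPencil exactFP d c kind).T.map (Factor.tri (n := d * k))).length = k ∧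
      valProd ((factorPencil exactFP d c kind).T.map (Factor.tri (n := d * k)))
        = pencilT d k c.N ∧
      ListBal σ 1 ((factorPencil exactFP d c kind).T.map (Factor.tri (n := d * k))) := by
  rw [factorPencil_T, pencilT_eq]
  rw [pencilT_eq] at hσ
  refine ⟨by rw [List.length_map, length_gaussianFactors], ?_⟩
  refine gaussianFactors_listBal hd ?_ isUni_one hσ0 hσ
  simpa [show d - 1 + 1 = d by omega] using hc.triangular_N

/-- The exact factorization of `S`, of either kind, is balanced. -/
theorem factorPencil_S_listBal (hd : 1 ≤ d) (hk : 1 ≤ k) (hc : c.IsReady d kind) {σ : ℝ}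
    (hσ0 : 0 ≤ σ) (hσ : ((d * k : ℕ) : ℝ) * (1 + ‖pencilS d k c.M‖ ^ 2) ≤ σ ^ 2) :
    (blockFactors (d * k) (factorPencil exactFP d c kind) 0 k).length = 2 * k ∧
      valProd (blockFactors (d * k) (factorPencil exactFP d c kind) 0 k) = pencilS d k c.M ∧
      ListBal σ 1 (blockFactors (d * k) (factorPencil exactFP d c kind) 0 k) := by
  have hkn : k ≤ d * k := Nat.le_mul_of_pos_left k (by omega)
  have hQ : ∀ b < k, (factorPencil exactFP d c kind).Q b = shiftSeq (d * k) := fun b hb => by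
    rw [factorPencil_Q, if_pos hb]
  cases kind with
  | frobenius =>
    rw [pencilS_eq] at hσ ⊢
    have key := frobenius_listBal (e := factorPencil exactFP d c .frobenius) (j := 0) (l := k)
      (m := companionCol c.M) (σ := σ) hkn (fun t i ht hi => ?_) hσ0 hσ hQ (fun b hb => ?_)
      (by omega)
    · rwa [frobSuffix_zero, frobPrefix_zero] at key
    · rw [companionCol, dif_pos ht, stack_eq (q := 0) (i := i) (by omega) (by simp), neg_eq_zero]
      exact hc.2 (i := ⟨t, ht⟩) (j := ⟨i, by omega⟩) hi
    · refine ⟨frobeniusSpike d c.M ⟨b, hb⟩, by simp only [factorPencil]; rw [dif_pos hb],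
        fun i => ?_⟩
      simp only [frobeniusSpike, companionCol, dif_pos hb, zero_add]
  | gaussian =>
    have hn : 1 ≤ d * k := hk.trans hkn
    have hU := shiftSeq_isUni hn
    have hG : ‖gaussMat d (gaussColS d c.M)‖ = ‖pencilS d k c.M‖ := by
      rw [← shift_pow_mul_gaussMat hd, (show IsUni (_ ^ k) from pow_mem hU k).norm_mul]
    rw [← hG] at hσ
    have hA : (gaussColS d c.M (d - 1)).BlockTriangular id := by
      rw [gaussColS, if_neg (by omega)]
      intro i j hij
      rw [Matrix.neg_apply, hc.2 hij, neg_zero]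
    obtain ⟨h1, h2⟩ := gaussianFactors_listBal hd hA (pow_mem hU k) hσ0 hσ
    have key := gaussian_listBal (e := factorPencil exactFP d c .gaussian) (k := k) hn hσ0 hσ hQ
      (fun b hb => ?_) (fun b hb => ?_) h1 h2 (k - 1) 0 (by omega)
    · rw [show k - 1 + 1 = k by omega, shift_pow_mul_gaussMat hd, length_gaussianFactors,
        pow_zero] at key
      exact ⟨by rw [key.1]; ring, key.2⟩
    · simp only [factorPencil]
      rw [if_neg (by omega)]
    · simp only [factorPencil]
      rw [if_pos hb]
      rfl

/-- In a balanced product, `ρ` is at least `σ⁻¹` in modulus, so that small errors cannot make it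
zero. -/
theorem ListBal.rho_bound {n : ℕ} {σ : ℝ} {A : Matrix (Fin n) (Fin n) ℂ} {xs : List (Factor n)}
    (h : ListBal σ A xs) {t : Tri} (ht : Factor.tri t ∈ xs) {ε : ℝ} (hε : σ * ε < 1)
    (hσ : 1 ≤ σ) : ε < ‖rho n (seqMatrix (n + 1) t.C)‖ := by
  induction xs generalizing A with
  | nil => simp at ht
  | cons x xs ih =>
    rcases List.mem_cons.1 ht with rfl | ht
    · obtain ⟨-, ⟨h1, h2⟩, -⟩ := h.1
      have h3 : 0 < ‖rho n (seqMatrix (n + 1) t.C)‖ := norm_pos_iff.2 h1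
      have h4 : 1 ≤ σ * ‖rho n (seqMatrix (n + 1) t.C)‖ := by
        have := mul_le_mul_of_nonneg_right h2 h3.le
        rwa [inv_mul_cancel₀ h3.ne'] at this
      exact lt_of_mul_lt_mul_left (hε.trans_le h4) (by linarith)
    · exact ih h.2 ht

theorem mem_blockFactors {n : ℕ} {s : Factored} {t : Tri} {b : ℕ} (l j : ℕ) (hj : j ≤ b)
    (hb : b < j + l) (ht : t ∈ s.R b) : Factor.tri t ∈ blockFactors n s j l := by
  induction l generalizing j with
  | zero => omega
  | succ l ih =>
    rw [blockFactors, List.mem_cons, List.mem_append]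
    rcases Nat.eq_or_lt_of_le hj with rfl | hj
    · exact .inr (.inl (List.mem_map_of_mem ht))
    · exact .inr (.inr (ih (j + 1) hj (by omega)))

theorem listSim_of_forall₂ {n : ℕ} {ε : ℝ} {ts ts' : List Tri}
    (h : List.Forall₂ (TriSim n ε 1 1) ts ts') : ListSim n ε 1 1 ts ts' := by
  induction h with
  | nil => exact .nil 1
  | cons h _ ih => exact .cons isUni_one h ih

section Rounding

variable {u : ℝ} (fp : FloatArith u)

theorem gaussianFactors_sim (hs : SmallFor u (d * k + 1)) (hd : 1 ≤ d)
    (A : ℕ → Matrix (Fin k) (Fin k) ℂ) :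
    ListSim (d * k) (456 * (((d * k : ℕ) + 1) ^ 2 * u)) 1 1 (gaussianFactors exactFP d A)
      (gaussianFactors fp d A) := by
  apply listSim_of_forall₂
  rw [gaussianFactors, gaussianFactors, List.ofFn_eq_map, List.ofFn_eq_map,
    List.forall₂_map_left_iff, List.forall₂_map_right_iff, List.forall₂_same]
  intro t _
  have ht := t.2
  have : k ≤ d * k := Nat.le_mul_of_pos_left k (by omega)
  exact storeSpike_sim fp hs (by omega)

theorem gaussianFactors_good (hs : SmallFor u (d * k + 1))
    (A : ℕ → Matrix (Fin k) (Fin k) ℂ) : ∀ t ∈ gaussianFactors fp d A, GoodTri u t := by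
  intro t ht
  rw [gaussianFactors, List.mem_ofFn] at ht
  obtain ⟨i, rfl⟩ := ht
  exact storeSpike_good fp hs

theorem factorPencil_good (hs : SmallFor u (d * k + 1)) :
    GoodFactored u (factorPencil fp d c kind) := by
  have h120 : 0 ≤ 120 * u := by have := hs.nonneg; positivity
  refine ⟨fun b j => ?_, fun b t ht => ?_, fun t ht => ?_⟩
  · rw [factorPencil_Q]
    split_ifs
    · unfold shiftSeq
      split_ifs
      · exact nearU_of_isUni h120 swapCore_isUni
      · exact nearU_of_isUni h120 isUni_one
    · exact nearU_of_isUni h120 isUni_one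
  · cases kind with
    | frobenius =>
      simp only [factorPencil] at ht
      split_ifs at ht
      · rw [List.mem_singleton.1 ht]
        exact storeSpike_good fp hs
      · simp at ht
    | gaussian =>
      simp only [factorPencil] at ht
      split_ifs at ht
      · exact gaussianFactors_good fp hs _ t ht
      · simp at ht
  · rw [factorPencil_T] at ht
    exact gaussianFactors_good fp hs _ t ht

/-- The computed compact storage is close to the exact one. -/
theorem factorPencil_sim (hs : SmallFor u (d * k + 1)) (hd : 1 ≤ d) (hk : 1 ≤ k) :
    FSim (d * k) k (456 * (((d * k : ℕ) + 1) ^ 2 * u)) (fun _ => 1) (fun _ => 1) (fun _ => 1)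
      (factorPencil exactFP d c kind) (factorPencil fp d c kind) := by
  have hu := hs.nonneg
  have hε : 0 ≤ 456 * ((((d * k : ℕ) : ℝ) + 1) ^ 2 * u) := by positivity
  have hkn : k ≤ d * k := Nat.le_mul_of_pos_left k (by omega)
  refine ⟨fun b hb => ?_, fun b hb => ?_, ?_⟩
  · rw [factorPencil_Q, factorPencil_Q]
    simpa using hε
  · cases kind with
    | frobenius =>
      simp only [factorPencil]
      rw [dif_pos hb, dif_pos hb]
      exact .cons isUni_one (storeSpike_sim fp hs (by omega)) (.nil 1)
    | gaussian =>
      simp only [factorPencil]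
      split_ifs
      · exact gaussianFactors_sim fp hs hd _
      · exact .nil 1
  · rw [factorPencil_T, factorPencil_T]
    exact gaussianFactors_sim fp hs hd _

theorem GoodFactored.toHessTri {s : Factored} (h : GoodFactored u s) :
    GoodHess u (toHessTri k s) := by
  refine ⟨h.Q 0, fun t ht => ?_, h.T⟩
  obtain ⟨b, -, hb⟩ := List.mem_flatMap.1 ht
  exact h.R b t hb

theorem exists_R_ne_nil (fp : FloatArith u) (hk : 1 ≤ k) :
    ∃ b < k, (factorPencil fp d c kind).R b ≠ [] := by
  cases kind with
  | frobenius =>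
    refine ⟨0, hk, ?_⟩
    simp only [factorPencil]
    rw [dif_pos (by omega)]
    simp
  | gaussian =>
    refine ⟨k - 1, by omega, ?_⟩
    simp only [factorPencil]
    rw [if_pos (by omega)]
    exact List.ne_nil_of_length_pos (by rw [length_gaussianFactors]; omega)

theorem FSim.toHessTri_ne_nil {ε : ℝ} {L L' M : ℕ → Matrix (Fin (d * k)) (Fin (d * k)) ℂ}
    {s : Factored} (hk : 1 ≤ k)
    (h : FSim (d * k) k ε L L' M (factorPencil exactFP d c kind) s) :
    (toHessTri k s).R ≠ [] ∧ (toHessTri k s).T ≠ [] := by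
  constructor
  · obtain ⟨b, hb, hR⟩ := exists_R_ne_nil (d := d) (c := c) (kind := kind) exactFP hk
    intro h0
    have h1 : s.R b = [] := by
      simp only [toHessTri, List.flatMap_eq_nil_iff] at h0
      exact h0 b (List.mem_range.2 hb)
    have := (h.R b hb).length_eq
    rw [h1] at this
    exact hR (List.length_eq_zero_iff.1 this)
  · have := h.T.length_eq
    rw [factorPencil_T, length_gaussianFactors] at this
    exact List.ne_nil_of_length_pos (show 0 < s.T.length by omega)

/-- The error in each stored factor after the reduction and `m` steps of the iteration, relative to
a unitary equivalence of the exact factors; here `n` is the size and `k` the number of factors. -/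
def factorError (n k tol m : ℕ) (u : ℝ) : ℝ :=
  456 * ((n + 1) ^ 2 * u) + (n - 1 : ℕ) * (k - 1 : ℕ) * (n * (10 ^ 8 * u))
    + m * (n * ((10 ^ 9 + 16 * tol) * u))

/-- The computed Schur form of a pencil with triangular `M₀` and `N_d` is a unitary equivalence of
the pencil up to errors that are linear in the errors of the factors. -/
theorem exists_backward_error_of_isReady {tol m : ℕ} (hs : SmallFor u (d * k + 1)) (hd : 2 ≤ d)
    (hk : 1 ≤ k) (hc : c.IsReady d kind) {s : HessTri}
    (hsteps : Steps (QRStep fp tol (d * k)) m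
      (toHessTri k (reduce fp (d * k) k (factorPencil fp d c kind))) s)
    (hdefl : ∀ i, i + 1 < d * k → s.Q i = 1) {σ τ : ℝ} (hσ1 : 1 ≤ σ) (hτ1 : 1 ≤ τ)
    (hσ : ((d * k : ℕ) : ℝ) * (1 + ‖pencilS d k c.M‖ ^ 2) ≤ σ ^ 2)
    (hτ : ((d * k : ℕ) : ℝ) * (1 + ‖pencilT d k c.N‖ ^ 2) ≤ τ ^ 2)
    (hσε : σ * factorError (d * k) k tol m u < 1) (hτε : τ * factorError (d * k) k tol m u < 1)
    (hσ2 : secondOrder (d * k) σ (2 * k) * factorError (d * k) k tol m u ≤ 1)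
    (hτ2 : secondOrder (d * k) τ (2 * k) * factorError (d * k) k tol m u ≤ 1) :
    (seqMatrix (d * k) s.Q * (s.R.map (Tri.toMatrix (d * k))).prod).BlockTriangular id ∧
      ((s.T.map (Tri.toMatrix (d * k))).prod).BlockTriangular id ∧
      ∃ U V δS δT : Matrix (Fin (d * k)) (Fin (d * k)) ℂ, IsUni U ∧ IsUni V ∧
        seqMatrix (d * k) s.Q * (s.R.map (Tri.toMatrix (d * k))).prod
          = Uᴴ * (pencilS d k c.M + δS) * V ∧
        (s.T.map (Tri.toMatrix (d * k))).prod = Uᴴ * (pencilT d k c.N + δT) * V ∧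
        ‖δS‖ ≤ 2 * k * (336 * (σ ^ 2 * factorError (d * k) k tol m u)) ∧
        ‖δT‖ ≤ 2 * k * (336 * (τ ^ 2 * factorError (d * k) k tol m u)) := by
  have hu := hs.nonneg
  have hn : 2 ≤ d * k := by nlinarith
  have hε₂ : (0 : ℝ) ≤ m * ((d * k : ℕ) * ((10 ^ 9 + 16 * tol) * u)) := by positivity
  have hε0 : 0 ≤ factorError (d * k) k tol m u := by unfold factorError; positivity
  -- the exactly factored pencil is compared with the computed factors after the storage, the
  -- reduction and the iteration
  obtain ⟨hgood, hQ1, L, M, hL, hM, h1⟩ := reduce_sim fp hs hn hk (factorPencil_good fp hs)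
    (factorPencil_sim (c := c) (kind := kind) fp hs (by omega) hk)
  obtain ⟨hR, hT⟩ := h1.toHessTri_ne_nil hk
  obtain ⟨-, U, M', V, hU, hM', -, h2⟩ := QRSteps.sim fp hs hgood.toHessTri hR hT hsteps
  -- the exact factors are balanced; in particular, `ρ` stays nonzero
  obtain ⟨lS, vS, bS⟩ := factorPencil_S_listBal (by omega) hk hc (by linarith) hσ
  obtain ⟨lT, vT, bT⟩ := factorPencil_T_listBal (by omega) hc (by linarith) hτ
  have hρ : ∀ b < k, ∀ t ∈ (factorPencil exactFP d c kind).R b,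
      factorError (d * k) k tol m u < ‖rho (d * k) (seqMatrix (d * k + 1) t.C)‖ :=
    fun b hb t ht => bS.rho_bound (mem_blockFactors k 0 (by omega) (by omega) ht) hσε hσ1
  have hρT : ∀ t ∈ (factorPencil exactFP d c kind).T,
      factorError (d * k) k tol m u < ‖rho (d * k) (seqMatrix (d * k + 1) t.C)‖ :=
    fun t ht => bT.rho_bound (List.mem_map_of_mem ht) hτε hτ1
  obtain ⟨tS, tT, U', V', hU', hV', ys, zs, hys, hzs, eS, eT⟩ :=
    exists_pert_of_sims hk hL hM hε₂ h1 (fun b hb hb' => hQ1 b hb hb') hρ hρT hU hM' h2 hdefl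
  refine ⟨tS, tT, U', V', ys.prod - pencilS d k c.M, zs.prod - pencilT d k c.N, hU', hV', ?_, ?_,
    ?_, ?_⟩
  · rw [eS, add_sub_cancel]
  · rw [eT, add_sub_cancel]
  -- the errors of the factors become backward errors `δS`, `δT`, by the balance of the products
  · have := (bS.norm_pertProd_sub_le hσ1 hε0 hys (by rwa [lS])).2
    rw [Matrix.one_mul, vS, lS] at this
    exact_mod_cast this
  · have := (bT.norm_pertProd_sub_le hτ1 hε0 hzs ?_).2
    · rw [Matrix.one_mul, vT, lT] at this
      refine this.trans (mul_le_mul_of_nonneg_right ?_ (by positivity))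
      linarith [k.cast_nonneg (α := ℝ)]
    · rw [lT]
      exact (mul_le_mul_of_nonneg_right (secondOrder_mono hτ1 (by omega)) hε0).trans hτ2

end Rounding

end StoredPencil

/-! ### Computed plane rotations of rows and columns -/

section PlaneRotations

variable {u : ℝ} (fp : FloatArith u) {k : ℕ} {p q : Fin k}

/-- The isometry with columns `e_p` and `e_q`. -/
def coordPair (p q : Fin k) : Matrix (Fin k) (Fin 2) ℂ := fun i s =>
  if i = ![p, q] s then 1 else 0

theorem coordPair_conj_mul (p q : Fin k) {m : Type*} (A : Matrix (Fin k) m ℂ) (s : Fin 2) (j : m) :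
    ((coordPair p q)ᴴ * A) s j = A (![p, q] s) j := by
  simp [Matrix.mul_apply, coordPair, apply_ite]

theorem mul_coordPair (p q : Fin k) {m : Type*} (A : Matrix m (Fin k) ℂ) (i : m) (s : Fin 2) :
    (A * coordPair p q) i s = A i (![p, q] s) := by
  simp [Matrix.mul_apply, coordPair]

theorem coordPair_isometry (hpq : p ≠ q) : (coordPair p q)ᴴ * coordPair p q = 1 := by
  ext a b
  rw [coordPair_conj_mul]
  fin_cases a <;> fin_cases b <;> simp [coordPair, hpq, hpq.symm]

theorem coordPair_mul {m : Type*} (X : Matrix (Fin 2) m ℂ) (i : Fin k) (j : m) :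
    (coordPair p q * X) i j = (if i = p then X 0 j else 0) + if i = q then X 1 j else 0 := by
  simp only [Matrix.mul_apply, Fin.sum_univ_two, coordPair, ite_mul, one_mul, zero_mul]
  rfl

theorem mul_coordPair_conj {m : Type*} (X : Matrix m (Fin 2) ℂ) (i : m) (j : Fin k) :
    (X * (coordPair p q)ᴴ) i j = (if j = p then X i 0 else 0) + if j = q then X i 1 else 0 := by
  simp only [Matrix.mul_apply, Fin.sum_univ_two, coordPair, Matrix.conjTranspose_apply]
  change X i 0 * star (if j = p then 1 else 0) + X i 1 * star (if j = q then 1 else 0) = _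
  split_ifs <;> simp

theorem norm_cmul_sub_le (hu : 0 ≤ u) (hu1 : u ≤ 1 / 1000) {g w : ℂ} (hw : ‖w‖ ≤ 1)
    (hg : ‖g - w‖ ≤ 120 * u) (x : ℂ) :
    ‖fp.cmul g x - w * x‖ ≤ 127 * u * ‖x‖ ∧ ‖fp.cmul x g - x * w‖ ≤ 127 * u * ‖x‖ := by
  have hg' : ‖g‖ ≤ 7 / 6 := by
    have := norm_le_norm_add_norm_sub' g w
    linarith
  have h0 : 6 * u * (‖g‖ * ‖x‖) + 120 * u * ‖x‖ ≤ 127 * u * ‖x‖ := by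
    have := mul_le_mul_of_nonneg_right hg' (by positivity : 0 ≤ u * ‖x‖)
    linarith
  have h1 : ‖(g - w) * x‖ ≤ 120 * u * ‖x‖ := by
    rw [norm_mul]
    exact mul_le_mul_of_nonneg_right hg (norm_nonneg x)
  have h2 := fp.cmul_err hu (by linarith) g x
  have h3 := fp.cmul_err hu (by linarith) x g
  rw [mul_comm ‖x‖] at h3
  constructor
  · calc _ = ‖(fp.cmul g x - g * x) + (g - w) * x‖ := by congr 1; ring
      _ ≤ _ := (norm_add_le _ _).trans (by linarith)
  · calc _ = ‖(fp.cmul x g - x * g) + (g - w) * x‖ := by congr 1; ring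
      _ ≤ _ := (norm_add_le _ _).trans (by linarith)

theorem norm_cadd_sub_le (hu : 0 ≤ u) (hu1 : u ≤ 1 / 1000) {m₁ m₂ z₁ z₂ : ℂ} {x y : ℝ}
    (hz₁ : ‖z₁‖ ≤ x) (hz₂ : ‖z₂‖ ≤ y) (h₁ : ‖m₁ - z₁‖ ≤ 127 * u * x)
    (h₂ : ‖m₂ - z₂‖ ≤ 127 * u * y) :
    ‖fp.cadd m₁ m₂ - (z₁ + z₂)‖ ≤ 130 * u * (x + y) := by
  have hx : 0 ≤ x := (norm_nonneg _).trans hz₁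
  have hy : 0 ≤ y := (norm_nonneg _).trans hz₂
  have h0 := fp.cadd_err hu m₁ m₂
  have hs : ‖(m₁ - z₁) + (m₂ - z₂)‖ ≤ 127 * u * (x + y) :=
    (norm_add_le _ _).trans (by linarith)
  have hm : ‖m₁ + m₂‖ ≤ 3 * (x + y) := by
    have e : m₁ + m₂ = ((m₁ - z₁) + (m₂ - z₂)) + (z₁ + z₂) := by ring
    have h5 : ‖z₁ + z₂‖ ≤ x + y := (norm_add_le _ _).trans (add_le_add hz₁ hz₂)
    have h6 : 127 * u * (x + y) ≤ 1 * (x + y) :=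
      mul_le_mul_of_nonneg_right (by linarith) (by positivity)
    rw [e]
    exact (norm_add_le _ _).trans (by linarith)
  have h7 := mul_le_mul_of_nonneg_left hm hu
  calc _ = ‖(fp.cadd m₁ m₂ - (m₁ + m₂)) + ((m₁ - z₁) + (m₂ - z₂))‖ := by congr 1; ring
    _ ≤ _ := (norm_add_le _ _).trans (by linarith)

theorem norm_le_of_col_bound {m : Type*} [Fintype m] {ε : ℝ} {E B : Matrix (Fin 2) m ℂ}
    (hε : 0 ≤ ε) (h : ∀ s j, ‖E s j‖ ≤ ε * (‖B 0 j‖ + ‖B 1 j‖)) : ‖E‖ ≤ 2 * ε * ‖B‖ := by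
  refine le_of_sq_le_sq ?_ (by positivity)
  rw [mul_pow, frobenius_norm_sq, frobenius_norm_sq, Fin.sum_univ_two, Fin.sum_univ_two,
    ← Finset.sum_add_distrib, ← Finset.sum_add_distrib, Finset.mul_sum]
  refine Finset.sum_le_sum fun j _ => ?_
  have h0 := pow_le_pow_left₀ (norm_nonneg _) (h 0 j) 2
  have h1 := pow_le_pow_left₀ (norm_nonneg _) (h 1 j) 2
  have h2 : (ε * (‖B 0 j‖ + ‖B 1 j‖)) ^ 2 ≤ 2 * ε ^ 2 * (‖B 0 j‖ ^ 2 + ‖B 1 j‖ ^ 2) := by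
    have := mul_nonneg (sq_nonneg ε) (sq_nonneg (‖B 0 j‖ - ‖B 1 j‖))
    linarith
  linarith

theorem norm_le_of_row_bound {m : Type*} [Fintype m] {ε : ℝ} {E B : Matrix m (Fin 2) ℂ}
    (hε : 0 ≤ ε) (h : ∀ i s, ‖E i s‖ ≤ ε * (‖B i 0‖ + ‖B i 1‖)) : ‖E‖ ≤ 2 * ε * ‖B‖ := by
  rw [← Matrix.frobenius_norm_conjTranspose E, ← Matrix.frobenius_norm_conjTranspose B]
  exact norm_le_of_col_bound hε fun s j => by simpa using h j s

theorem norm_entry_le_one {r : ℕ} {W : Matrix (Fin r) (Fin r) ℂ} (hW : IsUni W) (i j : Fin r) :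
    ‖W i j‖ ≤ 1 := entry_norm_bound_of_unitary hW i j

/-- A computed rotation of two rows is a unitary transformation with a relative error of order
`u`. -/
theorem norm_rotRows_sub_le (hu : 0 ≤ u) (hu1 : u ≤ 1 / 1000) (hpq : p ≠ q) {G W : Core}
    (hW : IsUni W) (hG : ‖G - W‖ ≤ 120 * u) (A : Matrix (Fin k) (Fin k) ℂ) :
    ‖rotRows fp G p q A - (plug (coordPair p q) W)ᴴ * A‖ ≤ 260 * u * ‖A‖ := by
  have hJ := coordPair_isometry hpq
  obtain ⟨X, hX⟩ : ∃ X : Matrix (Fin 2) (Fin k) ℂ, ∀ s j, X s j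
      = fp.cadd (fp.cmul (star (G 0 s)) (A p j)) (fp.cmul (star (G 1 s)) (A q j)) :=
    ⟨fun s j => _, fun s j => rfl⟩
  -- only two rows are affected, so that everything happens in a matrix with two rows
  have e : rotRows fp G p q A - (plug (coordPair p q) W)ᴴ * A
      = coordPair p q * (X - Wᴴ * ((coordPair p q)ᴴ * A)) := by
    have e1 : rotRows fp G p q A = A + coordPair p q * (X - (coordPair p q)ᴴ * A) := by
      ext i j
      rw [Matrix.add_apply, coordPair_mul, Matrix.sub_apply, Matrix.sub_apply, coordPair_conj_mul,
        coordPair_conj_mul, hX, hX, rotRows]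
      by_cases h1 : i = p
      · subst h1
        simp [hpq]
      · by_cases h2 : i = q
        · subst h2
          simp [h1]
        · simp [h1, h2]
    rw [e1, plug_conj, plug]
    simp only [Matrix.add_mul, Matrix.mul_sub, Matrix.sub_mul, Matrix.one_mul, Matrix.mul_one,
      Matrix.mul_assoc]
    abel
  have hent : ∀ i j, ‖star (G i j) - star (W i j)‖ ≤ 120 * u := fun i j => by
    rw [← star_sub, norm_star]
    exact (norm_entry_le (G - W) i j).trans hG
  have hstar : ∀ i j, ‖star (W i j)‖ ≤ 1 := fun i j => by
    rw [norm_star]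
    exact norm_entry_le_one hW i j
  rw [e, norm_isometry_mul hJ]
  refine (norm_le_of_col_bound (ε := 130 * u) (B := (coordPair p q)ᴴ * A) (by positivity)
    fun s j => ?_).trans ?_
  · rw [Matrix.sub_apply, hX, Matrix.mul_apply, Fin.sum_univ_two, coordPair_conj_mul,
      coordPair_conj_mul]
    simp only [Matrix.conjTranspose_apply, Matrix.cons_val_zero, Matrix.cons_val_one]
    refine norm_cadd_sub_le fp hu hu1 ?_ ?_ (norm_cmul_sub_le fp hu hu1 (hstar _ _) (hent _ _) _).1
      (norm_cmul_sub_le fp hu hu1 (hstar _ _) (hent _ _) _).1 <;>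
    · rw [norm_mul]
      exact mul_le_of_le_one_left (norm_nonneg _) (hstar _ _)
  · have := norm_coisometry_mul_le hJ A
    nlinarith

/-- A computed rotation of two columns is a unitary transformation with a relative error of order
`u`. -/
theorem norm_rotCols_sub_le (hu : 0 ≤ u) (hu1 : u ≤ 1 / 1000) (hpq : p ≠ q) {G W : Core}
    (hW : IsUni W) (hG : ‖G - W‖ ≤ 120 * u) (A : Matrix (Fin k) (Fin k) ℂ) :
    ‖rotCols fp G p q A - A * plug (coordPair p q) W‖ ≤ 260 * u * ‖A‖ := by
  have hJ := coordPair_isometry hpq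
  obtain ⟨X, hX⟩ : ∃ X : Matrix (Fin k) (Fin 2) ℂ, ∀ i s, X i s
      = fp.cadd (fp.cmul (A i p) (G 0 s)) (fp.cmul (A i q) (G 1 s)) :=
    ⟨fun i s => _, fun i s => rfl⟩
  have e : rotCols fp G p q A - A * plug (coordPair p q) W
      = (X - A * coordPair p q * W) * (coordPair p q)ᴴ := by
    have e1 : rotCols fp G p q A = A + (X - A * coordPair p q) * (coordPair p q)ᴴ := by
      ext i j
      rw [Matrix.add_apply, mul_coordPair_conj, Matrix.sub_apply, Matrix.sub_apply, mul_coordPair,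
        mul_coordPair, hX, hX, rotCols]
      by_cases h1 : j = p
      · subst h1
        simp [hpq]
      · by_cases h2 : j = q
        · subst h2
          simp [h1]
        · simp [h1, h2]
    rw [e1, plug]
    simp only [Matrix.mul_add, Matrix.mul_sub, Matrix.sub_mul, Matrix.mul_one, Matrix.mul_assoc]
    abel
  have hent : ∀ i j, ‖G i j - W i j‖ ≤ 120 * u := fun i j =>
    (norm_entry_le (G - W) i j).trans hG
  have hone := norm_entry_le_one hW
  rw [e, norm_mul_isometry hJ]
  refine (norm_le_of_row_bound (ε := 130 * u) (B := A * coordPair p q) (by positivity)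
    fun i s => ?_).trans ?_
  · rw [Matrix.sub_apply, hX, Matrix.mul_apply, Fin.sum_univ_two, mul_coordPair, mul_coordPair]
    simp only [Matrix.cons_val_zero, Matrix.cons_val_one]
    refine norm_cadd_sub_le fp hu hu1 ?_ ?_ (norm_cmul_sub_le fp hu hu1 (hone _ _) (hent _ _) _).2
      (norm_cmul_sub_le fp hu hu1 (hone _ _) (hent _ _) _).2 <;>
    · rw [norm_mul]
      exact mul_le_of_le_one_right (norm_nonneg _) (hone _ _)
  · have := norm_mul_coisometry_le hJ A
    nlinarith

end PlaneRotations

/-! ### The triangularization of `M₀` and `N_d` -/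

section Preprocessing

variable {d k : ℕ}

/-- The matrix with the blocks `F r c`. -/
def blockMat (F : Matrix (Fin d) (Fin d) (Matrix (Fin k) (Fin k) ℂ)) :
    Matrix (Fin (d * k)) (Fin (d * k)) ℂ :=
  Matrix.reindex finProdFinEquiv finProdFinEquiv (Matrix.of fun r c => F r.1 c.1 r.2 c.2)

theorem blockMat_mul (F G : Matrix (Fin d) (Fin d) (Matrix (Fin k) (Fin k) ℂ)) :
    blockMat (F * G) = blockMat F * blockMat G := by
  rw [blockMat, blockMat, blockMat, Matrix.reindex_apply, Matrix.reindex_apply,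
    Matrix.reindex_apply, Matrix.submatrix_mul_equiv]
  congr 1
  ext r c
  rw [Matrix.mul_apply, Fintype.sum_prod_type, Matrix.of_apply, Matrix.mul_apply, Matrix.sum_apply]
  simp only [Matrix.mul_apply, Matrix.of_apply]

theorem norm_blockMat_sq (F : Matrix (Fin d) (Fin d) (Matrix (Fin k) (Fin k) ℂ)) :
    ‖blockMat F‖ ^ 2 = ∑ r, ∑ c, ‖F r c‖ ^ 2 := by
  have e : ‖blockMat F‖ ^ 2 = ∑ x : Fin d × Fin k, ∑ y : Fin d × Fin k,
      ‖F x.1 y.1 x.2 y.2‖ ^ 2 := by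
    rw [frobenius_norm_sq, ← finProdFinEquiv.sum_comp]
    refine Finset.sum_congr rfl fun x _ => ?_
    rw [← finProdFinEquiv.sum_comp]
    simp [blockMat]
  rw [e]
  simp only [Fintype.sum_prod_type, frobenius_norm_sq]
  refine Finset.sum_congr rfl fun r _ => ?_
  rw [Finset.sum_comm]

theorem norm_blockMat_le {F G : Matrix (Fin d) (Fin d) (Matrix (Fin k) (Fin k) ℂ)} {ε : ℝ}
    (hε : 0 ≤ ε) (h : ∀ r c, ‖F r c‖ ≤ ε * ‖G r c‖) : ‖blockMat F‖ ≤ ε * ‖blockMat G‖ := by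
  refine le_of_sq_le_sq ?_ (by positivity)
  rw [mul_pow, norm_blockMat_sq, norm_blockMat_sq, Finset.mul_sum]
  refine Finset.sum_le_sum fun r _ => ?_
  rw [Finset.mul_sum]
  refine Finset.sum_le_sum fun c _ => ?_
  rw [← mul_pow]
  exact pow_le_pow_left₀ (norm_nonneg _) (h r c) 2

theorem blockMat_diagonal_conj (g : Fin d → Matrix (Fin k) (Fin k) ℂ) :
    (blockMat (Matrix.diagonal g))ᴴ = blockMat (Matrix.diagonal fun i => (g i)ᴴ) := by
  ext r c
  simp only [blockMat, Matrix.conjTranspose_apply, Matrix.reindex_apply, Matrix.submatrix_apply,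
    Matrix.of_apply, Matrix.diagonal_apply]
  split_ifs with h1 h2 h2
  · rw [Matrix.conjTranspose_apply, h1]
  · exact absurd h1.symm h2
  · exact absurd h2.symm h1
  · simp

theorem blockMat_diagonal_isUni {g : Fin d → Matrix (Fin k) (Fin k) ℂ} (hg : ∀ i, IsUni (g i)) :
    IsUni (blockMat (Matrix.diagonal g)) := by
  apply isUni_of_left
  rw [blockMat_diagonal_conj, ← blockMat_mul, Matrix.diagonal_mul_diagonal]
  simp only [(hg _).left]
  ext r c
  rw [Matrix.one_apply, blockMat, Matrix.reindex_apply, Matrix.submatrix_apply, Matrix.of_apply,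
    Matrix.diagonal_apply]
  by_cases h : r = c
  · rw [h, if_pos rfl, if_pos rfl, Matrix.one_apply_eq]
  · rw [if_neg h]
    split_ifs with h1
    · exact Matrix.one_apply_ne fun h2 => h (finProdFinEquiv.symm.injective (Prod.ext h1 h2))
    · rfl

/-- The blocks of `S`. -/
def blocksS (d : ℕ) {k : ℕ} (M : ℕ → Matrix (Fin k) (Fin k) ℂ) :
    Matrix (Fin d) (Fin d) (Matrix (Fin k) (Fin k) ℂ) := fun r c =>
  if c.val + 1 = d then -M r else if r.val = c.val + 1 then 1 else 0

/-- The blocks of `T`. -/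
def blocksT (d : ℕ) {k : ℕ} (N : ℕ → Matrix (Fin k) (Fin k) ℂ) :
    Matrix (Fin d) (Fin d) (Matrix (Fin k) (Fin k) ℂ) := fun r c =>
  if c.val + 1 = d then N (r + 1) else if r = c then 1 else 0

theorem pencilS_eq_blockMat (M : ℕ → Matrix (Fin k) (Fin k) ℂ) :
    pencilS d k M = blockMat (blocksS d M) := by
  rw [pencilS, blockMat]
  congr 1
  ext r c
  simp only [Matrix.of_apply, blocksS]
  split_ifs <;> simp_all [Matrix.one_apply]

theorem pencilT_eq_blockMat (N : ℕ → Matrix (Fin k) (Fin k) ℂ) :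
    pencilT d k N = blockMat (blocksT d N) := by
  rw [pencilT, blockMat]
  congr 1
  ext r c
  simp only [Matrix.of_apply, blocksT, Prod.ext_iff]
  split_ifs <;> simp_all [Matrix.one_apply]

/-- The block diagonal unitary matrix by which the pencil is multiplied from the right if its
coefficients are multiplied by `Wᴴ` from the left and by `X` from the right. -/
def rightFactor (d : ℕ) {k : ℕ} (W X : Matrix (Fin k) (Fin k) ℂ) :
    Matrix (Fin (d * k)) (Fin (d * k)) ℂ :=
  blockMat (Matrix.diagonal fun c : Fin d => if c.val + 1 = d then X else W)

theorem rightFactor_isUni {W X : Matrix (Fin k) (Fin k) ℂ} (hW : IsUni W) (hX : IsUni X) :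
    IsUni (rightFactor d W X) :=
  blockMat_diagonal_isUni fun c => by split_ifs <;> assumption

/-- A common unitary transformation of the coefficients is a unitary equivalence of the pencil by
block diagonal matrices: the identity blocks become `Wᴴ W`. The same matrices serve for `T`, by
`conj_pencilT`. -/
theorem conj_pencilS {W : Matrix (Fin k) (Fin k) ℂ} (hW : IsUni W) (X : Matrix (Fin k) (Fin k) ℂ)
    (M : ℕ → Matrix (Fin k) (Fin k) ℂ) :
    (blockMat (Matrix.diagonal fun _ : Fin d => W))ᴴ * pencilS d k M * rightFactor d W X
      = pencilS d k fun i => Wᴴ * M i * X := by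
  rw [blockMat_diagonal_conj, rightFactor, pencilS_eq_blockMat, pencilS_eq_blockMat,
    ← blockMat_mul, ← blockMat_mul]
  congr 1
  ext r c : 2
  rw [Matrix.mul_diagonal, Matrix.diagonal_mul]
  simp only [blocksS]
  split_ifs
  · simp
  · rw [Matrix.mul_one, hW.left]
  · simp

/-- The analogue of `conj_pencilS` for the second matrix of the pencil. -/
theorem conj_pencilT {W : Matrix (Fin k) (Fin k) ℂ} (hW : IsUni W) (X : Matrix (Fin k) (Fin k) ℂ)
    (N : ℕ → Matrix (Fin k) (Fin k) ℂ) :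
    (blockMat (Matrix.diagonal fun _ : Fin d => W))ᴴ * pencilT d k N * rightFactor d W X
      = pencilT d k fun i => Wᴴ * N i * X := by
  rw [blockMat_diagonal_conj, rightFactor, pencilT_eq_blockMat, pencilT_eq_blockMat,
    ← blockMat_mul, ← blockMat_mul]
  congr 1
  ext r c : 2
  rw [Matrix.mul_diagonal, Matrix.diagonal_mul]
  simp only [blocksT]
  split_ifs
  · simp
  · rw [Matrix.mul_one, hW.left]
  · simp

theorem blockMat_sub (F G : Matrix (Fin d) (Fin d) (Matrix (Fin k) (Fin k) ℂ)) :
    blockMat F - blockMat G = blockMat (F - G) := by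
  ext r c
  simp [blockMat]

theorem norm_pencilS_sub_le {M M' M₁ : ℕ → Matrix (Fin k) (Fin k) ℂ} {ε : ℝ} (hε : 0 ≤ ε)
    (h : ∀ i < d, ‖M₁ i - M' i‖ ≤ ε * ‖M i‖) :
    ‖pencilS d k M₁ - pencilS d k M'‖ ≤ ε * ‖pencilS d k M‖ := by
  rw [pencilS_eq_blockMat, pencilS_eq_blockMat, pencilS_eq_blockMat, blockMat_sub]
  refine norm_blockMat_le hε fun r c => ?_
  rw [Matrix.sub_apply]
  unfold blocksS
  split_ifs
  · rw [neg_sub_neg, norm_sub_rev, norm_neg]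
    exact h r r.2
  · simp only [sub_self, norm_zero]; positivity
  · simp

theorem norm_pencilT_sub_le {N N' N₁ : ℕ → Matrix (Fin k) (Fin k) ℂ} {ε : ℝ} (hε : 0 ≤ ε)
    (h : ∀ i, ‖N₁ i - N' i‖ ≤ ε * ‖N i‖) :
    ‖pencilT d k N₁ - pencilT d k N'‖ ≤ ε * ‖pencilT d k N‖ := by
  rw [pencilT_eq_blockMat, pencilT_eq_blockMat, pencilT_eq_blockMat, blockMat_sub]
  refine norm_blockMat_le hε fun r c => ?_
  rw [Matrix.sub_apply]
  unfold blocksT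
  split_ifs
  · exact h _
  · simp only [sub_self, norm_zero]; positivity
  · simp

theorem norm_clearEntry_sub_le (p q : Fin k) (A : Matrix (Fin k) (Fin k) ℂ) :
    ‖clearEntry p q A - A‖ ≤ ‖A p q‖ := by
  refine (frobenius_norm_le_sum _).trans ?_
  rw [Finset.sum_eq_single p, Finset.sum_eq_single q]
  · simp [clearEntry]
  · intro j _ hj
    simp [clearEntry, hj]
  · simp
  · intro i _ hi
    simp [clearEntry, hi]
  · simp

variable {u : ℝ} (fp : FloatArith u)

/-- An elementary step of the preprocessing is a unitary equivalence of the block companion pencil,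
with a relative error of order `u` in both matrices. -/
theorem QZStep.sim {tol : ℕ} (hu : 0 ≤ u) (hu1 : u ≤ 1 / 1000) {c c' : Coeffs k}
    (h : QZStep fp tol d c c') :
    ∃ U V : Matrix (Fin (d * k)) (Fin (d * k)) ℂ, IsUni U ∧ IsUni V ∧
      ‖pencilS d k c'.M - Uᴴ * pencilS d k c.M * V‖ ≤ (260 + tol) * u * ‖pencilS d k c.M‖ ∧
      ‖pencilT d k c'.N - Uᴴ * pencilT d k c.N * V‖ ≤ (260 + tol) * u * ‖pencilT d k c.N‖ := by
  have hε : 0 ≤ (260 + tol) * u := by positivity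
  have hle : 260 * u ≤ (260 + tol) * u := by
    have : (0 : ℝ) ≤ tol * u := by positivity
    linarith
  have hle' : tol * u ≤ (260 + tol) * u := by linarith
  cases h with
  | left p q hpq a b =>
    have hW := plug_isUni (coordPair_isometry hpq) (rot_isUni a b)
    have key := fun A : Matrix (Fin k) (Fin k) ℂ => (norm_rotRows_sub_le fp hu hu1 hpq
      (rot_isUni a b) (fp.givens_err hu hu1 a b) A).trans
      (mul_le_mul_of_nonneg_right hle (norm_nonneg _))
    refine ⟨_, _, blockMat_diagonal_isUni fun _ => hW, rightFactor_isUni hW isUni_one, ?_, ?_⟩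
    · rw [conj_pencilS hW]
      exact norm_pencilS_sub_le hε fun i _ => by simpa using key (c.M i)
    · rw [conj_pencilT hW]
      exact norm_pencilT_sub_le hε fun i => by simpa using key (c.N i)
  | right p q hpq a b =>
    have hW := plug_isUni (coordPair_isometry hpq) (rot_isUni a b)
    have key := fun A : Matrix (Fin k) (Fin k) ℂ => (norm_rotCols_sub_le fp hu hu1 hpq
      (rot_isUni a b) (fp.givens_err hu hu1 a b) A).trans
      (mul_le_mul_of_nonneg_right hle (norm_nonneg _))
    refine ⟨_, _, blockMat_diagonal_isUni fun _ => isUni_one, rightFactor_isUni isUni_one hW,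
      ?_, ?_⟩
    · rw [conj_pencilS isUni_one]
      exact norm_pencilS_sub_le hε fun i _ => by simpa using key (c.M i)
    · rw [conj_pencilT isUni_one]
      exact norm_pencilT_sub_le hε fun i => by simpa using key (c.N i)
  | clearM p q hM =>
    refine ⟨1, 1, isUni_one, isUni_one, ?_, by simpa using mul_nonneg hε (norm_nonneg _)⟩
    rw [Matrix.conjTranspose_one, Matrix.one_mul, Matrix.mul_one]
    refine norm_pencilS_sub_le hε fun i _ => ?_
    by_cases hi : i = 0
    · subst hi
      simp only [Function.update_self]
      exact ((norm_clearEntry_sub_le p q _).trans hM).trans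
        (mul_le_mul_of_nonneg_right hle' (norm_nonneg _))
    · simp only [Function.update_of_ne hi, sub_self, norm_zero]
      positivity
  | clearN p q hN =>
    refine ⟨1, 1, isUni_one, isUni_one, by simpa using mul_nonneg hε (norm_nonneg _), ?_⟩
    rw [Matrix.conjTranspose_one, Matrix.one_mul, Matrix.mul_one]
    refine norm_pencilT_sub_le hε fun i => ?_
    by_cases hi : i = d
    · subst hi
      simp only [Function.update_self]
      exact ((norm_clearEntry_sub_le p q _).trans hN).trans
        (mul_le_mul_of_nonneg_right hle' (norm_nonneg _))
    · simp only [Function.update_of_ne hi, sub_self, norm_zero]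
      positivity

theorem norm_conj_conj_sub_le {n : ℕ} {A B C U V U' V' : Matrix (Fin n) (Fin n) ℂ} {η ε : ℝ}
    (hU' : IsUni U') (hV' : IsUni V') (h : ‖B - Uᴴ * A * V‖ ≤ η) (h' : ‖C - U'ᴴ * B * V'‖ ≤ ε) :
    ‖C - (U * U')ᴴ * A * (V * V')‖ ≤ η + ε := by
  have e : C - (U * U')ᴴ * A * (V * V')
      = (C - U'ᴴ * B * V') + U'ᴴ * (B - Uᴴ * A * V) * V' := by
    simp only [Matrix.conjTranspose_mul, Matrix.mul_sub, Matrix.sub_mul, Matrix.mul_assoc]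
    abel
  rw [e]
  refine (norm_add_le _ _).trans ?_
  rw [hV'.norm_mul', hU'.conj.norm_mul]
  linarith

theorem norm_le_of_conj_sub {n : ℕ} {A B U V : Matrix (Fin n) (Fin n) ℂ} {η : ℝ}
    (hU : IsUni U) (hV : IsUni V) (h : ‖B - Uᴴ * A * V‖ ≤ η) : ‖B‖ ≤ η + ‖A‖ ∧ ‖A‖ ≤ η + ‖B‖ := by
  have e : ‖Uᴴ * A * V‖ = ‖A‖ := by rw [hV.norm_mul', hU.conj.norm_mul]
  have h1 := norm_le_norm_add_norm_sub' B (Uᴴ * A * V)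
  have h2 := norm_le_norm_add_norm_sub B (Uᴴ * A * V)
  constructor <;> linarith

/-- As long as `m` rounding errors stay small, their norms add up to at most twice the sum of the
errors relative to the original pencil. -/
theorem QZSteps.sim {tol m : ℕ} (hu : 0 ≤ u) (hu1 : u ≤ 1 / 1000)
    (hm : m * (2 * ((260 + tol) * u)) ≤ 1) {c c' : Coeffs k}
    (h : Steps (QZStep fp tol d) m c c') :
    ∃ U V : Matrix (Fin (d * k)) (Fin (d * k)) ℂ, IsUni U ∧ IsUni V ∧
      ‖pencilS d k c'.M - Uᴴ * pencilS d k c.M * V‖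
        ≤ m * (2 * ((260 + tol) * u)) * ‖pencilS d k c.M‖ ∧
      ‖pencilT d k c'.N - Uᴴ * pencilT d k c.N * V‖
        ≤ m * (2 * ((260 + tol) * u)) * ‖pencilT d k c.N‖ := by
  have hε : 0 ≤ (260 + tol) * u := by positivity
  induction h with
  | refl => exact ⟨1, 1, isUni_one, isUni_one, by simp, by simp⟩
  | @tail m a b c' _ hstep ih =>
    push_cast at hm ⊢
    have hm' : m * (2 * ((260 + tol) * u)) ≤ 1 := by linarith
    obtain ⟨U, V, hU, hV, hS, hT⟩ := ih hm'
    obtain ⟨U', V', hU', hV', hS', hT'⟩ := hstep.sim fp hu hu1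
    refine ⟨U * U', V * V', hU.mul hU', hV.mul hV', ?_, ?_⟩
    · refine (norm_conj_conj_sub_le hU' hV' hS hS').trans ?_
      -- the current pencil has at most twice the norm of the original one
      have h1 := (norm_le_of_conj_sub hU hV hS).1
      have h2 := mul_le_mul_of_nonneg_right hm' (norm_nonneg (pencilS d k a.M))
      have h3 := mul_le_mul_of_nonneg_left (show ‖pencilS d k b.M‖ ≤ 2 * ‖pencilS d k a.M‖ by
        linarith) hε
      linarith
    · refine (norm_conj_conj_sub_le hU' hV' hT hT').trans ?_
      have h1 := (norm_le_of_conj_sub hU hV hT).1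
      have h2 := mul_le_mul_of_nonneg_right hm' (norm_nonneg (pencilT d k a.N))
      have h3 := mul_le_mul_of_nonneg_left (show ‖pencilT d k b.N‖ ≤ 2 * ‖pencilT d k a.N‖ by
        linarith) hε
      linarith

theorem one_le_norm_of_entry {n : ℕ} {A : Matrix (Fin n) (Fin n) ℂ} {i j : Fin n} (h : A i j = 1) :
    1 ≤ ‖A‖ := by
  have := norm_entry_le A i j
  rwa [h, norm_one] at this

theorem one_le_norm_pencilS (hd : 2 ≤ d) (hk : 1 ≤ k) (M : ℕ → Matrix (Fin k) (Fin k) ℂ) :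
    1 ≤ ‖pencilS d k M‖ := by
  refine one_le_norm_of_entry (i := finProdFinEquiv (⟨1, by omega⟩, ⟨0, by omega⟩))
    (j := finProdFinEquiv (⟨0, by omega⟩, ⟨0, by omega⟩)) ?_
  simp only [pencilS, Matrix.reindex_apply, Matrix.submatrix_apply, Equiv.symm_apply_apply,
    Matrix.of_apply]
  rw [if_neg (by omega), if_pos (by simp)]

theorem one_le_norm_pencilT (hd : 2 ≤ d) (hk : 1 ≤ k) (N : ℕ → Matrix (Fin k) (Fin k) ℂ) :
    1 ≤ ‖pencilT d k N‖ := by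
  refine one_le_norm_of_entry (i := finProdFinEquiv (⟨0, by omega⟩, ⟨0, by omega⟩))
    (j := finProdFinEquiv (⟨0, by omega⟩, ⟨0, by omega⟩)) ?_
  simp only [pencilT, Matrix.reindex_apply, Matrix.submatrix_apply, Equiv.symm_apply_apply,
    Matrix.of_apply]
  rw [if_neg (by omega), if_pos (by simp)]

end Preprocessing

/-! ### The backward error bound -/

theorem secondOrder_mono_left {n N : ℕ} {σ σ' : ℝ} (hσ : 0 ≤ σ) (h : σ ≤ σ') :
    secondOrder n σ N ≤ secondOrder n σ' N := by
  have hσ' : 0 ≤ σ' := hσ.trans h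
  unfold secondOrder
  gcongr

/-- The coefficient of `n³ u` in the bound on the errors of the factors. -/
def factorConst (tol ν : ℕ) : ℝ := 1824 + 10 ^ 8 + ν * (10 ^ 9 + 16 * tol)

theorem factorConst_pos (tol ν : ℕ) : 0 < factorConst tol ν := by
  unfold factorConst
  positivity

theorem factorError_nonneg (n k tol m : ℕ) {u : ℝ} (hu : 0 ≤ u) : 0 ≤ factorError n k tol m u := by
  unfold factorError
  positivity

theorem factorError_le {n k tol ν m : ℕ} {u : ℝ} (hu : 0 ≤ u) (hn : 1 ≤ n) (hkn : k ≤ n)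
    (hm : m ≤ ν * n) : factorError n k tol m u ≤ (n : ℝ) ^ 3 * factorConst tol ν * u := by
  have hn1 : (1 : ℝ) ≤ n := by exact_mod_cast hn
  have h1 : ((n : ℝ) + 1) ^ 2 ≤ 4 * (n : ℝ) ^ 3 := by
    have : (n : ℝ) ^ 2 ≤ (n : ℝ) ^ 3 := pow_le_pow_right₀ hn1 (by norm_num)
    nlinarith
  have h2 : ((n - 1 : ℕ) : ℝ) ≤ n := by exact_mod_cast Nat.sub_le n 1
  have h3 : ((k - 1 : ℕ) : ℝ) ≤ n := by exact_mod_cast (Nat.sub_le k 1).trans hkn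
  have h4 : (m : ℝ) ≤ ν * n := by exact_mod_cast hm
  have h5 : (ν : ℝ) * n * n ≤ ν * (n : ℝ) ^ 3 := by
    have : (n : ℝ) ^ 2 ≤ (n : ℝ) ^ 3 := pow_le_pow_right₀ hn1 (by norm_num)
    nlinarith [ν.cast_nonneg (α := ℝ)]
  calc factorError n k tol m u
      ≤ 456 * ((4 * (n : ℝ) ^ 3) * u) + n * n * (n * (10 ^ 8 * u))
        + ν * n * (n * ((10 ^ 9 + 16 * tol) * u)) := by
        unfold factorError
        gcongr
    _ = 456 * ((4 * (n : ℝ) ^ 3) * u) + n * n * (n * (10 ^ 8 * u))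
        + ν * n * n * ((10 ^ 9 + 16 * tol) * u) := by ring
    _ ≤ 456 * ((4 * (n : ℝ) ^ 3) * u) + n * n * (n * (10 ^ 8 * u))
        + ν * (n : ℝ) ^ 3 * ((10 ^ 9 + 16 * tol) * u) := by gcongr
    _ = _ := by
        unfold factorConst
        ring

/-- The coefficient of `n⁶ ‖S‖² u` in the bound on the backward error: the first summand stems from
the preprocessing, the second one from the factors (`10752 = 2 * 336 * 4²`). -/
def errorConst (tol ν : ℕ) : ℝ := 2 * (ν * (260 + tol)) + 10752 * factorConst tol ν

/-- The unit round-off times this quantity has to be at most one.  The first two summands make the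
errors in core transformations harmless, the third one keeps the norms after the preprocessing within
a factor of two; the last one, with the errors of the factors, keeps `ρ` away from zero and absorbs
the terms of second order, for the bound `σ = 4 n max(K, 1)` on all partial products. -/
def threshold (tol ν d k : ℕ) (K : ℝ) : ℝ :=
  10 ^ 8 + 240 * ((d * k : ℕ) + 1) + ν * (k : ℝ) ^ 2 * (2 * (260 + tol))
    + (secondOrder (d * k) (4 * (d * k : ℕ) * max K 1) (2 * k) + 2 * (4 * (d * k : ℕ) * max K 1))
      * (((d * k : ℕ) : ℝ) ^ 3 * factorConst tol ν)

theorem secondOrder_nonneg {n N : ℕ} {σ : ℝ} (hσ : 0 ≤ σ) : 0 ≤ secondOrder n σ N := by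
  unfold secondOrder
  positivity

theorem threshold_pos (tol ν d k : ℕ) (K : ℝ) : 0 < threshold tol ν d k K := by
  have h1 : 0 ≤ 4 * ((d * k : ℕ) : ℝ) * max K 1 := by positivity
  have h2 := secondOrder_nonneg (n := d * k) (N := 2 * k) h1
  have h3 := factorConst_pos tol ν
  unfold threshold
  positivity

/-- If `B` is a unitary equivalence of `A` up to an error `η`, and a unitary equivalence of `B` has
the backward error `δ`, then the backward errors with respect to `A` add up. -/
theorem conj_backward_error {n : ℕ} {A B δ U V U' V' : Matrix (Fin n) (Fin n) ℂ} {η ε : ℝ}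
    (hU : IsUni U) (hV : IsUni V) (h : ‖B - Uᴴ * A * V‖ ≤ η) (hδ : ‖δ‖ ≤ ε) :
    (U * U')ᴴ * (A + U * (B - Uᴴ * A * V + δ) * Vᴴ) * (V * V') = U'ᴴ * (B + δ) * V' ∧
      ‖U * (B - Uᴴ * A * V + δ) * Vᴴ‖ ≤ η + ε := by
  constructor
  · have h1 : Uᴴ * (U * (B - Uᴴ * A * V + δ) * Vᴴ) * V = B - Uᴴ * A * V + δ := by
      rw [← Matrix.mul_assoc, ← Matrix.mul_assoc, hU.left, Matrix.one_mul, Matrix.mul_assoc,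
        hV.left, Matrix.mul_one]
    calc _ = U'ᴴ * (Uᴴ * A * V + Uᴴ * (U * (B - Uᴴ * A * V + δ) * Vᴴ) * V) * V' := by
          simp only [Matrix.conjTranspose_mul, Matrix.mul_add, Matrix.add_mul, Matrix.mul_assoc]
      _ = _ := by rw [h1, ← add_assoc, add_sub_cancel]
  · rw [hV.conj.norm_mul', hU.norm_mul]
    exact (norm_add_le _ _).trans (add_le_add h hδ)

section Bound

variable {d k tol ν m₁ m₂ : ℕ} {K u s s' : ℝ}

/-- The bound `σ = 4 n s` on the partial products of the factors, for a pencil whose norm `s'`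
after the preprocessing is at most twice the original norm `s`. -/
theorem scale_bounds (hn : 1 ≤ d * k) (hs : 1 ≤ s) (hs' : s' ≤ 2 * s) (h0 : 0 ≤ s') :
    1 ≤ 4 * ((d * k : ℕ) : ℝ) * s ∧
      ((d * k : ℕ) : ℝ) * (1 + s' ^ 2) ≤ (4 * ((d * k : ℕ) : ℝ) * s) ^ 2 := by
  have hn1 : (1 : ℝ) ≤ (d * k : ℕ) := by exact_mod_cast hn
  obtain ⟨n, hn'⟩ : ∃ n : ℝ, ((d * k : ℕ) : ℝ) = n := ⟨_, rfl⟩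
  rw [hn'] at hn1 ⊢
  have h1 : 1 ≤ n * s := one_le_mul_of_one_le_of_one_le hn1 hs
  have h2 : s' ^ 2 ≤ 4 * s ^ 2 := by nlinarith
  have h3 : 1 + s' ^ 2 ≤ 5 * s ^ 2 := by nlinarith
  have h4 : n ≤ n ^ 2 := by nlinarith
  refine ⟨by linarith, ?_⟩
  calc n * (1 + s' ^ 2) ≤ n ^ 2 * (5 * s ^ 2) := by gcongr
    _ ≤ (4 * n * s) ^ 2 := by nlinarith [mul_nonneg (sq_nonneg n) (sq_nonneg s)]

/-- The two smallness conditions on the errors of the factors. -/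
theorem factor_bounds (hn : 1 ≤ d * k) (hk : k ≤ d * k) (hu : 0 < u)
    (hu0 : threshold tol ν d k K * u ≤ 1) (hm₂ : m₂ ≤ ν * (d * k)) (hs : 1 ≤ s) (hsK : s ≤ K) :
    4 * ((d * k : ℕ) : ℝ) * s * factorError (d * k) k tol m₂ u < 1 ∧
      secondOrder (d * k) (4 * ((d * k : ℕ) : ℝ) * s) (2 * k) * factorError (d * k) k tol m₂ u
        ≤ 1 := by
  have hE0 := factorError_nonneg (d * k) k tol m₂ hu.le
  have hE := factorError_le (k := k) (tol := tol) hu.le hn hk hm₂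
  have hF0 := factorConst_pos tol ν
  obtain ⟨σ, hσ⟩ : ∃ σ : ℝ, 4 * ((d * k : ℕ) : ℝ) * max K 1 = σ := ⟨_, rfl⟩
  have hσ0 : 0 ≤ σ := by rw [← hσ]; positivity
  have hsσ : 4 * ((d * k : ℕ) : ℝ) * s ≤ σ := by
    rw [← hσ]
    gcongr
    exact hsK.trans (le_max_left K 1)
  have h2 := secondOrder_nonneg (n := d * k) (N := 2 * k) hσ0
  obtain ⟨F, hF⟩ : ∃ F : ℝ, ((d * k : ℕ) : ℝ) ^ 3 * factorConst tol ν = F := ⟨_, rfl⟩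
  have hF1 : 0 ≤ F := by rw [← hF]; positivity
  rw [hF] at hE
  -- `σ` bounds the scale of all pencils of norm at most `K`
  have hsum : (secondOrder (d * k) σ (2 * k) + 2 * σ) * (F * u) ≤ 1 := by
    refine le_trans ?_ hu0
    rw [threshold, hσ, hF, ← mul_assoc]
    refine mul_le_mul_of_nonneg_right ?_ hu.le
    have : (0 : ℝ) ≤ 10 ^ 8 + 240 * ((d * k : ℕ) + 1) + ν * (k : ℝ) ^ 2 * (2 * (260 + tol)) := by
      positivity
    linarith
  have hFu : 0 ≤ F * u := by positivity
  have h3 := mul_nonneg h2 hFu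
  have h4 := mul_nonneg hσ0 hFu
  have hs0 : 0 ≤ 4 * ((d * k : ℕ) : ℝ) * s := by positivity
  constructor
  · refine lt_of_le_of_lt (b := σ * (F * u)) (by gcongr) ?_
    linarith
  · refine le_trans (b := secondOrder (d * k) σ (2 * k) * (F * u)) ?_ (by linarith)
    exact (mul_le_mul_of_nonneg_left hE (secondOrder_nonneg hs0)).trans
      (mul_le_mul_of_nonneg_right (secondOrder_mono_left hs0 hsσ) hFu)

/-- The sum of the errors of the preprocessing and of the factors; `s` is the norm of the original
pencil. -/
theorem total_le (hn : 1 ≤ d * k) (hk : k ≤ d * k) (hu : 0 < u) (hm₁ : m₁ ≤ ν * k ^ 2)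
    (hm₂ : m₂ ≤ ν * (d * k)) (hs : 1 ≤ s) :
    m₁ * (2 * ((260 + tol) * u)) * s
        + 2 * k * (336 * ((4 * ((d * k : ℕ) : ℝ) * s) ^ 2 * factorError (d * k) k tol m₂ u))
      ≤ errorConst tol ν * (d * k) ^ 6 * s ^ 2 * u := by
  have hE0 := factorError_nonneg (d * k) k tol m₂ hu.le
  have hE := factorError_le (k := k) (tol := tol) hu.le hn hk hm₂
  have hF0 := factorConst_pos tol ν
  have hn1 : (1 : ℝ) ≤ (d * k : ℕ) := by exact_mod_cast hn
  have hk1 : (k : ℝ) ≤ (d * k : ℕ) := by exact_mod_cast hk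
  have hm : (m₁ : ℝ) ≤ ν * (k : ℝ) ^ 2 := by exact_mod_cast hm₁
  rw [show (d : ℝ) * k = (d * k : ℕ) by push_cast; rfl]
  obtain ⟨n, hn'⟩ : ∃ n : ℝ, ((d * k : ℕ) : ℝ) = n := ⟨_, rfl⟩
  rw [hn'] at hE hn1 hk1 ⊢
  have hk2 : (k : ℝ) ^ 2 ≤ n ^ 6 :=
    (pow_le_pow_left₀ k.cast_nonneg hk1 2).trans (pow_le_pow_right₀ hn1 (by norm_num))
  -- the preprocessing error is linear in `s ≥ 1`, and is absorbed in the square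
  have hs2 : s ≤ s ^ 2 := by nlinarith
  calc _ ≤ ν * n ^ 6 * (2 * ((260 + tol) * u)) * s ^ 2
        + 2 * n * (336 * ((4 * n * s) ^ 2 * (n ^ 3 * factorConst tol ν * u))) := by
        have : (m₁ : ℝ) ≤ ν * n ^ 6 := hm.trans (by gcongr)
        gcongr
    _ = _ := by
        unfold errorConst
        ring

end Bound

/-- The backward error bound with explicit constants: preprocessing and the phases on the factored
pencil combined. -/
theorem ComputedSchurForm.exists_backward_error {tol ν d k : ℕ} (hd : 2 ≤ d) (hk : 1 ≤ k) {K u : ℝ}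
    (hu : 0 < u) (hu0 : threshold tol ν d k K * u ≤ 1) (fp : FloatArith u) {kind : Factorization}
    {c : Coeffs k} (hS : ‖pencilS d k c.M‖ ≤ K) (hT : ‖pencilT d k c.N‖ ≤ K)
    {Shat That : Matrix (Fin (d * k)) (Fin (d * k)) ℂ}
    (h : ComputedSchurForm fp tol ν d kind c Shat That) :
    Shat.BlockTriangular id ∧ That.BlockTriangular id ∧
      ∃ U V δS δT : Matrix (Fin (d * k)) (Fin (d * k)) ℂ, IsUni U ∧ IsUni V ∧
        Uᴴ * (pencilS d k c.M + δS) * V = Shat ∧ Uᴴ * (pencilT d k c.N + δT) * V = That ∧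
        ‖δS‖ ≤ errorConst tol ν * (d * k) ^ 6 * ‖pencilS d k c.M‖ ^ 2 * u ∧
        ‖δT‖ ≤ errorConst tol ν * (d * k) ^ 6 * ‖pencilT d k c.N‖ ^ 2 * u := by
  obtain ⟨m₁, m₂, c', s, hm₁, hqz, hc', hm₂, hqr, hdefl, rfl, rfl⟩ := h
  have hkn : k ≤ d * k := Nat.le_mul_of_pos_left k (by omega)
  have hn : 1 ≤ d * k := hk.trans hkn
  -- all summands of the threshold are nonnegative, so that each of them satisfies its bound
  have hB : 0 ≤ (secondOrder (d * k) (4 * (d * k : ℕ) * max K 1) (2 * k)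
      + 2 * (4 * (d * k : ℕ) * max K 1)) * (((d * k : ℕ) : ℝ) ^ 3 * factorConst tol ν) := by
    have h1 : 0 ≤ 4 * ((d * k : ℕ) : ℝ) * max K 1 := by positivity
    have h2 := secondOrder_nonneg (n := d * k) (N := 2 * k) h1
    have h3 := factorConst_pos tol ν
    positivity
  have hB' := mul_nonneg hB hu.le
  have hqz0 : 0 ≤ ν * (k : ℝ) ^ 2 * (2 * (260 + tol)) * u := by positivity
  have hn0 : 0 ≤ 240 * ((d * k : ℕ) + 1) * u := by positivity
  rw [threshold, add_mul, add_mul, add_mul] at hu0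
  have hsmall : SmallFor u (d * k + 1) :=
    ⟨hu.le, by linarith, by push_cast at *; linarith⟩
  have hqz1 : m₁ * (2 * ((260 + tol) * u)) ≤ 1 := by
    have hm : (m₁ : ℝ) ≤ ν * (k : ℝ) ^ 2 := by exact_mod_cast hm₁
    have := mul_le_mul_of_nonneg_right hm (by positivity : 0 ≤ 2 * ((260 + tol) * u))
    linarith
  rw [← add_mul, ← add_mul, ← add_mul, ← threshold] at hu0
  obtain ⟨U₁, V₁, hU₁, hV₁, e₁, f₁⟩ := QZSteps.sim fp hu.le (by linarith [hsmall.le]) hqz1 hqz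
  -- the norms are at least one because of the identity blocks (`d ≥ 2`), and the preprocessing at
  -- most doubles them
  have hS1 := one_le_norm_pencilS hd hk c.M
  have hT1 := one_le_norm_pencilT hd hk c.N
  have hS' : ‖pencilS d k c'.M‖ ≤ 2 * ‖pencilS d k c.M‖ := by
    have := (norm_le_of_conj_sub hU₁ hV₁ e₁).1
    nlinarith
  have hT' : ‖pencilT d k c'.N‖ ≤ 2 * ‖pencilT d k c.N‖ := by
    have := (norm_le_of_conj_sub hU₁ hV₁ f₁).1
    nlinarith
  obtain ⟨σ1, σ2⟩ := scale_bounds hn hS1 hS' (norm_nonneg _)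
  obtain ⟨τ1, τ2⟩ := scale_bounds hn hT1 hT' (norm_nonneg _)
  obtain ⟨σ3, σ4⟩ := factor_bounds hn hkn hu hu0 hm₂ hS1 hS
  obtain ⟨τ3, τ4⟩ := factor_bounds hn hkn hu hu0 hm₂ hT1 hT
  obtain ⟨tS, tT, U₂, V₂, δS, δT, hU₂, hV₂, e₂, f₂, hδS, hδT⟩ :=
    exists_backward_error_of_isReady fp hsmall hd hk hc' hqr hdefl σ1 τ1 σ2 τ2 σ3 τ3 σ4 τ4
  obtain ⟨e₃, e₄⟩ := conj_backward_error (U' := U₂) (V' := V₂) hU₁ hV₁ e₁ hδS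
  obtain ⟨f₃, f₄⟩ := conj_backward_error (U' := U₂) (V' := V₂) hU₁ hV₁ f₁ hδT
  exact ⟨tS, tT, U₁ * U₂, V₁ * V₂, _, _, hU₁.mul hU₂, hV₁.mul hV₂, e₃.trans e₂.symm,
    f₃.trans f₂.symm, e₄.trans (total_le hn hkn hu hm₁ hm₂ hS1),
    f₄.trans (total_le hn hkn hu hm₁ hm₂ hT1)⟩

/-- The bounding polynomial `C (d k)⁶`. -/
theorem exists_bound_polynomial (C : ℝ) :
    ∃ p : MvPolynomial (Fin 2) ℝ, ∀ x y : ℝ, MvPolynomial.eval ![x, y] p = C * (x * y) ^ 6 :=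
  ⟨MvPolynomial.C C * (MvPolynomial.X 0 * MvPolynomial.X 1) ^ 6, fun x y => by simp⟩

end CoreChasing

end

theorem mainTheorem1 (tol ν : ℕ) :
    ∃ p : MvPolynomial (Fin 2) ℝ, ∀ (d k : ℕ), 2 ≤ d → 1 ≤ k → ∀ K : ℝ,
      ∃ u₀ : ℝ, 0 < u₀ ∧ ∀ (u : ℝ), 0 < u → u ≤ u₀ → ∀ (fp : CoreChasing.FloatArith u)
        (kind : CoreChasing.Factorization) (M N : ℕ → Matrix (Fin k) (Fin k) ℂ),
        ‖CoreChasing.pencilS d k M‖ ≤ K → ‖CoreChasing.pencilT d k N‖ ≤ K →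
        ∀ Shat That : Matrix (Fin (d * k)) (Fin (d * k)) ℂ,
          CoreChasing.ComputedSchurForm fp tol ν d kind ⟨M, N⟩ Shat That →
          ∃ δS δT : Matrix (Fin (d * k)) (Fin (d * k)) ℂ,
            (∃ U ∈ Matrix.unitaryGroup (Fin (d * k)) ℂ,
              ∃ V ∈ Matrix.unitaryGroup (Fin (d * k)) ℂ,
                Uᴴ * (CoreChasing.pencilS d k M + δS) * V = Shat ∧
                Uᴴ * (CoreChasing.pencilT d k N + δT) * V = That) ∧
            Shat.BlockTriangular id ∧ That.BlockTriangular id ∧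
            ‖δS‖ ≤ MvPolynomial.eval ![(d : ℝ), (k : ℝ)] p *
              ‖CoreChasing.pencilS d k M‖ ^ 2 * u ∧
            ‖δT‖ ≤ MvPolynomial.eval ![(d : ℝ), (k : ℝ)] p *
              ‖CoreChasing.pencilT d k N‖ ^ 2 * u := by
  obtain ⟨p, hp⟩ := CoreChasing.exists_bound_polynomial (CoreChasing.errorConst tol ν)
  refine ⟨p, fun d k hd hk K => ?_⟩
  have hpos := CoreChasing.threshold_pos tol ν d k K
  refine ⟨(CoreChasing.threshold tol ν d k K)⁻¹, inv_pos.2 hpos, ?_⟩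
  intro u hu hu0 fp kind M N hS hT Shat That h
  have hu1 : CoreChasing.threshold tol ν d k K * u ≤ 1 :=
    (mul_le_mul_of_nonneg_left hu0 hpos.le).trans_eq (mul_inv_cancel₀ hpos.ne')
  obtain ⟨tS, tT, U, V, δS, δT, hU, hV, eS, eT, hδS, hδT⟩ :=
    h.exists_backward_error (c := ⟨M, N⟩) hd hk hu hu1 fp hS hT
  rw [← hp] at hδS hδT
  exact ⟨δS, δT, ⟨U, hU, V, hV, eS, eT⟩, tS, tT, hδS, hδT⟩
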